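/- **Setting.** Consider the derivative nonlinear Schrödinger equation with $\sigma=-1$, $$i q_t+q_{xx}-i(|q|^2q)_x=0,\qquad q(x,t)\to0\ \text{ as } x\to\pm\infty, \qquad (1)$$ for $q:\mathbb R^2\to\mathbb C$ of class $C^2$ such that, for every $T$, $|q(x,t)|$ and $|q_x(x,t)|$ are bounded for $|t|\le T$ by an integrable function of $x$. *Scattering data.* Let $\theta(x,t;k)=k^2(x-2k^2t)$, $\Sigma=\mathbb R\cup i\mathbb R$, $D^{\pm}=\{k:\pm\operatorname{Re}k\,\operatorname{Im}k>0\}$, and let $\sigma_3=\mathrm{diag}(1,-1)$, $Q=\begin{pmatrix}0&q\\-q^*&0\end{pmatrix}$. The Jost solutions $\Phi_\pm$ of $\Phi_x=(ik^2\sigma_3+kQ)\Phi$ are normalised by $\Phi_\pm=e^{i\theta\sigma_3}+o(1)$ as $x\to\pm\infty$ for $k\in\Sigma$. Their columns $\Phi_{+1},\Phi_{-2}$ extend analytically to $D^+$, and $\Phi_{-1},\Phi_{+2}$ to $D^-$. The scattering matrix $S=(s_{ij})$ is given by $\Phi_+=\Phi_-S$, that is $s_{11}=\det(\Phi_{+1},\Phi_{-2})$,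 $s_{22}=\det(\Phi_{-1},\Phi_{+2})$, $s_{12}=\det(\Phi_{+2},\Phi_{-2})$, $s_{21}=\det(\Phi_{-1},\Phi_{+1})$. The reflection coefficients are $\rho=s_{21}/s_{11}$, $\tilde\rho=s_{12}/s_{22}$ on $\Sigma$. For a double zero $k_0\in D^+$ of $s_{11}$ the constants $b[k_0],d[k_0]$ are defined by $\Phi_{+1}=b\,\Phi_{-2}$ and $\partial_k\Phi_{+1}-b\,\partial_k\Phi_{-2}=d\,\Phi_{-2}$ at $k=k_0$, and $$A[k_0]=\frac{2b[k_0]}{s_{11}''(k_0)},\qquad B[k_0]=\frac{d[k_0]}{b[k_0]}-\frac{s_{11}'''(k_0)}{3s_{11}''(k_0)}.$$ For a double zero $k_0\in D^-$ of $s_{22}$ they are defined in the same way with $\Phi_{+2},\Phi_{-1},s_{22}$ in place of $\Phi_{+1},\Phi_{-2},s_{11}$. Let $k_1,\dots,k_N$ be distinct points of the open first quadrant. A *double-pole $N$-soliton* with spectrum $(k_n)$ is a solution $q$ of (1) as above such that $s_{11},s_{22}\ne0$ on $\Sigma$, $\rho=\tilde\rho=0$ on $\Sigma$, and the zeros of $s_{11}$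 in the open first quadrant are exactly $k_1,\dots,k_N$, all double ($s_{11}(k_n)=s_{11}'(k_n)=0\neq s_{11}''(k_n)$). *Determinants.* Let $\eta_n=k_n$ and $\eta_{N+n}=-k_n$ for $1\le n\le N$. For given numbers $A[\cdot],B[\cdot]$ at the points $\eta_n,\eta_n^*$ put, with $\theta'=\partial_k\theta$, $$C_n(z)=\frac{A[\eta_n]}{z-\eta_n}e^{-2i\theta(x,t;\eta_n)},\quad D_n=B[\eta_n]-2i\theta'(x,t;\eta_n),\quad \widehat C_n(z)=\frac{A[\eta_n^*]}{z-\eta_n^*}e^{2i\theta(x,t;\eta_n^*)},\quad \widehat D_n=B[\eta_n^*]+2i\theta'(x,t;\eta_n^*).$$ For $1\le n,j,m\le 2N$ write $u=\frac1{\eta_m-\eta_j^*}$, $w=\frac1{\eta_n^*-\eta_m}$, $P=C_m(\eta_n^*)\widehat C_j(\eta_m)$. The $4N\times4N$ matrices $H=(H^{(a,c)})$ and $\widehat H=(\widehat H^{(a,c)})$, $a,c\in\{1,2\}$, have the $2N\times2N$ blocks $$\begin{aligned} H^{(1,1)}_{nj}&=\sum_{m}P\,[-u(\widehat D_j+2u)+(D_m+w)(\widehat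 D_j+u)],& H^{(1,2)}_{nj}&=\sum_{m}P\,[-u+D_m+w],\\ H^{(2,1)}_{nj}&=\sum_{m}P\,w\,[u(\widehat D_j+2u)-(D_m+2w)(\widehat D_j+u)],& H^{(2,2)}_{nj}&=\sum_{m}P\,w\,[u-(D_m+2w)], \end{aligned}$$ $$\begin{aligned} \widehat H^{(1,1)}_{nj}&=\eta_n^*\sum_{m}\tfrac{P}{\eta_m}\Big[-u(\widehat D_j+2u)+\tfrac{\eta_m}{\eta_j^*}\big(D_m+w-\tfrac1{\eta_m}\big)\big(\widehat D_j+u-\tfrac1{\eta_j^*}\big)\Big],\\ \widehat H^{(1,2)}_{nj}&=\eta_n^*\sum_{m}\tfrac{P}{\eta_m}\Big[-u+\tfrac{\eta_m}{\eta_j^*}\big(D_m+w-\tfrac1{\eta_m}\big)\Big],\\ \widehat H^{(2,1)}_{nj}&=\sum_{m}P\,w\,\Big[u(\widehat D_j+2u)-\tfrac{\eta_m}{\eta_j^*}(D_m+2w)\big(\widehat D_j+u-\tfrac1{\eta_j^*}\big)\Big],\\ \widehat H^{(2,2)}_{nj}&=\sum_{m}P\,w\,\Big[u-\tfrac{\eta_m}{\eta_j^*}(D_m+2w)\Big].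 \end{aligned}$$ Finally $$G=\begin{pmatrix}I-H&\beta\\ \alpha^T&0\end{pmatrix},\qquad \widehat G=\begin{pmatrix}I-\widehat H&\beta\\ \alpha^T&0\end{pmatrix},\qquad \beta=(\underbrace{1,\dots,1}_{2N},\underbrace{0,\dots,0}_{2N})^T,$$ and $\alpha=(\alpha^{(1)},\alpha^{(2)})^T$ with $\alpha^{(1)}_n=A[\eta_n^*]e^{2i\theta(x,t;\eta_n^*)}\widehat D_n$, $\alpha^{(2)}_n=A[\eta_n^*]e^{2i\theta(x,t;\eta_n^*)}$. **Theorem.** Let $k_1,\dots,k_N$ be distinct points of the open first quadrant. (a) Let $q$ be a double-pole $N$-soliton with spectrum $(k_n)$ and let $A[\cdot],B[\cdot]$ be its discrete data. Then $A[k_n]\neq0$, $$A[k_n]=-A[k_n^*]^*=A[-k_n^*]^*=-A[-k_n],\qquad B[k_n]=B[k_n^*]^*=-B[-k_n^*]^*=-B[-k_n], \qquad (2)$$ and for all $(x,t)$ one has $\det(I-H)\neq0$, $\det(I-\widehat H)\ne0$ and $$q(x,t)=2i\left(\frac{\det\widehat G}{\det(I-\widehat H)}\right)^2\frac{\det(I-H)}{\det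 G}. \qquad (3)$$ Here $\det G$ vanishes exactly at the zeros of $q$, and at these points the right-hand side is read as $0$. (b) Conversely, for all numbers $A[\cdot],B[\cdot]$ on $\{\pm k_n,\pm k_n^*\}$ with $A[k_n]\ne0$ that satisfy (2), formula (3) defines a double-pole $N$-soliton with spectrum $(k_n)$ whose discrete data at $k_n$ are $A[k_n],B[k_n]$ for every $n$. -/

import Mathlib

open Filter Topology MeasureTheory
open scoped ComplexConjugate

noncomputable section

namespace DNLS

/-! ## The equation (with `σ = -1`) and the class of solutions -/

/-- `q` is a classical solution of `i q_t + q_xx + i σ (|q|² q)_x = 0` with `σ = -1`, with zero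
boundary conditions. The field `decay` is the quantitative form of decay under which the scattering
problem is posed: locally uniformly in `t`, both `q(·,t)` and `q_x(·,t)` are dominated by an
integrable function of `x`. -/
structure IsZBCSolution (q : ℝ → ℝ → ℂ) : Prop where
  contDiff : ContDiff ℝ 2 (fun p : ℝ × ℝ => q p.1 p.2)
  equation : ∀ x t : ℝ,
    Complex.I * deriv (fun s => q x s) t + iteratedDeriv 2 (fun y => q y t) x
      + Complex.I * (-1) * deriv (fun y => ((‖q y t‖ ^ 2 : ℝ) : ℂ) * q y t) x = 0
  tendsto_atTop : ∀ t : ℝ, Tendsto (fun x => q x t) atTop (𝓝 0)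
  tendsto_atBot : ∀ t : ℝ, Tendsto (fun x => q x t) atBot (𝓝 0)
  decay : ∀ T : ℝ, ∃ g : ℝ → ℝ, Integrable g ∧ ∀ x t : ℝ, |t| ≤ T →
    ‖q x t‖ ≤ g x ∧ ‖deriv (fun y => q y t) x‖ ≤ g x

/-! ## Direct scattering -/

/-- The matrix `X = i k² σ₃ + k Q` of the spectral problem `Φ_x = X Φ`, where
`Q = [[0, q], [-q*, 0]]`. -/
def laxX (q : ℝ → ℝ → ℂ) (x t : ℝ) (k : ℂ) : Matrix (Fin 2) (Fin 2) ℂ :=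
  (Complex.I * k ^ 2) • !![1, 0; 0, -1] + k • !![0, q x t; -conj (q x t), 0]

/-- `θ(x,t;k) = k² (x - 2 k² t)`. -/
def theta (x t : ℝ) (k : ℂ) : ℂ := k ^ 2 * ((x : ℂ) - 2 * k ^ 2 * (t : ℂ))

/-- The contour `Σ = ℝ ∪ iℝ`. -/
def contour : Set ℂ := {k | k.re = 0 ∨ k.im = 0}

/-- The entry `e^{iθ}` (for `j = 0`), `e^{-iθ}` (for `j = 1`) of `e^{iθσ₃}`. -/
def bgExp (j : Fin 2) (x t : ℝ) (k : ℂ) : ℂ :=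
  Complex.exp ((if j = 0 then 1 else -1) * Complex.I * theta x t k)

/-- `φ` solves the spectral problem at time `t` and, after division by the `j`-th exponential of
`e^{iθσ₃}`, tends to the `j`-th unit vector along `l` (`l = atTop` or `atBot`). For `k` on the contour
the exponential has modulus one, so that this is `Φ_j = e^{iθσ₃} e_j + o(1)`. For `k` off the contour,
in the region to which the column extends analytically, it is the (unique) solution
that gives the analytic extension. -/
def IsJostColumn (q : ℝ → ℝ → ℂ) (l : Filter ℝ) (j : Fin 2) (t : ℝ) (k : ℂ)
    (φ : ℝ → Fin 2 → ℂ) : Prop :=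
  (∀ x : ℝ, HasDerivAt φ ((laxX q x t k).mulVec (φ x)) x) ∧
    Tendsto (fun x => (bgExp j x t k)⁻¹ • φ x) l (𝓝 (Pi.single j 1))

/-- The `j`-th column of the Jost solution normalised along `l`. -/
def jost (q : ℝ → ℝ → ℂ) (l : Filter ℝ) (j : Fin 2) (x t : ℝ) (k : ℂ) : Fin 2 → ℂ :=
  Classical.epsilon (IsJostColumn q l j t k) x

/-- First column of `Φ₊`. -/
abbrev jostP1 (q : ℝ → ℝ → ℂ) := jost q atTop 0
/-- Second column of `Φ₊`. -/
abbrev jostP2 (q : ℝ → ℝ → ℂ) := jost q atTop 1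
/-- First column of `Φ₋`. -/
abbrev jostM1 (q : ℝ → ℝ → ℂ) := jost q atBot 0
/-- Second column of `Φ₋`. -/
abbrev jostM2 (q : ℝ → ℝ → ℂ) := jost q atBot 1

/-- Wronskian (determinant) of two columns. -/
def wr (u v : Fin 2 → ℂ) : ℂ := u 0 * v 1 - u 1 * v 0

/-! The scattering coefficients, through their Wronskian representations. These do not depend on the
point `(x,t)`, which is taken to be `(0,0)`. On the contour they are the entries of the matrix `S` with
`Φ₊ = Φ₋ S`; off the contour `s11` and `s22` are the analytic extensions to
`{Re k Im k > 0}` and `{Re k Im k < 0}`. -/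

def s11 (q : ℝ → ℝ → ℂ) (k : ℂ) : ℂ := wr (jostP1 q 0 0 k) (jostM2 q 0 0 k)
def s22 (q : ℝ → ℝ → ℂ) (k : ℂ) : ℂ := wr (jostM1 q 0 0 k) (jostP2 q 0 0 k)
def s12 (q : ℝ → ℝ → ℂ) (k : ℂ) : ℂ := wr (jostP2 q 0 0 k) (jostM2 q 0 0 k)
def s21 (q : ℝ → ℝ → ℂ) (k : ℂ) : ℂ := wr (jostM1 q 0 0 k) (jostP1 q 0 0 k)

/-- Reflection coefficient `ρ`. -/
def rho (q : ℝ → ℝ → ℂ) (k : ℂ) : ℂ := s21 q k / s11 q k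
/-- Reflection coefficient `ρ̃`. -/
def rhoTilde (q : ℝ → ℝ → ℂ) (k : ℂ) : ℂ := s12 q k / s22 q k

/-- The proportionality coefficient `u / v`: the constant `c` with `u = c v` for all `x, t`. -/
def ratio (u v : ℝ → ℝ → Fin 2 → ℂ) : ℂ :=
  Classical.epsilon fun c : ℂ => ∀ x t : ℝ, u x t = c • v x t

/-- `b[k₀]`. -/
def normB (q : ℝ → ℝ → ℂ) (k₀ : ℂ) : ℂ :=
  if 0 < k₀.re * k₀.im then
    ratio (fun x t => jostP1 q x t k₀) (fun x t => jostM2 q x t k₀)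
  else
    ratio (fun x t => jostP2 q x t k₀) (fun x t => jostM1 q x t k₀)

/-- `d[k₀]`; the derivatives are with respect to `k`. -/
def normD (q : ℝ → ℝ → ℂ) (k₀ : ℂ) : ℂ :=
  if 0 < k₀.re * k₀.im then
    ratio (fun x t => deriv (jostP1 q x t) k₀ - normB q k₀ • deriv (jostM2 q x t) k₀)
      (fun x t => jostM2 q x t k₀)
  else
    ratio (fun x t => deriv (jostP2 q x t) k₀ - normB q k₀ • deriv (jostM1 q x t) k₀)
      (fun x t => jostM1 q x t k₀)

/-- The discrete datum `A[k₀]`. -/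
def discA (q : ℝ → ℝ → ℂ) (k₀ : ℂ) : ℂ :=
  if 0 < k₀.re * k₀.im then 2 * normB q k₀ / iteratedDeriv 2 (s11 q) k₀
  else 2 * normB q k₀ / iteratedDeriv 2 (s22 q) k₀

/-- The discrete datum `B[k₀]`. -/
def discB (q : ℝ → ℝ → ℂ) (k₀ : ℂ) : ℂ :=
  if 0 < k₀.re * k₀.im then
    normD q k₀ / normB q k₀ - iteratedDeriv 3 (s11 q) k₀ / (3 * iteratedDeriv 2 (s11 q) k₀)
  else
    normD q k₀ / normB q k₀ - iteratedDeriv 3 (s22 q) k₀ / (3 * iteratedDeriv 2 (s22 q) k₀)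

/-- `q` is a double-pole `N`-soliton with spectrum generated by `k₁, …, k_N`: a solution with
zero boundary conditions, without spectral singularities, reflectionless, and such that the zeros
of `s11` in the open first quadrant are the `kₙ`, all of them double. -/
structure IsDoublePoleSoliton {N : ℕ} (k : Fin N → ℂ) (q : ℝ → ℝ → ℂ) : Prop where
  solution : IsZBCSolution q
  no_spectral_singularity : ∀ z ∈ contour, s11 q z ≠ 0 ∧ s22 q z ≠ 0
  reflectionless : ∀ z ∈ contour, rho q z = 0 ∧ rhoTilde q z = 0
  zeros : ∀ z : ℂ, 0 < z.re → 0 < z.im → (s11 q z = 0 ↔ ∃ n, z = k n)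
  deriv_zero : ∀ n, deriv (s11 q) (k n) = 0
  double : ∀ n, iteratedDeriv 2 (s11 q) (k n) ≠ 0

/-- The nondegeneracy and the symmetry constraints for the data `A[·]`, `B[·]` on the
discrete spectrum `{kₙ, kₙ*, -kₙ*, -kₙ}`. -/
structure IsNormingData {N : ℕ} (k : Fin N → ℂ) (A B : ℂ → ℂ) : Prop where
  ne_zero : ∀ n, A (k n) ≠ 0
  A_conj : ∀ n, A (conj (k n)) = -conj (A (k n))
  A_neg_conj : ∀ n, A (-conj (k n)) = conj (A (k n))
  A_neg : ∀ n, A (-k n) = -A (k n)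
  B_conj : ∀ n, B (conj (k n)) = conj (B (k n))
  B_neg_conj : ∀ n, B (-conj (k n)) = -conj (B (k n))
  B_neg : ∀ n, B (-k n) = -B (k n)

/-! ## The determinants

The `2N` indices are `Fin N ⊕ Fin N`, with `η = (k₁, …, k_N, -k₁, …, -k_N)`. -/

section Determinants

variable {N : ℕ} (k : Fin N → ℂ) (A B : ℂ → ℂ) (x t : ℝ)

/-- `ηₙ`. -/
def eta : Fin N ⊕ Fin N → ℂ := Sum.elim k (fun n => -k n)

/-- `ηₙ*`. -/
def etaStar (n : Fin N ⊕ Fin N) : ℂ := conj (eta k n)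

/-- `Cₙ(z)`. -/
def coefC (n : Fin N ⊕ Fin N) (z : ℂ) : ℂ :=
  A (eta k n) / (z - eta k n) * Complex.exp (-2 * Complex.I * theta x t (eta k n))

/-- `Ĉₙ(z)`. -/
def coefCHat (n : Fin N ⊕ Fin N) (z : ℂ) : ℂ :=
  A (etaStar k n) / (z - etaStar k n) * Complex.exp (2 * Complex.I * theta x t (etaStar k n))

/-- `Dₙ = B[ηₙ] - 2 i θ'(ηₙ)`. -/
def coefD (n : Fin N ⊕ Fin N) : ℂ :=
  B (eta k n) - 2 * Complex.I * deriv (theta x t) (eta k n)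

/-- `D̂ₙ = B[ηₙ*] + 2 i θ'(ηₙ*)`. -/
def coefDHat (n : Fin N ⊕ Fin N) : ℂ :=
  B (etaStar k n) + 2 * Complex.I * deriv (theta x t) (etaStar k n)

/-- The `4N × 4N` matrix `H`. -/
def matH : Matrix ((Fin N ⊕ Fin N) ⊕ (Fin N ⊕ Fin N)) ((Fin N ⊕ Fin N) ⊕ (Fin N ⊕ Fin N)) ℂ :=
  Matrix.fromBlocks
    (Matrix.of fun n j => ∑ m, coefC k A x t m (etaStar k n) * coefCHat k A x t j (eta k m) *
      (-(1 / (eta k m - etaStar k j)) * (coefDHat k B x t j + 2 / (eta k m - etaStar k j))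
        + (coefD k B x t m + 1 / (etaStar k n - eta k m)) *
          (coefDHat k B x t j + 1 / (eta k m - etaStar k j))))
    (Matrix.of fun n j => ∑ m, coefC k A x t m (etaStar k n) * coefCHat k A x t j (eta k m) *
      (-(1 / (eta k m - etaStar k j))
        + (coefD k B x t m + 1 / (etaStar k n - eta k m))))
    (Matrix.of fun n j => ∑ m, coefC k A x t m (etaStar k n) * coefCHat k A x t j (eta k m) /
      (etaStar k n - eta k m) *
      (1 / (eta k m - etaStar k j) * (coefDHat k B x t j + 2 / (eta k m - etaStar k j))
        - (coefD k B x t m + 2 / (etaStar k n - eta k m)) *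
          (coefDHat k B x t j + 1 / (eta k m - etaStar k j))))
    (Matrix.of fun n j => ∑ m, coefC k A x t m (etaStar k n) * coefCHat k A x t j (eta k m) /
      (etaStar k n - eta k m) *
      (1 / (eta k m - etaStar k j)
        - (coefD k B x t m + 2 / (etaStar k n - eta k m))))

/-- The `4N × 4N` matrix `Ĥ`. -/
def matHHat :
    Matrix ((Fin N ⊕ Fin N) ⊕ (Fin N ⊕ Fin N)) ((Fin N ⊕ Fin N) ⊕ (Fin N ⊕ Fin N)) ℂ :=
  Matrix.fromBlocks
    (Matrix.of fun n j => etaStar k n *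
      ∑ m, coefC k A x t m (etaStar k n) * coefCHat k A x t j (eta k m) / eta k m *
      (-(1 / (eta k m - etaStar k j)) * (coefDHat k B x t j + 2 / (eta k m - etaStar k j))
        + eta k m / etaStar k j *
          (coefD k B x t m + 1 / (etaStar k n - eta k m) - 1 / eta k m) *
          (coefDHat k B x t j + 1 / (eta k m - etaStar k j) - 1 / etaStar k j)))
    (Matrix.of fun n j => etaStar k n *
      ∑ m, coefC k A x t m (etaStar k n) * coefCHat k A x t j (eta k m) / eta k m *
      (-(1 / (eta k m - etaStar k j))
        + eta k m / etaStar k j *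
          (coefD k B x t m + 1 / (etaStar k n - eta k m) - 1 / eta k m)))
    (Matrix.of fun n j =>
      ∑ m, coefC k A x t m (etaStar k n) * coefCHat k A x t j (eta k m) /
      (etaStar k n - eta k m) *
      (1 / (eta k m - etaStar k j) * (coefDHat k B x t j + 2 / (eta k m - etaStar k j))
        - eta k m / etaStar k j * (coefD k B x t m + 2 / (etaStar k n - eta k m)) *
          (coefDHat k B x t j + 1 / (eta k m - etaStar k j) - 1 / etaStar k j)))
    (Matrix.of fun n j =>
      ∑ m, coefC k A x t m (etaStar k n) * coefCHat k A x t j (eta k m) /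
      (etaStar k n - eta k m) *
      (1 / (eta k m - etaStar k j)
        - eta k m / etaStar k j * (coefD k B x t m + 2 / (etaStar k n - eta k m))))

/-- The column vector `α = (α⁽¹⁾, α⁽²⁾)ᵀ`. -/
def vecAlpha : (Fin N ⊕ Fin N) ⊕ (Fin N ⊕ Fin N) → ℂ :=
  Sum.elim
    (fun n => A (etaStar k n) * Complex.exp (2 * Complex.I * theta x t (etaStar k n)) *
      coefDHat k B x t n)
    (fun n => A (etaStar k n) * Complex.exp (2 * Complex.I * theta x t (etaStar k n)))

/-- The column vector `β = (1, …, 1, 0, …, 0)ᵀ`. -/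
def vecBeta (N : ℕ) : (Fin N ⊕ Fin N) ⊕ (Fin N ⊕ Fin N) → ℂ :=
  Sum.elim (fun _ => 1) (fun _ => 0)

/-- The bordered matrix `[[I - M, β], [αᵀ, 0]]`. -/
def bordered
    (M : Matrix ((Fin N ⊕ Fin N) ⊕ (Fin N ⊕ Fin N)) ((Fin N ⊕ Fin N) ⊕ (Fin N ⊕ Fin N)) ℂ) :
    Matrix (((Fin N ⊕ Fin N) ⊕ (Fin N ⊕ Fin N)) ⊕ Unit)
      (((Fin N ⊕ Fin N) ⊕ (Fin N ⊕ Fin N)) ⊕ Unit) ℂ :=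
  Matrix.fromBlocks (1 - M) (Matrix.of fun i _ => vecBeta N i)
    (Matrix.of fun _ j => vecAlpha k A B x t j) 0

/-- `G`. -/
def matG := bordered k A B x t (matH k A B x t)

/-- `Ĝ`. -/
def matGHat := bordered k A B x t (matHHat k A B x t)

/-- `2i (det Ĝ / det (I - Ĥ))² det (I - H) / det G`. -/
def solitonFormula : ℂ :=
  2 * Complex.I * ((matGHat k A B x t).det / (1 - matHHat k A B x t).det) ^ 2 *
    ((1 - matH k A B x t).det / (matG k A B x t).det)

end Determinants

end DNLS

end

open Filter Topology MeasureTheory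
open scoped ComplexConjugate

noncomputable section

namespace DNLS

/-! The inverse problem is posed for a single row (f, g). Here f has double poles at the points ηₙ
and g at their conjugates. With c = A e^{-2iθ}, e = c D, P(z) = c/(z-η)² + e/(z-η) and f†(z) = conj
f(conj z), both f - P g and g† + P f† are regular at every η = ηₙ (`RowSol`). Everything rests on
one observation: f f† + g g† has no poles and is bounded, hence constant (`RowSol.exists_const`). On
the real axis it equals |f|² + |g|², so a row that vanishes at infinity, or at the origin, is zero.

Determinants. A row is determined by the values and derivatives of f at the points ηₙ*: they give
the principal parts of g, and g gives those of f. Requiring consistency is the linear system I - H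
when the row is normalised at infinity and I - Ĥ when it is normalised at the origin
(`matH_mulVec_inl`, `matHHat_mulVec_inl`). Uniqueness makes both determinants nonzero. The bordered
determinants extract the coefficient of 1/z in g. The row with value (1, 0) at the origin is
(`solF`, `solG`); its first entry has a limit `solFInf` of modulus one at infinity, and dividing by
that limit gives the row normalised at infinity. Hence the formula is -2i times the coefficient
`solGOne` times `solFInf` (`solitonFormula_eq`).

Part (b). Suitable corrections of the x- and t-derivatives of the row solve the same residue problem
and vanish at the origin, so they are zero: this is the Lax pair (`lax_x`, `lax_t`). Its
compatibility, read off from ∂_z g at z = 0, is the equation. As x → -∞ the residue data decay. As x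
→ +∞ their inverses do, and multiplication by a Blaschke product `bl` moves the poles of f to ηₙ*,
where the coefficients are small. This gives the decay of q, explicit Jost columns (`solM2`,
`solP1`), s₁₁ = `bl`, and the discrete data from the 1-jets of the columns at ηₙ (`solP1_jet`).

Part (a). For an arbitrary soliton the Jost columns are first constructed, analytically in λ = k²,
by a gauge transformation followed by Volterra equations (`IsPotential.exists_upperJost`). They
evolve by the time part of the Lax pair, so that b and d do not depend on (x, t)
(`IsZBCSolution.exists_isJet`), and the symmetries of the spectral problem give (2). Absence of
reflection says that Φ₊₁/s₁₁ in the upper half plane of λ continues, across the real axis, to the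
reflection of Φ₋₂ (`IsDoublePoleSoliton.real_eq`). By Morera's theorem the glued functions form a
row with the residue data of q and the value (1, 0) at the origin. Uniqueness identifies it with the
explicit row, and the potential is recovered from the differential equation of Φ₋₂ at k = 1
(`IsDoublePoleSoliton.eq_solQ`). -/

/-! ## Removable singularities and Liouville's theorem -/

/-- `f` agrees near `p`, except possibly at `p` itself, with a function analytic at `p`. -/
def Removable (f : ℂ → ℂ) (p : ℂ) : Prop :=
  ∃ g : ℂ → ℂ, AnalyticAt ℂ g p ∧ f =ᶠ[𝓝[≠] p] g

lemma _root_.AnalyticAt.removable {f : ℂ → ℂ} {p : ℂ} (h : AnalyticAt ℂ f p) : Removable f p :=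
  ⟨f, h, EventuallyEq.rfl⟩

namespace Removable

variable {f g : ℂ → ℂ} {p : ℂ}

lemma congr (h : Removable f p) (hfg : f =ᶠ[𝓝[≠] p] g) : Removable g p :=
  let ⟨u, hu, e⟩ := h
  ⟨u, hu, hfg.symm.trans e⟩

lemma add (hf : Removable f p) (hg : Removable g p) : Removable (fun z => f z + g z) p := by
  obtain ⟨u, hu, e⟩ := hf
  obtain ⟨v, hv, e'⟩ := hg
  exact ⟨fun z => u z + v z, hu.add hv, e.add e'⟩

lemma mul (hf : Removable f p) (hg : Removable g p) : Removable (fun z => f z * g z) p := by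
  obtain ⟨u, hu, e⟩ := hf
  obtain ⟨v, hv, e'⟩ := hg
  exact ⟨fun z => u z * v z, hu.mul hv, e.mul e'⟩

lemma const (c : ℂ) : Removable (fun _ => c) p := analyticAt_const.removable

lemma neg (hf : Removable f p) : Removable (fun z => -f z) p := by
  obtain ⟨u, hu, e⟩ := hf
  exact ⟨fun z => -u z, hu.neg, e.neg⟩

lemma sub (hf : Removable f p) (hg : Removable g p) : Removable (fun z => f z - g z) p := by
  simpa [sub_eq_add_neg] using hf.add hg.neg

lemma sum {ι : Type*} (s : Finset ι) {F : ι → ℂ → ℂ} (h : ∀ i ∈ s, Removable (F i) p) :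
    Removable (fun z => ∑ i ∈ s, F i z) p := by
  classical
  induction s using Finset.induction_on with
  | empty => simpa using Removable.const 0
  | insert a s ha ih =>
    simp only [Finset.sum_insert ha]
    exact (h a (by simp)).add (ih fun i hi => h i (by simp [hi]))

lemma comp_neg (hf : Removable f (-p)) : Removable (fun z => f (-z)) p := by
  obtain ⟨u, hu, e⟩ := hf
  refine ⟨fun z => u (-z), ?_, ?_⟩
  · exact AnalyticAt.fun_comp hu analyticAt_id.neg
  · have : Tendsto (fun z : ℂ => -z) (𝓝[≠] p) (𝓝[≠] (-p)) := by
      refine tendsto_nhdsWithin_of_tendsto_nhds_of_eventually_within _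
        ((continuous_neg.tendsto p).mono_left nhdsWithin_le_nhds) ?_
      filter_upwards [self_mem_nhdsWithin] with z hz
      simpa using hz
    exact this.eventually e

end Removable

/-- The local analytic representatives g p fit together to the entire function z ↦ g z z. It is
bounded outside a compact set by hypothesis and inside by continuity, so Liouville's theorem
applies. -/
lemma eq_const_of_removable {f : ℂ → ℂ} (h : ∀ p, Removable f p)
    (hb : f =O[cocompact ℂ] (fun _ => (1 : ℝ))) :
    ∃ c, ∀ p, f =ᶠ[𝓝[≠] p] fun _ => c := by
  choose g hg hfg using h
  have hF : ∀ p, ∀ᶠ z in 𝓝 p, g z z = g p z := by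
    intro p
    obtain ⟨U, hU, hUo, hpU⟩ := eventually_nhds_iff.1 (eventually_nhdsWithin_iff.1 (hfg p))
    filter_upwards [hUo.mem_nhds hpU, (hg p).eventually_analyticAt] with z hz hza
    by_cases hzp : z = p
    · rw [hzp]
    have h1 : f =ᶠ[𝓝[≠] z] g p := by
      have : ∀ᶠ y in 𝓝 z, y ∈ U ∧ y ≠ p := by
        filter_upwards [hUo.mem_nhds hz, isOpen_ne.mem_nhds hzp] with y h1 h2 using ⟨h1, h2⟩
      filter_upwards [nhdsWithin_le_nhds this] with y hy using hU y hy.1 hy.2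
    have h2 : g z =ᶠ[𝓝[≠] z] g p := (hfg z).symm.trans h1
    have h3 := ((hg z).continuousAt.eventuallyEq_nhds_iff_eventuallyEq_nhdsNE hza.continuousAt).1 h2
    exact h3.eq_of_nhds
  have hd : Differentiable ℂ (fun z => g z z) := fun p =>
    ((hg p).differentiableAt).congr_of_eventuallyEq (hF p)
  have hfe : ∀ p, f =ᶠ[𝓝[≠] p] fun z => g z z := fun p =>
    (hfg p).trans ((hF p).filter_mono nhdsWithin_le_nhds |>.mono fun z hz => hz.symm)
  obtain ⟨C, hC⟩ := hb.bound
  obtain ⟨K, hK, hKs⟩ := mem_cocompact.1 hC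
  have hbd : ∀ z ∈ Kᶜ, ‖g z z‖ ≤ C := by
    intro z hz
    have hev : ∀ᶠ y in 𝓝[≠] z, ‖g y y‖ ≤ C := by
      filter_upwards [hfe z, nhdsWithin_le_nhds (hK.isClosed.isOpen_compl.mem_nhds hz)] with y h1 h2
      have := hKs h2
      simp only [Set.mem_ofPred_eq, norm_one, mul_one] at this
      rw [← h1]; exact this
    have ht : Tendsto (fun y => ‖g y y‖) (𝓝[≠] z) (𝓝 ‖g z z‖) :=
      ((hd z).continuousAt.norm.tendsto).mono_left nhdsWithin_le_nhds
    exact le_of_tendsto ht hev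
  obtain ⟨C', hC'⟩ := hK.exists_bound_of_continuousOn hd.continuous.continuousOn
  have hB : Bornology.IsBounded (Set.range fun z => g z z) := by
    rw [isBounded_iff_forall_norm_le]
    refine ⟨max C C', ?_⟩
    rintro _ ⟨z, rfl⟩
    by_cases hz : z ∈ K
    · exact (hC' z hz).trans (le_max_right _ _)
    · exact (hbd z hz).trans (le_max_left _ _)
  refine ⟨g 0 0, fun p => (hfe p).trans (Eventually.of_forall fun z => ?_)⟩
  exact hd.apply_eq_apply_of_bounded hB z 0

/-! ## Morera: functions analytic off the real line -/

/-- A rectangle that meets the real axis is cut along it. In each half f is analytic inside and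
continuous up to the boundary, so Cauchy's theorem holds there, and the integrals along the cut
cancel. -/
lemma isConservativeOn_of_continuousOn_of_differentiableOn_off_real {f : ℂ → ℂ} {c : ℂ} {r : ℝ}
    (hc : ContinuousOn f (Metric.ball c r))
    (hd : ∀ z ∈ Metric.ball c r, z.im ≠ 0 → DifferentiableAt ℂ f z) :
    Complex.IsConservativeOn f (Metric.ball c r) := by
  intro z w hzw
  rw [← add_eq_zero_iff_eq_neg, Complex.wedgeIntegral_add_wedgeIntegral_eq]
  -- The case of a rectangle, between heights a and b, whose interior does not meet the real axis.
  have key : ∀ a b : ℝ, Set.uIcc a b ⊆ Set.uIcc z.im w.im → 0 ∉ Set.Ioo (min a b) (max a b) →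
      (∫ x : ℝ in z.re..w.re, f (x + a * Complex.I)) -
        (∫ x : ℝ in z.re..w.re, f (x + b * Complex.I)) +
        Complex.I • (∫ y : ℝ in a..b, f (w.re + y * Complex.I)) -
        Complex.I • (∫ y : ℝ in a..b, f (z.re + y * Complex.I)) = 0 := by
    intro a b hab h0
    have := Complex.integral_boundary_rect_eq_zero_of_continuousOn_of_differentiableOn f
      (⟨z.re, a⟩ : ℂ) ⟨w.re, b⟩ ?_ ?_
    · simpa using this
    · refine hc.mono fun y hy => hzw ?_
      rw [Complex.mem_reProdIm] at hy
      exact ⟨hy.1, hab hy.2⟩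
    · intro y hy
      rw [Complex.mem_reProdIm] at hy
      refine (hd y (hzw ⟨?_, hab ?_⟩) ?_).differentiableWithinAt
      · exact Set.Ioo_subset_Icc_self hy.1
      · exact Set.Ioo_subset_Icc_self hy.2
      · rintro h
        exact h0 (h ▸ hy.2)
  by_cases h0 : (0 : ℝ) ∈ Set.uIcc z.im w.im
  · have hv : ∀ s : ℝ, s ∈ Set.uIcc z.re w.re →
        ContinuousOn (fun y : ℝ => f (s + y * Complex.I)) (Set.uIcc z.im w.im) := by
      intro s hs
      refine hc.comp (by fun_prop) fun y hy => hzw ?_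
      exact Complex.mem_reProdIm.2 ⟨by simpa using hs, by simpa using hy⟩
    have hsub1 : Set.uIcc z.im 0 ⊆ Set.uIcc z.im w.im := Set.uIcc_subset_uIcc_left h0
    have hsub2 : Set.uIcc 0 w.im ⊆ Set.uIcc z.im w.im := Set.uIcc_subset_uIcc_right h0
    have hadd : ∀ s : ℝ, s ∈ Set.uIcc z.re w.re →
        (∫ y : ℝ in z.im..w.im, f (s + y * Complex.I)) =
          (∫ y : ℝ in z.im..0, f (s + y * Complex.I)) + ∫ y : ℝ in (0)..w.im, f (s + y * Complex.I) :=
      fun s hs => (intervalIntegral.integral_add_adjacent_intervals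
        ((hv s hs).mono hsub1).intervalIntegrable ((hv s hs).mono hsub2).intervalIntegrable).symm
    rw [hadd _ Set.right_mem_uIcc, hadd _ Set.left_mem_uIcc]
    have k1 := key z.im 0 hsub1 (by rintro ⟨h1, h2⟩; rcases le_total z.im 0 with h | h <;> simp_all)
    have k2 := key 0 w.im hsub2 (by rintro ⟨h1, h2⟩; rcases le_total w.im 0 with h | h <;> simp_all)
    simp only [smul_eq_mul] at k1 k2 ⊢
    linear_combination k1 + k2
  · exact key _ _ subset_rfl fun h => h0 (Set.Ioo_subset_Icc_self h)

/-- Morera's theorem on each disc. It serves to glue functions defined in the two half planes along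
the real axis. -/
lemma differentiableOn_of_continuousOn_of_off_real {f : ℂ → ℂ} {U : Set ℂ} (hU : IsOpen U)
    (hc : ContinuousOn f U) (hd : ∀ z ∈ U, z.im ≠ 0 → DifferentiableAt ℂ f z) :
    DifferentiableOn ℂ f U := by
  intro z hz
  obtain ⟨r, hr, hrU⟩ := Metric.isOpen_iff.1 hU z hz
  have h1 := isConservativeOn_of_continuousOn_of_differentiableOn_off_real (hc.mono hrU)
    fun w hw => hd w (hrU hw)
  have h2 := (Complex.IsConservativeOn.isExactOn_ball (hc.mono hrU) h1).differentiableOn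
    Metric.isOpen_ball
  exact (h2.differentiableAt (Metric.ball_mem_nhds z hr)).differentiableWithinAt

/-! ## Reflection `f ↦ conj (f (conj z))` -/

/-- `z ↦ conj (f (conj z))`. -/
def dag (f : ℂ → ℂ) (z : ℂ) : ℂ := conj (f (conj z))

lemma dag_analyticAt {f : ℂ → ℂ} {z : ℂ} (h : AnalyticAt ℂ f (conj z)) : AnalyticAt ℂ (dag f) z := by
  rw [Complex.analyticAt_iff_eventually_differentiableAt] at h ⊢
  have h' := (Complex.continuous_conj.tendsto z).eventually h
  filter_upwards [h'] with w hw
  have := hw.hasDerivAt.conj_conj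
  simp only [Complex.conj_conj] at this
  exact this.differentiableAt

lemma deriv_dag {f : ℂ → ℂ} {z : ℂ} : deriv (dag f) z = conj (deriv f (conj z)) := by
  have : dag f = conj ∘ f ∘ conj := rfl
  rw [this, deriv_conj_conj]
  rfl

lemma tendsto_conj_cocompact : Tendsto (conj : ℂ → ℂ) (cocompact ℂ) (cocompact ℂ) := by
  exact Complex.conjCLE.toHomeomorph.isClosedEmbedding.tendsto_cocompact

/-! ## Double poles -/

/-- The remainder is the second iterated slope function, so the identity holds for every z although
f is analytic only at p. -/
lemma exists_taylor_two {f : ℂ → ℂ} {p : ℂ} (h : AnalyticAt ℂ f p) :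
    ∃ u : ℂ → ℂ, AnalyticAt ℂ u p ∧
      ∀ z, f z = f p + (z - p) * deriv f p + (z - p) ^ 2 * u z := by
  have h1 : AnalyticAt ℂ (dslope f p) p := by
    obtain ⟨q, hq⟩ := h
    exact ⟨_, hq.has_fpower_series_dslope_fslope⟩
  have h2 : AnalyticAt ℂ (dslope (dslope f p) p) p := by
    obtain ⟨q, hq⟩ := h1
    exact ⟨_, hq.has_fpower_series_dslope_fslope⟩
  refine ⟨_, h2, fun z => ?_⟩
  have e1 := sub_smul_dslope f p z
  have e2 := sub_smul_dslope (dslope f p) p z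
  simp only [smul_eq_mul, dslope_same] at e1 e2
  linear_combination -e1 - (z - p) * e2

/-- The principal part `c / (z - p)² + e / (z - p)`. -/
def pp (p c e z : ℂ) : ℂ := c / (z - p) ^ 2 + e / (z - p)

/-- At a double pole only the 1-jet of the factor g matters. This is how a residue condition becomes
a pair of equations between values and derivatives. -/
lemma removable_pp_mul_sub {g : ℂ → ℂ} {p : ℂ} (c e : ℂ) (hg : AnalyticAt ℂ g p) :
    Removable (fun z => pp p c e z * g z - pp p (c * g p) (c * deriv g p + e * g p) z) p := by
  obtain ⟨u, hu, h⟩ := exists_taylor_two hg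
  refine ⟨fun z => c * u z + e * (deriv g p + (z - p) * u z), by fun_prop, ?_⟩
  filter_upwards [self_mem_nhdsWithin] with z hz
  have hz' : z - p ≠ 0 := sub_ne_zero.2 hz
  rw [h z, pp, pp]
  field_simp
  ring

lemma analyticAt_pp {p c e z : ℂ} (h : z ≠ p) : AnalyticAt ℂ (pp p c e) z := by
  have : z - p ≠ 0 := sub_ne_zero.2 h
  unfold pp
  fun_prop (disch := simpa using this)

lemma dag_pp (p c e : ℂ) : dag (pp p c e) = pp (conj p) (conj c) (conj e) := by
  ext z; simp [dag, pp]

lemma Removable.dag {f : ℂ → ℂ} {p : ℂ} (h : Removable f p) : Removable (dag f) (conj p) := by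
  obtain ⟨u, hu, e⟩ := h
  refine ⟨DNLS.dag u, dag_analyticAt (by simpa using hu), ?_⟩
  have : Tendsto (conj : ℂ → ℂ) (𝓝[≠] (conj p)) (𝓝[≠] p) := by
    refine tendsto_nhdsWithin_of_tendsto_nhds_of_eventually_within _ ?_ ?_
    · simpa using (Complex.continuous_conj.tendsto (conj p)).mono_left nhdsWithin_le_nhds
    · filter_upwards [self_mem_nhdsWithin] with z hz h
      exact hz (by simp [← Set.mem_singleton_iff.1 h])
  filter_upwards [this.eventually e] with z hz
  simp only [DNLS.dag, hz]

lemma eq_zero_of_removable_pp {p c e : ℂ} (h : Removable (pp p c e) p) : c = 0 ∧ e = 0 := by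
  obtain ⟨u, hu, he⟩ := h
  have hid : Tendsto (fun z : ℂ => z - p) (𝓝[≠] p) (𝓝 0) := by
    have : Tendsto (fun z : ℂ => z - p) (𝓝 p) (𝓝 (p - p)) := by
      exact (continuous_id.sub continuous_const).tendsto p
    simpa using this.mono_left nhdsWithin_le_nhds
  have hu' : Tendsto u (𝓝[≠] p) (𝓝 (u p)) := hu.continuousAt.tendsto.mono_left nhdsWithin_le_nhds
  have hc : c = 0 := by
    have h1 : Tendsto (fun z => (z - p) ^ 2 * u z - e * (z - p)) (𝓝[≠] p) (𝓝 0) := by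
      simpa using ((hid.pow 2).mul hu').sub (hid.const_mul e)
    refine tendsto_nhds_unique (tendsto_const_nhds.congr' ?_) h1
    filter_upwards [he, self_mem_nhdsWithin] with z hz hzp
    have : z - p ≠ 0 := sub_ne_zero.2 hzp
    rw [← hz, pp]; field_simp; ring
  refine ⟨hc, ?_⟩
  have h1 : Tendsto (fun z => (z - p) * u z) (𝓝[≠] p) (𝓝 0) := by
    simpa using hid.mul hu'
  refine tendsto_nhds_unique (tendsto_const_nhds.congr' ?_) h1
  filter_upwards [he, self_mem_nhdsWithin] with z hz hzp
  have : z - p ≠ 0 := sub_ne_zero.2 hzp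
  rw [← hz, pp, hc]; field_simp; ring

/-- Identity theorem: the complement of a finite set in the plane is connected, and the zeros
accumulate at the origin, which is not in S. -/
lemma eq_zero_of_eq_zero_on_Icc {f : ℂ → ℂ} {S : Set ℂ} (hS : S.Finite)
    (hre : ∀ z ∈ S, z.im ≠ 0) (hf : ∀ z, z ∉ S → AnalyticAt ℂ f z)
    (h0 : ∀ x : ℝ, |x| ≤ 1 → f x = 0) {z : ℂ} (hz : z ∉ S) : f z = 0 := by
  have hconn : IsPreconnected Sᶜ :=
    (hS.countable.isConnected_compl_of_one_lt_rank (by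
      rw [Complex.rank_real_complex]; exact Cardinal.one_lt_two)).isPreconnected
  have h0S : (0 : ℂ) ∈ Sᶜ := fun h => hre 0 h (by simp)
  refine AnalyticOnNhd.eqOn_zero_of_preconnected_of_frequently_eq_zero
    (fun w hw => hf w hw) hconn h0S ?_ hz
  have ht : Tendsto (fun x : ℝ => (x : ℂ)) (𝓝[≠] 0) (𝓝[≠] 0) := by
    refine tendsto_nhdsWithin_of_tendsto_nhds_of_eventually_within _ ?_ ?_
    · have := Complex.continuous_ofReal.tendsto 0
      simpa using this.mono_left nhdsWithin_le_nhds
    · filter_upwards [self_mem_nhdsWithin] with x hx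
      simpa using hx
  refine ht.frequently (Eventually.frequently ?_)
  have : ∀ᶠ x : ℝ in 𝓝 0, |x| < 1 :=
    (continuous_abs.tendsto (0 : ℝ)).eventually (eventually_lt_nhds (by simp))
  filter_upwards [nhdsWithin_le_nhds this] with x hx using h0 x hx.le

lemma tendsto_inv_cocompact : Tendsto (fun z : ℂ => z⁻¹) (cocompact ℂ) (𝓝 0) := by
  rw [← Metric.cobounded_eq_cocompact]
  exact tendsto_inv₀_cobounded

lemma pp_isBigO (p c e : ℂ) : pp p c e =O[cocompact ℂ] (fun z => z⁻¹) := by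
  have hz : Tendsto (fun z : ℂ => z - p) (cocompact ℂ) (cocompact ℂ) := by
    simpa [sub_eq_add_neg] using! (Homeomorph.addRight (-p)).isClosedEmbedding.tendsto_cocompact
  have h0 : Tendsto (fun z : ℂ => (z - p)⁻¹) (cocompact ℂ) (𝓝 0) :=
    tendsto_inv_cocompact.comp hz
  have hne : ∀ᶠ z in cocompact ℂ, z ≠ 0 ∧ z - p ≠ 0 := by
    filter_upwards [(isCompact_singleton (x := (0 : ℂ))).compl_mem_cocompact,
      (isCompact_singleton (x := p)).compl_mem_cocompact] with z h1 h2
    exact ⟨h1, sub_ne_zero.2 h2⟩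
  have h1 : (fun z : ℂ => (z - p)⁻¹) =O[cocompact ℂ] (fun z => z⁻¹) := by
    have hb : (fun z : ℂ => 1 + p * (z - p)⁻¹) =O[cocompact ℂ] (fun _ => (1 : ℂ)) := by
      have : Tendsto (fun z : ℂ => 1 + p * (z - p)⁻¹) (cocompact ℂ) (𝓝 (1 + p * 0)) :=
        tendsto_const_nhds.add (h0.const_mul p)
      exact this.isBigO_one ℂ
    have := hb.mul (Asymptotics.isBigO_refl (fun z : ℂ => z⁻¹) (cocompact ℂ))
    refine (this.congr' ?_ ?_)
    · filter_upwards [hne] with z hz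
      obtain ⟨h1, h2⟩ := hz
      field_simp; ring
    · simp
  have h2 : (fun z : ℂ => c * (z - p)⁻¹ + e) =O[cocompact ℂ] (fun _ => (1 : ℂ)) := by
    have : Tendsto (fun z : ℂ => c * (z - p)⁻¹ + e) (cocompact ℂ) (𝓝 (c * 0 + e)) :=
      (h0.const_mul c).add tendsto_const_nhds
    exact this.isBigO_one ℂ
  refine (h2.mul h1).congr' ?_ (by simp)
  filter_upwards [hne] with z hz
  obtain ⟨_, h2⟩ := hz
  rw [pp]; field_simp

lemma mul_pp_sub (p c e : ℂ) : (fun z => z * pp p c e z - e) =ᶠ[cocompact ℂ] pp p (p * c) (c + p * e) := by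
  filter_upwards [(isCompact_singleton (x := p)).compl_mem_cocompact] with z hz
  have : z - p ≠ 0 := sub_ne_zero.2 hz
  rw [pp, pp]; field_simp; ring

lemma deriv_pp {p c e z : ℂ} (h : z ≠ p) :
    HasDerivAt (pp p c e) (-(2 * c) / (z - p) ^ 3 - e / (z - p) ^ 2) z := by
  have hz : z - p ≠ 0 := sub_ne_zero.2 h
  have h1 : HasDerivAt (fun z => z - p) 1 z := (hasDerivAt_id z).sub_const p
  have := ((hasDerivAt_const z c).fun_div (h1.fun_pow 2) (by positivity)).fun_add
    ((hasDerivAt_const z e).fun_div h1 hz)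
  refine this.congr_deriv ?_
  field_simp; ring

/-! ### Partial fractions with double poles -/

section Pf

set_option linter.unusedSectionVars false

variable {ι : Type*} [Fintype ι]

/-- The rational function with value `c₀` at infinity and with the principal parts
`c n / (z - p n)² + e n / (z - p n)`. -/
def pf (p : ι → ℂ) (c₀ : ℂ) (c e : ι → ℂ) (z : ℂ) : ℂ := c₀ + ∑ n, pp (p n) (c n) (e n) z

variable {p : ι → ℂ} {c₀ : ℂ} {c e : ι → ℂ}

lemma pf_analyticAt {z : ℂ} (h : ∀ n, z ≠ p n) : AnalyticAt ℂ (pf p c₀ c e) z := by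
  unfold pf
  exact analyticAt_const.fun_add (Finset.univ.analyticAt_fun_sum fun n _ => analyticAt_pp (h n))

lemma pf_sub_isBigO : (fun z => pf p c₀ c e z - c₀) =O[cocompact ℂ] (fun z => z⁻¹) := by
  simp only [pf, add_sub_cancel_left]
  exact Asymptotics.IsBigO.fun_sum fun n _ => pp_isBigO _ _ _

lemma pf_tendsto : Tendsto (pf p c₀ c e) (cocompact ℂ) (𝓝 c₀) := by
  have h := (pf_sub_isBigO (p := p) (c₀ := c₀) (c := c) (e := e)).trans_tendsto
    tendsto_inv_cocompact
  simpa using h.add_const c₀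

lemma pf_isBigO_one : pf p c₀ c e =O[cocompact ℂ] (fun _ => (1 : ℝ)) := pf_tendsto.isBigO_one ℝ

/-- One step of the expansion at infinity. The coefficient of 1/z is the sum of the e n, and the
result is again a partial fraction with the same poles, so the step can be repeated. -/
lemma mul_pf_sub : (fun z => z * (pf p c₀ c e z - c₀)) =ᶠ[cocompact ℂ]
    pf p (∑ n, e n) (fun n => p n * c n) (fun n => c n + p n * e n) := by
  have : ∀ᶠ z in cocompact ℂ, ∀ n, z * pp (p n) (c n) (e n) z - e n
      = pp (p n) (p n * c n) (c n + p n * e n) z :=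
    Filter.eventually_all.2 fun n => mul_pp_sub _ _ _
  filter_upwards [this] with z hz
  simp only [pf, add_sub_cancel_left, Finset.mul_sum, ← hz, Finset.sum_sub_distrib]
  ring

lemma pf_hasDerivAt {z : ℂ} (h : ∀ n, z ≠ p n) :
    HasDerivAt (pf p c₀ c e) (∑ n, (-(2 * c n) / (z - p n) ^ 3 - e n / (z - p n) ^ 2)) z := by
  unfold pf
  exact (HasDerivAt.fun_sum fun n _ => deriv_pp (h n)).const_add c₀

lemma dag_pf : dag (pf p c₀ c e) =
    pf (fun n => conj (p n)) (conj c₀) (fun n => conj (c n)) (fun n => conj (e n)) := by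
  ext z
  have := fun n => congrFun (dag_pp (p n) (c n) (e n)) z
  simp only [dag] at this
  simp only [dag, pf, map_add, map_sum, this]

lemma pf_removable_sub_pp (hp : Function.Injective p) (n : ι) :
    Removable (fun z => pf p c₀ c e z - pp (p n) (c n) (e n) z) (p n) := by
  classical
  have : (fun z => pf p c₀ c e z - pp (p n) (c n) (e n) z) =
      fun z => c₀ + ∑ m ∈ Finset.univ.erase n, pp (p m) (c m) (e m) z := by
    ext z
    rw [pf, ← Finset.add_sum_erase _ _ (Finset.mem_univ n)]; ring
  rw [this]
  refine (Removable.const _).add (Removable.sum _ fun m hm => ?_)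
  exact (analyticAt_pp fun h => (Finset.ne_of_mem_erase hm) (hp h.symm)).removable

lemma pf_coeff_eq_zero (hp : Function.Injective p)
    (h : ∀ z, (∀ n, z ≠ p n) → pf p c₀ c e z = 0) : c₀ = 0 ∧ ∀ n, c n = 0 ∧ e n = 0 := by
  have hfin : (Set.range p).Finite := Set.finite_range p
  constructor
  · refine tendsto_nhds_unique (pf_tendsto (p := p) (c₀ := c₀) (c := c) (e := e))
      (tendsto_const_nhds.congr' ?_)
    filter_upwards [hfin.isCompact.compl_mem_cocompact] with z hz
    exact (h z fun n hn => hz ⟨n, hn.symm⟩).symm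
  · intro n
    refine eq_zero_of_removable_pp (p := p n) ?_
    refine (pf_removable_sub_pp (c₀ := c₀) (c := c) (e := e) hp n).neg.congr ?_
    have h1 : ∀ᶠ z in 𝓝[≠] (p n), ∀ m, z ≠ p m := by
      refine Filter.eventually_all.2 fun m => ?_
      by_cases hm : m = n
      · subst hm; exact self_mem_nhdsWithin
      · exact nhdsWithin_le_nhds (isOpen_ne.mem_nhds fun h => hm (hp h.symm))
    filter_upwards [h1] with z hz
    rw [h z hz]; ring

lemma pf_add (p : ι → ℂ) (a b : ℂ) (c c' e e' : ι → ℂ) (z : ℂ) :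
    pf p (a + b) (fun n => c n + c' n) (fun n => e n + e' n) z = pf p a c e z + pf p b c' e' z := by
  simp only [pf, pp, add_div, Finset.sum_add_distrib]; ring

lemma pf_smul (p : ι → ℂ) (s a : ℂ) (c e : ι → ℂ) (z : ℂ) :
    pf p (s * a) (fun n => s * c n) (fun n => s * e n) z = s * pf p a c e z := by
  simp only [pf, pp, mul_add, Finset.mul_sum, mul_div_assoc]

/-- The coefficients range over a finite-dimensional space, on which restriction to [-1, 1] is
linear and injective, hence bounded below. Bounds on the real axis thereby become bounds on
coefficients with a constant that depends only on the poles. -/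
lemma exists_pf_coeff_bound (hp : Function.Injective p) (him : ∀ n, (p n).im ≠ 0) :
    ∃ K : ℝ, 0 ≤ K ∧ ∀ (c₀ : ℂ) (c e : ι → ℂ) (M : ℝ), 0 ≤ M →
      (∀ x : ℝ, |x| ≤ 1 → ‖pf p c₀ c e x‖ ≤ M) →
      ‖c₀‖ ≤ K * M ∧ ∀ n, ‖c n‖ ≤ K * M ∧ ‖e n‖ ≤ K * M := by
  have hne : ∀ (x : ℝ) n, (x : ℂ) ≠ p n := fun x n h => him n (by rw [← h]; simp)
  let L : ℂ × (ι → ℂ) × (ι → ℂ) →ₗ[ℂ] C(Set.Icc (-1 : ℝ) 1, ℂ) :=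
    { toFun := fun v => ⟨fun x => pf p v.1 v.2.1 v.2.2 (x : ℝ), by
        refine continuous_iff_continuousAt.2 fun x => ?_
        exact ContinuousAt.comp (f := fun x : Set.Icc (-1 : ℝ) 1 => ((x : ℝ) : ℂ))
          (pf_analyticAt (hne x)).continuousAt (by fun_prop)⟩
      map_add' := fun v w => by
        ext x; exact pf_add _ _ _ _ _ _ _ _
      map_smul' := fun s v => by
        ext x; exact pf_smul _ _ _ _ _ _ }
  have hLv : ∀ v x, L v x = pf p v.1 v.2.1 v.2.2 (x : ℝ) := fun _ _ => rfl
  clear_value L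
  have hL : LinearMap.ker L = ⊥ := by
    rw [LinearMap.ker_eq_bot']
    rintro ⟨c₀, c, e⟩ hv
    have h0 : ∀ x : ℝ, |x| ≤ 1 → pf p c₀ c e x = 0 := fun x hx => by
      rw [← hLv (c₀, c, e) ⟨x, abs_le.1 hx⟩, hv]; rfl
    have := pf_coeff_eq_zero (c₀ := c₀) (c := c) (e := e) hp fun z hz =>
      eq_zero_of_eq_zero_on_Icc (Set.finite_range p) (by rintro _ ⟨n, rfl⟩; exact him n)
        (fun w hw => pf_analyticAt fun n hn => hw ⟨n, hn.symm⟩) h0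
        (fun ⟨n, hn⟩ => hz n hn.symm)
    ext n
    · exact this.1
    · exact (this.2 n).1
    · exact (this.2 n).2
  obtain ⟨K, -, hK⟩ := L.exists_antilipschitzWith hL
  refine ⟨K, K.2, fun c₀ c e M hM h => ?_⟩
  have h1 : ‖((c₀, c, e) : ℂ × (ι → ℂ) × (ι → ℂ))‖ ≤ K * M := by
    refine (ZeroHomClass.bound_of_antilipschitz L hK _).trans ?_
    gcongr
    exact (ContinuousMap.norm_le _ hM).2 fun x => by
      rw [hLv]; exact h x (abs_le.2 x.2)
  refine ⟨(norm_fst_le _).trans h1, fun n => ⟨?_, ?_⟩⟩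
  · exact (norm_le_pi_norm c n).trans ((norm_fst_le (c, e)).trans
      ((norm_snd_le (c₀, c, e)).trans h1))
  · exact (norm_le_pi_norm e n).trans ((norm_snd_le (c, e)).trans
      ((norm_snd_le (c₀, c, e)).trans h1))

/-! ## The Riemann-Hilbert problem for a row -/

/-- A row `(f, g)` that is analytic except for double poles of `f` at the `η n` and of `g` at their
conjugates, with the prescribed residue conditions, and that is bounded near infinity. -/
structure RowSol (η c e : ι → ℂ) (f g : ℂ → ℂ) : Prop where
  anf : ∀ z, (∀ n, z ≠ η n) → AnalyticAt ℂ f z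
  ang : ∀ z, (∀ n, z ≠ conj (η n)) → AnalyticAt ℂ g z
  reg : ∀ n, Removable (fun z => f z - pp (η n) (c n) (e n) z * g z) (η n)
  reg' : ∀ n, Removable (fun z => dag g z + pp (η n) (c n) (e n) z * dag f z) (η n)
  bdf : f =O[cocompact ℂ] (fun _ => (1 : ℝ))
  bdg : g =O[cocompact ℂ] (fun _ => (1 : ℝ))

lemma dag_isBigO_one {f : ℂ → ℂ} (h : f =O[cocompact ℂ] (fun _ => (1 : ℝ))) :
    dag f =O[cocompact ℂ] (fun _ => (1 : ℝ)) := by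
  have := h.comp_tendsto tendsto_conj_cocompact
  refine Asymptotics.IsBigO.trans ?_ this
  refine Asymptotics.isBigO_of_le _ fun z => ?_
  simp [dag]

namespace RowSol

variable {η c e : ι → ℂ} {f g : ℂ → ℂ}

lemma sub {f₂ g₂ : ℂ → ℂ} (h : RowSol η c e f g) (h₂ : RowSol η c e f₂ g₂) :
    RowSol η c e (fun z => f z - f₂ z) (fun z => g z - g₂ z) where
  anf z hz := (h.anf z hz).sub (h₂.anf z hz)
  ang z hz := (h.ang z hz).sub (h₂.ang z hz)
  reg n := by
    convert (h.reg n).sub (h₂.reg n) using 2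
    ring
  reg' n := by
    convert (h.reg' n).sub (h₂.reg' n) using 2
    simp only [dag, map_sub]
    ring
  bdf := h.bdf.sub h₂.bdf
  bdg := h.bdg.sub h₂.bdg

variable (hη : ∀ n m, η n ≠ conj (η m))
include hη

/-- The two residue conditions at ηₙ are skew to each other, so the poles cancel in f f† + g g† = (f
- P g) f† + g (g† + P f†), P being the principal part. The conjugate points follow because the
expression is invariant under †, and Liouville's theorem finishes. -/
lemma exists_const (h : RowSol η c e f g) : ∃ C, ∀ z, (∀ n, z ≠ η n) → (∀ n, z ≠ conj (η n)) →
    f z * dag f z + g z * dag g z = C := by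
  set F : ℂ → ℂ := fun z => f z * dag f z + g z * dag g z with hF
  have hFan : ∀ z, (∀ n, z ≠ η n) → (∀ n, z ≠ conj (η n)) → AnalyticAt ℂ F z := by
    intro z h1 h2
    have h1' : ∀ n, conj z ≠ conj (η n) := fun n hn => h1 n (by simpa using congrArg conj hn)
    have h2' : ∀ n, conj z ≠ η n := fun n hn => h2 n (by simpa using congrArg conj hn)
    exact ((h.anf z h1).mul (dag_analyticAt (h.anf _ h2'))).add
      ((h.ang z h2).mul (dag_analyticAt (h.ang _ h1')))
  have hFη : ∀ n, Removable F (η n) := by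
    intro n
    have h1 : AnalyticAt ℂ (dag f) (η n) := dag_analyticAt (h.anf _ fun m hm => hη m n hm.symm)
    have h2 : AnalyticAt ℂ g (η n) := h.ang _ fun m hm => hη n m hm
    convert ((h.reg n).mul h1.removable).add (h2.removable.mul (h.reg' n)) using 2
    ring
  have hdag : dag F = F := by
    ext z
    simp only [hF, dag, map_add, map_mul, Complex.conj_conj]
    ring
  have hrem : ∀ q, Removable F q := by
    intro q
    by_cases h1 : ∃ n, q = η n
    · obtain ⟨n, rfl⟩ := h1; exact hFη n
    by_cases h2 : ∃ n, q = conj (η n)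
    · obtain ⟨n, rfl⟩ := h2
      rw [← hdag]; exact (hFη n).dag
    push Not at h1 h2
    exact (hFan q h1 h2).removable
  have hbd : F =O[cocompact ℂ] (fun _ => (1 : ℝ)) := by
    have := (h.bdf.mul (dag_isBigO_one h.bdf)).add (h.bdg.mul (dag_isBigO_one h.bdg))
    simpa using this
  obtain ⟨C, hC⟩ := eq_const_of_removable hrem hbd
  refine ⟨C, fun z h1 h2 => ?_⟩
  exact ((hFan z h1 h2).continuousAt.eventuallyEq_nhds_iff_eventuallyEq_nhdsNE
    continuousAt_const).1 (hC z) |>.eq_of_nhds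

/-- On the real axis the expression is |f|² + |g|², so both entries vanish there and then everywhere
by the identity theorem. -/
lemma eq_zero_of_const_eq_zero (h : RowSol η c e f g)
    (h0 : ∀ z, (∀ n, z ≠ η n) → (∀ n, z ≠ conj (η n)) → f z * dag f z + g z * dag g z = 0) :
    (∀ z, (∀ n, z ≠ η n) → f z = 0) ∧ ∀ z, (∀ n, z ≠ conj (η n)) → g z = 0 := by
  have him : ∀ n, (η n).im ≠ 0 := fun n hn => hη n n (Complex.conj_eq_iff_im.2 hn).symm
  have hreal : ∀ x : ℝ, f x = 0 ∧ g x = 0 := by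
    intro x
    have := h0 x (fun n hn => him n (by rw [← hn]; simp))
      (fun n hn => him n (by simpa using (congrArg Complex.im hn).symm))
    simp only [dag, Complex.conj_ofReal, Complex.mul_conj] at this
    norm_cast at this
    have h1 := Complex.normSq_nonneg (f x)
    have h2 := Complex.normSq_nonneg (g x)
    exact ⟨Complex.normSq_eq_zero.1 (by linarith), Complex.normSq_eq_zero.1 (by linarith)⟩
  constructor
  · intro z hz
    exact eq_zero_of_eq_zero_on_Icc (Set.finite_range η) (by rintro _ ⟨n, rfl⟩; exact him n)
      (fun w hw => h.anf w fun n hn => hw ⟨n, hn.symm⟩) (fun x _ => (hreal x).1)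
      (fun ⟨n, hn⟩ => hz n hn.symm)
  · intro z hz
    exact eq_zero_of_eq_zero_on_Icc (Set.finite_range fun n => conj (η n))
      (by rintro _ ⟨n, rfl⟩; simpa using him n)
      (fun w hw => h.ang w fun n hn => hw ⟨n, hn.symm⟩) (fun x _ => (hreal x).2)
      (fun ⟨n, hn⟩ => hz n hn.symm)

/-- Uniqueness for the normalisation at the origin, used for I - Ĥ and for all later identifications
of rows. The counterpart at infinity, `eq_zero_of_tendsto_zero`, serves I - H. -/
lemma eq_zero_of_apply_zero (h0 : ∀ n, η n ≠ 0) (h : RowSol η c e f g) (hf : f 0 = 0)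
    (hg : g 0 = 0) :
    (∀ z, (∀ n, z ≠ η n) → f z = 0) ∧ ∀ z, (∀ n, z ≠ conj (η n)) → g z = 0 := by
  obtain ⟨C, hC⟩ := h.exists_const hη
  have := hC 0 (fun n => (h0 n).symm) (fun n hn => h0 n (by simpa using congrArg conj hn.symm))
  rw [hf, hg, zero_mul, zero_mul, add_zero] at this
  exact h.eq_zero_of_const_eq_zero hη fun z h1 h2 => by rw [hC z h1 h2, this]

lemma eq_zero_of_tendsto_zero (h : RowSol η c e f g) (hf : Tendsto f (cocompact ℂ) (𝓝 0))
    (hg : Tendsto g (cocompact ℂ) (𝓝 0)) :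
    (∀ z, (∀ n, z ≠ η n) → f z = 0) ∧ ∀ z, (∀ n, z ≠ conj (η n)) → g z = 0 := by
  obtain ⟨C, hC⟩ := h.exists_const hη
  have hd : ∀ {u : ℂ → ℂ}, Tendsto u (cocompact ℂ) (𝓝 0) → Tendsto (dag u) (cocompact ℂ) (𝓝 0) :=
    fun hu => by
      have := (Complex.continuous_conj.tendsto 0).comp (hu.comp tendsto_conj_cocompact)
      simpa [Function.comp_def, dag] using! this
  have h1 : Tendsto (fun z => f z * dag f z + g z * dag g z) (cocompact ℂ) (𝓝 0) := by
    simpa using (hf.mul (hd hf)).add (hg.mul (hd hg))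
  have h2 : C = 0 := by
    refine tendsto_nhds_unique (tendsto_const_nhds.congr' ?_) h1
    filter_upwards [(Set.finite_range η).isCompact.compl_mem_cocompact,
      (Set.finite_range fun n => conj (η n)).isCompact.compl_mem_cocompact] with z h1 h2
    exact (hC z (fun n hn => h1 ⟨n, hn.symm⟩) (fun n hn => h2 ⟨n, hn.symm⟩)).symm
  exact h.eq_zero_of_const_eq_zero hη fun z h1' h2' => by rw [hC z h1' h2', h2]

end RowSol

/-- The second product accommodates the product rule when a residue condition is differentiated
along a family; c' = e' = 0 gives back the plain condition. -/
lemma removable_pf_sub_pp_mul {η c e c' e' ch eh : ι → ℂ} {h₀ : ℂ} {k k' : ℂ → ℂ}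
    (hη : Function.Injective η) (n : ι) (hk : AnalyticAt ℂ k (η n)) (hk' : AnalyticAt ℂ k' (η n))
    (hc : ch n = c n * k (η n) + c' n * k' (η n))
    (he : eh n = c n * deriv k (η n) + e n * k (η n) +
      (c' n * deriv k' (η n) + e' n * k' (η n))) :
    Removable (fun z => pf η h₀ ch eh z - pp (η n) (c n) (e n) z * k z
      - pp (η n) (c' n) (e' n) z * k' z) (η n) := by
  convert ((pf_removable_sub_pp (c₀ := h₀) (c := ch) (e := eh) hη n).sub
    (removable_pp_mul_sub (c n) (e n) hk)).sub (removable_pp_mul_sub (c' n) (e' n) hk') using 2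
  simp only [pp, hc, he, add_div]
  ring

lemma rowSol_pf {η c e cf ef cg eg : ι → ℂ} {f₀ g₀ : ℂ} (hη : Function.Injective η)
    (hη' : ∀ n m, η n ≠ conj (η m))
    (hcf : ∀ n, cf n = c n * pf (fun n => conj (η n)) g₀ cg eg (η n))
    (hef : ∀ n, ef n = c n * deriv (pf (fun n => conj (η n)) g₀ cg eg) (η n) +
      e n * pf (fun n => conj (η n)) g₀ cg eg (η n))
    (hcg : ∀ n, cg n = -(conj (c n) * pf η f₀ cf ef (conj (η n))))
    (heg : ∀ n, eg n = -(conj (c n) * deriv (pf η f₀ cf ef) (conj (η n)) +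
      conj (e n) * pf η f₀ cf ef (conj (η n)))) :
    RowSol η c e (pf η f₀ cf ef) (pf (fun n => conj (η n)) g₀ cg eg) where
  anf z hz := pf_analyticAt hz
  ang z hz := pf_analyticAt hz
  reg n := by
    have := removable_pf_sub_pp_mul (c := c) (e := e) (c' := 0) (e' := 0) (ch := cf) (eh := ef)
      (h₀ := f₀) (k' := 0) hη n (pf_analyticAt (c₀ := g₀) (c := cg) (e := eg) (hη' n))
      analyticAt_const (by simp [hcf]) (by simp [hef])
    simpa using this
  reg' n := by
    have hd : AnalyticAt ℂ (dag (pf η f₀ cf ef)) (η n) :=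
      dag_analyticAt (pf_analyticAt fun m hm => hη' m n hm.symm)
    have := removable_pf_sub_pp_mul (c := fun n => -c n) (e := fun n => -e n) (c' := 0) (e' := 0)
      (ch := fun n => conj (cg n)) (eh := fun n => conj (eg n)) (h₀ := conj g₀) (k' := 0) hη n
      hd analyticAt_const (by simp [hcg, dag]) (by simp [heg, dag, deriv_dag]; ring)
    rw [dag_pf]
    simp only [Complex.conj_conj]
    refine this.congr (Eventually.of_forall fun z => ?_)
    simp only [pp]
    simp
    ring
  bdf := pf_isBigO_one
  bdg := pf_isBigO_one

end Pf

/-! ### The linear systems behind the determinants -/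

section Explicit

set_option linter.unusedSectionVars false

variable {N : ℕ} (k : Fin N → ℂ) (A B : ℂ → ℂ) (x t : ℝ)

/-- The coefficient `A[ηₙ] e^{-2iθ(ηₙ)}`. -/
def resC (n : Fin N ⊕ Fin N) : ℂ :=
  A (eta k n) * Complex.exp (-2 * Complex.I * theta x t (eta k n))

/-- The coefficient `A[ηₙ] e^{-2iθ(ηₙ)} Dₙ`. -/
def resE (n : Fin N ⊕ Fin N) : ℂ := resC k A x t n * coefD k B x t n

/-- The coefficient `A[ηₙ*] e^{2iθ(ηₙ*)}`. -/
def hatC (n : Fin N ⊕ Fin N) : ℂ :=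
  A (etaStar k n) * Complex.exp (2 * Complex.I * theta x t (etaStar k n))

variable {k A B}

lemma hasDerivAt_theta (x t : ℝ) (z : ℂ) :
    HasDerivAt (theta x t) (2 * z * x - 8 * z ^ 3 * t) z := by
  have h : HasDerivAt (fun z : ℂ => z ^ 2 * ((x : ℂ) - 2 * z ^ 2 * (t : ℂ)))
      (2 * z * ((x : ℂ) - 2 * z ^ 2 * t) + z ^ 2 * (-(2 * (2 * z) * t))) z := by
    have h1 : HasDerivAt (fun z : ℂ => z ^ 2) (2 * z) z := by simpa using hasDerivAt_pow 2 z
    exact h1.fun_mul (((h1.const_mul 2).mul_const (t : ℂ)).const_sub (x : ℂ))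
  exact h.congr_deriv (by ring)

lemma theta_conj (x t : ℝ) (z : ℂ) : theta x t (conj z) = conj (theta x t z) := by
  simp [theta, map_ofNat]

lemma theta_neg (x t : ℝ) (z : ℂ) : theta x t (-z) = theta x t z := by
  simp [theta]

section

variable (hre : ∀ n, 0 < (k n).re) (him : ∀ n, 0 < (k n).im)
include hre him

lemma eta_mem (n : Fin N ⊕ Fin N) : 0 < (eta k n).re * (eta k n).im := by
  rcases n with n | n <;> simp [eta, hre n, him n]

lemma eta_im_ne (n : Fin N ⊕ Fin N) : (eta k n).im ≠ 0 :=
  right_ne_zero_of_mul (eta_mem hre him n).ne'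

lemma eta_ne_zero (n : Fin N ⊕ Fin N) : eta k n ≠ 0 := fun h => by
  have := eta_mem hre him n
  simp [h] at this

lemma eta_ne_conj (n m : Fin N ⊕ Fin N) : eta k n ≠ conj (eta k m) := fun h => by
  have h1 := eta_mem hre him n
  have h2 := eta_mem hre him m
  rw [h] at h1
  simp at h1
  linarith

lemma eta_injective (hk : Function.Injective k) : Function.Injective (eta k) := by
  have hne : ∀ n m, k n ≠ -k m := fun n m h => by
    have h1 := hre n
    rw [h, Complex.neg_re] at h1
    linarith [hre m]
  rintro (n | n) (m | m) h
  · exact congrArg _ (hk h)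
  · exact absurd h (hne n m)
  · exact absurd h.symm (hne m n)
  · exact congrArg _ (hk (neg_injective h))

end

section

variable (hA : IsNormingData k A B)
include hA

lemma IsNormingData.A_etaStar (n : Fin N ⊕ Fin N) : A (etaStar k n) = -conj (A (eta k n)) := by
  rcases n with n | n
  · exact hA.A_conj n
  · simp [etaStar, eta, hA.A_neg_conj, hA.A_neg]

lemma IsNormingData.B_etaStar (n : Fin N ⊕ Fin N) : B (etaStar k n) = conj (B (eta k n)) := by
  rcases n with n | n
  · exact hA.B_conj n
  · simp [etaStar, eta, hA.B_neg_conj, hA.B_neg]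

/-- Together with `coefDHat_eq` this makes the data at ηₙ* the reflection, up to sign, of those at
ηₙ, which is what the second residue condition of `RowSol` requires. -/
lemma hatC_eq (n : Fin N ⊕ Fin N) : hatC k A x t n = -conj (resC k A x t n) := by
  rw [hatC, resC, hA.A_etaStar, etaStar, theta_conj, map_mul, ← Complex.exp_conj]
  simp [map_ofNat]

lemma coefDHat_eq (n : Fin N ⊕ Fin N) : coefDHat k B x t n = conj (coefD k B x t n) := by
  rw [coefDHat, coefD, hA.B_etaStar, (hasDerivAt_theta x t _).deriv, (hasDerivAt_theta x t _).deriv,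
    etaStar]
  simp [map_ofNat]

lemma IsNormingData.A_eta_ne_zero (n : Fin N ⊕ Fin N) : A (eta k n) ≠ 0 := by
  rcases n with n | n
  · exact hA.ne_zero n
  · simpa [eta, hA.A_neg] using hA.ne_zero n

lemma resC_ne_zero (n : Fin N ⊕ Fin N) : resC k A x t n ≠ 0 :=
  mul_ne_zero (hA.A_eta_ne_zero n) (Complex.exp_ne_zero _)

end

/-- Minus the value at `0` of a sum of principal parts. -/
def at0 {ι : Type*} [Fintype ι] (p c e : ι → ℂ) : ℂ := -∑ n, pp (p n) (c n) (e n) 0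

variable (k A B)

/-- The second entry of a row, in terms of the values of the first entry and of its derivative at
the points `ηₙ*`. -/
def rowG (g₀ : ℂ) (v : (Fin N ⊕ Fin N) ⊕ (Fin N ⊕ Fin N) → ℂ) : ℂ → ℂ :=
  pf (fun n => conj (eta k n)) g₀ (fun j => hatC k A x t j * v (.inl j))
    (fun j => hatC k A x t j * (v (.inr j) + coefDHat k B x t j * v (.inl j)))

/-- The first entry of a row, in terms of the second. -/
def rowF (f₀ : ℂ) (g : ℂ → ℂ) : ℂ → ℂ :=
  pf (eta k) f₀ (fun n => resC k A x t n * g (eta k n))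
    (fun n => resC k A x t n * deriv g (eta k n) + resE k A B x t n * g (eta k n))

/-- `rowG`, normalised to vanish at the origin. -/
def rowG₀ (v : (Fin N ⊕ Fin N) ⊕ (Fin N ⊕ Fin N) → ℂ) : ℂ → ℂ :=
  rowG k A B x t (at0 (fun n => conj (eta k n)) (fun j => hatC k A x t j * v (.inl j))
    (fun j => hatC k A x t j * (v (.inr j) + coefDHat k B x t j * v (.inl j)))) v

/-- `rowF`, normalised to have the value `s` at the origin. -/
def rowF₀ (s : ℂ) (g : ℂ → ℂ) : ℂ → ℂ :=
  rowF k A B x t (s + at0 (eta k) (fun n => resC k A x t n * g (eta k n))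
    (fun n => resC k A x t n * deriv g (eta k n) + resE k A B x t n * g (eta k n))) g

variable {k A B} {x t}

section

variable (hre : ∀ n, 0 < (k n).re) (him : ∀ n, 0 < (k n).im)
include hre him

lemma deriv_rowG (g₀ : ℂ) (v : (Fin N ⊕ Fin N) ⊕ (Fin N ⊕ Fin N) → ℂ) (m : Fin N ⊕ Fin N) :
    deriv (rowG k A B x t g₀ v) (eta k m) =
      ∑ j, (-(2 * (hatC k A x t j * v (.inl j))) / (eta k m - conj (eta k j)) ^ 3 -
        hatC k A x t j * (v (.inr j) + coefDHat k B x t j * v (.inl j)) /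
          (eta k m - conj (eta k j)) ^ 2) :=
  (pf_hasDerivAt (eta_ne_conj hre him m)).deriv

lemma deriv_rowF (f₀ : ℂ) (g : ℂ → ℂ) (n : Fin N ⊕ Fin N) :
    deriv (rowF k A B x t f₀ g) (conj (eta k n)) =
      ∑ m, (-(2 * (resC k A x t m * g (eta k m))) / (conj (eta k n) - eta k m) ^ 3 -
        (resC k A x t m * deriv g (eta k m) + resE k A B x t m * g (eta k m)) /
          (conj (eta k n) - eta k m) ^ 2) :=
  (pf_hasDerivAt fun m h => eta_ne_conj hre him m n h.symm).deriv

omit hre him in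
lemma sum_mul_add_sum_mul {ι κ : Type*} [Fintype ι] [Fintype κ] (a b : κ → ι → ℂ) (v w : ι → ℂ) :
    ∑ j, (∑ m, a m j) * v j + ∑ j, (∑ m, b m j) * w j = ∑ m, ∑ j, (a m j * v j + b m j * w j) := by
  simp only [Finset.sum_mul, ← Finset.sum_add_distrib]
  exact Finset.sum_comm

omit hre him in
lemma mulVec_sum {ι : Type*} [Fintype ι] (M : Matrix (ι ⊕ ι) (ι ⊕ ι) ℂ) (v : ι ⊕ ι → ℂ)
    (i : ι ⊕ ι) :
    M.mulVec v i = ∑ j, M i (.inl j) * v (.inl j) + ∑ j, M i (.inr j) * v (.inr j) := by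
  rw [Matrix.mulVec, dotProduct, Fintype.sum_sum_type]

/-- This is the meaning of H. A vector v of prescribed values and derivatives of f at ηₙ* determines
g through its principal parts, g determines a new f in the same way, and H sends v to the values and
derivatives of this new f, up to its constant term. -/
lemma matH_mulVec_inl (f₀ : ℂ) (v : (Fin N ⊕ Fin N) ⊕ (Fin N ⊕ Fin N) → ℂ) (n : Fin N ⊕ Fin N) :
    rowF k A B x t f₀ (rowG k A B x t 0 v) (conj (eta k n)) =
      f₀ + (matH k A B x t).mulVec v (.inl n) := by
  rw [rowF, pf, add_right_inj]
  simp only [deriv_rowG hre him, mulVec_sum, matH,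
    Matrix.fromBlocks_apply₁₁, Matrix.fromBlocks_apply₁₂, Matrix.of_apply]
  rw [sum_mul_add_sum_mul]
  refine Finset.sum_congr rfl fun m _ => ?_
  rw [rowG, pf, zero_add]
  simp only [pp, Finset.mul_sum, Finset.sum_div, ← Finset.sum_add_distrib]
  refine Finset.sum_congr rfl fun j _ => ?_
  simp only [coefC, coefCHat, resC, hatC, resE, etaStar]
  -- The two sides agree as polynomials in the inverses of p and z, so no denominator has to be
  -- nonzero.
  generalize eta k m - conj (eta k j) = p
  generalize conj (eta k n) - eta k m = z
  ring

lemma matH_mulVec_inr (f₀ : ℂ) (v : (Fin N ⊕ Fin N) ⊕ (Fin N ⊕ Fin N) → ℂ) (n : Fin N ⊕ Fin N) :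
    deriv (rowF k A B x t f₀ (rowG k A B x t 0 v)) (conj (eta k n)) =
      (matH k A B x t).mulVec v (.inr n) := by
  rw [deriv_rowF hre him]
  simp only [deriv_rowG hre him, mulVec_sum, matH,
    Matrix.fromBlocks_apply₂₁, Matrix.fromBlocks_apply₂₂, Matrix.of_apply]
  rw [sum_mul_add_sum_mul]
  refine Finset.sum_congr rfl fun m _ => ?_
  rw [rowG, pf, zero_add]
  simp only [pp, Finset.mul_sum, Finset.sum_div, ← Finset.sum_add_distrib, ← Finset.sum_sub_distrib,
    ← Finset.sum_neg_distrib]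
  refine Finset.sum_congr rfl fun j _ => ?_
  simp only [coefC, coefCHat, resC, hatC, resE, etaStar]
  generalize eta k m - conj (eta k j) = p
  generalize conj (eta k n) - eta k m = z
  ring

omit hre him in
lemma rowG₀_apply (v : (Fin N ⊕ Fin N) ⊕ (Fin N ⊕ Fin N) → ℂ) (z : ℂ) :
    rowG₀ k A B x t v z = ∑ j, (pp (conj (eta k j)) (hatC k A x t j * v (.inl j))
      (hatC k A x t j * (v (.inr j) + coefDHat k B x t j * v (.inl j))) z -
      pp (conj (eta k j)) (hatC k A x t j * v (.inl j))
      (hatC k A x t j * (v (.inr j) + coefDHat k B x t j * v (.inl j))) 0) := by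
  rw [rowG₀, rowG, pf, at0, Finset.sum_sub_distrib]
  ring

omit hre him in
lemma rowF₀_apply (s : ℂ) (g : ℂ → ℂ) (z : ℂ) :
    rowF₀ k A B x t s g z = s + ∑ n, (pp (eta k n) (resC k A x t n * g (eta k n))
      (resC k A x t n * deriv g (eta k n) + resE k A B x t n * g (eta k n)) z -
      pp (eta k n) (resC k A x t n * g (eta k n))
      (resC k A x t n * deriv g (eta k n) + resE k A B x t n * g (eta k n)) 0) := by
  rw [rowF₀, rowF, pf, at0, Finset.sum_sub_distrib]
  ring

/-- The matrix Ĥ is the same composition with both entries normalised at the origin: constants are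
subtracted so that g vanishes there and f takes the value s. -/
lemma matHHat_mulVec_inl (s : ℂ) (v : (Fin N ⊕ Fin N) ⊕ (Fin N ⊕ Fin N) → ℂ)
    (n : Fin N ⊕ Fin N) :
    rowF₀ k A B x t s (rowG₀ k A B x t v) (conj (eta k n)) =
      s + (matHHat k A B x t).mulVec v (.inl n) := by
  rw [rowF₀_apply, add_right_inj]
  have hd : ∀ m, deriv (rowG₀ k A B x t v) (eta k m) = _ := fun m => deriv_rowG hre him _ v m
  simp only [hd, mulVec_sum, matHHat,
    Matrix.fromBlocks_apply₁₁, Matrix.fromBlocks_apply₁₂, Matrix.of_apply]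
  simp only [Finset.mul_sum (a := etaStar k n)]
  rw [sum_mul_add_sum_mul]
  refine Finset.sum_congr rfl fun m _ => ?_
  rw [rowG₀_apply]
  simp only [pp, Finset.mul_sum, Finset.sum_div, ← Finset.sum_add_distrib,
    ← Finset.sum_sub_distrib]
  refine Finset.sum_congr rfl fun j _ => ?_
  simp only [coefC, coefCHat, resC, hatC, resE, etaStar]
  have h1 : eta k m - conj (eta k j) ≠ 0 := sub_ne_zero.2 (eta_ne_conj hre him m j)
  have h2 : conj (eta k n) - eta k m ≠ 0 := sub_ne_zero.2 (eta_ne_conj hre him m n).symm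
  have h3 : eta k m ≠ 0 := eta_ne_zero hre him m
  have h4 : conj (eta k j) ≠ 0 := by simpa using eta_ne_zero hre him j
  have h5 : conj (eta k n) ≠ 0 := by simpa using eta_ne_zero hre him n
  generalize conj (eta k j) = s at *
  generalize conj (eta k n) = z at *
  generalize eta k m = p at *
  field_simp
  ring

lemma matHHat_mulVec_inr (s : ℂ) (v : (Fin N ⊕ Fin N) ⊕ (Fin N ⊕ Fin N) → ℂ)
    (n : Fin N ⊕ Fin N) :
    deriv (rowF₀ k A B x t s (rowG₀ k A B x t v)) (conj (eta k n)) =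
      (matHHat k A B x t).mulVec v (.inr n) := by
  rw [rowF₀, deriv_rowF hre him]
  have hd : ∀ m, deriv (rowG₀ k A B x t v) (eta k m) = _ := fun m => deriv_rowG hre him _ v m
  simp only [hd, mulVec_sum, matHHat,
    Matrix.fromBlocks_apply₂₁, Matrix.fromBlocks_apply₂₂, Matrix.of_apply]
  rw [sum_mul_add_sum_mul]
  refine Finset.sum_congr rfl fun m _ => ?_
  rw [rowG₀_apply]
  simp only [pp, Finset.mul_sum, Finset.sum_div, ← Finset.sum_add_distrib,
    ← Finset.sum_sub_distrib, ← Finset.sum_neg_distrib]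
  refine Finset.sum_congr rfl fun j _ => ?_
  simp only [coefC, coefCHat, resC, hatC, resE, etaStar]
  have h1 : eta k m - conj (eta k j) ≠ 0 := sub_ne_zero.2 (eta_ne_conj hre him m j)
  have h2 : conj (eta k n) - eta k m ≠ 0 := sub_ne_zero.2 (eta_ne_conj hre him m n).symm
  have h3 : eta k m ≠ 0 := eta_ne_zero hre him m
  have h4 : conj (eta k j) ≠ 0 := by simpa using eta_ne_zero hre him j
  have h5 : conj (eta k n) ≠ 0 := by simpa using eta_ne_zero hre him n
  generalize conj (eta k j) = s at *
  generalize conj (eta k n) = z at *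
  generalize eta k m = p at *
  field_simp
  ring

/-- The condition at ηₙ is built into `rowF`. The one at ηₙ* is built into `rowG`, provided that v
really consists of the values and derivatives of f at these points. -/
lemma rowSol_of_fixed (hk : Function.Injective k) (hA : IsNormingData k A B) {f₀ g₀ : ℂ}
    {v : (Fin N ⊕ Fin N) ⊕ (Fin N ⊕ Fin N) → ℂ}
    (h1 : ∀ n, rowF k A B x t f₀ (rowG k A B x t g₀ v) (conj (eta k n)) = v (.inl n))
    (h2 : ∀ n, deriv (rowF k A B x t f₀ (rowG k A B x t g₀ v)) (conj (eta k n)) = v (.inr n)) :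
    RowSol (eta k) (resC k A x t) (resE k A B x t) (rowF k A B x t f₀ (rowG k A B x t g₀ v))
      (rowG k A B x t g₀ v) := by
  refine rowSol_pf (eta_injective hre him hk) (eta_ne_conj hre him) (fun n => rfl) (fun n => rfl)
    (fun n => ?_) fun n => ?_
  · have := h1 n
    rw [rowF] at this
    rw [this, hatC_eq x t hA]; ring
  · have e1 := h1 n
    have e2 := h2 n
    rw [rowF] at e1 e2
    rw [e1, e2, hatC_eq x t hA, coefDHat_eq x t hA, resE, map_mul]; ring

omit hre him in
lemma deriv_eq_zero_of_eq_zero {ι : Type*} [Finite ι] {p : ι → ℂ} {f : ℂ → ℂ}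
    (h : ∀ z, (∀ n, z ≠ p n) → f z = 0) {z : ℂ} (hz : ∀ n, z ≠ p n) : deriv f z = 0 := by
  have : f =ᶠ[𝓝 z] fun _ => 0 := by
    have : ∀ᶠ w in 𝓝 z, ∀ n, w ≠ p n := eventually_all.2 fun n => isOpen_ne.mem_nhds (hz n)
    filter_upwards [this] with w hw using h w hw
  rw [this.deriv_eq, deriv_const]

/-- A vector in the kernel of I - H yields a row that vanishes at infinity. Such a row is zero, and
the vector consists of its values and derivatives. -/
lemma det_one_sub_matH_ne_zero (hk : Function.Injective k) (hA : IsNormingData k A B) :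
    (1 - matH k A B x t).det ≠ 0 := by
  intro h
  obtain ⟨v, hv0, hv⟩ := Matrix.exists_mulVec_eq_zero_iff.2 h
  have hv' : (matH k A B x t).mulVec v = v := by
    rw [Matrix.sub_mulVec, Matrix.one_mulVec, sub_eq_zero] at hv
    exact hv.symm
  have h1 := matH_mulVec_inl (A := A) (B := B) (x := x) (t := t) hre him 0 v
  have h2 := matH_mulVec_inr (A := A) (B := B) (x := x) (t := t) hre him 0 v
  rw [hv'] at h1 h2
  simp only [zero_add] at h1
  have hs := rowSol_of_fixed hre him hk hA h1 h2
  have := (hs.eq_zero_of_tendsto_zero (eta_ne_conj hre him) pf_tendsto pf_tendsto).1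
  apply hv0
  ext (n | n)
  · rw [← h1 n]
    exact this _ fun m hm => eta_ne_conj hre him m n hm.symm
  · rw [← h2 n]
    exact deriv_eq_zero_of_eq_zero this fun m hm => eta_ne_conj hre him m n hm.symm

omit hre him in
lemma rowG₀_zero (v : (Fin N ⊕ Fin N) ⊕ (Fin N ⊕ Fin N) → ℂ) : rowG₀ k A B x t v 0 = 0 := by
  rw [rowG₀_apply]; simp

omit hre him in
lemma rowF₀_zero (s : ℂ) (g : ℂ → ℂ) : rowF₀ k A B x t s g 0 = s := by
  rw [rowF₀_apply]; simp

lemma det_one_sub_matHHat_ne_zero (hk : Function.Injective k) (hA : IsNormingData k A B) :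
    (1 - matHHat k A B x t).det ≠ 0 := by
  intro h
  obtain ⟨v, hv0, hv⟩ := Matrix.exists_mulVec_eq_zero_iff.2 h
  have hv' : (matHHat k A B x t).mulVec v = v := by
    rw [Matrix.sub_mulVec, Matrix.one_mulVec, sub_eq_zero] at hv
    exact hv.symm
  have h1 := matHHat_mulVec_inl (A := A) (B := B) (x := x) (t := t) hre him 0 v
  have h2 := matHHat_mulVec_inr (A := A) (B := B) (x := x) (t := t) hre him 0 v
  rw [hv'] at h1 h2
  simp only [zero_add] at h1
  have hs := rowSol_of_fixed hre him hk hA h1 h2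
  have := (hs.eq_zero_of_apply_zero (eta_ne_conj hre him) (eta_ne_zero hre him)
    (rowF₀_zero _ _) (rowG₀_zero _)).1
  apply hv0
  ext (n | n)
  · rw [← h1 n]
    exact this _ fun m hm => eta_ne_conj hre him m n hm.symm
  · rw [← h2 n]
    exact deriv_eq_zero_of_eq_zero this fun m hm => eta_ne_conj hre him m n hm.symm

end

/-! ## The explicit solution -/

variable (k A B x t)

/-- The values and the derivatives of the first entry at the points `ηₙ*`. -/
def vHat : (Fin N ⊕ Fin N) ⊕ (Fin N ⊕ Fin N) → ℂ :=
  (1 - matHHat k A B x t)⁻¹.mulVec (vecBeta N)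

/-- The `(1,2)` entry of the explicit solution of the Riemann-Hilbert problem. -/
def solG : ℂ → ℂ := rowG₀ k A B x t (vHat k A B x t)

/-- The `(1,1)` entry of the explicit solution of the Riemann-Hilbert problem. -/
def solF : ℂ → ℂ := rowF₀ k A B x t 1 (solG k A B x t)

/-- The value of `solF` at infinity. -/
def solFInf : ℂ := 1 + at0 (eta k) (fun n => resC k A x t n * solG k A B x t (eta k n))
    (fun n => resC k A x t n * deriv (solG k A B x t) (eta k n) +
      resE k A B x t n * solG k A B x t (eta k n))

/-- The coefficient of `1 / z` in the expansion of `solG` at infinity. -/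
def solGOne : ℂ := ∑ j, hatC k A x t j *
  (vHat k A B x t (.inr j) + coefDHat k B x t j * vHat k A B x t (.inl j))

/-- The potential of the explicit solution. -/
def solQ : ℂ := -2 * Complex.I * solGOne k A B x t * solFInf k A B x t

variable {k A B x t}

lemma solG_zero : solG k A B x t 0 = 0 := rowG₀_zero _

lemma solF_zero : solF k A B x t 0 = 1 := rowF₀_zero _ _

lemma RowSol.comp_neg {ι : Type*} {η c e : ι → ℂ} {f g : ℂ → ℂ} (h : RowSol η c e f g)
    (σ : ι → ι) (hη : ∀ n, η (σ n) = -η n) (hc : ∀ n, c (σ n) = -c n)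
    (he : ∀ n, e (σ n) = e n) : RowSol η c e (fun z => f (-z)) (fun z => -g (-z)) := by
  have htend : Tendsto (fun z : ℂ => -z) (cocompact ℂ) (cocompact ℂ) :=
    (Homeomorph.neg ℂ).isClosedEmbedding.tendsto_cocompact
  have hpp : ∀ n z, pp (η n) (c n) (e n) z = -pp (η (σ n)) (c (σ n)) (e (σ n)) (-z) := by
    intro n z
    rw [hη, hc, he, pp, pp]
    have h1 : -z - -η n = -(z - η n) := by ring
    rw [h1, neg_sq, div_neg]; ring
  refine ⟨fun z hz => ?_, fun z hz => ?_, fun n => ?_, fun n => ?_, ?_, ?_⟩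
  · refine (h.anf (-z) fun n hn => hz (σ n) ?_).fun_comp analyticAt_id.neg
    rw [hη, ← hn, neg_neg]
  · refine ((h.ang (-z) fun n hn => hz (σ n) ?_).fun_comp analyticAt_id.neg).neg
    rw [hη, map_neg, ← hn, neg_neg]
  · have := h.reg (σ n)
    rw [hη n] at this
    convert this.comp_neg using 2 with z
    rw [hpp, hη]; ring
  · have := h.reg' (σ n)
    rw [hη n] at this
    convert this.comp_neg.neg using 2 with z
    rw [hpp, hη]; simp only [dag, map_neg]; ring
  · exact h.bdf.comp_tendsto htend
  · exact (h.bdg.comp_tendsto htend).neg_left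

section

variable (hre : ∀ n, 0 < (k n).re) (him : ∀ n, 0 < (k n).im) (hk : Function.Injective k)
  (hA : IsNormingData k A B)
include hre him hk hA

lemma one_sub_matHHat_mulVec : (matHHat k A B x t).mulVec (vHat k A B x t) =
    vHat k A B x t - vecBeta N := by
  have h : IsUnit (1 - matHHat k A B x t).det :=
    (det_one_sub_matHHat_ne_zero hre him hk hA).isUnit
  have : (1 - matHHat k A B x t).mulVec (vHat k A B x t) = vecBeta N := by
    rw [vHat, Matrix.mulVec_mulVec, Matrix.mul_nonsing_inv _ h, Matrix.one_mulVec]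
  rw [Matrix.sub_mulVec, Matrix.one_mulVec] at this
  rw [← this]; abel

lemma solF_conj_eta (n : Fin N ⊕ Fin N) :
    solF k A B x t (conj (eta k n)) = vHat k A B x t (.inl n) := by
  rw [solF, solG, matHHat_mulVec_inl hre him, one_sub_matHHat_mulVec hre him hk hA]
  simp [vecBeta]

lemma deriv_solF_conj_eta (n : Fin N ⊕ Fin N) :
    deriv (solF k A B x t) (conj (eta k n)) = vHat k A B x t (.inr n) := by
  rw [solF, solG, matHHat_mulVec_inr hre him, one_sub_matHHat_mulVec hre him hk hA]
  simp [vecBeta]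

lemma rowSol_sol : RowSol (eta k) (resC k A x t) (resE k A B x t) (solF k A B x t)
    (solG k A B x t) :=
  rowSol_of_fixed hre him hk hA (solF_conj_eta hre him hk hA) (deriv_solF_conj_eta hre him hk hA)

/-- Uniqueness for the Riemann-Hilbert problem. -/
lemma RowSol.eq_sol {f g : ℂ → ℂ} (h : RowSol (eta k) (resC k A x t) (resE k A B x t) f g)
    (hf : f 0 = 1) (hg : g 0 = 0) :
    (∀ z, (∀ n, z ≠ eta k n) → f z = solF k A B x t z) ∧
      ∀ z, (∀ n, z ≠ conj (eta k n)) → g z = solG k A B x t z := by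
  have := (h.sub (rowSol_sol hre him hk hA)).eq_zero_of_apply_zero (eta_ne_conj hre him)
    (eta_ne_zero hre him) (by simp [hf, solF_zero]) (by simp [hg, solG_zero])
  exact ⟨fun z hz => sub_eq_zero.1 (this.1 z hz), fun z hz => sub_eq_zero.1 (this.2 z hz)⟩

/-- A and B are odd and θ is even, so the residue data are compatible with z ↦ -z and uniqueness
forces the parity. It removes the value of `solG` and the 1/z term of `solF` at infinity. -/
lemma sol_neg : (∀ z, (∀ n, z ≠ eta k n) → solF k A B x t (-z) = solF k A B x t z) ∧
    ∀ z, (∀ n, z ≠ conj (eta k n)) → -solG k A B x t (-z) = solG k A B x t z := by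
  have hc : ∀ n, resC k A x t (Sum.swap n) = -resC k A x t n := by
    rintro (n | n) <;> simp [resC, eta, theta_neg, hA.A_neg]
  have hD : ∀ n, coefD k B x t (Sum.swap n) = -coefD k B x t n := by
    rintro (n | n) <;> simp [coefD, eta, (hasDerivAt_theta x t _).deriv, hA.B_neg] <;> ring
  refine RowSol.eq_sol hre him hk hA ((rowSol_sol hre him hk hA).comp_neg Sum.swap
    (fun n => ?_) hc (fun n => ?_)) ?_ ?_
  · rcases n with n | n <;> simp [eta]
  · simp [resE, hc, hD]
  · simp [solF_zero]
  · simp [solG_zero]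

lemma solG_eq : solG k A B x t = rowG k A B x t 0 (vHat k A B x t) := by
  have h0 : at0 (fun n => conj (eta k n)) (fun j => hatC k A x t j * vHat k A B x t (.inl j))
    (fun j => hatC k A x t j * (vHat k A B x t (.inr j) +
      coefDHat k B x t j * vHat k A B x t (.inl j))) = 0 := by
    have ht : Tendsto (solG k A B x t) (cocompact ℂ) (𝓝 _) := pf_tendsto
    have hneg : Tendsto (fun z : ℂ => -z) (cocompact ℂ) (cocompact ℂ) :=
      (Homeomorph.neg ℂ).isClosedEmbedding.tendsto_cocompact
    have ht' := (ht.comp hneg).neg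
    have := tendsto_nhds_unique ht (ht'.congr' ?_)
    · exact self_eq_neg.1 this
    · filter_upwards [(Set.finite_range fun n => conj (eta k n)).isCompact.compl_mem_cocompact]
        with z hz
      exact (sol_neg hre him hk hA).2 z fun n hn => hz ⟨n, hn.symm⟩
  rw [solG, rowG₀, h0]

lemma solF_eq : solF k A B x t = rowF k A B x t (solFInf k A B x t) (solG k A B x t) := rfl

lemma sol_det_eq_one (z : ℂ) (h1 : ∀ n, z ≠ eta k n) (h2 : ∀ n, z ≠ conj (eta k n)) :
    solF k A B x t z * dag (solF k A B x t) z + solG k A B x t z * dag (solG k A B x t) z = 1 := by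
  obtain ⟨C, hC⟩ := (rowSol_sol (x := x) (t := t) hre him hk hA).exists_const (eta_ne_conj hre him)
  have := hC 0 (fun n => (eta_ne_zero hre him n).symm) (fun n hn =>
    eta_ne_zero hre him n (by simpa using congrArg conj hn.symm))
  simp only [dag, map_zero, solF_zero, solG_zero, map_one, mul_one, mul_zero, add_zero] at this
  rw [hC z h1 h2, this]

lemma solG_tendsto : Tendsto (solG k A B x t) (cocompact ℂ) (𝓝 0) := by
  rw [solG_eq hre him hk hA]; exact pf_tendsto

/-- Limit z → ∞ of f f† + g g† = 1, since g vanishes at infinity. -/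
lemma norm_solFInf : ‖solFInf k A B x t‖ = 1 := by
  have hf : Tendsto (solF k A B x t) (cocompact ℂ) (𝓝 (solFInf k A B x t)) := pf_tendsto
  have hg := solG_tendsto (x := x) (t := t) hre him hk hA
  have hd : ∀ {u : ℂ → ℂ} {c : ℂ}, Tendsto u (cocompact ℂ) (𝓝 c) →
      Tendsto (dag u) (cocompact ℂ) (𝓝 (conj c)) :=
    fun hu => (Complex.continuous_conj.tendsto _).comp (hu.comp tendsto_conj_cocompact)
  have h1 := (hf.mul (hd hf)).add (hg.mul (hd hg))
  have h2 : solFInf k A B x t * conj (solFInf k A B x t) + 0 * conj 0 = 1 := by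
    refine tendsto_nhds_unique h1 (tendsto_const_nhds.congr' ?_)
    filter_upwards [(Set.finite_range (eta k)).isCompact.compl_mem_cocompact,
      (Set.finite_range fun n => conj (eta k n)).isCompact.compl_mem_cocompact] with z h1 h2
    exact (sol_det_eq_one hre him hk hA z (fun n hn => h1 ⟨n, hn.symm⟩)
      (fun n hn => h2 ⟨n, hn.symm⟩)).symm
  rw [zero_mul, add_zero, Complex.mul_conj, Complex.normSq_eq_norm_sq] at h2
  norm_cast at h2
  nlinarith [norm_nonneg (solFInf k A B x t)]

lemma solFInf_ne_zero : solFInf k A B x t ≠ 0 := by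
  rw [← norm_ne_zero_iff, norm_solFInf hre him hk hA]; exact one_ne_zero

omit hre him hk hA in
-- Schur complement with respect to the block I - M, whose inverse sends β to v.
lemma det_bordered {M : Matrix ((Fin N ⊕ Fin N) ⊕ (Fin N ⊕ Fin N)) _ ℂ} (hM : (1 - M).det ≠ 0)
    {v : (Fin N ⊕ Fin N) ⊕ (Fin N ⊕ Fin N) → ℂ} (hv : (1 - M).mulVec v = vecBeta N) :
    (bordered k A B x t M).det = -((1 - M).det * ∑ i, vecAlpha k A B x t i * v i) := by
  have hu : IsUnit (1 - M).det := hM.isUnit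
  let : Invertible (1 - M) := Matrix.invertibleOfIsUnitDet _ hu
  have hv' : v = (1 - M)⁻¹.mulVec (vecBeta N) := by
    rw [← hv, Matrix.mulVec_mulVec, Matrix.nonsing_inv_mul _ hu, Matrix.one_mulVec]
  rw [bordered, Matrix.det_fromBlocks₁₁, Matrix.invOf_eq_nonsing_inv, Matrix.mul_assoc,
    ← mul_neg]
  congr 1
  rw [Matrix.det_unique]
  simp only [Matrix.sub_apply, Matrix.zero_apply, zero_sub, Matrix.mul_apply, Matrix.of_apply, hv',
    Matrix.mulVec, dotProduct]

omit hre him hk hA in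
lemma vecAlpha_dot : ∑ i, vecAlpha k A B x t i * vHat k A B x t i = solGOne k A B x t := by
  rw [Fintype.sum_sum_type, solGOne, ← Finset.sum_add_distrib]
  refine Finset.sum_congr rfl fun n _ => ?_
  simp only [vecAlpha, Sum.elim_inl, Sum.elim_inr, hatC]
  ring

lemma det_matGHat : (matGHat k A B x t).det =
    -((1 - matHHat k A B x t).det * solGOne k A B x t) := by
  rw [matGHat, det_bordered (det_one_sub_matHHat_ne_zero hre him hk hA) (v := vHat k A B x t),
    vecAlpha_dot]
  rw [Matrix.sub_mulVec, Matrix.one_mulVec, one_sub_matHHat_mulVec hre him hk hA]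
  abel

/-- The explicit row is normalised at the origin, but g vanishes at infinity as well. Dividing by
the limit of f therefore gives the row normalised at infinity, so the solutions of the two linear
systems are proportional. -/
lemma det_matG : (matG k A B x t).det =
    -((1 - matH k A B x t).det * (solGOne k A B x t / solFInf k A B x t)) := by
  have h0 := solFInf_ne_zero (x := x) (t := t) hre him hk hA
  have hv : (1 - matH k A B x t).mulVec ((solFInf k A B x t)⁻¹ • vHat k A B x t) = vecBeta N := by
    rw [Matrix.mulVec_smul, inv_smul_eq_iff₀ h0, Matrix.sub_mulVec, Matrix.one_mulVec]
    ext (n | n)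
    · have h1 := matH_mulVec_inl (A := A) (B := B) (x := x) (t := t) hre him (solFInf k A B x t)
        (vHat k A B x t) n
      rw [← solG_eq hre him hk hA, ← solF_eq hre him hk hA, solF_conj_eta hre him hk hA] at h1
      simp [h1, vecBeta]
    · have h1 := matH_mulVec_inr (A := A) (B := B) (x := x) (t := t) hre him (solFInf k A B x t)
        (vHat k A B x t) n
      rw [← solG_eq hre him hk hA, ← solF_eq hre him hk hA, deriv_solF_conj_eta hre him hk hA] at h1
      simp [h1, vecBeta]
  rw [matG, det_bordered (det_one_sub_matH_ne_zero hre him hk hA) hv, ← vecAlpha_dot,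
    Finset.sum_div]
  congr 2
  refine Finset.sum_congr rfl fun i _ => ?_
  simp only [Pi.smul_apply, smul_eq_mul]
  ring

lemma solitonFormula_eq : solitonFormula k A B x t = solQ k A B x t := by
  have h0 := solFInf_ne_zero (x := x) (t := t) hre him hk hA
  have h1 := det_one_sub_matHHat_ne_zero (x := x) (t := t) hre him hk hA
  have h2 := det_one_sub_matH_ne_zero (x := x) (t := t) hre him hk hA
  rw [solitonFormula, det_matGHat hre him hk hA, det_matG hre him hk hA, solQ]
  -- Where `solGOne` vanishes both bordered determinants vanish; the formula has the value 0 there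
  -- because division by zero yields 0.
  by_cases h : solGOne k A B x t = 0
  · simp [h]
  · field_simp

lemma det_matG_eq_zero_iff : (matG k A B x t).det = 0 ↔ solQ k A B x t = 0 := by
  have h0 := solFInf_ne_zero (x := x) (t := t) hre him hk hA
  have h2 := det_one_sub_matH_ne_zero (x := x) (t := t) hre him hk hA
  rw [det_matG hre him hk hA, solQ]
  simp [h0, h2]

end

end Explicit

/-! ### Smooth dependence on x and t -/

section Smooth

variable {N : ℕ} {k : Fin N → ℂ} {A B : ℂ → ℂ} {r : WithTop ℕ∞}

lemma contDiff_theta (z : ℂ) : ContDiff ℝ r fun p : ℝ × ℝ => theta p.1 p.2 z := by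
  unfold theta
  have h1 : ContDiff ℝ r fun p : ℝ × ℝ => (p.1 : ℂ) := Complex.ofRealCLM.contDiff.comp contDiff_fst
  have h2 : ContDiff ℝ r fun p : ℝ × ℝ => (p.2 : ℂ) := Complex.ofRealCLM.contDiff.comp contDiff_snd
  fun_prop

lemma contDiff_deriv_theta (z : ℂ) : ContDiff ℝ r fun p : ℝ × ℝ => deriv (theta p.1 p.2) z := by
  simp only [(hasDerivAt_theta _ _ z).deriv]
  have h1 : ContDiff ℝ r fun p : ℝ × ℝ => (p.1 : ℂ) := Complex.ofRealCLM.contDiff.comp contDiff_fst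
  have h2 : ContDiff ℝ r fun p : ℝ × ℝ => (p.2 : ℂ) := Complex.ofRealCLM.contDiff.comp contDiff_snd
  fun_prop

lemma contDiff_cexp_theta (a z : ℂ) :
    ContDiff ℝ r fun p : ℝ × ℝ => Complex.exp (a * theta p.1 p.2 z) :=
  (contDiff_const.mul (contDiff_theta z)).cexp

lemma contDiff_resC (n) : ContDiff ℝ r fun p : ℝ × ℝ => resC k A p.1 p.2 n :=
  contDiff_const.mul (contDiff_cexp_theta _ _)

lemma contDiff_hatC (n) : ContDiff ℝ r fun p : ℝ × ℝ => hatC k A p.1 p.2 n :=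
  contDiff_const.mul (contDiff_cexp_theta _ _)

lemma contDiff_coefC (n) (z : ℂ) : ContDiff ℝ r fun p : ℝ × ℝ => coefC k A p.1 p.2 n z :=
  contDiff_const.mul (contDiff_cexp_theta _ _)

lemma contDiff_coefCHat (n) (z : ℂ) : ContDiff ℝ r fun p : ℝ × ℝ => coefCHat k A p.1 p.2 n z :=
  contDiff_const.mul (contDiff_cexp_theta _ _)

lemma contDiff_coefD (n) : ContDiff ℝ r fun p : ℝ × ℝ => coefD k B p.1 p.2 n :=
  contDiff_const.sub (contDiff_const.mul (contDiff_deriv_theta _))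

lemma contDiff_coefDHat (n) : ContDiff ℝ r fun p : ℝ × ℝ => coefDHat k B p.1 p.2 n :=
  contDiff_const.add (contDiff_const.mul (contDiff_deriv_theta _))

lemma contDiff_resE (n) : ContDiff ℝ r fun p : ℝ × ℝ => resE k A B p.1 p.2 n :=
  (contDiff_resC n).mul (contDiff_coefD n)

lemma contDiff_matHHat (i j) : ContDiff ℝ r fun p : ℝ × ℝ => matHHat k A B p.1 p.2 i j := by
  have hC := fun n z => contDiff_coefC (k := k) (A := A) (r := r) n z
  have hC' := fun n z => contDiff_coefCHat (k := k) (A := A) (r := r) n z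
  have hD := fun n => contDiff_coefD (k := k) (B := B) (r := r) n
  have hD' := fun n => contDiff_coefDHat (k := k) (B := B) (r := r) n
  rcases i with i | i <;> rcases j with j | j <;>
    simp only [matHHat, Matrix.fromBlocks_apply₁₁, Matrix.fromBlocks_apply₁₂,
      Matrix.fromBlocks_apply₂₁, Matrix.fromBlocks_apply₂₂, Matrix.of_apply, div_eq_mul_inv] <;>
    fun_prop

lemma contDiff_det {ι : Type*} [Fintype ι] [DecidableEq ι] {M : ℝ × ℝ → Matrix ι ι ℂ}
    (h : ∀ i j, ContDiff ℝ r fun p => M p i j) : ContDiff ℝ r fun p => (M p).det := by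
  simp only [Matrix.det_apply']
  refine ContDiff.sum fun σ _ => ?_
  exact contDiff_const.mul (contDiff_prod fun i _ => h _ _)

/-- By Cramer's rule every coordinate is a quotient of determinants with smooth entries and nowhere
vanishing denominator. -/
lemma contDiff_vHat (hre : ∀ n, 0 < (k n).re) (him : ∀ n, 0 < (k n).im) (hk : Function.Injective k)
    (hA : IsNormingData k A B) (i) : ContDiff ℝ r fun p : ℝ × ℝ => vHat k A B p.1 p.2 i := by
  have hM : ∀ i j, ContDiff ℝ r fun p : ℝ × ℝ => (1 - matHHat k A B p.1 p.2) i j :=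
    fun i j => contDiff_const.sub (contDiff_matHHat i j)
  have hdet := contDiff_det hM
  have e : (fun p : ℝ × ℝ => vHat k A B p.1 p.2 i) = fun p => ((1 - matHHat k A B p.1 p.2).det)⁻¹ *
      ((1 - matHHat k A B p.1 p.2).updateCol i (vecBeta N)).det := by
    ext p
    rw [vHat, Matrix.inv_def, Matrix.smul_mulVec, ← Matrix.cramer_eq_adjugate_mulVec,
      Ring.inverse_eq_inv', Pi.smul_apply, Matrix.cramer_apply, smul_eq_mul]
  rw [e]
  refine (hdet.inv fun p => det_one_sub_matHHat_ne_zero hre him hk hA).mul (contDiff_det ?_)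
  intro a b
  simp only [Matrix.updateCol_apply]
  split_ifs
  · exact contDiff_const
  · exact hM a b

end Smooth

/-! ## Families of rows -/

section Family

variable {ι : Type*} [Fintype ι]

lemma hasDerivAt_pf {p : ι → ℂ} {c₀ : ℝ → ℂ} {c e : ℝ → ι → ℂ} {c₀' : ℂ} {c' e' : ι → ℂ} {s : ℝ}
    (h₀ : HasDerivAt c₀ c₀' s) (hc : ∀ n, HasDerivAt (fun s => c s n) (c' n) s)
    (he : ∀ n, HasDerivAt (fun s => e s n) (e' n) s) (z : ℂ) :
    HasDerivAt (fun s => pf p (c₀ s) (c s) (e s) z) (pf p c₀' c' e' z) s := by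
  unfold pf pp
  exact h₀.add (HasDerivAt.fun_sum fun n _ => ((hc n).div_const _).add ((he n).div_const _))

lemma hasDerivAt_deriv_pf {p : ι → ℂ} {c₀ : ℝ → ℂ} {c e : ℝ → ι → ℂ} {c₀' : ℂ} {c' e' : ι → ℂ}
    {s : ℝ} (hc : ∀ n, HasDerivAt (fun s => c s n) (c' n) s)
    (he : ∀ n, HasDerivAt (fun s => e s n) (e' n) s) {z : ℂ} (hz : ∀ n, z ≠ p n) :
    HasDerivAt (fun s => deriv (pf p (c₀ s) (c s) (e s)) z) (deriv (pf p c₀' c' e') z) s := by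
  simp only [(pf_hasDerivAt hz).deriv]
  exact HasDerivAt.fun_sum fun n _ =>
    ((((hc n).const_mul 2).fun_neg).div_const _).sub ((he n).div_const _)

/-- Differentiating the residue conditions along a family. -/
lemma removable_deriv_family {η : ι → ℂ} (hη : Function.Injective η)
    (hη' : ∀ n m, η n ≠ conj (η m)) {c e cf ef cg eg : ℝ → ι → ℂ} {g₀ : ℝ → ℂ}
    {c' e' cf' ef' cg' eg' : ι → ℂ} {f₀' g₀' : ℂ} {s : ℝ}
    (hc : ∀ n, HasDerivAt (fun s => c s n) (c' n) s)
    (he : ∀ n, HasDerivAt (fun s => e s n) (e' n) s)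
    (hcf : ∀ n, HasDerivAt (fun s => cf s n) (cf' n) s)
    (hef : ∀ n, HasDerivAt (fun s => ef s n) (ef' n) s)
    (hcg : ∀ n, HasDerivAt (fun s => cg s n) (cg' n) s)
    (heg : ∀ n, HasDerivAt (fun s => eg s n) (eg' n) s)
    (hg₀ : HasDerivAt g₀ g₀' s)
    (h1 : ∀ s n, cf s n = c s n * pf (fun n => conj (η n)) (g₀ s) (cg s) (eg s) (η n))
    (h2 : ∀ s n, ef s n = c s n * deriv (pf (fun n => conj (η n)) (g₀ s) (cg s) (eg s)) (η n) +
      e s n * pf (fun n => conj (η n)) (g₀ s) (cg s) (eg s) (η n)) (n : ι) :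
    Removable (fun z => pf η f₀' cf' ef' z -
      pp (η n) (c s n) (e s n) z * pf (fun n => conj (η n)) g₀' cg' eg' z -
      pp (η n) (c' n) (e' n) z * pf (fun n => conj (η n)) (g₀ s) (cg s) (eg s) z) (η n) := by
  have d0 := hasDerivAt_pf (p := fun n => conj (η n)) hg₀ hcg heg (η n)
  have d1 := hasDerivAt_deriv_pf (p := fun n => conj (η n)) (c₀ := g₀) (c₀' := g₀') hcg heg (hη' n)
  refine removable_pf_sub_pp_mul hη n (pf_analyticAt (hη' n)) (pf_analyticAt (hη' n)) ?_ ?_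
  · have := (hc n).fun_mul d0
    simp only [← h1] at this
    rw [(hcf n).unique this]; ring
  · have := ((hc n).fun_mul d1).fun_add ((he n).fun_mul d0)
    simp only [← h2] at this
    rw [(hef n).unique this]; ring

end Family

/-- Differentiating the residue data in x amounts, modulo regular terms, to multiplying their
principal part by -2iz². The term with -4ip arises because z² is not constant to first order at a
double pole. -/
lemma removable_pp_x (p c e : ℂ) : Removable (fun z =>
    pp p (-2 * Complex.I * p ^ 2 * c) (-2 * Complex.I * p ^ 2 * e - 4 * Complex.I * p * c) z +
      2 * Complex.I * z ^ 2 * pp p c e z) p := by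
  refine ⟨fun z => 2 * Complex.I * c + 2 * Complex.I * e * (z + p), by fun_prop, ?_⟩
  filter_upwards [self_mem_nhdsWithin] with z hz
  have hz' : z - p ≠ 0 := sub_ne_zero.2 hz
  rw [pp, pp]
  field_simp
  ring

/-- The t-derivative of the data is, modulo regular terms, -2z² times their x-derivative, as θ_t =
-2k² θ_x. -/
lemma removable_pp_t (p c e : ℂ) : Removable (fun z =>
    pp p (4 * Complex.I * p ^ 4 * c) (4 * Complex.I * p ^ 4 * e + 16 * Complex.I * p ^ 3 * c) z +
      2 * z ^ 2 * pp p (-2 * Complex.I * p ^ 2 * c)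
        (-2 * Complex.I * p ^ 2 * e - 4 * Complex.I * p * c) z) p := by
  refine ⟨fun z => -4 * Complex.I * p ^ 2 * c - 4 * Complex.I * p ^ 2 * e * (z + p)
    - 8 * Complex.I * p * c * (z + p), by fun_prop, ?_⟩
  filter_upwards [self_mem_nhdsWithin] with z hz
  have hz' : z - p ≠ 0 := sub_ne_zero.2 hz
  rw [pp, pp]
  field_simp
  ring

/-- The derivative of `F` at `(x, t)` in the direction `w`. -/
def dirD (w : ℝ × ℝ) (F : ℝ → ℝ → ℂ) (x t : ℝ) : ℂ :=
  fderiv ℝ (fun p : ℝ × ℝ => F p.1 p.2) (x, t) w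

lemma hasDerivAt_line {F : ℝ → ℝ → ℂ} (hF : ContDiff ℝ 1 fun p : ℝ × ℝ => F p.1 p.2)
    (w : ℝ × ℝ) (x t : ℝ) :
    HasDerivAt (fun s => F (x + s * w.1) (t + s * w.2)) (dirD w F x t) 0 := by
  have h1 : HasDerivAt (fun s : ℝ => ((x + s * w.1, t + s * w.2) : ℝ × ℝ)) w 0 := by
    have h2 : ∀ a b : ℝ, HasDerivAt (fun s : ℝ => a + s * b) b 0 := fun a b => by
      simpa using ((hasDerivAt_id (0 : ℝ)).mul_const b).const_add a
    exact (h2 x w.1).prodMk (h2 t w.2)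
  have h3 := (hF.differentiable one_ne_zero (x, t)).hasFDerivAt
  have := HasFDerivAt.comp_hasDerivAt_of_eq (0 : ℝ) h3 h1 (by simp)
  exact this

lemma hasDerivAt_fst {F : ℝ → ℝ → ℂ} (hF : ContDiff ℝ 1 fun p : ℝ × ℝ => F p.1 p.2) (x t : ℝ) :
    HasDerivAt (fun y => F y t) (dirD (1, 0) F x t) x := by
  have h3 := (hF.differentiable one_ne_zero (x, t)).hasFDerivAt
  exact HasFDerivAt.comp_hasDerivAt x h3 ((hasDerivAt_id x).prodMk (hasDerivAt_const x t))

lemma hasDerivAt_snd {F : ℝ → ℝ → ℂ} (hF : ContDiff ℝ 1 fun p : ℝ × ℝ => F p.1 p.2) (x t : ℝ) :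
    HasDerivAt (fun s => F x s) (dirD (0, 1) F x t) t := by
  have h3 := (hF.differentiable one_ne_zero (x, t)).hasFDerivAt
  exact HasFDerivAt.comp_hasDerivAt t h3 ((hasDerivAt_const t x).prodMk (hasDerivAt_id t))

/-! ### Derivatives of the residue data -/

section Residues

variable {N : ℕ} {k : Fin N → ℂ} {A B : ℂ → ℂ} {x t : ℝ}

lemma hasDerivAt_exp_theta_x (a z : ℂ) (x t : ℝ) : HasDerivAt
    (fun y : ℝ => Complex.exp (a * theta y t z)) (a * z ^ 2 * Complex.exp (a * theta x t z)) x := by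
  have h : HasDerivAt (fun y : ℝ => theta y t z) (z ^ 2) x := by
    have := ((Complex.ofRealCLM.hasDerivAt (x := x)).sub_const (2 * z ^ 2 * (t : ℂ))).const_mul
      (z ^ 2)
    exact this.congr_deriv (by simp)
  exact (h.const_mul a).cexp.congr_deriv (by ring)

lemma hasDerivAt_exp_theta_t (a z : ℂ) (x t : ℝ) : HasDerivAt
    (fun s : ℝ => Complex.exp (a * theta x s z))
    (a * (-2 * z ^ 4) * Complex.exp (a * theta x t z)) t := by
  have h : HasDerivAt (fun s : ℝ => theta x s z) (-2 * z ^ 4) t := by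
    have := (((Complex.ofRealCLM.hasDerivAt (x := t)).const_mul (2 * z ^ 2)).const_sub
      (x : ℂ)).const_mul (z ^ 2)
    exact this.congr_deriv (by simp; ring)
  exact (h.const_mul a).cexp.congr_deriv (by ring)

lemma dirD_resC_x (n) : dirD (1, 0) (fun x t => resC k A x t n) x t =
    -2 * Complex.I * eta k n ^ 2 * resC k A x t n := by
  refine (hasDerivAt_fst (contDiff_resC n) x t).unique ?_
  exact ((hasDerivAt_exp_theta_x _ _ x t).const_mul _).congr_deriv (by rw [resC]; ring)

lemma dirD_resC_t (n) : dirD (0, 1) (fun x t => resC k A x t n) x t =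
    4 * Complex.I * eta k n ^ 4 * resC k A x t n := by
  refine (hasDerivAt_snd (contDiff_resC n) x t).unique ?_
  exact ((hasDerivAt_exp_theta_t _ _ x t).const_mul _).congr_deriv (by rw [resC]; ring)

lemma coefD_eq (n) : coefD k B x t n =
    B (eta k n) - 2 * Complex.I * (2 * eta k n * x - 8 * eta k n ^ 3 * t) := by
  rw [coefD, (hasDerivAt_theta _ _ _).deriv]

lemma dirD_resE_x (n) : dirD (1, 0) (fun x t => resE k A B x t n) x t =
    -2 * Complex.I * eta k n ^ 2 * resE k A B x t n - 4 * Complex.I * eta k n * resC k A x t n := by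
  refine (hasDerivAt_fst (contDiff_resE n) x t).unique ?_
  have h1 := hasDerivAt_fst (F := fun x t => resC k A x t n) (contDiff_resC n) x t
  rw [dirD_resC_x] at h1
  have h2 : HasDerivAt (fun y => coefD k B y t n) (-4 * Complex.I * eta k n) x := by
    simp only [coefD_eq]
    exact ((((Complex.ofRealCLM.hasDerivAt (x := x)).const_mul (2 * eta k n)).sub_const
      (8 * eta k n ^ 3 * t)).const_mul (2 * Complex.I) |>.const_sub (B (eta k n))).congr_deriv
        (by simp; ring)
  exact (h1.fun_mul h2).congr_deriv (by rw [resE]; ring)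

lemma dirD_resE_t (n) : dirD (0, 1) (fun x t => resE k A B x t n) x t =
    4 * Complex.I * eta k n ^ 4 * resE k A B x t n +
      16 * Complex.I * eta k n ^ 3 * resC k A x t n := by
  refine (hasDerivAt_snd (contDiff_resE n) x t).unique ?_
  have h1 := hasDerivAt_snd (F := fun x t => resC k A x t n) (contDiff_resC n) x t
  rw [dirD_resC_t] at h1
  have h2 : HasDerivAt (fun s => coefD k B x s n) (16 * Complex.I * eta k n ^ 3) t := by
    simp only [coefD_eq]
    exact ((((Complex.ofRealCLM.hasDerivAt (x := t)).const_mul (8 * eta k n ^ 3)).const_sub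
      (2 * eta k n * x)).const_mul (2 * Complex.I) |>.const_sub (B (eta k n))).congr_deriv
        (by simp; ring)
  exact (h1.fun_mul h2).congr_deriv (by rw [resE]; ring)

end Residues

/-! ### Coefficients of the explicit row -/

section Coefficients

variable {N : ℕ} (k : Fin N → ℂ) (A B : ℂ → ℂ) (n : Fin N ⊕ Fin N) (x t : ℝ)

/-- Coefficients of `(z - ηₙ*)⁻²` in `solG`. -/
def gC : ℂ := hatC k A x t n * vHat k A B x t (.inl n)

/-- Coefficients of `(z - ηₙ*)⁻¹` in `solG`. -/
def gE : ℂ := hatC k A x t n * (vHat k A B x t (.inr n) +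
  coefDHat k B x t n * vHat k A B x t (.inl n))

/-- Coefficients of `(z - ηₙ)⁻²` in `solF`. -/
def fC : ℂ := resC k A x t n * solG k A B x t (eta k n)

/-- Coefficients of `(z - ηₙ)⁻¹` in `solF`. -/
def fE : ℂ := resC k A x t n * deriv (solG k A B x t) (eta k n) +
  resE k A B x t n * solG k A B x t (eta k n)

variable {k A B n x t}

lemma solF_eq_pf : solF k A B x t = pf (eta k) (solFInf k A B x t)
    (fun n => fC k A B n x t) (fun n => fE k A B n x t) := rfl

section

variable (hre : ∀ n, 0 < (k n).re) (him : ∀ n, 0 < (k n).im) (hk : Function.Injective k)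
  (hA : IsNormingData k A B)
include hre him hk hA

lemma solG_eq_pf : solG k A B x t = pf (fun n => conj (eta k n)) 0
    (fun n => gC k A B n x t) (fun n => gE k A B n x t) := solG_eq hre him hk hA

variable {r : WithTop ℕ∞}

lemma contDiff_gC (n) : ContDiff ℝ r fun p : ℝ × ℝ => gC k A B n p.1 p.2 :=
  (contDiff_hatC n).mul (contDiff_vHat hre him hk hA _)

lemma contDiff_gE (n) : ContDiff ℝ r fun p : ℝ × ℝ => gE k A B n p.1 p.2 :=
  (contDiff_hatC n).mul ((contDiff_vHat hre him hk hA _).add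
    ((contDiff_coefDHat n).mul (contDiff_vHat hre him hk hA _)))

lemma contDiff_solG_apply (z : ℂ) : ContDiff ℝ r fun p : ℝ × ℝ => solG k A B p.1 p.2 z := by
  simp only [solG_eq_pf hre him hk hA, pf, pp]
  exact contDiff_const.add (ContDiff.sum fun n _ => ((contDiff_gC hre him hk hA n).div_const _).add
    ((contDiff_gE hre him hk hA n).div_const _))

lemma contDiff_deriv_solG (m) :
    ContDiff ℝ r fun p : ℝ × ℝ => deriv (solG k A B p.1 p.2) (eta k m) := by
  simp only [solG_eq_pf hre him hk hA, (pf_hasDerivAt (eta_ne_conj hre him m)).deriv]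
  exact ContDiff.sum fun n _ => ((contDiff_const.mul (contDiff_gC hre him hk hA n)).neg.div_const
    _).sub ((contDiff_gE hre him hk hA n).div_const _)

lemma contDiff_fC (n) : ContDiff ℝ r fun p : ℝ × ℝ => fC k A B n p.1 p.2 :=
  (contDiff_resC n).mul (contDiff_solG_apply hre him hk hA _)

lemma contDiff_fE (n) : ContDiff ℝ r fun p : ℝ × ℝ => fE k A B n p.1 p.2 :=
  ((contDiff_resC n).mul (contDiff_deriv_solG hre him hk hA n)).add
    ((contDiff_resE n).mul (contDiff_solG_apply hre him hk hA _))

lemma contDiff_solFInf : ContDiff ℝ r fun p : ℝ × ℝ => solFInf k A B p.1 p.2 := by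
  refine contDiff_const.add (ContDiff.neg (ContDiff.sum fun n _ => ?_))
  exact ((contDiff_fC hre him hk hA n).div_const _).add ((contDiff_fE hre him hk hA n).div_const _)

lemma contDiff_solGOne : ContDiff ℝ r fun p : ℝ × ℝ => solGOne k A B p.1 p.2 :=
  ContDiff.sum fun n _ => contDiff_gE hre him hk hA n

lemma contDiff_solQ : ContDiff ℝ r fun p : ℝ × ℝ => solQ k A B p.1 p.2 :=
  (contDiff_const.mul (contDiff_solGOne hre him hk hA)).mul (contDiff_solFInf hre him hk hA)

lemma conj_gC (n) : conj (gC k A B n x t) = -resC k A x t n * dag (solF k A B x t) (eta k n) := by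
  rw [gC, hatC_eq x t hA, dag, solF_conj_eta hre him hk hA]
  simp

lemma conj_gE (n) : conj (gE k A B n x t) =
    -resC k A x t n * deriv (dag (solF k A B x t)) (eta k n) +
      -resE k A B x t n * dag (solF k A B x t) (eta k n) := by
  rw [gE, hatC_eq x t hA, deriv_dag, dag, solF_conj_eta hre him hk hA,
    deriv_solF_conj_eta hre him hk hA, coefDHat_eq x t hA, resE]
  simp; ring

end

end Coefficients

/-! ### Directional derivatives of the explicit row -/

section Directional

variable {N : ℕ} (k : Fin N → ℂ) (A B : ℂ → ℂ) (w : ℝ × ℝ) (x t : ℝ)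

/-- Directional derivative of `solF`. -/
def dotF : ℂ → ℂ := pf (eta k) (dirD w (solFInf k A B) x t)
  (fun n => dirD w (fC k A B n) x t) (fun n => dirD w (fE k A B n) x t)

/-- Directional derivative of `solG`. -/
def dotG : ℂ → ℂ := pf (fun n => conj (eta k n)) 0
  (fun n => dirD w (gC k A B n) x t) (fun n => dirD w (gE k A B n) x t)

variable {k A B w x t}
variable (hre : ∀ n, 0 < (k n).re) (him : ∀ n, 0 < (k n).im) (hk : Function.Injective k)
  (hA : IsNormingData k A B)
include hre him hk hA

lemma hasDerivAt_solF_line (z : ℂ) :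
    HasDerivAt (fun s => solF k A B (x + s * w.1) (t + s * w.2) z) (dotF k A B w x t z) 0 :=
  hasDerivAt_pf (hasDerivAt_line (contDiff_solFInf hre him hk hA) w x t)
    (fun n => hasDerivAt_line (contDiff_fC hre him hk hA n) w x t)
    (fun n => hasDerivAt_line (contDiff_fE hre him hk hA n) w x t) z

lemma hasDerivAt_solG_line (z : ℂ) :
    HasDerivAt (fun s => solG k A B (x + s * w.1) (t + s * w.2) z) (dotG k A B w x t z) 0 := by
  simp only [solG_eq_pf hre him hk hA]
  exact hasDerivAt_pf (hasDerivAt_const _ _)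
    (fun n => hasDerivAt_line (contDiff_gC hre him hk hA n) w x t)
    (fun n => hasDerivAt_line (contDiff_gE hre him hk hA n) w x t) z

lemma hasDerivAt_solF_x (z : ℂ) :
    HasDerivAt (fun y => solF k A B y t z) (dotF k A B (1, 0) x t z) x :=
  hasDerivAt_pf (hasDerivAt_fst (contDiff_solFInf hre him hk hA) x t)
    (fun n => hasDerivAt_fst (contDiff_fC hre him hk hA n) x t)
    (fun n => hasDerivAt_fst (contDiff_fE hre him hk hA n) x t) z

lemma hasDerivAt_solG_x (z : ℂ) :
    HasDerivAt (fun y => solG k A B y t z) (dotG k A B (1, 0) x t z) x := by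
  simp only [solG_eq_pf hre him hk hA]
  exact hasDerivAt_pf (hasDerivAt_const _ _)
    (fun n => hasDerivAt_fst (contDiff_gC hre him hk hA n) x t)
    (fun n => hasDerivAt_fst (contDiff_gE hre him hk hA n) x t) z

lemma dotF_zero : dotF k A B w x t 0 = 0 :=
  (hasDerivAt_solF_line hre him hk hA 0).unique (by simp only [solF_zero]; exact hasDerivAt_const _ _)

lemma dotG_zero : dotG k A B w x t 0 = 0 :=
  (hasDerivAt_solG_line hre him hk hA 0).unique (by simp only [solG_zero]; exact hasDerivAt_const _ _)

/-- Product rule for the residue condition. The last term, with the derivative of the data, is what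
the corrections in the Lax equations have to cancel. -/
lemma removable_dot (n) : Removable (fun z => dotF k A B w x t z -
    pp (eta k n) (resC k A x t n) (resE k A B x t n) z * dotG k A B w x t z -
    pp (eta k n) (dirD w (fun x t => resC k A x t n) x t)
      (dirD w (fun x t => resE k A B x t n) x t) z * solG k A B x t z) (eta k n) := by
  have := removable_deriv_family (g₀' := 0) (f₀' := dirD w (solFInf k A B) x t)
    (eta_injective hre him hk) (eta_ne_conj hre him)
    (fun n => hasDerivAt_line (F := fun x t => resC k A x t n) (contDiff_resC n) w x t)
    (fun n => hasDerivAt_line (F := fun x t => resE k A B x t n) (contDiff_resE n) w x t)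
    (fun n => hasDerivAt_line (contDiff_fC hre him hk hA n) w x t)
    (fun n => hasDerivAt_line (contDiff_fE hre him hk hA n) w x t)
    (fun n => hasDerivAt_line (contDiff_gC hre him hk hA n) w x t)
    (fun n => hasDerivAt_line (contDiff_gE hre him hk hA n) w x t)
    (hasDerivAt_const (0 : ℝ) (0 : ℂ))
    (fun s n => by rw [← solG_eq_pf hre him hk hA]; rfl)
    (fun s n => by rw [← solG_eq_pf hre him hk hA]; rfl) n
  rw [← solG_eq_pf hre him hk hA] at this
  simpa only [zero_mul, add_zero] using! this

/-- The reflected row (g†, f†) satisfies conditions of the first kind with data -c, -e, so the same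
differentiation applies to it. -/
lemma removable_dot' (n) : Removable (fun z => dag (dotG k A B w x t) z +
    pp (eta k n) (resC k A x t n) (resE k A B x t n) z * dag (dotF k A B w x t) z +
    pp (eta k n) (dirD w (fun x t => resC k A x t n) x t)
      (dirD w (fun x t => resE k A B x t n) x t) z * dag (solF k A B x t) z) (eta k n) := by
  have := removable_deriv_family (f₀' := 0)
    (eta_injective hre him hk) (eta_ne_conj hre him)
    (fun n => (hasDerivAt_line (F := fun x t => resC k A x t n) (contDiff_resC n) w x t).fun_neg)
    (fun n => (hasDerivAt_line (F := fun x t => resE k A B x t n) (contDiff_resE n) w x t).fun_neg)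
    (fun n => (hasDerivAt_line (contDiff_gC hre him hk hA n) w x t).star)
    (fun n => (hasDerivAt_line (contDiff_gE hre him hk hA n) w x t).star)
    (fun n => (hasDerivAt_line (contDiff_fC hre him hk hA n) w x t).star)
    (fun n => (hasDerivAt_line (contDiff_fE hre him hk hA n) w x t).star)
    (hasDerivAt_line (contDiff_solFInf hre him hk hA) w x t).star
    (fun s n => by
      have := conj_gC (x := x + s * w.1) (t := t + s * w.2) hre him hk hA n
      rw [solF_eq_pf, dag_pf] at this
      exact this)
    (fun s n => by
      have := conj_gE (x := x + s * w.1) (t := t + s * w.2) hre him hk hA n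
      rw [solF_eq_pf, dag_pf] at this
      exact this) n
  rw [dotG, dotF, solF_eq_pf, dag_pf, dag_pf, dag_pf]
  simp only [Complex.conj_conj, map_zero]
  refine this.congr (Eventually.of_forall fun z => ?_)
  simp only [pp, zero_mul, add_zero, neg_div, starRingEnd_apply]
  ring

end Directional

/-! ## The spatial equation of the Lax pair for the explicit solution -/

lemma pf_mul_mul_isBigO_one {ι : Type*} [Fintype ι] {p : ι → ℂ} {c₀ : ℂ} {c e : ι → ℂ} :
    (fun z => z * (z * (pf p c₀ c e z - c₀) - ∑ n, e n)) =O[cocompact ℂ] (fun _ => (1 : ℝ)) := by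
  refine (pf_isBigO_one.congr' (mul_pf_sub (p := p) (c₀ := ∑ n, e n) (c := fun n => p n * c n)
    (e := fun n => c n + p n * e n)).symm EventuallyEq.rfl).congr' ?_ EventuallyEq.rfl
  filter_upwards [mul_pf_sub (p := p) (c₀ := c₀) (c := c) (e := e)] with z hz
  rw [hz]

section Lax

set_option linter.unusedSectionVars false

variable {N : ℕ} {k : Fin N → ℂ} {A B : ℂ → ℂ} {x t : ℝ}

lemma contDiff_dirD {F : ℝ → ℝ → ℂ} (hF : ContDiff ℝ ⊤ fun p : ℝ × ℝ => F p.1 p.2) (w : ℝ × ℝ) :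
    ContDiff ℝ ⊤ fun p : ℝ × ℝ => dirD w F p.1 p.2 :=
  (hF.fderiv_right le_top).clm_apply contDiff_const

lemma dirD_comm {F : ℝ → ℝ → ℂ} (hF : ContDiff ℝ 2 fun p : ℝ × ℝ => F p.1 p.2) (v w : ℝ × ℝ) :
    dirD v (dirD w F) x t = dirD w (dirD v F) x t := by
  have hs : IsSymmSndFDerivAt ℝ (fun p : ℝ × ℝ => F p.1 p.2) (x, t) :=
    hF.contDiffAt.isSymmSndFDerivAt (by simp)
  have hd : DifferentiableAt ℝ (fderiv ℝ fun p : ℝ × ℝ => F p.1 p.2) (x, t) :=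
    (hF.fderiv_right (m := 1) (by norm_num)).differentiable one_ne_zero _
  have h : ∀ v w : ℝ × ℝ, dirD v (dirD w F) x t =
      fderiv ℝ (fderiv ℝ fun p : ℝ × ℝ => F p.1 p.2) (x, t) v w := fun v w => by
    have := (hd.hasFDerivAt.clm_apply (hasFDerivAt_const w (x, t))).fderiv
    unfold dirD
    simp only [Prod.mk.eta]
    rw [this]; simp
  rw [h, h, hs.eq]

variable (hre : ∀ n, 0 < (k n).re) (him : ∀ n, 0 < (k n).im) (hk : Function.Injective k)
  (hA : IsNormingData k A B)
include hre him hk hA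

lemma mul_solG_eventuallyEq : (fun z => z * solG k A B x t z) =ᶠ[cocompact ℂ]
    pf (fun n => conj (eta k n)) (solGOne k A B x t) (fun n => conj (eta k n) * gC k A B n x t)
      (fun n => gC k A B n x t + conj (eta k n) * gE k A B n x t) := by
  have := mul_pf_sub (p := fun n => conj (eta k n)) (c₀ := 0) (c := fun n => gC k A B n x t)
    (e := fun n => gE k A B n x t)
  rw [← solG_eq_pf hre him hk hA] at this
  simpa only [sub_zero] using! this

lemma mul_solG_tendsto : Tendsto (fun z => z * solG k A B x t z) (cocompact ℂ)
    (𝓝 (solGOne k A B x t)) :=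
  (pf_tendsto).congr' (mul_solG_eventuallyEq hre him hk hA).symm

lemma mul_dag_solG_tendsto : Tendsto (fun z => z * dag (solG k A B x t) z) (cocompact ℂ)
    (𝓝 (conj (solGOne k A B x t))) := by
  have := (Complex.continuous_conj.tendsto _).comp
    ((mul_solG_tendsto (x := x) (t := t) hre him hk hA).comp tendsto_conj_cocompact)
  refine this.congr fun z => ?_
  simp [dag]

lemma solQ_mul_conj : solQ k A B x t * conj (solFInf k A B x t) =
    -2 * Complex.I * solGOne k A B x t := by
  have h := norm_solFInf (x := x) (t := t) hre him hk hA
  rw [solQ, mul_assoc, Complex.mul_conj', h]; simp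

lemma solGOne_eq : solGOne k A B x t =
    Complex.I / 2 * solQ k A B x t * conj (solFInf k A B x t) := by
  rw [mul_assoc, solQ_mul_conj hre him hk hA]
  linear_combination solGOne k A B x t * Complex.I_mul_I

lemma mul_solF_sub_bounded : (fun z => z * (solF k A B x t z - solFInf k A B x t)) =O[cocompact ℂ]
    (fun _ => (1 : ℝ)) := by
  rw [solF_eq_pf]
  exact pf_isBigO_one.congr' mul_pf_sub.symm EventuallyEq.rfl

/-- This is the 1/z coefficient of `solF` at infinity; it equals its own negative because `solF` is
even. -/
lemma sum_fE_eq_zero : ∑ n, fE k A B n x t = 0 := by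
  have h : Tendsto (fun z => z * (solF k A B x t z - solFInf k A B x t)) (cocompact ℂ)
      (𝓝 (∑ n, fE k A B n x t)) := by
    rw [solF_eq_pf]
    exact pf_tendsto.congr' mul_pf_sub.symm
  have hn : Tendsto (fun z : ℂ => -z) (cocompact ℂ) (cocompact ℂ) :=
    (Homeomorph.neg ℂ).isClosedEmbedding.tendsto_cocompact
  have h2 := (h.comp hn).neg
  have h3 : Tendsto (fun z => z * (solF k A B x t z - solFInf k A B x t)) (cocompact ℂ)
      (𝓝 (-∑ n, fE k A B n x t)) := by
    refine h2.congr' ?_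
    filter_upwards [(Set.finite_range (eta k)).isCompact.compl_mem_cocompact] with z hz
    simp only [Function.comp]
    rw [(sol_neg hre him hk hA).1 z fun n hn => hz ⟨n, hn.symm⟩]
    ring
  exact self_eq_neg.1 (tendsto_nhds_unique h h3)

lemma sum_dirD_fE_eq_zero (w : ℝ × ℝ) : ∑ n, dirD w (fE k A B n) x t = 0 := by
  refine (HasDerivAt.fun_sum (u := Finset.univ) fun n _ =>
    hasDerivAt_line (contDiff_fE hre him hk hA n) w x t).unique ?_
  simp only [sum_fE_eq_zero hre him hk hA]
  exact hasDerivAt_const _ _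

lemma sum_dirD_gE (w : ℝ × ℝ) : ∑ n, dirD w (gE k A B n) x t = dirD w (solGOne k A B) x t :=
  (HasDerivAt.fun_sum (u := Finset.univ) fun n _ =>
    hasDerivAt_line (contDiff_gE hre him hk hA n) w x t).unique
    (hasDerivAt_line (contDiff_solGOne hre him hk hA) w x t)

lemma dag_solF_analyticAt {z : ℂ} (h : ∀ n, z ≠ conj (eta k n)) :
    AnalyticAt ℂ (dag (solF k A B x t)) z :=
  dag_analyticAt (pf_analyticAt fun n hn => h n (by simpa using congrArg conj hn))

lemma dag_solG_analyticAt {z : ℂ} (h : ∀ n, z ≠ eta k n) :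
    AnalyticAt ℂ (dag (solG k A B x t)) z :=
  dag_analyticAt ((rowSol_sol hre him hk hA).ang _
    fun n hn => h n (by simpa using congrArg conj hn))

lemma solG_analyticAt_eta (n) : AnalyticAt ℂ (solG k A B x t) (eta k n) :=
  (rowSol_sol hre him hk hA).ang _ fun m => eta_ne_conj hre him n m

/-- The term 2iz² g compensates the derivative of the data at the poles. The rest is z q times (g†,
-f†), which satisfies the same two residue conditions as (f, g). The growth of order z in the second
entry cancels exactly because q conj(f∞) = -2i g₁ (`solQ_mul_conj`), and this determines q. -/
lemma rowSol_lax_x : RowSol (eta k) (resC k A x t) (resE k A B x t)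
    (fun z => dotF k A B (1, 0) x t z + z * solQ k A B x t * dag (solG k A B x t) z)
    (fun z => dotG k A B (1, 0) x t z - 2 * Complex.I * z ^ 2 * solG k A B x t z -
      z * solQ k A B x t * dag (solF k A B x t) z) := by
  have hs := rowSol_sol (x := x) (t := t) hre him hk hA
  have hz : ∀ {p}, AnalyticAt ℂ (fun z : ℂ => z) p := analyticAt_id
  refine ⟨fun z h => ?_, fun z h => ?_, fun n => ?_, fun n => ?_, ?_, ?_⟩
  · exact (pf_analyticAt h).add ((hz.mul analyticAt_const).mul (dag_solG_analyticAt hre him hk hA h))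
  · exact ((pf_analyticAt h).sub ((analyticAt_const.mul (hz.pow 2)).mul (hs.ang z h))).sub
      ((hz.mul analyticAt_const).mul (dag_solF_analyticAt hre him hk hA h))
  · have h1 := removable_dot (w := (1, 0)) (x := x) (t := t) hre him hk hA n
    rw [dirD_resC_x, dirD_resE_x] at h1
    have h2 := (removable_pp_x (eta k n) (resC k A x t n) (resE k A B x t n)).mul
      (solG_analyticAt_eta (x := x) (t := t) hre him hk hA n).removable
    have h3 := (show AnalyticAt ℂ (fun z => z * solQ k A B x t) (eta k n) by fun_prop).removable.mul
      (hs.reg' n)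
    convert (h1.add h2).add h3 using 2
    ring
  · have h1 := removable_dot' (w := (1, 0)) (x := x) (t := t) hre him hk hA n
    rw [dirD_resC_x, dirD_resE_x] at h1
    have h2 := (removable_pp_x (eta k n) (resC k A x t n) (resE k A B x t n)).mul
      (dag_solF_analyticAt (x := x) (t := t) hre him hk hA (eta_ne_conj hre him n)).removable
    have h3 := (show AnalyticAt ℂ (fun z => 2 * Complex.I * z ^ 2) (eta k n) by
      fun_prop).removable.mul (hs.reg' n)
    have h4 := (show AnalyticAt ℂ (fun z => z * conj (solQ k A B x t)) (eta k n) by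
      fun_prop).removable.mul (hs.reg n)
    convert ((h1.sub h2).add h3).sub h4 using 2
    simp [dag, map_ofNat]
    ring
  · refine pf_isBigO_one.add (((mul_dag_solG_tendsto hre him hk hA).isBigO_one ℝ).const_mul_left
      (solQ k A B x t) |>.congr_left fun z => by ring)
  · have h1 : (fun z => z * (z * solG k A B x t z - solGOne k A B x t)) =O[cocompact ℂ]
        (fun _ => (1 : ℝ)) := by
      have := pf_mul_mul_isBigO_one (p := fun n => conj (eta k n)) (c₀ := 0)
        (c := fun n => gC k A B n x t) (e := fun n => gE k A B n x t)
      rw [← solG_eq_pf hre him hk hA] at this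
      simpa only [sub_zero] using! this
    have h2 : (fun z => z * (dag (solF k A B x t) z - conj (solFInf k A B x t))) =O[cocompact ℂ]
        (fun _ => (1 : ℝ)) :=
      (dag_isBigO_one (mul_solF_sub_bounded (x := x) (t := t) hre him hk hA)).congr_left
        fun z => by simp [dag]
    have h4 : dotG k A B (1, 0) x t =O[cocompact ℂ] (fun _ => (1 : ℝ)) := pf_isBigO_one
    refine ((h4.add (h1.const_mul_left (-2 * Complex.I))).add
      (h2.const_mul_left (-solQ k A B x t))).congr_left fun z => ?_
    linear_combination z * solQ_mul_conj (x := x) (t := t) hre him hk hA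

/-- The row of `rowSol_lax_x` vanishes at the origin, where `solF` and `solG` do not depend on x;
uniqueness makes it zero. -/
lemma lax_x : (∀ z, (∀ n, z ≠ eta k n) →
      dotF k A B (1, 0) x t z = -(z * solQ k A B x t * dag (solG k A B x t) z)) ∧
    ∀ z, (∀ n, z ≠ conj (eta k n)) → dotG k A B (1, 0) x t z =
      2 * Complex.I * z ^ 2 * solG k A B x t z + z * solQ k A B x t * dag (solF k A B x t) z := by
  obtain ⟨h1, h2⟩ := (rowSol_lax_x (x := x) (t := t) hre him hk hA).eq_zero_of_apply_zero
    (eta_ne_conj hre him) (eta_ne_zero hre him)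
    (by simp [dotF_zero hre him hk hA]) (by simp [dotG_zero hre him hk hA])
  exact ⟨fun z hz => by linear_combination h1 z hz, fun z hz => by linear_combination h2 z hz⟩

/-- Limit z → ∞ of the first equation of `lax_x`. -/
lemma dirD_solFInf_x : dirD (1, 0) (solFInf k A B) x t =
    Complex.I / 2 * (solQ k A B x t * conj (solQ k A B x t)) * solFInf k A B x t := by
  have h1 : Tendsto (dotF k A B (1, 0) x t) (cocompact ℂ) (𝓝 (dirD (1, 0) (solFInf k A B) x t)) :=
    pf_tendsto
  have h2 := (mul_dag_solG_tendsto (x := x) (t := t) hre him hk hA).const_mul (-solQ k A B x t)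
  rw [tendsto_nhds_unique h1 (h2.congr' ?_), solGOne_eq hre him hk hA]
  · simp [map_ofNat]; ring
  · filter_upwards [(Set.finite_range (eta k)).isCompact.compl_mem_cocompact] with z hz
    rw [(lax_x hre him hk hA).1 z fun n hn => hz ⟨n, hn.symm⟩]
    ring

end Lax

/-! ## The temporal equation of the Lax pair for the explicit solution -/

section LaxTime

set_option linter.unusedSectionVars false

variable {N : ℕ} {k : Fin N → ℂ} {A B : ℂ → ℂ} {x t : ℝ}

variable (k A B x t) in
/-- Coefficient of `k` in the off-diagonal part of the time evolution. -/
def solT : ℂ := Complex.I * dirD (1, 0) (solQ k A B) x t +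
  solQ k A B x t * conj (solQ k A B x t) * solQ k A B x t

variable (hre : ∀ n, 0 < (k n).re) (him : ∀ n, 0 < (k n).im) (hk : Function.Injective k)
  (hA : IsNormingData k A B)
include hre him hk hA

lemma dirD_solQ_x : dirD (1, 0) (solQ k A B) x t =
    -2 * Complex.I * (dirD (1, 0) (solGOne k A B) x t * solFInf k A B x t +
      solGOne k A B x t * dirD (1, 0) (solFInf k A B) x t) := by
  refine (hasDerivAt_fst (contDiff_solQ hre him hk hA) x t).unique ?_
  have := ((hasDerivAt_fst (contDiff_solGOne hre him hk hA) x t).const_mul (-2 * Complex.I)).fun_mul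
    (hasDerivAt_fst (contDiff_solFInf hre him hk hA) x t)
  exact this.congr_deriv (by ring)

/-- The left side is the coefficient of z at infinity in the second entry of `rowSol_lax_t`. Its
vanishing dictates the form of `solT`. -/
lemma solT_mul_conj : 2 * dirD (1, 0) (solGOne k A B) x t -
    Complex.I * (solQ k A B x t * conj (solQ k A B x t)) * solGOne k A B x t -
      solT k A B x t * conj (solFInf k A B x t) = 0 := by
  have h := norm_solFInf (x := x) (t := t) hre him hk hA
  have h2 : solFInf k A B x t * conj (solFInf k A B x t) = 1 := by
    rw [Complex.mul_conj', h]; simp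
  have h3 := solGOne_eq (x := x) (t := t) hre him hk hA
  rw [solT, dirD_solQ_x hre him hk hA, dirD_solFInf_x hre him hk hA]
  generalize dirD (1, 0) (solGOne k A B) x t = g at *
  generalize solFInf k A B x t = f at *
  generalize conj f = f' at *
  generalize solGOne k A B x t = G at *
  generalize solQ k A B x t = q at *
  generalize conj q = q' at *
  linear_combination (2 * Complex.I ^ 2 * g + Complex.I ^ 3 * G * q * q') * h2 +
    (2 * g + Complex.I * G * q * q' - q ^ 2 * q' * f') * Complex.I_mul_I -
    2 * Complex.I * q * q' * h3

/-- Adding 2z² times the x-derivative cancels the derivative of the data at the poles. The term with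
i|q|² removes the growth of order z² in the first entry, by `dirD_solFInf_x`, and the one with
`solT` removes the growth of order z left in the second. -/
lemma rowSol_lax_t : RowSol (eta k) (resC k A x t) (resE k A B x t)
    (fun z => dotF k A B (0, 1) x t z + 2 * z ^ 2 * dotF k A B (1, 0) x t z -
      z ^ 2 * (Complex.I * (solQ k A B x t * conj (solQ k A B x t))) * solF k A B x t z +
      z * solT k A B x t * dag (solG k A B x t) z)
    (fun z => dotG k A B (0, 1) x t z + 2 * z ^ 2 * dotG k A B (1, 0) x t z -
      z ^ 2 * (Complex.I * (solQ k A B x t * conj (solQ k A B x t))) * solG k A B x t z -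
      z * solT k A B x t * dag (solF k A B x t) z) := by
  have hs := rowSol_sol (x := x) (t := t) hre him hk hA
  have hz : ∀ {p}, AnalyticAt ℂ (fun z : ℂ => z) p := analyticAt_id
  set a := Complex.I * (solQ k A B x t * conj (solQ k A B x t)) with ha
  have hac : conj a = -a := by simp [ha]; ring
  refine ⟨fun z h => ?_, fun z h => ?_, fun n => ?_, fun n => ?_, ?_, ?_⟩
  · exact (((pf_analyticAt h).add ((analyticAt_const.mul (hz.pow 2)).mul (pf_analyticAt h))).sub
      (((hz.pow 2).mul analyticAt_const).mul (hs.anf z h))).add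
      ((hz.mul analyticAt_const).mul (dag_solG_analyticAt hre him hk hA h))
  · exact (((pf_analyticAt h).add ((analyticAt_const.mul (hz.pow 2)).mul (pf_analyticAt h))).sub
      (((hz.pow 2).mul analyticAt_const).mul (hs.ang z h))).sub
      ((hz.mul analyticAt_const).mul (dag_solF_analyticAt hre him hk hA h))
  · have h1 := removable_dot (w := (0, 1)) (x := x) (t := t) hre him hk hA n
    rw [dirD_resC_t, dirD_resE_t] at h1
    have h1' := removable_dot (w := (1, 0)) (x := x) (t := t) hre him hk hA n
    rw [dirD_resC_x, dirD_resE_x] at h1'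
    have h2 := (removable_pp_t (eta k n) (resC k A x t n) (resE k A B x t n)).mul
      (solG_analyticAt_eta (x := x) (t := t) hre him hk hA n).removable
    have h3 := (show AnalyticAt ℂ (fun z => z * solT k A B x t) (eta k n) by fun_prop).removable.mul
      (hs.reg' n)
    have h4 := (show AnalyticAt ℂ (fun z => z ^ 2 * a) (eta k n) by fun_prop).removable.mul
      (hs.reg n)
    have h5 := (show AnalyticAt ℂ (fun z => 2 * z ^ 2) (eta k n) by fun_prop).removable.mul h1'
    convert (((h1.add h2).add h5).sub h4).add h3 using 2
    ring
  · have h1 := removable_dot' (w := (0, 1)) (x := x) (t := t) hre him hk hA n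
    rw [dirD_resC_t, dirD_resE_t] at h1
    have h1' := removable_dot' (w := (1, 0)) (x := x) (t := t) hre him hk hA n
    rw [dirD_resC_x, dirD_resE_x] at h1'
    have h2 := (removable_pp_t (eta k n) (resC k A x t n) (resE k A B x t n)).mul
      (dag_solF_analyticAt (x := x) (t := t) hre him hk hA (eta_ne_conj hre him n)).removable
    have h3 := (show AnalyticAt ℂ (fun z => z * conj (solT k A B x t)) (eta k n) by
      fun_prop).removable.mul (hs.reg n)
    have h4 := (show AnalyticAt ℂ (fun z => z ^ 2 * a) (eta k n) by fun_prop).removable.mul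
      (hs.reg' n)
    have h5 := (show AnalyticAt ℂ (fun z => 2 * z ^ 2) (eta k n) by fun_prop).removable.mul h1'
    convert (((h1.sub h2).add h5).add h4).sub h3 using 2
    simp only [dag, map_sub, map_add, map_mul, map_pow, Complex.conj_conj, hac, map_ofNat]
    ring
  · have h1 := pf_mul_mul_isBigO_one (p := eta k) (c₀ := dirD (1, 0) (solFInf k A B) x t)
      (c := fun n => dirD (1, 0) (fC k A B n) x t) (e := fun n => dirD (1, 0) (fE k A B n) x t)
    have h2 := pf_mul_mul_isBigO_one (p := eta k) (c₀ := solFInf k A B x t)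
      (c := fun n => fC k A B n x t) (e := fun n => fE k A B n x t)
    rw [sum_dirD_fE_eq_zero hre him hk hA] at h1
    rw [sum_fE_eq_zero hre him hk hA] at h2
    have h3 := ((mul_dag_solG_tendsto (x := x) (t := t) hre him hk hA).isBigO_one ℝ).const_mul_left
      (solT k A B x t)
    have h4 : dotF k A B (0, 1) x t =O[cocompact ℂ] (fun _ => (1 : ℝ)) := pf_isBigO_one
    refine ((h4.add (h1.const_mul_left 2)).sub (h2.const_mul_left a)).add h3 |>.congr_left
      fun z => ?_
    rw [solF_eq_pf, dirD_solFInf_x hre him hk hA, dotF, dotF, dirD_solFInf_x hre him hk hA]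
    ring
  · have h1 := pf_mul_mul_isBigO_one (p := fun n => conj (eta k n)) (c₀ := 0)
      (c := fun n => dirD (1, 0) (gC k A B n) x t) (e := fun n => dirD (1, 0) (gE k A B n) x t)
    have h2 := pf_mul_mul_isBigO_one (p := fun n => conj (eta k n)) (c₀ := 0)
      (c := fun n => gC k A B n x t) (e := fun n => gE k A B n x t)
    rw [sum_dirD_gE hre him hk hA] at h1
    rw [← solG_eq_pf hre him hk hA] at h2
    have h3 := (dag_isBigO_one (mul_solF_sub_bounded (x := x) (t := t) hre him hk hA)).const_mul_left
      (-solT k A B x t)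
    have h4 : dotG k A B (0, 1) x t =O[cocompact ℂ] (fun _ => (1 : ℝ)) := pf_isBigO_one
    refine ((h4.add (h1.const_mul_left 2)).sub (h2.const_mul_left a)).add h3 |>.congr_left
      fun z => ?_
    change _ = _ + 2 * z ^ 2 * pf _ _ _ _ z - _ - _
    simp only [dag, map_sub, map_mul, Complex.conj_conj]
    have h5 : ∑ n, gE k A B n x t = solGOne k A B x t := rfl
    rw [h5]
    linear_combination -z * solT_mul_conj (x := x) (t := t) hre him hk hA

lemma lax_t {z : ℂ} (hz : ∀ n, z ≠ conj (eta k n)) : dotG k A B (0, 1) x t z =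
    -2 * z ^ 2 * dotG k A B (1, 0) x t z +
      z ^ 2 * (Complex.I * (solQ k A B x t * conj (solQ k A B x t))) * solG k A B x t z +
      z * solT k A B x t * dag (solF k A B x t) z := by
  obtain ⟨-, h2⟩ := (rowSol_lax_t (x := x) (t := t) hre him hk hA).eq_zero_of_apply_zero
    (eta_ne_conj hre him) (eta_ne_zero hre him)
    (by simp [dotF_zero hre him hk hA]) (by simp [dotG_zero hre him hk hA])
  linear_combination h2 z hz

lemma zero_ne_conj_eta (n) : 0 ≠ conj (eta k n) := fun h =>
  eta_ne_zero hre him n ((map_eq_zero (starRingEnd ℂ)).1 h.symm)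

lemma eventually_ne_conj_eta : ∀ᶠ z in 𝓝 (0 : ℂ), ∀ n, z ≠ conj (eta k n) :=
  eventually_all.2 fun n => isOpen_ne.mem_nhds (zero_ne_conj_eta hre him hk hA n)

lemma hasDerivAt_dag_solF_zero : ∃ d, HasDerivAt (dag (solF k A B x t)) d 0 :=
  ⟨_, (dag_solF_analyticAt hre him hk hA (zero_ne_conj_eta hre him hk hA)).differentiableAt.hasDerivAt⟩

lemma dag_solF_zero : dag (solF k A B x t) 0 = 1 := by simp [dag, solF_zero]

/-- In `lax_x` only z q f† contributes to first order at the origin, where f† = 1. -/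
lemma deriv_dotG_x : deriv (dotG k A B (1, 0) x t) 0 = solQ k A B x t := by
  obtain ⟨d, hd⟩ := hasDerivAt_dag_solF_zero (x := x) (t := t) hre him hk hA
  have hg := ((rowSol_sol (x := x) (t := t) hre him hk hA).ang _
    (zero_ne_conj_eta hre him hk hA)).differentiableAt.hasDerivAt
  have h : dotG k A B (1, 0) x t =ᶠ[𝓝 0] fun z =>
      2 * Complex.I * z ^ 2 * solG k A B x t z + z * solQ k A B x t * dag (solF k A B x t) z := by
    filter_upwards [eventually_ne_conj_eta hre him hk hA] with z hz
    exact (lax_x hre him hk hA).2 z hz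
  rw [h.deriv_eq]
  have := ((((hasDerivAt_id (0 : ℂ)).fun_pow 2).const_mul (2 * Complex.I)).fun_mul hg).fun_add
    (((hasDerivAt_id (0 : ℂ)).mul_const (solQ k A B x t)).fun_mul hd)
  exact (this.congr_deriv (by simp [dag_solF_zero hre him hk hA])).deriv

lemma deriv_dotG_t : deriv (dotG k A B (0, 1) x t) 0 = solT k A B x t := by
  obtain ⟨d, hd⟩ := hasDerivAt_dag_solF_zero (x := x) (t := t) hre him hk hA
  have hg := ((rowSol_sol (x := x) (t := t) hre him hk hA).ang _
    (zero_ne_conj_eta hre him hk hA)).differentiableAt.hasDerivAt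
  have hx : HasDerivAt (dotG k A B (1, 0) x t) _ 0 :=
    (pf_analyticAt (zero_ne_conj_eta hre him hk hA)).differentiableAt.hasDerivAt
  have h : dotG k A B (0, 1) x t =ᶠ[𝓝 0] fun z => -2 * z ^ 2 * dotG k A B (1, 0) x t z +
      z ^ 2 * (Complex.I * (solQ k A B x t * conj (solQ k A B x t))) * solG k A B x t z +
      z * solT k A B x t * dag (solF k A B x t) z := by
    filter_upwards [eventually_ne_conj_eta hre him hk hA] with z hz
    exact lax_t hre him hk hA hz
  rw [h.deriv_eq]
  have h2 := (hasDerivAt_id (0 : ℂ)).fun_pow 2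
  have := (((h2.const_mul (-2)).fun_mul hx).fun_add
    ((h2.mul_const (Complex.I * (solQ k A B x t * conj (solQ k A B x t)))).fun_mul hg)).fun_add
    (((hasDerivAt_id (0 : ℂ)).mul_const (solT k A B x t)).fun_mul hd)
  exact (this.congr_deriv (by simp [dag_solF_zero hre him hk hA])).deriv

lemma contDiff_deriv_solG_zero {r} :
    ContDiff ℝ r fun p : ℝ × ℝ => deriv (solG k A B p.1 p.2) 0 := by
  simp only [solG_eq_pf hre him hk hA, (pf_hasDerivAt (zero_ne_conj_eta hre him hk hA)).deriv]
  exact ContDiff.sum fun n _ => ((contDiff_const.mul (contDiff_gC hre him hk hA n)).neg.div_const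
    _).sub ((contDiff_gE hre him hk hA n).div_const _)

lemma dirD_deriv_solG_zero (w : ℝ × ℝ) :
    dirD w (fun x t => deriv (solG k A B x t) 0) x t = deriv (dotG k A B w x t) 0 := by
  refine (hasDerivAt_line (contDiff_deriv_solG_zero hre him hk hA) w x t).unique ?_
  simp only [solG_eq_pf hre him hk hA]
  exact hasDerivAt_deriv_pf (c₀ := fun _ => 0) (c₀' := 0)
    (fun n => hasDerivAt_line (contDiff_gC hre him hk hA n) w x t)
    (fun n => hasDerivAt_line (contDiff_gE hre him hk hA n) w x t) (zero_ne_conj_eta hre him hk hA)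

/-- Compatibility of the Lax pair, seen at z = 0: q and `solT` are the x- and t-derivatives of one
function, ∂_z `solG` at the origin, so the symmetry of second derivatives gives a conservation law.
-/
lemma dirD_solQ_t : dirD (0, 1) (solQ k A B) x t = dirD (1, 0) (solT k A B) x t := by
  have h := dirD_comm (F := fun x t => deriv (solG k A B x t) 0) (x := x) (t := t)
    (contDiff_deriv_solG_zero (A := A) (B := B) hre him hk hA)
    (0, 1) (1, 0)
  have h1 : dirD (1, 0) (fun x t => deriv (solG k A B x t) 0) = solQ k A B := by
    ext x t
    rw [dirD_deriv_solG_zero hre him hk hA, deriv_dotG_x hre him hk hA]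
  have h2 : dirD (0, 1) (fun x t => deriv (solG k A B x t) 0) = solT k A B := by
    ext x t
    rw [dirD_deriv_solG_zero hre him hk hA, deriv_dotG_t hre him hk hA]
  rwa [h1, h2] at h

lemma solQ_equation : Complex.I * deriv (fun s => solQ k A B x s) t +
    iteratedDeriv 2 (fun y => solQ k A B y t) x
      + Complex.I * (-1) * deriv (fun y => ((‖solQ k A B y t‖ ^ 2 : ℝ) : ℂ) * solQ k A B y t) x
        = 0 := by
  have hq := contDiff_solQ (A := A) (B := B) (r := ⊤) hre him hk hA
  have hx := fun y => hasDerivAt_fst (hq.of_le le_top) y t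
  have hxx := hasDerivAt_fst ((contDiff_dirD hq (1, 0)).of_le le_top) x t
  have hN : ∀ y, ((‖solQ k A B y t‖ ^ 2 : ℝ) : ℂ) * solQ k A B y t =
      solQ k A B y t * conj (solQ k A B y t) * solQ k A B y t := fun y => by
    rw [Complex.mul_conj']; push_cast; ring
  have hn : DifferentiableAt ℝ
      (fun y => solQ k A B y t * conj (solQ k A B y t) * solQ k A B y t) x :=
    (((hx x).fun_mul (hx x).star).fun_mul (hx x)).differentiableAt
  simp only [hN]
  have h1 : deriv (fun s => solQ k A B x s) t = _ := (hasDerivAt_snd (hq.of_le le_top) x t).deriv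
  have h2 : iteratedDeriv 2 (fun y => solQ k A B y t) x =
      dirD (1, 0) (dirD (1, 0) (solQ k A B)) x t := by
    rw [iteratedDeriv_succ, iteratedDeriv_one]
    have : deriv (fun y => solQ k A B y t) = fun y => dirD (1, 0) (solQ k A B) y t :=
      funext fun y => (hx y).deriv
    rw [this, hxx.deriv]
  have hT : ContDiff ℝ 1 fun p : ℝ × ℝ => solT k A B p.1 p.2 := by
    have hq1 := contDiff_solQ (A := A) (B := B) (r := 1) hre him hk hA
    exact (contDiff_const.mul ((contDiff_dirD hq (1, 0)).of_le le_top)).add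
      ((hq1.mul (Complex.conjCLE.contDiff.comp hq1)).mul hq1)
  have h3 : dirD (1, 0) (solT k A B) x t = _ := (hasDerivAt_fst hT x t).unique
    ((hxx.const_mul Complex.I).fun_add hn.hasDerivAt)
  rw [h1, h2, dirD_solQ_t hre him hk hA, h3]
  linear_combination dirD (1, 0) (dirD (1, 0) (solQ k A B)) x t * Complex.I_mul_I

end LaxTime

/-! ## The Blaschke product -/

section Blaschke

variable {N : ℕ} (k : Fin N → ℂ)

/-- A factor of the transmission coefficient of the reflectionless potential. -/
def blFactor (n : Fin N ⊕ Fin N) (z : ℂ) : ℂ :=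
  (z - eta k n) * conj (eta k n) / ((z - conj (eta k n)) * eta k n)

/-- The scattering coefficient `s₁₁` of the reflectionless potential. -/
def bl (z : ℂ) : ℂ := ∏ n, blFactor k n z ^ 2

/-- The regular factor of `bl` at the pole `ηₙ*`. -/
def blV (n : Fin N ⊕ Fin N) (z : ℂ) : ℂ :=
  ((z - eta k n) * conj (eta k n) / eta k n) ^ 2 *
    ∏ m ∈ Finset.univ.erase n, blFactor k m z ^ 2

/-- The regular factor of `bl` at the zero `ηₙ`. -/
def blU (n : Fin N ⊕ Fin N) (z : ℂ) : ℂ :=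
  (conj (eta k n) / ((z - conj (eta k n)) * eta k n)) ^ 2 *
    ∏ m ∈ Finset.univ.erase n, blFactor k m z ^ 2

/-- The value of `bl` at infinity. -/
def blInf : ℂ := ∏ n, (conj (eta k n) / eta k n) ^ 2

variable {k}

lemma bl_eq_pp_mul (n) (z : ℂ) : bl k z = pp (conj (eta k n)) 1 0 z * blV k n z := by
  rw [bl, ← Finset.mul_prod_erase _ _ (Finset.mem_univ n), blV, pp, ← mul_assoc]
  congr 1
  simp only [blFactor, div_eq_mul_inv, mul_inv, zero_mul, add_zero, mul_pow, inv_pow]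
  ring

lemma bl_eq_sq_mul (n) (z : ℂ) : bl k z = (z - eta k n) ^ 2 * blU k n z := by
  rw [bl, ← Finset.mul_prod_erase _ _ (Finset.mem_univ n), blU, ← mul_assoc]
  congr 1
  simp only [blFactor, div_eq_mul_inv, mul_inv, mul_pow, inv_pow]
  ring

variable (hre : ∀ n, 0 < (k n).re) (him : ∀ n, 0 < (k n).im)
include hre him

lemma conj_eta_ne_zero (n) : conj (eta k n) ≠ 0 := fun h =>
  eta_ne_zero hre him n ((map_eq_zero (starRingEnd ℂ)).1 h)

lemma blFactor_analyticAt {n} {z : ℂ} (h : z ≠ conj (eta k n)) :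
    AnalyticAt ℂ (blFactor k n) z := by
  unfold blFactor
  have h1 := eta_ne_zero hre him n
  have h2 := sub_ne_zero.2 h
  refine AnalyticAt.div (by fun_prop) (by fun_prop) (mul_ne_zero h2 h1)

lemma blFactor_ne_zero {n} {z : ℂ} (h : z ≠ conj (eta k n)) (h' : z ≠ eta k n) :
    blFactor k n z ≠ 0 :=
  div_ne_zero (mul_ne_zero (sub_ne_zero.2 h') (conj_eta_ne_zero hre him n))
    (mul_ne_zero (sub_ne_zero.2 h) (eta_ne_zero hre him n))

lemma bl_analyticAt {z : ℂ} (h : ∀ n, z ≠ conj (eta k n)) : AnalyticAt ℂ (bl k) z := by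
  unfold bl
  exact Finset.analyticAt_fun_prod _ fun n _ => (blFactor_analyticAt hre him (h n)).pow 2

lemma bl_ne_zero {z : ℂ} (h : ∀ n, z ≠ conj (eta k n)) (h' : ∀ n, z ≠ eta k n) : bl k z ≠ 0 :=
  Finset.prod_ne_zero_iff.2 fun n _ => pow_ne_zero 2 (blFactor_ne_zero hre him (h n) (h' n))

lemma bl_zero : bl k 0 = 1 := by
  refine Finset.prod_eq_one fun n _ => ?_
  have h1 := eta_ne_zero hre him n
  have h2 := conj_eta_ne_zero hre him n
  rw [blFactor]
  have : (0 - eta k n) * conj (eta k n) / ((0 - conj (eta k n)) * eta k n) = 1 := by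
    rw [div_eq_one_iff_eq (by simp [h1])]
    ring
  rw [this, one_pow]

lemma norm_bl_ofReal (x : ℝ) : ‖bl k x‖ = 1 := by
  rw [bl, norm_prod]
  refine Finset.prod_eq_one fun n _ => ?_
  have h1 := eta_ne_zero hre him n
  have h3 : (x : ℂ) - eta k n ≠ 0 := fun h => eta_im_ne hre him n (by
    rw [← sub_eq_zero.1 h]; simp)
  have h2 : ‖(x : ℂ) - conj (eta k n)‖ = ‖(x : ℂ) - eta k n‖ := by
    rw [← RCLike.norm_conj]; simp
  rw [blFactor, norm_pow, norm_div, norm_mul, norm_mul, h2, RCLike.norm_conj,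
    div_self (mul_ne_zero (norm_ne_zero_iff.2 h3) (norm_ne_zero_iff.2 h1)), one_pow]

lemma blV_analyticAt (hk : Function.Injective k) (n) :
    AnalyticAt ℂ (blV k n) (conj (eta k n)) := by
  have h1 := eta_ne_zero hre him n
  refine AnalyticAt.mul ?_ (Finset.analyticAt_fun_prod _ fun m hm =>
    (blFactor_analyticAt hre him ?_).pow 2)
  · exact ((by fun_prop : AnalyticAt ℂ (fun z => (z - eta k n) * conj (eta k n)) _).div
      analyticAt_const h1).pow 2
  · exact fun h => Finset.ne_of_mem_erase hm
      (eta_injective hre him hk (star_injective h)).symm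

lemma blU_analyticAt (n) : AnalyticAt ℂ (blU k n) (eta k n) := by
  refine AnalyticAt.mul ?_ (Finset.analyticAt_fun_prod _ fun m hm =>
    (blFactor_analyticAt hre him (eta_ne_conj hre him n m)).pow 2)
  have h1 : AnalyticAt ℂ (fun z => (z - conj (eta k n)) * eta k n) (eta k n) := by fun_prop
  exact (analyticAt_const.fun_div h1 (mul_ne_zero (sub_ne_zero.2 (eta_ne_conj hre him n n))
    (eta_ne_zero hre him n))).fun_pow 2

lemma blU_ne_zero (hk : Function.Injective k) (n) : blU k n (eta k n) ≠ 0 := by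
  refine mul_ne_zero (pow_ne_zero 2 (div_ne_zero (conj_eta_ne_zero hre him n)
    (mul_ne_zero (sub_ne_zero.2 (eta_ne_conj hre him n n)) (eta_ne_zero hre him n))))
    (Finset.prod_ne_zero_iff.2 fun m hm => pow_ne_zero 2 (blFactor_ne_zero hre him
      (eta_ne_conj hre him n m) fun h => Finset.ne_of_mem_erase hm (eta_injective hre him hk h).symm))

lemma bl_tendsto : Tendsto (bl k) (cocompact ℂ) (𝓝 (blInf k)) := by
  unfold bl blInf
  refine tendsto_finsetProd _ fun n _ => Tendsto.pow ?_ 2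
  have h1 : Tendsto (fun z => (conj (eta k n) / eta k n) *
      (1 + pp (conj (eta k n)) 0 (conj (eta k n) - eta k n) z)) (cocompact ℂ)
      (𝓝 ((conj (eta k n) / eta k n) * (1 + 0))) :=
    ((((pp_isBigO _ _ _).trans_tendsto tendsto_inv_cocompact)).const_add 1).const_mul _
  rw [add_zero, mul_one] at h1
  refine h1.congr' ?_
  filter_upwards [(isCompact_singleton (x := conj (eta k n))).compl_mem_cocompact] with z hz
  have h2 : z - conj (eta k n) ≠ 0 := sub_ne_zero.2 hz
  have h3 := eta_ne_zero hre him n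
  rw [blFactor, pp]
  field_simp
  ring

/-- The double zeros of `bl` absorb the poles of h at ηₙ, and its double poles create new ones at
ηₙ*. The difference of the two sides has only removable singularities and tends to zero at infinity.
-/
lemma mul_bl_eq_pf (hk : Function.Injective k) {h : ℂ → ℂ} {h₀ : ℂ}
    (han : ∀ z, (∀ n, z ≠ eta k n) → AnalyticAt ℂ h z)
    (hrem : ∀ n, Removable (fun z => (z - eta k n) ^ 2 * h z) (eta k n))
    (hlim : Tendsto h (cocompact ℂ) (𝓝 h₀)) {z : ℂ} (hz : ∀ n, z ≠ eta k n)
    (hz' : ∀ n, z ≠ conj (eta k n)) :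
    h z * bl k z = pf (fun n => conj (eta k n)) (h₀ * blInf k)
      (fun n => blV k n (conj (eta k n)) * h (conj (eta k n)))
      (fun n => deriv (blV k n) (conj (eta k n)) * h (conj (eta k n)) +
        blV k n (conj (eta k n)) * deriv h (conj (eta k n))) z := by
  set c := fun n => blV k n (conj (eta k n)) * h (conj (eta k n))
  set e := fun n => deriv (blV k n) (conj (eta k n)) * h (conj (eta k n)) +
        blV k n (conj (eta k n)) * deriv h (conj (eta k n))
  set F := fun z => h z * bl k z - pf (fun n => conj (eta k n)) (h₀ * blInf k) c e z with hF
  have hinj : Function.Injective fun n => conj (eta k n) :=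
    star_injective.comp (eta_injective hre him hk)
  have hFan : ∀ z, (∀ n, z ≠ eta k n) → (∀ n, z ≠ conj (eta k n)) → AnalyticAt ℂ F z :=
    fun z h1 h2 => ((han z h1).mul (bl_analyticAt hre him h2)).sub (pf_analyticAt h2)
  have h1 : ∀ p, Removable F p := by
    intro p
    by_cases hp : ∃ n, p = eta k n
    · obtain ⟨n, rfl⟩ := hp
      convert ((hrem n).mul (blU_analyticAt hre him n).removable).sub
        (pf_analyticAt (c₀ := h₀ * blInf k) (c := c) (e := e)
          (eta_ne_conj hre him n)).removable using 2 with z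
      rw [hF]; simp only
      rw [bl_eq_sq_mul n]; ring
    by_cases hp' : ∃ n, p = conj (eta k n)
    · obtain ⟨n, rfl⟩ := hp'
      push Not at hp
      have hv := blV_analyticAt hre him hk n
      have hh := han _ hp
      have h2 := removable_pp_mul_sub 1 0 (hv.mul hh)
      have h3 := pf_removable_sub_pp (c₀ := h₀ * blInf k) (c := c) (e := e) hinj n
      have h4 : deriv (blV k n * h) (conj (eta k n)) = e n :=
        (hv.differentiableAt.hasDerivAt.mul hh.differentiableAt.hasDerivAt).deriv
      rw [h4] at h2
      convert h2.sub h3 using 2 with z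
      rw [hF]; simp only [Pi.mul_apply]
      rw [bl_eq_pp_mul n]; simp only [c]; ring_nf
    push Not at hp hp'
    exact (hFan p hp hp').removable
  have hF0 : Tendsto F (cocompact ℂ) (𝓝 0) := by
    have := (hlim.mul (bl_tendsto hre him)).sub
      (pf_tendsto (p := fun n => conj (eta k n)) (c₀ := h₀ * blInf k) (c := c) (e := e))
    rwa [sub_self] at this
  obtain ⟨C, hC⟩ := eq_const_of_removable h1 (hF0.isBigO_one ℝ)
  have hFC : ∀ z, (∀ n, z ≠ eta k n) → (∀ n, z ≠ conj (eta k n)) → F z = C := fun z h1 h2 =>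
    ((hFan z h1 h2).continuousAt.eventuallyEq_nhds_iff_eventuallyEq_nhdsNE
      continuousAt_const).1 (hC z) |>.eq_of_nhds
  have hC0 : C = 0 := by
    refine tendsto_nhds_unique (tendsto_const_nhds.congr' ?_) hF0
    filter_upwards [(Set.finite_range (eta k)).isCompact.compl_mem_cocompact,
      (Set.finite_range fun n => conj (eta k n)).isCompact.compl_mem_cocompact] with z h1 h2
    exact (hFC z (fun n hn => h1 ⟨n, hn.symm⟩) (fun n hn => h2 ⟨n, hn.symm⟩)).symm
  have := hFC z hz hz'
  rw [hC0] at this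
  exact sub_eq_zero.1 this

end Blaschke

/-! ## Decay of the explicit solution -/

section Decay

set_option linter.unusedSectionVars false

lemma isBigO_principal_iff_exists {α E F : Type*} [Norm E] [Norm F] {u : α → E} {w : α → F} {S : Set α} :
    u =O[𝓟 S] w ↔ ∃ C, ∀ p ∈ S, ‖u p‖ ≤ C * ‖w p‖ := by
  simp [Asymptotics.isBigO_iff]

/-- The slab `|t| ≤ T`. -/
def slab (T : ℝ) : Set (ℝ × ℝ) := {p | |p.2| ≤ T}

/-- The left half of the slab. -/
def slabL (T : ℝ) : Set (ℝ × ℝ) := {p | p.1 ≤ 0 ∧ |p.2| ≤ T}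

/-- The right half of the slab. -/
def slabR (T : ℝ) : Set (ℝ × ℝ) := {p | 0 ≤ p.1 ∧ |p.2| ≤ T}

/-- The weight `(1 + x²)⁻¹`. -/
def wt (p : ℝ × ℝ) : ℝ := (1 + p.1 ^ 2)⁻¹

lemma wt_pos (p : ℝ × ℝ) : 0 < wt p := by unfold wt; positivity

lemma norm_wt (p : ℝ × ℝ) : ‖wt p‖ = wt p := Real.norm_of_nonneg (wt_pos p).le

lemma wt_le_one (p : ℝ × ℝ) : wt p ≤ 1 := inv_le_one_of_one_le₀ (by nlinarith [sq_nonneg p.1])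

lemma principal_slab (T : ℝ) : 𝓟 (slab T) = 𝓟 (slabL T) ⊔ 𝓟 (slabR T) := by
  rw [sup_principal]
  congr 1
  ext p
  simp only [slab, slabL, slabR, Set.mem_ofPred_eq, Set.mem_union]
  constructor
  · intro h
    rcases le_total p.1 0 with h' | h' <;> simp [h, h']
  · rintro (h | h) <;> exact h.2

lemma wt_isBigO_one (l : Filter (ℝ × ℝ)) : wt =O[l] (fun _ => (1 : ℝ)) :=
  Asymptotics.IsBigO.of_bound 1 (Eventually.of_forall fun p => by
    rw [norm_wt]; simpa using wt_le_one p)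

/-- Bounds for the coefficients of a partial fraction in terms of its values on `[-1, 1]`. -/
lemma pf_coeff_isBigO {ι : Type*} [Fintype ι] {p : ι → ℂ} (hp : Function.Injective p)
    (him : ∀ n, (p n).im ≠ 0) {α : Type*} {S : Set α} {w : α → ℝ} (hw : ∀ a, 0 ≤ w a)
    {c₀ : α → ℂ} {c e : ι → α → ℂ} {C : ℝ}
    (h : ∀ a ∈ S, ∀ x : ℝ, |x| ≤ 1 →
      ‖pf p (c₀ a) (fun n => c n a) (fun n => e n a) x‖ ≤ C * w a) :
    c₀ =O[𝓟 S] w ∧ ∀ n, c n =O[𝓟 S] w ∧ e n =O[𝓟 S] w := by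
  obtain ⟨K, hK, h2⟩ := exists_pf_coeff_bound hp him
  have h3 := fun a (ha : a ∈ S) => h2 (c₀ a) (fun n => c n a) (fun n => e n a) (C * w a)
    ((norm_nonneg _).trans (h a ha 0 (by simp))) (h a ha)
  have h4 : ∀ a, ‖w a‖ = w a := fun a => Real.norm_of_nonneg (hw a)
  refine ⟨isBigO_principal_iff_exists.2 ⟨K * C, fun a ha => ?_⟩, fun n =>
    ⟨isBigO_principal_iff_exists.2 ⟨K * C, fun a ha => ?_⟩,
      isBigO_principal_iff_exists.2 ⟨K * C, fun a ha => ?_⟩⟩⟩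
  · rw [h4, mul_assoc]; exact (h3 a ha).1
  · rw [h4, mul_assoc]; exact ((h3 a ha).2 n).1
  · rw [h4, mul_assoc]; exact ((h3 a ha).2 n).2

lemma pf_isBigO_of_coeff {ι : Type*} [Fintype ι] {p : ι → ℂ} {α : Type*} {l : Filter α} {w : α → ℝ}
    {c₀ : α → ℂ} {c e : ι → α → ℂ} (h₀ : c₀ =O[l] w) (hc : ∀ n, c n =O[l] w)
    (he : ∀ n, e n =O[l] w) (z : ℂ) :
    (fun a => pf p (c₀ a) (fun n => c n a) (fun n => e n a) z) =O[l] w := by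
  unfold pf pp
  simp only [div_eq_mul_inv]
  exact h₀.add (Asymptotics.IsBigO.fun_sum fun n _ =>
    ((hc n).const_mul_left ((z - p n) ^ 2)⁻¹ |>.congr_left fun a => mul_comm _ _).add
      ((he n).const_mul_left (z - p n)⁻¹ |>.congr_left fun a => mul_comm _ _))

lemma pf_isBigO_of_coeff_real {ι : Type*} [Fintype ι] {p : ι → ℂ} (him : ∀ n, (p n).im ≠ 0)
    {α : Type*} {S : Set α} {w : α → ℝ} (hw : ∀ a, 0 ≤ w a)
    {c₀ : α → ℂ} {c e : ι → α → ℂ} (h₀ : c₀ =O[𝓟 S] w) (hc : ∀ n, c n =O[𝓟 S] w)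
    (he : ∀ n, e n =O[𝓟 S] w) : ∃ C, ∀ a ∈ S, ∀ x : ℝ, |x| ≤ 1 →
      ‖pf p (c₀ a) (fun n => c n a) (fun n => e n a) x‖ ≤ C * w a := by
  simp only [isBigO_principal_iff_exists, fun a => Real.norm_of_nonneg (hw a)] at h₀ hc he
  obtain ⟨C₀, h₀⟩ := h₀
  choose C1 hc using hc
  choose C2 he using he
  have hb : ∀ n, ∃ M, ∀ x : ℝ, |x| ≤ 1 → ‖((x : ℂ) - p n)⁻¹‖ ≤ M := by
    intro n
    refine ⟨|(p n).im|⁻¹, fun x _ => ?_⟩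
    rw [norm_inv]
    refine inv_anti₀ (abs_pos.2 (him n)) ?_
    have := Complex.abs_im_le_norm ((x : ℂ) - p n)
    simpa using this
  choose M hM using hb
  refine ⟨C₀ + ∑ n, (C1 n * M n ^ 2 + C2 n * M n), fun a ha x hx => ?_⟩
  rw [pf, add_mul, Finset.sum_mul]
  refine (norm_add_le _ _).trans (add_le_add (h₀ a ha) ((norm_sum_le _ _).trans
    (Finset.sum_le_sum fun n _ => ?_)))
  rw [pp, div_eq_mul_inv, div_eq_mul_inv, add_mul]
  refine (norm_add_le _ _).trans (add_le_add ?_ ?_)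
  · rw [norm_mul, mul_right_comm, ← inv_pow, norm_pow]
    gcongr
    · exact (norm_nonneg _).trans (hc n a ha)
    · exact hc n a ha
    · exact hM n x hx
  · rw [norm_mul, mul_right_comm]
    gcongr
    · exact (norm_nonneg _).trans (he n a ha)
    · exact he n a ha
    · exact hM n x hx

lemma exists_exp_mul_le {a : ℝ} (ha : 0 < a) :
    ∃ C, ∀ x : ℝ, 0 ≤ x → (1 + x) * Real.exp (-(a * x)) ≤ C * (1 + x ^ 2)⁻¹ := by
  -- The constant comes from the cubic term of the exponential series, a³(1+x)³/6 ≤ e^{a+ax}, and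
  -- from (1+x)(1+x²) ≤ (1+x)³.
  refine ⟨6 * Real.exp a / a ^ 3, fun x hx => ?_⟩
  have h1 := Real.pow_div_factorial_le_exp (a * (1 + x)) (by positivity) 3
  rw [le_mul_inv_iff₀ (by positivity), Real.exp_neg, div_eq_mul_inv, mul_assoc, mul_assoc,
    ← div_eq_mul_inv]
  rw [mul_add, mul_one, Real.exp_add] at h1
  have h2 : (Nat.factorial 3 : ℝ) = 6 := by norm_num [Nat.factorial]
  rw [h2] at h1
  have h3 : (1 + x) * (1 + x ^ 2) ≤ (1 + x) ^ 3 := by nlinarith [mul_nonneg hx hx]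
  have h4 := Real.exp_pos (a * x)
  have h5 : (1 + x) * ((Real.exp (a * x))⁻¹ * (1 + x ^ 2)) =
    (1 + x) * (1 + x ^ 2) / Real.exp (a * x) := by field_simp
  rw [h5, div_le_iff₀ h4]
  have h6 : (a + a * x) ^ 3 = a ^ 3 * (1 + x) ^ 3 := by ring
  rw [h6, div_le_iff₀ (by norm_num)] at h1
  have h7 : 6 * (Real.exp a / a ^ 3) * Real.exp (a * x) =
      (6 * (Real.exp a * Real.exp (a * x))) / a ^ 3 := by ring
  rw [h7, le_div_iff₀ (by positivity)]
  nlinarith [pow_pos ha 3]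

variable {N : ℕ} {k : Fin N → ℂ} {A B : ℂ → ℂ} {x t : ℝ}

lemma norm_resC (n) : ‖resC k A x t n‖ = ‖A (eta k n)‖ *
    (Real.exp (2 * (eta k n ^ 2).im * x) * Real.exp (-4 * (eta k n ^ 4).im * t)) := by
  rw [resC, norm_mul, Complex.norm_exp, ← Real.exp_add]
  congr 2
  rw [theta]
  have : -2 * Complex.I * (eta k n ^ 2 * (x - 2 * eta k n ^ 2 * t)) =
    -2 * Complex.I * (eta k n ^ 2 * x - 2 * eta k n ^ 4 * t) := by ring
  rw [this]
  simp
  ring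

lemma coefD_isBigO (T : ℝ) (n) : ∃ C, 0 ≤ C ∧ ∀ x t : ℝ, |t| ≤ T →
    ‖coefD k B x t n‖ ≤ C * (1 + |x|) := by
  refine ⟨‖B (eta k n)‖ + 16 * ‖eta k n ^ 3‖ * |T| + 4 * ‖eta k n‖, by positivity,
    fun x t ht => ?_⟩
  have h0 := abs_nonneg x
  have ht' : |t| ≤ |T| := ht.trans (le_abs_self T)
  rw [coefD_eq]
  calc _ ≤ ‖B (eta k n)‖ + 2 * (2 * ‖eta k n‖ * |x| + 8 * ‖eta k n ^ 3‖ * |t|) := by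
        refine (norm_sub_le _ _).trans (add_le_add le_rfl ?_)
        rw [norm_mul, norm_mul, Complex.norm_I, mul_one, Complex.norm_ofNat]
        refine mul_le_mul_of_nonneg_left ((norm_sub_le _ _).trans (le_of_eq ?_)) (by norm_num)
        simp
    _ ≤ ‖B (eta k n)‖ + 2 * (2 * ‖eta k n‖ * |x| + 8 * ‖eta k n ^ 3‖ * |T|) := by gcongr
    _ ≤ _ := by
        have h1 := norm_nonneg (B (eta k n))
        have h2 := norm_nonneg (eta k n)
        have h3 := norm_nonneg (eta k n ^ 3)
        have h4 := abs_nonneg T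
        have h5 : 0 ≤ ‖eta k n ^ 3‖ * |T| := by positivity
        nlinarith [mul_nonneg h1 h0, mul_nonneg h5 h0, mul_nonneg h2 h0]

variable (hre : ∀ n, 0 < (k n).re) (him : ∀ n, 0 < (k n).im)
include hre him

lemma eta_sq_im_pos (n) : 0 < (eta k n ^ 2).im := by
  have := eta_mem hre him n
  rw [sq, Complex.mul_im]; linarith

lemma exp_time_le {T t a : ℝ} (ht : |t| ≤ T) : Real.exp (a * t) ≤ Real.exp (|a| * |T|) := by
  refine Real.exp_le_exp.2 ((le_abs_self _).trans ?_)
  rw [abs_mul]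
  exact mul_le_mul_of_nonneg_left (ht.trans (le_abs_self T)) (abs_nonneg a)

/-- Since Im ηₙ² > 0, e^{-2iθ(ηₙ)} decays exponentially as x → -∞. The factor 1 + |x| is kept in
order to absorb the linear growth of `coefD`. -/
lemma exists_norm_resC_le (T : ℝ) (n) : ∃ C, 0 ≤ C ∧ ∀ x t : ℝ, x ≤ 0 → |t| ≤ T →
    (1 + |x|) * ‖resC k A x t n‖ ≤ C * (1 + x ^ 2)⁻¹ := by
  obtain ⟨C, hC⟩ := exists_exp_mul_le (mul_pos two_pos (eta_sq_im_pos hre him n))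
  have hC0 : 0 ≤ C := by
    have := hC 0 le_rfl
    norm_num at this; linarith
  refine ⟨‖A (eta k n)‖ * (C * Real.exp (|-4 * (eta k n ^ 4).im| * |T|)), by positivity,
    fun x t hx ht => ?_⟩
  rw [norm_resC]
  have h1 := hC (-x) (by linarith)
  rw [mul_neg, neg_neg, neg_sq] at h1
  rw [abs_of_nonpos hx]
  have h2 := exp_time_le hre him (a := -4 * (eta k n ^ 4).im) ht
  have h3 : 0 ≤ C * (1 + x ^ 2)⁻¹ := by positivity
  calc _ = ‖A (eta k n)‖ * (((1 + -x) * Real.exp (2 * (eta k n ^ 2).im * x)) *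
        Real.exp (-4 * (eta k n ^ 4).im * t)) := by ring
    _ ≤ ‖A (eta k n)‖ * ((C * (1 + x ^ 2)⁻¹) * Real.exp (|-4 * (eta k n ^ 4).im| * |T|)) := by
        gcongr
    _ = _ := by ring

lemma exists_norm_resC_inv_le (T : ℝ) (n) : ∃ C, 0 ≤ C ∧ ∀ x t : ℝ, 0 ≤ x → |t| ≤ T →
    (1 + |x|) * ‖(resC k A x t n)⁻¹‖ ≤ C * (1 + x ^ 2)⁻¹ := by
  obtain ⟨C, hC⟩ := exists_exp_mul_le (mul_pos two_pos (eta_sq_im_pos hre him n))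
  have hC0 : 0 ≤ C := by
    have := hC 0 le_rfl
    norm_num at this; linarith
  refine ⟨‖A (eta k n)‖⁻¹ * (C * Real.exp (|4 * (eta k n ^ 4).im| * |T|)), by positivity,
    fun x t hx ht => ?_⟩
  rw [norm_inv, norm_resC, mul_inv, mul_inv, ← Real.exp_neg, ← Real.exp_neg]
  have h1 := hC x hx
  rw [abs_of_nonneg hx]
  have h2 := exp_time_le hre him (a := 4 * (eta k n ^ 4).im) ht
  have h3 : 0 ≤ C * (1 + x ^ 2)⁻¹ := by positivity
  have h4 : -(-4 * (eta k n ^ 4).im * t) = 4 * (eta k n ^ 4).im * t := by ring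
  rw [h4]
  calc _ = ‖A (eta k n)‖⁻¹ * (((1 + x) * Real.exp (-(2 * (eta k n ^ 2).im * x))) *
        Real.exp (4 * (eta k n ^ 4).im * t)) := by ring
    _ ≤ ‖A (eta k n)‖⁻¹ * ((C * (1 + x ^ 2)⁻¹) * Real.exp (|4 * (eta k n ^ 4).im| * |T|)) := by
        gcongr
    _ = _ := by ring

lemma isBigO_wt_of_weighted {u : ℝ × ℝ → ℂ} {S : Set (ℝ × ℝ)} {C : ℝ} (T : ℝ) (n)
    (hS : S ⊆ slab T) (h : ∀ p ∈ S, (1 + |p.1|) * ‖u p‖ ≤ C * (1 + p.1 ^ 2)⁻¹) :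
    u =O[𝓟 S] wt ∧ (fun p => u p * coefD k B p.1 p.2 n) =O[𝓟 S] wt := by
  obtain ⟨D, hD, hD'⟩ := coefD_isBigO (k := k) (B := B) T n
  refine ⟨isBigO_principal_iff_exists.2 ⟨C, fun p hp => ?_⟩,
    isBigO_principal_iff_exists.2 ⟨D * C, fun p hp => ?_⟩⟩
  · rw [norm_wt]
    refine le_trans ?_ (h p hp)
    nlinarith [abs_nonneg p.1, norm_nonneg (u p), mul_nonneg (abs_nonneg p.1) (norm_nonneg (u p))]
  · rw [norm_wt, norm_mul, mul_assoc]
    calc _ ≤ ‖u p‖ * (D * (1 + |p.1|)) := by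
          gcongr; exact hD' _ _ (hS hp)
      _ = D * ((1 + |p.1|) * ‖u p‖) := by ring
      _ ≤ _ := mul_le_mul_of_nonneg_left (h p hp) hD

lemma resC_isBigO (T : ℝ) (n) : (fun p : ℝ × ℝ => resC k A p.1 p.2 n) =O[𝓟 (slabL T)] wt ∧
    (fun p : ℝ × ℝ => resE k A B p.1 p.2 n) =O[𝓟 (slabL T)] wt := by
  obtain ⟨C, -, h⟩ := exists_norm_resC_le (A := A) hre him T n
  exact isBigO_wt_of_weighted hre him T n (fun p hp => hp.2) (fun p hp => h p.1 p.2 hp.1 hp.2)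

lemma resC_inv_isBigO (T : ℝ) (n) :
    (fun p : ℝ × ℝ => (resC k A p.1 p.2 n)⁻¹) =O[𝓟 (slabR T)] wt ∧
    (fun p : ℝ × ℝ => (resC k A p.1 p.2 n)⁻¹ * coefD k B p.1 p.2 n) =O[𝓟 (slabR T)] wt := by
  obtain ⟨C, -, h⟩ := exists_norm_resC_inv_le (A := A) hre him T n
  exact isBigO_wt_of_weighted hre him T n (fun p hp => hp.2) (fun p hp => h p.1 p.2 hp.1 hp.2)

end Decay

/-! ## The explicit solution solves the equation -/

section Decay

set_option linter.unusedSectionVars false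

lemma conj_isBigO_iff {α : Type*} {l : Filter α} {w : α → ℝ} {u : α → ℂ} :
    (fun a => conj (u a)) =O[l] w ↔ u =O[l] w := by
  rw [← Asymptotics.isBigO_norm_left]
  simp only [RCLike.norm_conj]
  rw [Asymptotics.isBigO_norm_left]

lemma mul_isBigO {α : Type*} {l : Filter α} {w : α → ℝ} {u v : α → ℂ} (hu : u =O[l] w)
    (hv : v =O[l] (fun _ => (1 : ℝ))) : (fun a => u a * v a) =O[l] w := by
  simpa using hu.mul hv

lemma deriv_pf_isBigO_of_coeff {ι : Type*} [Fintype ι] {p : ι → ℂ} {α : Type*} {l : Filter α}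
    {w : α → ℝ} {c₀ : α → ℂ} {c e : ι → α → ℂ} (hc : ∀ n, c n =O[l] w)
    (he : ∀ n, e n =O[l] w) {z : ℂ} (hz : ∀ n, z ≠ p n) :
    (fun a => deriv (pf p (c₀ a) (fun n => c n a) (fun n => e n a)) z) =O[l] w := by
  simp only [(pf_hasDerivAt hz).deriv, div_eq_mul_inv]
  exact Asymptotics.IsBigO.fun_sum fun n _ =>
    ((hc n).const_mul_left (-2 * ((z - p n) ^ 3)⁻¹) |>.congr_left fun a => by ring).sub
      ((he n).const_mul_left ((z - p n) ^ 2)⁻¹ |>.congr_left fun a => mul_comm _ _)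

lemma removable_sq_mul_pf {ι : Type*} [Fintype ι] {p : ι → ℂ} (hp : Function.Injective p)
    (c₀ : ℂ) (c e : ι → ℂ) (n : ι) :
    Removable (fun z => (z - p n) ^ 2 * pf p c₀ c e z) (p n) := by
  have h1 := (show AnalyticAt ℂ (fun z => (z - p n) ^ 2) (p n) by fun_prop).removable.mul
    (pf_removable_sub_pp (c₀ := c₀) (c := c) (e := e) hp n)
  have h2 : AnalyticAt ℂ (fun z => c n + e n * (z - p n)) (p n) := by fun_prop
  refine (h1.add h2.removable).congr ?_
  filter_upwards [self_mem_nhdsWithin] with z hz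
  have : z - p n ≠ 0 := sub_ne_zero.2 hz
  rw [pp]
  field_simp
  ring

section Transmission

variable {N : ℕ} (k : Fin N → ℂ) (A B : ℂ → ℂ) (x t : ℝ)

/-- The function `solF * bl` without its removable singularities. -/
def solFS : ℂ → ℂ := pf (fun n => conj (eta k n)) (solFInf k A B x t * blInf k)
  (fun n => blV k n (conj (eta k n)) * solF k A B x t (conj (eta k n)))
  (fun n => deriv (blV k n) (conj (eta k n)) * solF k A B x t (conj (eta k n)) +
    blV k n (conj (eta k n)) * deriv (solF k A B x t) (conj (eta k n)))

/-- The function `dag solG * bl` without its removable singularities. -/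
def solGS : ℂ → ℂ := pf (fun n => conj (eta k n)) 0
  (fun n => blV k n (conj (eta k n)) * dag (solG k A B x t) (conj (eta k n)))
  (fun n => deriv (blV k n) (conj (eta k n)) * dag (solG k A B x t) (conj (eta k n)) +
    blV k n (conj (eta k n)) * deriv (dag (solG k A B x t)) (conj (eta k n)))

end Transmission

variable {N : ℕ} {k : Fin N → ℂ} {A B : ℂ → ℂ} {x t : ℝ}
variable (hre : ∀ n, 0 < (k n).re) (him : ∀ n, 0 < (k n).im) (hk : Function.Injective k)
  (hA : IsNormingData k A B)
include hre him hk hA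

lemma solFS_eq {z : ℂ} (hz : ∀ n, z ≠ eta k n) (hz' : ∀ n, z ≠ conj (eta k n)) :
    solFS k A B x t z = solF k A B x t z * bl k z :=
  (mul_bl_eq_pf hre him hk (fun _ h => pf_analyticAt h)
    (removable_sq_mul_pf (eta_injective hre him hk) _ _ _) pf_tendsto hz hz').symm

lemma solGS_eq {z : ℂ} (hz : ∀ n, z ≠ eta k n) (hz' : ∀ n, z ≠ conj (eta k n)) :
    solGS k A B x t z = dag (solG k A B x t) z * bl k z := by
  have h1 := removable_sq_mul_pf (eta_injective hre him hk) 0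
    (fun n => conj (gC k A B n x t)) (fun n => conj (gE k A B n x t))
  have h2 : dag (solG k A B x t) = pf (eta k) 0 (fun n => conj (gC k A B n x t))
      (fun n => conj (gE k A B n x t)) := by
    rw [solG_eq_pf hre him hk hA, dag_pf]
    simp
  have h3 : Tendsto (dag (solG k A B x t)) (cocompact ℂ) (𝓝 0) := by rw [h2]; exact pf_tendsto
  rw [← h2] at h1
  rw [mul_bl_eq_pf hre him hk (fun _ h => dag_solG_analyticAt hre him hk hA h) h1 h3 hz hz',
    zero_mul]
  rfl

lemma norm_sol_ofReal (s : ℝ) : ‖solF k A B x t s‖ ^ 2 + ‖solG k A B x t s‖ ^ 2 = 1 := by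
  have h := sol_det_eq_one (x := x) (t := t) hre him hk hA s
    (fun n hn => eta_im_ne hre him n (by rw [← hn]; simp))
    (fun n hn => eta_im_ne hre him n (by simpa using (congrArg Complex.im hn).symm))
  simp only [dag, Complex.conj_ofReal, Complex.mul_conj'] at h
  exact_mod_cast h

lemma norm_solF_ofReal_le (s : ℝ) : ‖solF k A B x t s‖ ≤ 1 := by
  nlinarith [norm_sol_ofReal (x := x) (t := t) hre him hk hA s, norm_nonneg (solF k A B x t s),
    sq_nonneg ‖solG k A B x t s‖]

lemma norm_solG_ofReal_le (s : ℝ) : ‖solG k A B x t s‖ ≤ 1 := by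
  nlinarith [norm_sol_ofReal (x := x) (t := t) hre him hk hA s, norm_nonneg (solG k A B x t s),
    sq_nonneg ‖solF k A B x t s‖]

lemma conj_eta_injective : Function.Injective fun n => conj (eta k n) :=
  star_injective.comp (eta_injective hre him hk)

lemma conj_eta_im_ne (n) : (conj (eta k n)).im ≠ 0 := by
  simpa using eta_im_ne hre him n

variable {S : Set (ℝ × ℝ)} {T : ℝ}

/-- On the real axis |f|² + |g|² = 1, which bounds f there for all x and t at once;
`pf_coeff_isBigO` transfers the bound to the coefficients. -/
lemma f_coeff_isBigO_one :
    (fun p : ℝ × ℝ => solFInf k A B p.1 p.2) =O[𝓟 S] (fun _ => (1 : ℝ)) ∧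
    ∀ n, (fun p : ℝ × ℝ => fC k A B n p.1 p.2) =O[𝓟 S] (fun _ => (1 : ℝ)) ∧
      (fun p : ℝ × ℝ => fE k A B n p.1 p.2) =O[𝓟 S] (fun _ => (1 : ℝ)) :=
  pf_coeff_isBigO (C := 1) (eta_injective hre him hk) (eta_im_ne hre him) (fun _ => zero_le_one)
    fun p _ s _ => by
      rw [mul_one]
      exact norm_solF_ofReal_le hre him hk hA s

lemma g_coeff_isBigO {C : ℝ} {w : ℝ × ℝ → ℝ} (hw : ∀ p, 0 ≤ w p)
    (h : ∀ p ∈ S, ∀ s : ℝ, |s| ≤ 1 → ‖solG k A B p.1 p.2 s‖ ≤ C * w p) (n) :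
    (fun p : ℝ × ℝ => gC k A B n p.1 p.2) =O[𝓟 S] w ∧
      (fun p : ℝ × ℝ => gE k A B n p.1 p.2) =O[𝓟 S] w :=
  (pf_coeff_isBigO (c₀ := fun _ => 0) (c := fun n p => gC k A B n p.1 p.2)
    (e := fun n p => gE k A B n p.1 p.2) (C := C) (conj_eta_injective hre him hk hA)
    (conj_eta_im_ne hre him hk hA) hw fun p hp s hs => by
      have := h p hp s hs
      rwa [solG_eq_pf hre him hk hA] at this).2 n

lemma g_coeff_isBigO_one (n) :
    (fun p : ℝ × ℝ => gC k A B n p.1 p.2) =O[𝓟 S] (fun _ => (1 : ℝ)) ∧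
      (fun p : ℝ × ℝ => gE k A B n p.1 p.2) =O[𝓟 S] (fun _ => (1 : ℝ)) :=
  g_coeff_isBigO hre him hk hA (C := 1) (fun _ => zero_le_one) (fun p _ s _ => by
    rw [mul_one]; exact norm_solG_ofReal_le hre him hk hA s) n

/-- The coefficients of `solG` are the residue data times bounded values of f† and of its
derivative, and the data decay as x → -∞. -/
lemma g_coeff_isBigO_left (n) :
    (fun p : ℝ × ℝ => gC k A B n p.1 p.2) =O[𝓟 (slabL T)] wt ∧
      (fun p : ℝ × ℝ => gE k A B n p.1 p.2) =O[𝓟 (slabL T)] wt := by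
  obtain ⟨h0, h1⟩ := f_coeff_isBigO_one (S := slabL T) hre him hk hA
  obtain ⟨hc, he⟩ := resC_isBigO (A := A) (B := B) hre him T n
  have h2 : (fun p : ℝ × ℝ => dag (solF k A B p.1 p.2) (eta k n)) =O[𝓟 (slabL T)]
      (fun _ => (1 : ℝ)) :=
    conj_isBigO_iff.2 (pf_isBigO_of_coeff h0 (fun n => (h1 n).1) (fun n => (h1 n).2) _)
  have h3 : (fun p : ℝ × ℝ => deriv (dag (solF k A B p.1 p.2)) (eta k n)) =O[𝓟 (slabL T)]
      (fun _ => (1 : ℝ)) := by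
    simp only [deriv_dag]
    exact conj_isBigO_iff.2 (deriv_pf_isBigO_of_coeff (fun n => (h1 n).1) (fun n => (h1 n).2)
      fun m h => eta_ne_conj hre him m n h.symm)
  constructor
  · refine conj_isBigO_iff.1 ?_
    simp only [conj_gC hre him hk hA]
    exact mul_isBigO hc.neg_left h2
  · refine conj_isBigO_iff.1 ?_
    simp only [conj_gE hre him hk hA]
    exact (mul_isBigO hc.neg_left h3).add (mul_isBigO he.neg_left h2)

/-- As x → +∞ the data blow up while the coefficients stay bounded, so the values that multiply the
data must decay. The residue conditions are solved for these values. -/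
lemma sol_eta_isBigO_right (n) :
    (fun p : ℝ × ℝ => solG k A B p.1 p.2 (eta k n)) =O[𝓟 (slabR T)] wt ∧
    (fun p : ℝ × ℝ => deriv (solG k A B p.1 p.2) (eta k n)) =O[𝓟 (slabR T)] wt ∧
    (fun p : ℝ × ℝ => dag (solF k A B p.1 p.2) (eta k n)) =O[𝓟 (slabR T)] wt ∧
    (fun p : ℝ × ℝ => deriv (dag (solF k A B p.1 p.2)) (eta k n)) =O[𝓟 (slabR T)] wt := by
  obtain ⟨hc, he⟩ := resC_inv_isBigO (A := A) (B := B) hre him T n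
  have hf := (f_coeff_isBigO_one (S := slabR T) hre him hk hA).2 n
  have hg := g_coeff_isBigO_one (S := slabR T) hre him hk hA n
  have hr : ∀ x t, resC k A x t n ≠ 0 := fun x t => resC_ne_zero x t hA n
  have hg1 := conj_isBigO_iff.2 hg.1
  have hg2 := conj_isBigO_iff.2 hg.2
  refine ⟨(mul_isBigO hc hf.1).congr_left fun p => ?_,
    ((mul_isBigO hc hf.2).sub (mul_isBigO he hf.1)).congr_left fun p => ?_,
    (mul_isBigO hc.neg_left hg1).congr_left fun p => ?_,
    ((mul_isBigO hc.neg_left hg2).add (mul_isBigO he hg1)).congr_left fun p => ?_⟩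
  · have := hr p.1 p.2
    rw [fC]; field_simp
  · have := hr p.1 p.2
    rw [fC, fE, resE]; field_simp; ring
  · have := hr p.1 p.2
    rw [conj_gC hre him hk hA]; field_simp
  · have := hr p.1 p.2
    rw [conj_gC hre him hk hA, conj_gE hre him hk hA, resE]; field_simp; ring

lemma solGS_coeff_isBigO (n) :
    (fun p : ℝ × ℝ => blV k n (conj (eta k n)) * dag (solG k A B p.1 p.2) (conj (eta k n)))
      =O[𝓟 (slabR T)] wt ∧
    (fun p : ℝ × ℝ => deriv (blV k n) (conj (eta k n)) *
      dag (solG k A B p.1 p.2) (conj (eta k n)) +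
      blV k n (conj (eta k n)) * deriv (dag (solG k A B p.1 p.2)) (conj (eta k n)))
      =O[𝓟 (slabR T)] wt := by
  obtain ⟨h1, h2, -, -⟩ := sol_eta_isBigO_right (T := T) hre him hk hA n
  have h1' := conj_isBigO_iff.2 h1
  have h2' := conj_isBigO_iff.2 h2
  simp only [deriv_dag, dag, Complex.conj_conj]
  exact ⟨h1'.const_mul_left _, (h1'.const_mul_left _).add (h2'.const_mul_left _)⟩

lemma solFS_coeff_isBigO (n) :
    (fun p : ℝ × ℝ => blV k n (conj (eta k n)) * solF k A B p.1 p.2 (conj (eta k n)))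
      =O[𝓟 (slabR T)] wt ∧
    (fun p : ℝ × ℝ => deriv (blV k n) (conj (eta k n)) * solF k A B p.1 p.2 (conj (eta k n)) +
      blV k n (conj (eta k n)) * deriv (solF k A B p.1 p.2) (conj (eta k n)))
      =O[𝓟 (slabR T)] wt := by
  obtain ⟨-, -, h1, h2⟩ := sol_eta_isBigO_right (T := T) hre him hk hA n
  simp only [deriv_dag, dag] at h1 h2
  have h1' := conj_isBigO_iff.1 h1
  have h2' := conj_isBigO_iff.1 h2
  exact ⟨h1'.const_mul_left _, (h1'.const_mul_left _).add (h2'.const_mul_left _)⟩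

/-- The coefficients of `solGS` are made of the conjugated 1-jets of `solG` at ηₙ, which decay. As
|`bl`| = 1 on the real axis, `solG` is as small as `solGS` there, and its coefficients follow. -/
lemma g_coeff_isBigO_right (n) :
    (fun p : ℝ × ℝ => gC k A B n p.1 p.2) =O[𝓟 (slabR T)] wt ∧
      (fun p : ℝ × ℝ => gE k A B n p.1 p.2) =O[𝓟 (slabR T)] wt := by
  have h := solGS_coeff_isBigO (A := A) (B := B) (T := T) hre him hk hA
  obtain ⟨C, hC⟩ := pf_isBigO_of_coeff_real (conj_eta_im_ne hre him hk hA)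
    (fun p => (wt_pos p).le) (Asymptotics.isBigO_zero wt (𝓟 (slabR T)))
    (fun n => (h n).1) (fun n => (h n).2)
  refine g_coeff_isBigO hre him hk hA (C := C) (fun p => (wt_pos p).le) (fun p hp s hs => ?_) n
  have h1 := hC p hp s hs
  have h2 := solGS_eq (x := p.1) (t := p.2) hre him hk hA (z := s)
    (fun n hn => eta_im_ne hre him n (by rw [← hn]; simp))
    (fun n hn => eta_im_ne hre him n (by simpa using (congrArg Complex.im hn).symm))
  have h3 : ‖solGS k A B p.1 p.2 s‖ = ‖solG k A B p.1 p.2 s‖ := by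
    rw [h2, norm_mul, norm_bl_ofReal hre him, dag, RCLike.norm_conj, Complex.conj_ofReal, mul_one]
  rw [← h3]
  exact h1

lemma g_coeff_isBigO_slab (n) :
    (fun p : ℝ × ℝ => gC k A B n p.1 p.2) =O[𝓟 (slab T)] wt ∧
      (fun p : ℝ × ℝ => gE k A B n p.1 p.2) =O[𝓟 (slab T)] wt := by
  rw [principal_slab]
  have h1 := g_coeff_isBigO_left (A := A) (B := B) (T := T) hre him hk hA n
  have h2 := g_coeff_isBigO_right (A := A) (B := B) (T := T) hre him hk hA n
  exact ⟨h1.1.sup h2.1, h1.2.sup h2.2⟩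

lemma solGOne_isBigO : (fun p : ℝ × ℝ => solGOne k A B p.1 p.2) =O[𝓟 (slab T)] wt :=
  Asymptotics.IsBigO.fun_sum fun n _ => (g_coeff_isBigO_slab hre him hk hA n).2

lemma solQ_isBigO : (fun p : ℝ × ℝ => solQ k A B p.1 p.2) =O[𝓟 (slab T)] wt :=
  mul_isBigO ((solGOne_isBigO hre him hk hA).const_mul_left _) (f_coeff_isBigO_one hre him hk hA).1

/-- On [-1, 1] the equation of `lax_x` bounds the x-derivative of `solG` by `solG` and q; the
coefficient bound then applies to the differentiated partial fraction. -/
lemma dirD_solGOne_isBigO :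
    (fun p : ℝ × ℝ => dirD (1, 0) (solGOne k A B) p.1 p.2) =O[𝓟 (slab T)] wt := by
  have hg := g_coeff_isBigO_slab (A := A) (B := B) (T := T) hre him hk hA
  obtain ⟨C, hC⟩ := pf_isBigO_of_coeff_real (conj_eta_im_ne hre him hk hA)
    (fun p => (wt_pos p).le) (Asymptotics.isBigO_zero wt (𝓟 (slab T)))
    (fun n => (hg n).1) (fun n => (hg n).2)
  obtain ⟨D, hD⟩ := isBigO_principal_iff_exists.1 (solQ_isBigO (A := A) (B := B) (T := T) hre him hk hA)
  have h1 := pf_coeff_isBigO (c₀ := fun _ : ℝ × ℝ => 0) (S := slab T) (w := wt)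
    (c := fun n p => dirD (1, 0) (gC k A B n) p.1 p.2)
    (e := fun n p => dirD (1, 0) (gE k A B n) p.1 p.2) (C := 2 * C + D)
    (conj_eta_injective hre him hk hA)
    (conj_eta_im_ne hre him hk hA) (fun p => (wt_pos p).le) fun p hp s hs => by
      have h2 := (lax_x (x := p.1) (t := p.2) hre him hk hA).2 s
        (fun n hn => eta_im_ne hre him n (by simpa using (congrArg Complex.im hn).symm))
      have h3 := hC p hp s hs
      have h4 : ‖solG k A B p.1 p.2 s‖ ≤ C * wt p := by
        rw [solG_eq_pf hre him hk hA]; exact h3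
      have h5 : ‖dag (solF k A B p.1 p.2) s‖ ≤ 1 := by
        rw [dag, RCLike.norm_conj, Complex.conj_ofReal]
        exact norm_solF_ofReal_le hre him hk hA s
      have h6 := hD p hp
      rw [norm_wt] at h6
      change ‖dotG k A B (1, 0) p.1 p.2 s‖ ≤ _
      rw [h2]
      refine (norm_add_le _ _).trans ?_
      rw [add_mul]
      have hs' : ‖(s : ℂ)‖ ≤ 1 := by simpa using hs
      refine add_le_add ?_ ?_
      · rw [norm_mul, norm_mul, norm_mul, norm_pow, Complex.norm_I, Complex.norm_ofNat, mul_one,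
          mul_assoc, mul_assoc]
        refine mul_le_mul_of_nonneg_left ?_ (by norm_num)
        calc _ ≤ 1 * ‖solG k A B p.1 p.2 s‖ := by
              gcongr; exact pow_le_one₀ (norm_nonneg _) hs'
          _ ≤ _ := by rwa [one_mul]
      · rw [norm_mul, norm_mul]
        calc _ ≤ 1 * (D * wt p) * 1 := by
              gcongr
              exact mul_nonneg zero_le_one ((norm_nonneg _).trans h6)
          _ = _ := by ring
  refine (Asymptotics.IsBigO.fun_sum (s := Finset.univ) fun n _ => (h1.2 n).2).congr_left fun p => ?_
  exact sum_dirD_gE hre him hk hA (1, 0)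

lemma dirD_solQ_isBigO : (fun p : ℝ × ℝ => dirD (1, 0) (solQ k A B) p.1 p.2) =O[𝓟 (slab T)] wt := by
  have h0 := (f_coeff_isBigO_one (A := A) (B := B) (S := slab T) hre him hk hA).1
  have hq := solQ_isBigO (A := A) (B := B) (T := T) hre him hk hA
  have hq1 := hq.trans (wt_isBigO_one _)
  have h1 := dirD_solGOne_isBigO (A := A) (B := B) (T := T) hre him hk hA
  have h2 := solGOne_isBigO (A := A) (B := B) (T := T) hre him hk hA
  have h3 : (fun p : ℝ × ℝ => dirD (1, 0) (solFInf k A B) p.1 p.2) =O[𝓟 (slab T)]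
      (fun _ => (1 : ℝ)) := by
    simp only [dirD_solFInf_x hre him hk hA]
    exact mul_isBigO ((mul_isBigO hq1 (conj_isBigO_iff.2 hq1)).const_mul_left _) h0
  simp only [dirD_solQ_x hre him hk hA]
  exact ((mul_isBigO h1 h0).add (mul_isBigO h2 h3)).const_mul_left _

lemma tendsto_zero_of_isBigO_wt {u : ℝ × ℝ → ℂ} (h : u =O[𝓟 (slab |t|)] wt) :
    Tendsto (fun x => u (x, t)) atTop (𝓝 0) ∧ Tendsto (fun x => u (x, t)) atBot (𝓝 0) := by
  obtain ⟨C, hC⟩ := isBigO_principal_iff_exists.1 h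
  have h1 : ∀ x : ℝ, ‖u (x, t)‖ ≤ C * (1 + x ^ 2)⁻¹ := fun x => by
    have := hC (x, t) (le_refl |t|)
    rwa [norm_wt] at this
  have h2 : ∀ {l : Filter ℝ}, Tendsto (fun x : ℝ => |x|) l atTop →
      Tendsto (fun x => u (x, t)) l (𝓝 0) := fun {l} hl => by
    refine squeeze_zero_norm h1 ?_
    have h3 : Tendsto (fun x : ℝ => 1 + x ^ 2) l atTop := by
      refine tendsto_atTop_add_const_left _ _ ?_
      refine (((tendsto_pow_atTop two_ne_zero).comp hl)).congr fun x => ?_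
      simp
    simpa using h3.inv_tendsto_atTop.const_mul C
  exact ⟨h2 tendsto_abs_atTop_atTop, h2 tendsto_abs_atBot_atTop⟩

lemma isZBCSolution_solQ : IsZBCSolution (solQ k A B) where
  contDiff := contDiff_solQ hre him hk hA
  equation x t := solQ_equation hre him hk hA
  tendsto_atTop t := (tendsto_zero_of_isBigO_wt hre him hk hA (solQ_isBigO hre him hk hA)).1
  tendsto_atBot t := (tendsto_zero_of_isBigO_wt hre him hk hA (solQ_isBigO hre him hk hA)).2
  decay T := by
    obtain ⟨C, hC⟩ := isBigO_principal_iff_exists.1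
      (solQ_isBigO (A := A) (B := B) (T := T) hre him hk hA)
    obtain ⟨D, hD⟩ := isBigO_principal_iff_exists.1
      (dirD_solQ_isBigO (A := A) (B := B) (T := T) hre him hk hA)
    refine ⟨fun x => max C D * (1 + x ^ 2)⁻¹, integrable_inv_one_add_sq.const_mul _,
      fun x t ht => ⟨?_, ?_⟩⟩
    · have := hC (x, t) ht
      rw [norm_wt] at this
      exact this.trans (mul_le_mul_of_nonneg_right (le_max_left _ _) (wt_pos (x, t)).le)
    · have := hD (x, t) ht
      rw [norm_wt] at this
      rw [(hasDerivAt_fst (contDiff_solQ hre him hk hA) x t).deriv]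
      exact this.trans (mul_le_mul_of_nonneg_right (le_max_right _ _) (wt_pos (x, t)).le)

end Decay

/-! ## Jost columns and their symmetries -/

section LinearODE

/-- Gronwall's inequality, forwards and backwards. -/
lemma norm_le_exp_mul_of_norm_deriv_le {E : Type*} [NormedAddCommGroup E] [NormedSpace ℝ E]
    {φ φ' : ℝ → E} {K a b : ℝ} (hφ : ∀ x ∈ Set.uIcc a b, HasDerivAt φ (φ' x) x)
    (hK : ∀ x ∈ Set.uIcc a b, ‖φ' x‖ ≤ K * ‖φ x‖) : ‖φ b‖ ≤ ‖φ a‖ * Real.exp (K * |b - a|) := by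
  rcases le_total a b with hab | hab
  · rw [Set.uIcc_of_le hab] at hφ hK
    have := norm_le_gronwallBound_of_norm_deriv_right_le (f := φ) (f' := φ') (δ := ‖φ a‖) (K := K)
      (ε := 0) (a := a) (b := b) (fun x hx => (hφ x hx).continuousAt.continuousWithinAt)
      (fun x hx => (hφ x ⟨hx.1, hx.2.le⟩).hasDerivWithinAt) le_rfl
      (fun x hx => by simpa using hK x ⟨hx.1, hx.2.le⟩) b ⟨hab, le_rfl⟩
    rwa [gronwallBound_ε0, ← abs_of_nonneg (sub_nonneg.2 hab)] at this
  · rw [Set.uIcc_of_ge hab] at hφ hK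
    have hn : ∀ x ∈ Set.Icc (-a) (-b), -x ∈ Set.Icc b a := fun x hx =>
      ⟨by linarith [hx.2], by linarith [hx.1]⟩
    have hd : ∀ x ∈ Set.Icc (-a) (-b), HasDerivAt (fun x => φ (-x)) (-φ' (-x)) x := fun x hx => by
      have := HasDerivAt.scomp x (hφ (-x) (hn x hx)) (hasDerivAt_neg x)
      simpa using! this
    have := norm_le_gronwallBound_of_norm_deriv_right_le (f := fun x => φ (-x))
      (f' := fun x => -φ' (-x)) (δ := ‖φ a‖) (K := K)
      (ε := 0) (a := -a) (b := -b) (fun x hx => (hd x hx).continuousAt.continuousWithinAt)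
      (fun x hx => (hd x ⟨hx.1, hx.2.le⟩).hasDerivWithinAt) (by simp)
      (fun x hx => by simpa using hK (-x) (hn x ⟨hx.1, hx.2.le⟩)) (-b) ⟨by linarith, le_rfl⟩
    rw [gronwallBound_ε0, neg_neg] at this
    rwa [abs_of_nonpos (sub_nonpos.2 hab), show -(b - a) = -b - -a by ring]

end LinearODE

section Jost

variable {q : ℝ → ℝ → ℂ} {x t : ℝ} {k : ℂ} {l : Filter ℝ} {j : Fin 2} {φ ψ : ℝ → Fin 2 → ℂ}

lemma laxX_mulVec (v : Fin 2 → ℂ) : (laxX q x t k).mulVec v =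
    ![Complex.I * k ^ 2 * v 0 + k * q x t * v 1,
      -(k * conj (q x t)) * v 0 - Complex.I * k ^ 2 * v 1] := by
  ext i
  fin_cases i <;> simp [laxX, Matrix.mulVec, dotProduct, Fin.sum_univ_two]
  ring

lemma norm_laxX_mulVec_le (v : Fin 2 → ℂ) :
    ‖(laxX q x t k).mulVec v‖ ≤ (‖k‖ ^ 2 + ‖k‖ * ‖q x t‖) * ‖v‖ := by
  have h0 := norm_le_pi_norm v 0
  have h1 := norm_le_pi_norm v 1
  rw [laxX_mulVec, pi_norm_le_iff_of_nonneg (by positivity)]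
  intro i
  fin_cases i
  · refine (norm_add_le _ _).trans ?_
    simp only [norm_mul, norm_pow, Complex.norm_I, one_mul, add_mul]
    gcongr
  · refine (norm_sub_le _ _).trans ?_
    simp only [norm_mul, norm_neg, norm_pow, Complex.norm_I, one_mul, add_mul, RCLike.norm_conj]
    rw [add_comm]
    gcongr

/-- A column solving the spectral problem. -/
def IsLaxSol (q : ℝ → ℝ → ℂ) (t : ℝ) (k : ℂ) (φ : ℝ → Fin 2 → ℂ) : Prop :=
  ∀ x : ℝ, HasDerivAt φ ((laxX q x t k).mulVec (φ x)) x

lemma isLaxSol_iff : IsLaxSol q t k φ ↔ ∀ x,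
    HasDerivAt (fun x => φ x 0) (Complex.I * k ^ 2 * φ x 0 + k * q x t * φ x 1) x ∧
    HasDerivAt (fun x => φ x 1) (-(k * conj (q x t)) * φ x 0 - Complex.I * k ^ 2 * φ x 1) x := by
  refine forall_congr' fun x => ?_
  rw [laxX_mulVec, hasDerivAt_pi, Fin.forall_fin_two]
  rfl

lemma IsLaxSol.smul (h : IsLaxSol q t k φ) (c : ℂ) : IsLaxSol q t k (fun x => c • φ x) :=
  fun x => by
    rw [Matrix.mulVec_smul]; exact (h x).fun_const_smul c

lemma IsLaxSol.neg (h : IsLaxSol q t k φ) : IsLaxSol q t k (fun x => -φ x) :=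
  fun x => by
    rw [Matrix.mulVec_neg]; exact (h x).fun_neg

lemma IsLaxSol.sub (h : IsLaxSol q t k φ) (h' : IsLaxSol q t k ψ) :
    IsLaxSol q t k (fun x => φ x - ψ x) :=
  fun x => by
    rw [Matrix.mulVec_sub]; exact (h x).fun_sub (h' x)

lemma IsLaxSol.wr_eq (h : IsLaxSol q t k φ) (h' : IsLaxSol q t k ψ) (x y : ℝ) :
    wr (φ x) (ψ x) = wr (φ y) (ψ y) := by
  rw [isLaxSol_iff] at h h'
  have hd : ∀ x, HasDerivAt (fun x => wr (φ x) (ψ x)) 0 x := fun x =>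
    (((h x).1.fun_mul (h' x).2).fun_sub ((h x).2.fun_mul (h' x).1)).congr_deriv (by ring)
  exact is_const_of_deriv_eq_zero (fun x => (hd x).differentiableAt) (fun x => (hd x).deriv) x y

lemma IsLaxSol.norm_le (hq : Continuous fun x => q x t) (h : IsLaxSol q t k φ) (a b : ℝ) :
    ∃ C, ‖φ b‖ ≤ ‖φ a‖ * C := by
  obtain ⟨M, hM⟩ := isCompact_uIcc.exists_bound_of_continuousOn (hq.continuousOn (s := Set.uIcc a b))
  exact ⟨_, norm_le_exp_mul_of_norm_deriv_le (K := ‖k‖ ^ 2 + ‖k‖ * M) (fun x _ => h x)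
    fun x hx => (norm_laxX_mulVec_le _).trans (by gcongr; exact hM x hx)⟩

lemma IsLaxSol.eq_zero (hq : Continuous fun x => q x t) (h : IsLaxSol q t k φ) {a : ℝ}
    (ha : φ a = 0) (b : ℝ) : φ b = 0 := by
  obtain ⟨C, hC⟩ := h.norm_le hq a b
  simpa [ha] using hC

lemma IsLaxSol.exists_smul_eq (hq : Continuous fun x => q x t) (h : IsLaxSol q t k φ)
    (h' : IsLaxSol q t k ψ) {a : ℝ} (hφ : φ a ≠ 0) (hw : wr (φ a) (ψ a) = 0) :
    ∃ c : ℂ, ∀ x, ψ x = c • φ x := by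
  obtain ⟨c, hc⟩ : ∃ c : ℂ, ψ a = c • φ a := by
    rw [wr] at hw
    by_cases h0 : φ a 0 = 0
    · have h1 : φ a 1 ≠ 0 := fun h1 => hφ (by ext i; fin_cases i <;> simp [h0, h1])
      refine ⟨ψ a 1 / φ a 1, ?_⟩
      rw [h0, zero_mul, zero_sub, neg_eq_zero, mul_eq_zero, or_iff_right h1] at hw
      ext i; fin_cases i <;> simp [h0, h1, hw]
    · refine ⟨ψ a 0 / φ a 0, ?_⟩
      ext i; fin_cases i
      · simp [h0]
      · simp only [Fin.mk_one, Pi.smul_apply, smul_eq_mul]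
        field_simp
        linear_combination hw
  exact ⟨c, fun x => sub_eq_zero.1
    ((h'.sub (h.smul c)).eq_zero hq (a := a) (by simp [hc]) x)⟩

lemma bgExp_ne_zero : bgExp j x t k ≠ 0 := Complex.exp_ne_zero _

/-- The square of the background exponential is bounded along `l`. -/
def BgBdd (l : Filter ℝ) (j : Fin 2) (t : ℝ) (k : ℂ) : Prop :=
  (fun x => bgExp j x t k ^ 2) =O[l] (fun _ => (1 : ℝ))

lemma IsJostColumn.isLaxSol (h : IsJostColumn q l j t k φ) : IsLaxSol q t k φ := h.1

lemma IsJostColumn.ne_zero [l.NeBot] (hq : Continuous fun x => q x t)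
    (h : IsJostColumn q l j t k φ) (x : ℝ) : φ x ≠ 0 := fun h0 => by
  have h1 := h.2
  simp only [h.isLaxSol.eq_zero hq h0, smul_zero] at h1
  have := congrFun (tendsto_nhds_unique h1 tendsto_const_nhds) j
  simp at this

/-- Uniqueness of the Jost columns. -/
lemma IsJostColumn.unique [l.NeBot] (hq : Continuous fun x => q x t) (hb : BgBdd l j t k)
    (h : IsJostColumn q l j t k φ) (h' : IsJostColumn q l j t k ψ) : ψ = φ := by
  -- The normalised columns tend to the same unit vector, so their Wronskian tends to 0. Restoring
  -- the bounded squared exponential keeps this limit, and the Wronskian of the columns themselves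
  -- is constant.
  have h1 : Tendsto (fun x => wr ((bgExp j x t k)⁻¹ • φ x) ((bgExp j x t k)⁻¹ • ψ x)) l (𝓝 0) := by
    have e1 := h.2
    have e2 := h'.2
    rw [tendsto_pi_nhds] at e1 e2
    have := ((e1 0).mul (e2 1)).sub ((e1 1).mul (e2 0))
    have e : (Pi.single j 1 : Fin 2 → ℂ) 0 * (Pi.single j 1 : Fin 2 → ℂ) 1 -
        (Pi.single j 1 : Fin 2 → ℂ) 1 * (Pi.single j 1 : Fin 2 → ℂ) 0 = 0 := by ring
    rw [e] at this
    exact this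
  have h2 : Tendsto (fun x => wr (φ x) (ψ x)) l (𝓝 0) := by
    have h3 := hb.mul_isLittleO ((Asymptotics.isLittleO_one_iff ℝ).2 h1)
    simp only [one_mul] at h3
    refine ((Asymptotics.isLittleO_one_iff ℝ).1 h3).congr fun x => ?_
    have := bgExp_ne_zero (j := j) (x := x) (t := t) (k := k)
    simp only [wr, Pi.smul_apply, smul_eq_mul]
    field_simp
  have h3 : wr (φ 0) (ψ 0) = 0 := by
    refine tendsto_nhds_unique (tendsto_const_nhds.congr fun x => ?_) h2
    exact h.isLaxSol.wr_eq h'.isLaxSol 0 x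
  obtain ⟨c, hc⟩ := h.isLaxSol.exists_smul_eq hq h'.isLaxSol (h.ne_zero hq 0) h3
  have hc1 : c = 1 := by
    have e2 := h'.2
    simp only [hc, smul_comm _ c] at e2
    have := congrFun (tendsto_nhds_unique e2 (h.2.const_smul c)) j
    simpa using this.symm
  ext1 x
  rw [hc, hc1, one_smul]

lemma jost_isJostColumn (h : ∃ φ, IsJostColumn q l j t k φ) :
    IsJostColumn q l j t k (fun x => jost q l j x t k) := Classical.epsilon_spec h

lemma IsJostColumn.jost_eq [l.NeBot] (hq : Continuous fun x => q x t) (hb : BgBdd l j t k)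
    (h : IsJostColumn q l j t k φ) (x : ℝ) : jost q l j x t k = φ x :=
  congrFun (h.unique hq hb (jost_isJostColumn ⟨φ, h⟩)) x

lemma norm_bgExp : ‖bgExp j x t k‖ =
    Real.exp ((if j = 0 then -1 else 1) * (2 * (k.re * k.im) * x - 2 * (k ^ 4).im * t)) := by
  have h : Complex.I * theta x t k = Complex.I * (k ^ 2 * x - 2 * k ^ 4 * t) := by
    rw [theta]; ring
  have h2 : (k ^ 2).im = 2 * (k.re * k.im) := by rw [sq, Complex.mul_im]; ring
  rw [bgExp, Complex.norm_exp, mul_assoc, h]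
  congr 1
  split_ifs
  · simp [h2]
  · simp [h2]

/-- |e^{iθ}|² is a constant times e^{-2 Im(k²) x}, bounded in the direction in which the column is
normalised when k lies in the closure of its domain of analyticity. The next three lemmas are the
other columns. -/
lemma bgBdd_of_nonneg_top (h : 0 ≤ k.re * k.im) : BgBdd atTop 0 t k := by
  refine Asymptotics.IsBigO.of_bound (Real.exp (2 * (2 * (k ^ 4).im * t))) ?_
  filter_upwards [eventually_ge_atTop 0] with x hx
  rw [norm_pow, norm_bgExp, ← Real.exp_nat_mul, norm_one, mul_one]
  refine Real.exp_le_exp.2 ?_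
  have := mul_nonneg h hx
  simp only [if_true]; push_cast; linarith

lemma bgBdd_of_nonneg_bot (h : 0 ≤ k.re * k.im) : BgBdd atBot 1 t k := by
  refine Asymptotics.IsBigO.of_bound (Real.exp (-(2 * (2 * (k ^ 4).im * t)))) ?_
  filter_upwards [eventually_le_atBot 0] with x hx
  rw [norm_pow, norm_bgExp, ← Real.exp_nat_mul, norm_one, mul_one]
  refine Real.exp_le_exp.2 ?_
  have := mul_nonpos_of_nonneg_of_nonpos h hx
  simp only [one_ne_zero, if_false]; push_cast; linarith

lemma bgBdd_of_nonpos_top (h : k.re * k.im ≤ 0) : BgBdd atTop 1 t k := by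
  refine Asymptotics.IsBigO.of_bound (Real.exp (-(2 * (2 * (k ^ 4).im * t)))) ?_
  filter_upwards [eventually_ge_atTop 0] with x hx
  rw [norm_pow, norm_bgExp, ← Real.exp_nat_mul, norm_one, mul_one]
  refine Real.exp_le_exp.2 ?_
  have := mul_nonpos_of_nonpos_of_nonneg h hx
  simp only [one_ne_zero, if_false]; push_cast; linarith

lemma bgBdd_of_nonpos_bot (h : k.re * k.im ≤ 0) : BgBdd atBot 0 t k := by
  refine Asymptotics.IsBigO.of_bound (Real.exp (2 * (2 * (k ^ 4).im * t))) ?_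
  filter_upwards [eventually_le_atBot 0] with x hx
  rw [norm_pow, norm_bgExp, ← Real.exp_nat_mul, norm_one, mul_one]
  refine Real.exp_le_exp.2 ?_
  have := mul_nonneg_of_nonpos_of_nonpos h hx
  simp only [if_true]; push_cast; linarith

/-- The symmetry `v ↦ (v₂*, -v₁*)`. -/
def jc (v : Fin 2 → ℂ) : Fin 2 → ℂ := ![conj (v 1), -conj (v 0)]

lemma wr_jc (u v : Fin 2 → ℂ) : wr (jc u) (jc v) = conj (wr u v) := by
  simp [wr, jc]; ring

lemma wr_swap (u v : Fin 2 → ℂ) : wr u v = -wr v u := by simp [wr]; ring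

lemma wr_smul_left (c : ℂ) (u v : Fin 2 → ℂ) : wr (c • u) v = c * wr u v := by simp [wr]; ring

lemma wr_smul_right (c : ℂ) (u v : Fin 2 → ℂ) : wr u (c • v) = c * wr u v := by simp [wr]; ring

lemma jc_smul (c : ℂ) (v : Fin 2 → ℂ) : jc (c • v) = conj c • jc v := by
  ext i; fin_cases i <;> simp [jc]

lemma jc_sub (u v : Fin 2 → ℂ) : jc (u - v) = jc u - jc v := by
  ext i; fin_cases i <;> simp [jc]; ring

lemma jc_jc (v : Fin 2 → ℂ) : jc (jc v) = -v := by
  ext i; fin_cases i <;> simp [jc]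

lemma continuous_jc : Continuous jc := by
  refine continuous_pi fun i => ?_
  fin_cases i
  · exact Complex.continuous_conj.comp (continuous_apply 1)
  · exact (Complex.continuous_conj.comp (continuous_apply 0)).neg

lemma IsLaxSol.jc (h : IsLaxSol q t (conj k) φ) : IsLaxSol q t k (fun x => jc (φ x)) := by
  rw [isLaxSol_iff] at h ⊢
  intro x
  obtain ⟨h0, h1⟩ := h x
  constructor
  · refine h1.star.congr_deriv ?_
    simp only [DNLS.jc, ← starRingEnd_apply]
    simp; ring
  · refine h0.star.neg.congr_deriv ?_
    simp only [DNLS.jc, ← starRingEnd_apply]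
    simp

lemma conj_bgExp_zero : conj (bgExp 0 x t (conj k)) = bgExp 1 x t k := by
  rw [bgExp, bgExp, ← Complex.exp_conj, theta_conj]; simp

lemma conj_bgExp_one : conj (bgExp 1 x t (conj k)) = bgExp 0 x t k := by
  rw [bgExp, bgExp, ← Complex.exp_conj, theta_conj]; simp

lemma IsJostColumn.jc_one (h : IsJostColumn q l 1 t (conj k) φ) :
    IsJostColumn q l 0 t k (fun x => jc (φ x)) := by
  refine ⟨h.isLaxSol.jc, ?_⟩
  have := (continuous_jc.tendsto _).comp h.2
  have e : jc (Pi.single 1 1) = Pi.single 0 1 := by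
    ext i; fin_cases i <;> simp [DNLS.jc]
  rw [e] at this
  refine this.congr fun x => ?_
  rw [Function.comp, jc_smul, map_inv₀, conj_bgExp_one]

lemma IsJostColumn.jc_zero (h : IsJostColumn q l 0 t (conj k) φ) :
    IsJostColumn q l 1 t k (fun x => -jc (φ x)) := by
  refine ⟨h.isLaxSol.jc.neg, ?_⟩
  have := ((continuous_jc.tendsto _).comp h.2).neg
  have e : -jc (Pi.single 0 1) = Pi.single 1 1 := by
    ext i; fin_cases i <;> simp [DNLS.jc]
  rw [e] at this
  refine this.congr fun x => ?_
  rw [Function.comp, jc_smul, map_inv₀, conj_bgExp_zero, smul_neg]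

/-- The symmetry `v ↦ (v₁, -v₂)`. -/
def s3 (v : Fin 2 → ℂ) : Fin 2 → ℂ := ![v 0, -v 1]

lemma s3_smul (c : ℂ) (v : Fin 2 → ℂ) : s3 (c • v) = c • s3 v := by
  ext i; fin_cases i <;> simp [s3]

lemma s3_sub (u v : Fin 2 → ℂ) : s3 (u - v) = s3 u - s3 v := by
  ext i; fin_cases i <;> simp [s3]; ring

lemma IsLaxSol.s3 (h : IsLaxSol q t k φ) : IsLaxSol q t (-k) (fun x => s3 (φ x)) := by
  rw [isLaxSol_iff] at h ⊢
  intro x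
  obtain ⟨h0, h1⟩ := h x
  constructor
  · exact h0.congr_deriv (by simp [DNLS.s3])
  · exact h1.neg.congr_deriv (by simp [DNLS.s3]; ring)

lemma bgExp_neg : bgExp j x t (-k) = bgExp j x t k := by
  rw [bgExp, bgExp, theta_neg]

lemma continuous_s3 : Continuous s3 := by
  refine continuous_pi fun i => ?_
  fin_cases i
  · exact continuous_apply 0
  · exact (continuous_apply 1).neg

lemma IsJostColumn.s3_zero (h : IsJostColumn q l 0 t k φ) :
    IsJostColumn q l 0 t (-k) (fun x => s3 (φ x)) := by
  refine ⟨h.isLaxSol.s3, ?_⟩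
  have := (continuous_s3.tendsto _).comp h.2
  have e : s3 (Pi.single 0 1) = Pi.single 0 1 := by
    ext i; fin_cases i <;> simp [DNLS.s3]
  rw [e] at this
  refine this.congr fun x => ?_
  rw [Function.comp, s3_smul, bgExp_neg]

lemma IsJostColumn.s3_one (h : IsJostColumn q l 1 t k φ) :
    IsJostColumn q l 1 t (-k) (fun x => -s3 (φ x)) := by
  refine ⟨h.isLaxSol.s3.neg, ?_⟩
  have := ((continuous_s3.tendsto _).comp h.2).neg
  have e : -s3 (Pi.single 1 1) = Pi.single 1 1 := by
    ext i; fin_cases i <;> simp [DNLS.s3]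
  rw [e] at this
  refine this.congr fun x => ?_
  rw [Function.comp, s3_smul, bgExp_neg, smul_neg]

end Jost

/-! ## The Jost columns of the explicit solution -/

/-! ### First-order jets and the constants of proportionality -/

section LocalExpansion

lemma _root_.AnalyticAt.deriv_sub_mul {U : ℂ → ℂ} {p : ℂ} (hU : AnalyticAt ℂ U p) :
    ∀ᶠ z in 𝓝 p, deriv (fun z => (z - p) * U z) z = U z + (z - p) * deriv U z := by
  filter_upwards [hU.eventually_analyticAt] with z hz
  have := (((hasDerivAt_id' z).sub_const p).fun_mul hz.differentiableAt.hasDerivAt)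
  simpa using this.deriv

lemma deriv_sub_sq_mul {U : ℂ → ℂ} {p : ℂ} (hU : AnalyticAt ℂ U p) {f : ℂ → ℂ}
    (hf : f =ᶠ[𝓝 p] fun z => (z - p) ^ 2 * U z) : deriv f p = 0 ∧
    iteratedDeriv 2 f p = 2 * U p ∧ iteratedDeriv 3 f p = 6 * deriv U p := by
  have h1 : deriv f =ᶠ[𝓝 p] fun z => (z - p) * (2 * U z + (z - p) * deriv U z) := by
    refine hf.deriv.trans ?_
    filter_upwards [hU.eventually_analyticAt] with z hz
    have := (((hasDerivAt_id' z).sub_const p).fun_pow 2).fun_mul hz.differentiableAt.hasDerivAt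
    rw [HasDerivAt.deriv this]
    simp; ring
  have hV : AnalyticAt ℂ (fun z => 2 * U z + (z - p) * deriv U z) p :=
    (analyticAt_const.mul hU).add ((by fun_prop : AnalyticAt ℂ (fun z => z - p) p).mul hU.deriv)
  have h2 : iteratedDeriv 2 f =ᶠ[𝓝 p] fun z => (2 * U z + (z - p) * deriv U z) +
      (z - p) * deriv (fun z => 2 * U z + (z - p) * deriv U z) z := by
    rw [iteratedDeriv_succ, iteratedDeriv_one]
    exact h1.deriv.trans hV.deriv_sub_mul
  have hV' : deriv (fun z => 2 * U z + (z - p) * deriv U z) p = 3 * deriv U p := by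
    have := (hU.differentiableAt.hasDerivAt.const_mul 2).fun_add
      (((hasDerivAt_id' p).sub_const p).fun_mul hU.deriv.differentiableAt.hasDerivAt)
    rw [HasDerivAt.deriv this]
    simp; ring
  refine ⟨by simpa using h1.self_of_nhds, by simpa using h2.self_of_nhds, ?_⟩
  rw [iteratedDeriv_succ, h2.deriv_eq]
  have := hV.differentiableAt.hasDerivAt.fun_add
    (((hasDerivAt_id' p).sub_const p).fun_mul hV.deriv.differentiableAt.hasDerivAt)
  rw [HasDerivAt.deriv this, hV']
  simp; ring

/-- A regular function times (z - p)² does not contribute to the 1-jet at p. -/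
lemma jet_eq_of_removable {F G β R : ℂ → ℂ} {p : ℂ} (hF : AnalyticAt ℂ F p)
    (hG : AnalyticAt ℂ G p) (hβ : AnalyticAt ℂ β p) (hR : Removable R p)
    (h : ∀ᶠ z in 𝓝[≠] p, F z = β z * G z + (z - p) ^ 2 * R z) :
    F p = β p * G p ∧ deriv F p = deriv β p * G p + β p * deriv G p := by
  obtain ⟨R', hR', hRR⟩ := hR
  have hq : AnalyticAt ℂ (fun z => (z - p) ^ 2) p := by fun_prop
  have h1 : F =ᶠ[𝓝 p] fun z => β z * G z + (z - p) ^ 2 * R' z := by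
    refine (hF.continuousAt.eventuallyEq_nhds_iff_eventuallyEq_nhdsNE
      ((hβ.mul hG).add (hq.mul hR')).continuousAt).1 ?_
    filter_upwards [h, hRR] with z h1 h2
    rw [h1, h2]; rfl
  refine ⟨by simpa using h1.self_of_nhds, ?_⟩
  rw [h1.deriv_eq]
  have := (hβ.differentiableAt.hasDerivAt.fun_mul hG.differentiableAt.hasDerivAt).fun_add
    ((((hasDerivAt_id' p).sub_const p).fun_pow 2).fun_mul hR'.differentiableAt.hasDerivAt)
  rw [HasDerivAt.deriv this]
  simp

/-- The choice made in `ratio` is determined as soon as v does not vanish at one point. -/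
lemma ratio_eq {u v : ℝ → ℝ → Fin 2 → ℂ} {c : ℂ} (h : ∀ x t, u x t = c • v x t)
    (hv : v 0 0 ≠ 0) : ratio u v = c := by
  have h2 : ∀ x t, u x t = ratio u v • v x t :=
    Classical.epsilon_spec (p := fun c : ℂ => ∀ x t : ℝ, u x t = c • v x t) ⟨c, h⟩
  exact smul_left_injective ℂ hv ((h2 0 0).symm.trans (h 0 0))

end LocalExpansion

/-! ### Explicit Jost columns -/

section Explicit

set_option linter.unusedSectionVars false

variable {N : ℕ} (k : Fin N → ℂ) (A B : ℂ → ℂ) (x t : ℝ) (z : ℂ)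

/-- The second Jost column at `-∞`, explicitly. -/
def solM2 : Fin 2 → ℂ := bgExp 1 x t z • ![solG k A B x t z, dag (solF k A B x t) z]

/-- The first Jost column at `+∞`, explicitly. -/
def solP1 : Fin 2 → ℂ := bgExp 0 x t z • ![solFS k A B x t z, -solGS k A B x t z]

variable {k A B x t z}

lemma hasDerivAt_bgExp_zero :
    HasDerivAt (fun x => bgExp 0 x t z) (Complex.I * z ^ 2 * bgExp 0 x t z) x := by
  simp only [bgExp, if_true, one_mul]
  exact hasDerivAt_exp_theta_x _ _ _ _

lemma hasDerivAt_bgExp_one :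
    HasDerivAt (fun x => bgExp 1 x t z) (-Complex.I * z ^ 2 * bgExp 1 x t z) x := by
  simp only [bgExp, one_ne_zero, if_false, neg_mul, one_mul]
  simpa only [neg_mul] using! hasDerivAt_exp_theta_x (-Complex.I) z x t

lemma bgExp_mul : bgExp 0 x t z * bgExp 1 x t z = 1 := by
  rw [bgExp, bgExp, ← Complex.exp_add]
  simp

variable (hre : ∀ n, 0 < (k n).re) (him : ∀ n, 0 < (k n).im) (hk : Function.Injective k)
  (hA : IsNormingData k A B)
include hre him hk hA

lemma hasDerivAt_dag_solF_x (hz : ∀ n, z ≠ conj (eta k n)) :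
    HasDerivAt (fun x => dag (solF k A B x t) z)
      (-(z * conj (solQ k A B x t) * solG k A B x t z)) x := by
  have := (hasDerivAt_solF_x (x := x) (t := t) hre him hk hA (conj z)).star
  rw [(lax_x hre him hk hA).1 _ fun n hn => hz n (by simpa using congrArg conj hn)] at this
  refine this.congr_deriv ?_
  simp [dag, ← starRingEnd_apply]

lemma hasDerivAt_dag_solG_x (hz : ∀ n, z ≠ eta k n) :
    HasDerivAt (fun x => dag (solG k A B x t) z)
      (-2 * Complex.I * z ^ 2 * dag (solG k A B x t) z +
        z * conj (solQ k A B x t) * solF k A B x t z) x := by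
  have := (hasDerivAt_solG_x (x := x) (t := t) hre him hk hA (conj z)).star
  rw [(lax_x hre him hk hA).2 _ fun n hn => hz n ((starRingEnd ℂ).injective hn)] at this
  refine this.congr_deriv ?_
  simp [dag, ← starRingEnd_apply, map_ofNat]

lemma isLaxSol_solM2 (hz : ∀ n, z ≠ conj (eta k n)) :
    IsLaxSol (solQ k A B) t z (fun x => solM2 k A B x t z) := by
  rw [isLaxSol_iff]
  intro x
  have hb := hasDerivAt_bgExp_one (x := x) (t := t) (z := z)
  have hg := hasDerivAt_solG_x (x := x) (t := t) hre him hk hA z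
  rw [(lax_x hre him hk hA).2 z hz] at hg
  have hf := hasDerivAt_dag_solF_x (x := x) (t := t) hre him hk hA hz
  constructor
  · exact (hb.fun_mul hg).congr_deriv (by simp [solM2]; ring)
  · exact (hb.fun_mul hf).congr_deriv (by simp [solM2]; ring)

/-- The derivatives of `solFS` and `solGS` with respect to `x`, as functions of `z`. -/
lemma exists_hasDerivAt_solFS : ∃ F' G' : ℂ → ℂ,
    (∀ z, (∀ n, z ≠ conj (eta k n)) → AnalyticAt ℂ F' z) ∧
    (∀ z, (∀ n, z ≠ conj (eta k n)) → AnalyticAt ℂ G' z) ∧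
    (∀ z, HasDerivAt (fun x => solFS k A B x t z) (F' z) x) ∧
    ∀ z, HasDerivAt (fun x => solGS k A B x t z) (G' z) x := by
  have hf := fun n => hasDerivAt_solF_x (x := x) (t := t) hre him hk hA (conj (eta k n))
  have hf' := fun n => hasDerivAt_deriv_pf (c₀ := fun x => solFInf k A B x t)
    (c₀' := dirD (1, 0) (solFInf k A B) x t)
    (fun n => hasDerivAt_fst (contDiff_fC (A := A) (B := B) hre him hk hA n) x t)
    (fun n => hasDerivAt_fst (contDiff_fE (A := A) (B := B) hre him hk hA n) x t)
    (fun m (h : conj (eta k n) = eta k m) => eta_ne_conj hre him m n h.symm)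
  have hg : ∀ n, HasDerivAt (fun x => dag (solG k A B x t) (conj (eta k n))) _ x := fun n =>
    (hasDerivAt_solG_x (x := x) (t := t) hre him hk hA (conj (conj (eta k n)))).star
  have hg' : ∀ n, HasDerivAt (fun x => deriv (dag (solG k A B x t)) (conj (eta k n))) _ x :=
    fun n => by
      simp only [deriv_dag, Complex.conj_conj, solG_eq_pf hre him hk hA]
      exact (hasDerivAt_deriv_pf (c₀ := fun _ => 0) (c₀' := 0)
        (fun n => hasDerivAt_fst (contDiff_gC (A := A) (B := B) hre him hk hA n) x t)
        (fun n => hasDerivAt_fst (contDiff_gE (A := A) (B := B) hre him hk hA n) x t)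
        (eta_ne_conj hre him n)).star
  refine ⟨_, _, ?_, ?_,
    hasDerivAt_pf ((hasDerivAt_fst (contDiff_solFInf hre him hk hA) x t).mul_const (blInf k))
      (fun n => (hf n).const_mul _) (fun n => ((hf n).const_mul _).add ((hf' n).const_mul _)),
    hasDerivAt_pf (hasDerivAt_const x (0 : ℂ))
      (fun n => (hg n).const_mul _) (fun n => ((hg n).const_mul _).add ((hg' n).const_mul _))⟩
  · exact fun z hz => pf_analyticAt hz
  · exact fun z hz => pf_analyticAt hz

lemma eventually_ne_poles (h : ∀ n, z ≠ conj (eta k n)) :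
    ∀ᶠ w in 𝓝[≠] z, (∀ n, w ≠ eta k n) ∧ ∀ n, w ≠ conj (eta k n) := by
  refine Eventually.and ?_ (nhdsWithin_le_nhds
    (eventually_all.2 fun n => isOpen_ne.mem_nhds (h n)))
  refine eventually_all.2 fun n => ?_
  by_cases hn : z = eta k n
  · rw [← hn]; exact self_mem_nhdsWithin
  · exact nhdsWithin_le_nhds (isOpen_ne.mem_nhds hn)

lemma eq_of_eq_off_poles {F G : ℂ → ℂ} (hF : AnalyticAt ℂ F z) (hG : AnalyticAt ℂ G z)
    (hz : ∀ n, z ≠ conj (eta k n))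
    (h : ∀ w, (∀ n, w ≠ eta k n) → (∀ n, w ≠ conj (eta k n)) → F w = G w) : F z = G z := by
  refine ((hF.continuousAt.eventuallyEq_nhds_iff_eventuallyEq_nhdsNE hG.continuousAt).1
    ?_).self_of_nhds
  filter_upwards [eventually_ne_poles hre him hk hA hz] with w hw using h w hw.1 hw.2

lemma solFS_analyticAt (hz : ∀ n, z ≠ conj (eta k n)) : AnalyticAt ℂ (solFS k A B x t) z :=
  pf_analyticAt hz

lemma solGS_analyticAt (hz : ∀ n, z ≠ conj (eta k n)) : AnalyticAt ℂ (solGS k A B x t) z :=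
  pf_analyticAt hz

/-- Away from ηₙ these are the equations of f and g† multiplied by `bl`, which does not depend on x.
They persist at ηₙ by analyticity in z, since the poles there have been removed. -/
lemma hasDerivAt_solFS_x (hz : ∀ n, z ≠ conj (eta k n)) :
    HasDerivAt (fun x => solFS k A B x t z) (-(z * solQ k A B x t * solGS k A B x t z)) x ∧
    HasDerivAt (fun x => solGS k A B x t z) (-2 * Complex.I * z ^ 2 * solGS k A B x t z +
        z * conj (solQ k A B x t) * solFS k A B x t z) x := by
  obtain ⟨F', G', hF', hG', h1, h2⟩ := exists_hasDerivAt_solFS (x := x) (t := t) hre him hk hA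
  have a1 := solFS_analyticAt (x := x) (t := t) hre him hk hA hz
  have a2 := solGS_analyticAt (x := x) (t := t) hre him hk hA hz
  have e1 : F' z = -(z * solQ k A B x t * solGS k A B x t z) := by
    refine eq_of_eq_off_poles (F := F') (G := fun z => -(z * solQ k A B x t * solGS k A B x t z))
      hre him hk hA (hF' z hz) (((analyticAt_id.mul analyticAt_const).mul a2).neg) hz
      fun w hw hw' => ?_
    refine (h1 w).unique ?_
    simp only [solFS_eq hre him hk hA hw hw', solGS_eq hre him hk hA hw hw']
    have := (hasDerivAt_solF_x (x := x) (t := t) hre him hk hA w).mul_const (bl k w)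
    rw [(lax_x hre him hk hA).1 w hw] at this
    exact this.congr_deriv (by ring)
  have e2 : G' z = -2 * Complex.I * z ^ 2 * solGS k A B x t z +
        z * conj (solQ k A B x t) * solFS k A B x t z := by
    have a3 : AnalyticAt ℂ (fun z : ℂ => -2 * Complex.I * z ^ 2) z := by fun_prop
    refine eq_of_eq_off_poles (F := G') (G := fun z => -2 * Complex.I * z ^ 2 * solGS k A B x t z +
        z * conj (solQ k A B x t) * solFS k A B x t z)
      hre him hk hA (hG' z hz) ((a3.mul a2).add ((analyticAt_id.mul analyticAt_const).mul a1)) hz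
      fun w hw hw' => ?_
    refine (h2 w).unique ?_
    simp only [solFS_eq hre him hk hA hw hw', solGS_eq hre him hk hA hw hw']
    exact ((hasDerivAt_dag_solG_x (x := x) (t := t) hre him hk hA hw).mul_const
      (bl k w)).congr_deriv (by ring)
  rw [← e1, ← e2]
  exact ⟨h1 z, h2 z⟩

lemma isLaxSol_solP1 (hz : ∀ n, z ≠ conj (eta k n)) :
    IsLaxSol (solQ k A B) t z (fun x => solP1 k A B x t z) := by
  rw [isLaxSol_iff]
  intro x
  have hb := hasDerivAt_bgExp_zero (x := x) (t := t) (z := z)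
  obtain ⟨hf, hg⟩ := hasDerivAt_solFS_x (x := x) (t := t) hre him hk hA hz
  constructor
  · exact (hb.fun_mul hf).congr_deriv (by simp [solP1]; ring)
  · exact (hb.fun_mul hg.fun_neg).congr_deriv (by simp [solP1]; ring)

lemma tendsto_zero_of_isBigO_wt_left {u : ℝ × ℝ → ℂ} (h : u =O[𝓟 (slabL |t|)] wt) :
    Tendsto (fun x => u (x, t)) atBot (𝓝 0) := by
  have h1 : (fun p : ℝ × ℝ => if p.1 ≤ 0 then u p else 0) =O[𝓟 (slab |t|)] wt := by
    rw [isBigO_principal_iff_exists] at h ⊢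
    obtain ⟨C, hC⟩ := h
    have hC0 : 0 ≤ C := by
      have := (norm_nonneg _).trans (hC (0, t) ⟨le_rfl, le_rfl⟩)
      simpa [norm_wt, wt] using this
    refine ⟨C, fun p hp => ?_⟩
    split_ifs with h0
    · exact hC p ⟨h0, hp⟩
    · rw [norm_zero]; positivity
  refine (tendsto_zero_of_isBigO_wt hre him hk hA h1).2.congr' ?_
  filter_upwards [eventually_le_atBot 0] with x hx
  simp [hx]

lemma tendsto_zero_of_isBigO_wt_right {u : ℝ × ℝ → ℂ} (h : u =O[𝓟 (slabR |t|)] wt) :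
    Tendsto (fun x => u (x, t)) atTop (𝓝 0) := by
  have h1 : (fun p : ℝ × ℝ => if 0 ≤ p.1 then u p else 0) =O[𝓟 (slab |t|)] wt := by
    rw [isBigO_principal_iff_exists] at h ⊢
    obtain ⟨C, hC⟩ := h
    have hC0 : 0 ≤ C := by
      have := (norm_nonneg _).trans (hC (0, t) ⟨le_rfl, le_rfl⟩)
      simpa [norm_wt, wt] using this
    refine ⟨C, fun p hp => ?_⟩
    split_ifs with h0
    · exact hC p ⟨h0, hp⟩
    · rw [norm_zero]; positivity
  refine (tendsto_zero_of_isBigO_wt hre him hk hA h1).1.congr' ?_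
  filter_upwards [eventually_ge_atTop 0] with x hx
  simp [hx]

lemma f_coeff_isBigO_left {T : ℝ} (n) :
    (fun p : ℝ × ℝ => fC k A B n p.1 p.2) =O[𝓟 (slabL T)] wt ∧
      (fun p : ℝ × ℝ => fE k A B n p.1 p.2) =O[𝓟 (slabL T)] wt := by
  have hg := g_coeff_isBigO_one (A := A) (B := B) (S := slabL T) hre him hk hA
  obtain ⟨hc, he⟩ := resC_isBigO (A := A) (B := B) hre him T n
  have h2 : (fun p : ℝ × ℝ => solG k A B p.1 p.2 (eta k n)) =O[𝓟 (slabL T)]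
      (fun _ => (1 : ℝ)) := by
    simp only [solG_eq_pf hre him hk hA]
    exact pf_isBigO_of_coeff (Asymptotics.isBigO_zero _ _) (fun n => (hg n).1) (fun n => (hg n).2) _
  have h3 : (fun p : ℝ × ℝ => deriv (solG k A B p.1 p.2) (eta k n)) =O[𝓟 (slabL T)]
      (fun _ => (1 : ℝ)) := by
    simp only [solG_eq_pf hre him hk hA]
    exact deriv_pf_isBigO_of_coeff (c₀ := fun _ => 0) (fun n => (hg n).1) (fun n => (hg n).2)
      (eta_ne_conj hre him n)
  exact ⟨mul_isBigO hc h2, (mul_isBigO hc h3).add (mul_isBigO he h2)⟩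

lemma tendsto_solM2 : Tendsto (fun x => solG k A B x t z) atBot (𝓝 0) ∧
    Tendsto (fun x => solF k A B x t z) atBot (𝓝 1) := by
  constructor
  · have hg := g_coeff_isBigO_left (A := A) (B := B) (T := |t|) hre him hk hA
    have := pf_isBigO_of_coeff (p := fun n => conj (eta k n)) (Asymptotics.isBigO_zero wt _)
      (fun n => (hg n).1) (fun n => (hg n).2) z
    refine (tendsto_zero_of_isBigO_wt_left hre him hk hA this).congr fun x => ?_
    rw [solG_eq_pf hre him hk hA]
  · have hf := f_coeff_isBigO_left (A := A) (B := B) (T := |t|) hre him hk hA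
    have h1 := fun z => tendsto_zero_of_isBigO_wt_left hre him hk hA (pf_isBigO_of_coeff
      (p := eta k) (Asymptotics.isBigO_zero wt _) (fun n => (hf n).1) (fun n => (hf n).2) z)
    -- The constant term of `solF` is eliminated through its value 1 at the origin, which leaves
    -- only the decaying principal parts.
    have h2 := ((h1 z).sub (h1 0)).const_add 1
    simp only [sub_zero, add_zero] at h2
    refine h2.congr fun x => ?_
    have h3 := solF_zero (k := k) (A := A) (B := B) (x := x) (t := t)
    rw [solF_eq_pf] at h3 ⊢
    simp only [pf] at h3 ⊢
    linear_combination -h3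

lemma solFS_zero : solFS k A B x t 0 = 1 := by
  rw [solFS_eq hre him hk hA (fun n h => eta_ne_zero hre him n h.symm)
    (zero_ne_conj_eta hre him hk hA), solF_zero, bl_zero hre him, mul_one]

lemma tendsto_solP1 : Tendsto (fun x => solGS k A B x t z) atTop (𝓝 0) ∧
    Tendsto (fun x => solFS k A B x t z) atTop (𝓝 1) := by
  constructor
  · have hg := solGS_coeff_isBigO (A := A) (B := B) (T := |t|) hre him hk hA
    have := pf_isBigO_of_coeff (p := fun n => conj (eta k n)) (Asymptotics.isBigO_zero wt _)
      (fun n => (hg n).1) (fun n => (hg n).2) z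
    exact tendsto_zero_of_isBigO_wt_right hre him hk hA this
  · have hf := solFS_coeff_isBigO (A := A) (B := B) (T := |t|) hre him hk hA
    have h1 := fun z => tendsto_zero_of_isBigO_wt_right hre him hk hA (pf_isBigO_of_coeff
      (p := fun n => conj (eta k n)) (Asymptotics.isBigO_zero wt _) (fun n => (hf n).1)
      (fun n => (hf n).2) z)
    have h2 := ((h1 z).sub (h1 0)).const_add 1
    simp only [sub_zero, add_zero] at h2
    refine h2.congr fun x => ?_
    have h3 := solFS_zero (x := x) (t := t) hre him hk hA
    simp only [solFS, pf] at h3 ⊢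
    linear_combination -h3

lemma ne_conj_eta_of_nonneg (hz : 0 ≤ z.re * z.im) (n) : z ≠ conj (eta k n) := by
  rintro rfl
  have := eta_mem hre him n
  simp at hz; linarith

lemma isJostColumn_solM2 (hz : 0 ≤ z.re * z.im) :
    IsJostColumn (solQ k A B) atBot 1 t z (fun x => solM2 k A B x t z) := by
  refine ⟨isLaxSol_solM2 hre him hk hA (ne_conj_eta_of_nonneg hre him hk hA hz), ?_⟩
  simp only [solM2, smul_smul, inv_mul_cancel₀ bgExp_ne_zero, one_smul]
  rw [tendsto_pi_nhds, Fin.forall_fin_two]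
  constructor
  · simpa using (tendsto_solM2 (t := t) (z := z) hre him hk hA).1
  · simpa [dag, Function.comp_def] using (Complex.continuous_conj.tendsto _).comp
      (tendsto_solM2 (t := t) (z := conj z) hre him hk hA).2

lemma isJostColumn_solP1 (hz : 0 ≤ z.re * z.im) :
    IsJostColumn (solQ k A B) atTop 0 t z (fun x => solP1 k A B x t z) := by
  refine ⟨isLaxSol_solP1 hre him hk hA (ne_conj_eta_of_nonneg hre him hk hA hz), ?_⟩
  simp only [solP1, smul_smul, inv_mul_cancel₀ bgExp_ne_zero, one_smul]
  rw [tendsto_pi_nhds, Fin.forall_fin_two]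
  constructor
  · simpa using (tendsto_solP1 (t := t) (z := z) hre him hk hA).2
  · simpa using (tendsto_solP1 (t := t) (z := z) hre him hk hA).1.neg

lemma continuous_solQ : Continuous fun x => solQ k A B x t :=
  continuous_iff_continuousAt.2 fun x =>
    (hasDerivAt_fst (contDiff_solQ hre him hk hA) x t).continuousAt

lemma jostM2_solQ (hz : 0 ≤ z.re * z.im) : jostM2 (solQ k A B) x t z = solM2 k A B x t z :=
  (isJostColumn_solM2 hre him hk hA hz).jost_eq (continuous_solQ hre him hk hA)
    (bgBdd_of_nonneg_bot hz) x

lemma jostP1_solQ (hz : 0 ≤ z.re * z.im) : jostP1 (solQ k A B) x t z = solP1 k A B x t z :=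
  (isJostColumn_solP1 hre him hk hA hz).jost_eq (continuous_solQ hre him hk hA)
    (bgBdd_of_nonneg_top hz) x

/-- Off the poles the Wronskian is `bl` times f f† + g g† = 1. -/
lemma wr_solP1_solM2 (hz : ∀ n, z ≠ conj (eta k n)) :
    wr (solP1 k A B x t z) (solM2 k A B x t z) = bl k z := by
  have h : wr (solP1 k A B x t z) (solM2 k A B x t z) =
      solFS k A B x t z * dag (solF k A B x t) z + solGS k A B x t z * solG k A B x t z := by
    simp only [wr, solP1, solM2, Pi.smul_apply, smul_eq_mul, Matrix.cons_val_zero,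
      Matrix.cons_val_one]
    linear_combination (solFS k A B x t z * dag (solF k A B x t) z +
      solGS k A B x t z * solG k A B x t z) * bgExp_mul (x := x) (t := t) (z := z)
  rw [h]
  refine eq_of_eq_off_poles (F := fun z => solFS k A B x t z * dag (solF k A B x t) z +
    solGS k A B x t z * solG k A B x t z) hre him hk hA
    (((solFS_analyticAt hre him hk hA hz).mul (dag_solF_analyticAt hre him hk hA hz)).add
      ((solGS_analyticAt hre him hk hA hz).mul ((rowSol_sol hre him hk hA).ang z hz)))
    (bl_analyticAt hre him hz) hz fun w hw hw' => ?_
  rw [solFS_eq hre him hk hA hw hw', solGS_eq hre him hk hA hw hw']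
  linear_combination bl k w * sol_det_eq_one (x := x) (t := t) hre him hk hA w hw hw'

lemma s11_solQ (hz : 0 ≤ z.re * z.im) : s11 (solQ k A B) z = bl k z := by
  rw [s11, jostP1_solQ hre him hk hA hz, jostM2_solQ hre him hk hA hz,
    wr_solP1_solM2 hre him hk hA (ne_conj_eta_of_nonneg hre him hk hA hz)]

end Explicit

/-! ## The explicit solution is a double-pole soliton -/

/-! ### Symmetries of the Jost columns and of the scattering coefficients -/

section Symmetry

/-- The analytically continued Jost columns of `q` exist. -/
structure HasJost (q : ℝ → ℝ → ℂ) : Prop where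
  continuous : ∀ t, Continuous fun x => q x t
  top : ∀ t z, 0 ≤ z.re * z.im → ∃ φ, IsJostColumn q atTop 0 t z φ
  bot : ∀ t z, 0 ≤ z.re * z.im → ∃ φ, IsJostColumn q atBot 1 t z φ

namespace HasJost

variable {q : ℝ → ℝ → ℂ} (h : HasJost q) {x t : ℝ} {z : ℂ}
include h

lemma isP1 (hz : 0 ≤ z.re * z.im) : IsJostColumn q atTop 0 t z (fun x => jostP1 q x t z) :=
  jost_isJostColumn (h.top t z hz)

lemma isM2 (hz : 0 ≤ z.re * z.im) : IsJostColumn q atBot 1 t z (fun x => jostM2 q x t z) :=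
  jost_isJostColumn (h.bot t z hz)

lemma P2_eq (hz : z.re * z.im ≤ 0) : jostP2 q x t z = -jc (jostP1 q x t (conj z)) :=
  (h.isP1 (z := conj z) (by simpa using hz)).jc_zero.jost_eq (h.continuous t)
    (bgBdd_of_nonpos_top hz) x

lemma M1_eq (hz : z.re * z.im ≤ 0) : jostM1 q x t z = jc (jostM2 q x t (conj z)) :=
  (h.isM2 (z := conj z) (by simpa using hz)).jc_one.jost_eq (h.continuous t)
    (bgBdd_of_nonpos_bot hz) x

lemma P1_neg (hz : 0 ≤ z.re * z.im) : jostP1 q x t (-z) = s3 (jostP1 q x t z) :=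
  (h.isP1 hz).s3_zero.jost_eq (h.continuous t) (bgBdd_of_nonneg_top (by simpa using hz)) x

lemma M2_neg (hz : 0 ≤ z.re * z.im) : jostM2 q x t (-z) = -s3 (jostM2 q x t z) :=
  (h.isM2 hz).s3_one.jost_eq (h.continuous t) (bgBdd_of_nonneg_bot (by simpa using hz)) x

lemma s22_eq (hz : z.re * z.im ≤ 0) : s22 q z = conj (s11 q (conj z)) := by
  rw [s22, h.P2_eq hz, h.M1_eq hz, s11, ← wr_jc, wr_swap]
  simp [wr]; ring

lemma s11_neg (hz : 0 ≤ z.re * z.im) : s11 q (-z) = s11 q z := by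
  rw [s11, h.P1_neg hz, h.M2_neg hz, s11]
  simp [wr, s3]

lemma s12_eq (hz : z.re * z.im = 0) : s12 q z = -conj (s21 q (conj z)) := by
  have hz' : (conj z).re * (conj z).im = 0 := by simpa using hz
  rw [s12, h.P2_eq hz.le, s21, h.M1_eq hz'.le, ← wr_jc, jc_jc, Complex.conj_conj]
  simp [wr]; ring

end HasJost

lemma re_mul_im_eq_zero_of_mem_contour {z : ℂ} (hz : z ∈ contour) : z.re * z.im = 0 := by
  rcases hz with hz | hz <;> simp [hz]

end Symmetry

/-! ### Scattering data of the explicit solution -/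

section Reconstruction

set_option linter.unusedSectionVars false

variable {N : ℕ} {k : Fin N → ℂ} {A B : ℂ → ℂ} {x t : ℝ} {z : ℂ}

variable (hre : ∀ n, 0 < (k n).re) (him : ∀ n, 0 < (k n).im) (hk : Function.Injective k)
  (hA : IsNormingData k A B)
include hre him hk hA

lemma hasJost_solQ : HasJost (solQ k A B) where
  continuous _ := continuous_solQ hre him hk hA
  top _ _ hz := ⟨_, isJostColumn_solP1 hre him hk hA hz⟩
  bot _ _ hz := ⟨_, isJostColumn_solM2 hre him hk hA hz⟩

lemma ne_eta_of_nonpos (hz : z.re * z.im ≤ 0) (n) : z ≠ eta k n := by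
  rintro rfl
  exact absurd (eta_mem hre him n) (not_lt.2 hz)

/-- On the contour both columns are multiples of (f, -g†): Φ₋₁ as the reflection of `solM2`, and
`solP1` with the additional factor `bl`. -/
lemma s21_solQ (hz : z.re * z.im = 0) : s21 (solQ k A B) z = 0 := by
  have hz' : (conj z).re * (conj z).im = 0 := by simpa using hz
  rw [s21, (hasJost_solQ hre him hk hA).M1_eq hz.le, jostM2_solQ hre him hk hA hz'.ge,
    jostP1_solQ hre him hk hA hz.ge, solM2, solP1, jc_smul, wr_smul_left, wr_smul_right,
    solFS_eq hre him hk hA (ne_eta_of_nonpos hre him hk hA hz.le)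
      (ne_conj_eta_of_nonneg hre him hk hA hz.ge),
    solGS_eq hre him hk hA (ne_eta_of_nonpos hre him hk hA hz.le)
      (ne_conj_eta_of_nonneg hre him hk hA hz.ge)]
  simp [wr, jc, dag]
  right; right; ring

/-- The residue conditions multiplied by (z - ηₙ)². The double zero of `bl` turns the principal part
into a scalar function that relates the two columns up to second order, and its 1-jet carries A and
B. -/
lemma solP1_expansion (n) : ∃ R₀ R₁ : ℂ → ℂ, Removable R₀ (eta k n) ∧ Removable R₁ (eta k n) ∧
    ∀ᶠ z in 𝓝[≠] (eta k n),
      solP1 k A B x t z 0 = ((resC k A x t n + resE k A B x t n * (z - eta k n)) * blU k n z *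
        Complex.exp (2 * Complex.I * theta x t z)) * solM2 k A B x t z 0 +
          (z - eta k n) ^ 2 * R₀ z ∧
      solP1 k A B x t z 1 = ((resC k A x t n + resE k A B x t n * (z - eta k n)) * blU k n z *
        Complex.exp (2 * Complex.I * theta x t z)) * solM2 k A B x t z 1 +
          (z - eta k n) ^ 2 * R₁ z := by
  have hs := rowSol_sol (x := x) (t := t) hre him hk hA
  have hb : AnalyticAt ℂ (fun z => bgExp 0 x t z) (eta k n) := by
    unfold bgExp theta; fun_prop
  have hu := blU_analyticAt hre him n
  refine ⟨fun z => bgExp 0 x t z * blU k n z *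
    (solF k A B x t z - pp (eta k n) (resC k A x t n) (resE k A B x t n) z * solG k A B x t z),
    fun z => -(bgExp 0 x t z * blU k n z) * (dag (solG k A B x t) z +
      pp (eta k n) (resC k A x t n) (resE k A B x t n) z * dag (solF k A B x t) z),
    (hb.mul hu).removable.mul (hs.reg n), ((hb.mul hu).neg.removable.mul (hs.reg' n)), ?_⟩
  filter_upwards [eventually_ne_poles hre him hk hA (eta_ne_conj hre him n), self_mem_nhdsWithin]
    with z hz hzn
  have h0 : z - eta k n ≠ 0 := sub_ne_zero.2 hzn
  have he : Complex.exp (2 * Complex.I * theta x t z) * bgExp 1 x t z = bgExp 0 x t z := by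
    simp only [bgExp, ← Complex.exp_add]
    congr 1; simp; ring
  have hp : (z - eta k n) ^ 2 * pp (eta k n) (resC k A x t n) (resE k A B x t n) z =
      resC k A x t n + resE k A B x t n * (z - eta k n) := by
    rw [pp]; field_simp
  simp only [solP1, solM2, Pi.smul_apply, smul_eq_mul, Matrix.cons_val_zero, Matrix.cons_val_one,
    solFS_eq hre him hk hA hz.1 hz.2, solGS_eq hre him hk hA hz.1 hz.2, bl_eq_sq_mul n z, ← hp,
    ← he]
  constructor <;> ring

lemma exp_mul_resC (n) : resC k A x t n * Complex.exp (2 * Complex.I * theta x t (eta k n)) =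
    A (eta k n) := by
  rw [resC, mul_assoc, ← Complex.exp_add]
  simp

lemma solP1_jet (n) :
    solP1 k A B x t (eta k n) = (A (eta k n) * blU k n (eta k n)) • solM2 k A B x t (eta k n) ∧
    deriv (solP1 k A B x t) (eta k n) =
      (A (eta k n) * (deriv (blU k n) (eta k n) + B (eta k n) * blU k n (eta k n))) •
        solM2 k A B x t (eta k n) +
      (A (eta k n) * blU k n (eta k n)) • deriv (solM2 k A B x t) (eta k n) := by
  have hc := eta_ne_conj hre him n
  have hb0 : AnalyticAt ℂ (fun z => bgExp 0 x t z) (eta k n) := by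
    unfold bgExp theta; fun_prop
  have hb1 : AnalyticAt ℂ (fun z => bgExp 1 x t z) (eta k n) := by
    unfold bgExp theta; fun_prop
  have hP0 : AnalyticAt ℂ (fun z => solP1 k A B x t z 0) (eta k n) :=
    hb0.mul (solFS_analyticAt hre him hk hA hc)
  have hP1 : AnalyticAt ℂ (fun z => solP1 k A B x t z 1) (eta k n) :=
    hb0.mul (solGS_analyticAt hre him hk hA hc).neg
  have hM0 : AnalyticAt ℂ (fun z => solM2 k A B x t z 0) (eta k n) :=
    hb1.mul ((rowSol_sol hre him hk hA).ang _ hc)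
  have hM1 : AnalyticAt ℂ (fun z => solM2 k A B x t z 1) (eta k n) :=
    hb1.mul (dag_solF_analyticAt hre him hk hA hc)
  have hdP : deriv (solP1 k A B x t) (eta k n) = ![deriv (fun z => solP1 k A B x t z 0) (eta k n),
      deriv (fun z => solP1 k A B x t z 1) (eta k n)] := by
    refine HasDerivAt.deriv (hasDerivAt_pi.2 (Fin.forall_fin_two.2 ⟨?_, ?_⟩))
    · exact hP0.differentiableAt.hasDerivAt
    · exact hP1.differentiableAt.hasDerivAt
  have hdM : deriv (solM2 k A B x t) (eta k n) = ![deriv (fun z => solM2 k A B x t z 0) (eta k n),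
      deriv (fun z => solM2 k A B x t z 1) (eta k n)] := by
    refine HasDerivAt.deriv (hasDerivAt_pi.2 (Fin.forall_fin_two.2 ⟨?_, ?_⟩))
    · exact hM0.differentiableAt.hasDerivAt
    · exact hM1.differentiableAt.hasDerivAt
  have hu := blU_analyticAt hre him n
  set β : ℂ → ℂ := fun z => (resC k A x t n + resE k A B x t n * (z - eta k n)) * blU k n z *
    Complex.exp (2 * Complex.I * theta x t z)
  -- The derivative of θ coming from the exponential cancels the one contained in `coefD`. Only B
  -- remains, so the jet is independent of x and t.
  have hβd : HasDerivAt β (A (eta k n) * (deriv (blU k n) (eta k n) +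
      B (eta k n) * blU k n (eta k n))) (eta k n) := by
    have h1 := ((((hasDerivAt_id' (eta k n)).sub_const (eta k n)).const_mul
      (resE k A B x t n)).const_add (resC k A x t n)).fun_mul hu.differentiableAt.hasDerivAt
    have h2 := ((hasDerivAt_theta x t (eta k n)).const_mul (2 * Complex.I)).cexp
    refine (h1.fun_mul h2).congr_deriv ?_
    rw [← exp_mul_resC (x := x) (t := t) hre him hk hA n, resE, coefD_eq]
    ring
  have hβ0 : β (eta k n) = A (eta k n) * blU k n (eta k n) := by
    simp only [β]
    rw [← exp_mul_resC (x := x) (t := t) hre him hk hA n]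
    ring
  have hβ : AnalyticAt ℂ β (eta k n) := by
    have h1 : AnalyticAt ℂ (fun z => resC k A x t n + resE k A B x t n * (z - eta k n))
      (eta k n) := by fun_prop
    have h2 : AnalyticAt ℂ (fun z => Complex.exp (2 * Complex.I * theta x t z)) (eta k n) := by
      unfold theta; fun_prop
    exact (h1.mul hu).mul h2
  obtain ⟨R₀, R₁, hR₀, hR₁, hE⟩ := solP1_expansion (x := x) (t := t) hre him hk hA n
  obtain ⟨e0, e0'⟩ := jet_eq_of_removable hP0 hM0 hβ hR₀ (hE.mono fun z hz => hz.1)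
  obtain ⟨e1, e1'⟩ := jet_eq_of_removable hP1 hM1 hβ hR₁ (hE.mono fun z hz => hz.2)
  rw [hβ0] at e0 e0' e1 e1'
  rw [hβd.deriv] at e0' e1'
  constructor
  · ext i; fin_cases i
    · exact e0
    · exact e1
  · rw [hdP, hdM]
    ext i; fin_cases i
    · exact e0'
    · exact e1'

lemma eventually_nonneg (hz : 0 < z.re * z.im) : ∀ᶠ w in 𝓝 z, 0 ≤ w.re * w.im := by
  have hc : Continuous fun w : ℂ => w.re * w.im := by fun_prop
  filter_upwards [hc.continuousAt.eventually (lt_mem_nhds hz)] with w hw using hw.le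

lemma s11_solQ_jet (n) : deriv (s11 (solQ k A B)) (eta k n) = 0 ∧
    iteratedDeriv 2 (s11 (solQ k A B)) (eta k n) = 2 * blU k n (eta k n) ∧
    iteratedDeriv 3 (s11 (solQ k A B)) (eta k n) = 6 * deriv (blU k n) (eta k n) := by
  refine deriv_sub_sq_mul (blU_analyticAt hre him n) ?_
  filter_upwards [eventually_nonneg hre him hk hA (eta_mem hre him n)] with w hw
  rw [s11_solQ hre him hk hA hw, bl_eq_sq_mul n]

lemma solM2_ne_zero (n) : jostM2 (solQ k A B) x t (eta k n) ≠ 0 :=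
  ((hasJost_solQ hre him hk hA).isM2 (eta_mem hre him n).le).ne_zero
    (continuous_solQ hre him hk hA) x

lemma normB_solQ (n) : normB (solQ k A B) (eta k n) = A (eta k n) * blU k n (eta k n) := by
  have hz := eta_mem hre him n
  rw [normB, if_pos hz]
  refine ratio_eq (fun x t => ?_) (solM2_ne_zero hre him hk hA n)
  rw [jostP1_solQ hre him hk hA hz.le, jostM2_solQ hre him hk hA hz.le]
  exact (solP1_jet hre him hk hA n).1

lemma normD_solQ (n) : normD (solQ k A B) (eta k n) =
    A (eta k n) * (deriv (blU k n) (eta k n) + B (eta k n) * blU k n (eta k n)) := by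
  have hz := eta_mem hre him n
  have hev := eventually_nonneg hre him hk hA hz
  rw [normD, if_pos hz]
  refine ratio_eq (fun x t => ?_) (solM2_ne_zero hre him hk hA n)
  have h1 : jostP1 (solQ k A B) x t =ᶠ[𝓝 (eta k n)] solP1 k A B x t :=
    hev.mono fun w hw => jostP1_solQ hre him hk hA hw
  have h2 : jostM2 (solQ k A B) x t =ᶠ[𝓝 (eta k n)] solM2 k A B x t :=
    hev.mono fun w hw => jostM2_solQ hre him hk hA hw
  rw [h1.deriv_eq, h2.deriv_eq, normB_solQ hre him hk hA, jostM2_solQ hre him hk hA hz.le,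
    (solP1_jet hre him hk hA n).2]
  abel

lemma discA_solQ (n) : discA (solQ k A B) (eta k n) = A (eta k n) := by
  have hu := blU_ne_zero hre him hk n
  rw [discA, if_pos (eta_mem hre him n), normB_solQ hre him hk hA,
    (s11_solQ_jet hre him hk hA n).2.1]
  field_simp

lemma discB_solQ (n) : discB (solQ k A B) (eta k n) = B (eta k n) := by
  have hu := blU_ne_zero hre him hk n
  have hA0 := hA.A_eta_ne_zero n
  rw [discB, if_pos (eta_mem hre him n), normB_solQ hre him hk hA, normD_solQ hre him hk hA,
    (s11_solQ_jet hre him hk hA n).2.1, (s11_solQ_jet hre him hk hA n).2.2]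
  field_simp
  ring

lemma s11_solQ_eq_zero_iff (h1 : 0 < z.re) (h2 : 0 < z.im) :
    s11 (solQ k A B) z = 0 ↔ ∃ n, z = k n := by
  have hz := mul_pos h1 h2
  rw [s11_solQ hre him hk hA hz.le]
  constructor
  · intro h
    by_contra hn
    refine bl_ne_zero hre him (ne_conj_eta_of_nonneg hre him hk hA hz.le) (fun n hzn => ?_) h
    rcases n with n | n
    · exact hn ⟨n, hzn⟩
    · rw [hzn] at h1
      have := hre n
      simp [eta] at h1
      linarith
  · rintro ⟨n, rfl⟩
    rw [bl_eq_sq_mul (.inl n)]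
    simp [eta]

lemma isDoublePoleSoliton_solQ : IsDoublePoleSoliton k (solQ k A B) where
  solution := isZBCSolution_solQ hre him hk hA
  no_spectral_singularity z hz := by
    have hz := re_mul_im_eq_zero_of_mem_contour hz
    have hz' : (conj z).re * (conj z).im = 0 := by simpa using hz
    have h1 : ∀ {z : ℂ}, z.re * z.im = 0 → s11 (solQ k A B) z ≠ 0 := fun {z} hz => by
      rw [s11_solQ hre him hk hA hz.ge]
      exact bl_ne_zero hre him (ne_conj_eta_of_nonneg hre him hk hA hz.ge)
        (ne_eta_of_nonpos hre him hk hA hz.le)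
    refine ⟨h1 hz, ?_⟩
    rw [(hasJost_solQ hre him hk hA).s22_eq hz.le]
    exact (map_ne_zero _).2 (h1 hz')
  reflectionless z hz := by
    have hz := re_mul_im_eq_zero_of_mem_contour hz
    have hz' : (conj z).re * (conj z).im = 0 := by simpa using hz
    rw [rho, rhoTilde, s21_solQ hre him hk hA hz, (hasJost_solQ hre him hk hA).s12_eq hz,
      s21_solQ hre him hk hA hz']
    simp
  zeros z h1 h2 := s11_solQ_eq_zero_iff hre him hk hA h1 h2
  deriv_zero n := (s11_solQ_jet hre him hk hA (.inl n)).1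
  double n := by
    have := (s11_solQ_jet hre him hk hA (.inl n)).2.1
    simp only [eta, Sum.elim_inl] at this
    rw [this]
    exact mul_ne_zero two_ne_zero (blU_ne_zero hre him hk (.inl n))

end Reconstruction

/-! ## Volterra operators -/

section Volterra

/-- The reflection of a point to the closed upper half plane. -/
def up (l : ℂ) : ℂ := ⟨l.re, |l.im|⟩

lemma continuous_up : Continuous up := by
  have : up = fun l : ℂ => (l.re : ℂ) + (|l.im| : ℝ) * Complex.I := by
    ext l; exact Complex.mk_eq_add_mul_I _ _
  rw [this]
  fun_prop

lemma up_eq {l : ℂ} (hl : 0 ≤ l.im) : up l = l := by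
  apply Complex.ext <;> simp [up, abs_of_nonneg hl]

/-- The kernel `e^{2iμλs}`. -/
def vker (μ : ℝ) (l : ℂ) (s : ℝ) : ℂ := Complex.exp (2 * Complex.I * μ * up l * s)

lemma norm_vker_le {μ : ℝ} (hμ : 0 ≤ μ) (l : ℂ) {s : ℝ} (hs : 0 ≤ s) : ‖vker μ l s‖ ≤ 1 := by
  rw [vker, Complex.norm_exp, Real.exp_le_one_iff]
  have : (2 * Complex.I * μ * up l * s).re = -(2 * μ * |l.im| * s) := by
    simp [up]
  rw [this]
  have := abs_nonneg l.im
  simp only [Left.neg_nonpos_iff]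
  positivity

/-- The Volterra operator with kernel `e^{2iμλ(y-x)} c(y)` on `y > x`. -/
def volt (μ : ℝ) (c : ℝ → ℂ) (h : ℝ × ℂ → ℂ) (p : ℝ × ℂ) : ℂ :=
  ∫ y in Set.Ioi p.1, vker μ p.2 (y - p.1) * c y * h (y, p.2)

variable {μ : ℝ} {c : ℝ → ℂ} {h : ℝ × ℂ → ℂ}

lemma continuous_volt_integrand (hc : Continuous c) (hh : Continuous h) :
    Continuous fun a : ℝ × ℝ × ℂ => vker μ a.2.2 (a.1 - a.2.1) * c a.1 * h (a.1, a.2.2) := by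
  unfold vker
  have := continuous_up
  fun_prop

lemma norm_volt_integrand_le (hμ : 0 ≤ μ) {x y : ℝ} (hy : x < y) (l : ℂ) :
    ‖vker μ l (y - x) * c y * h (y, l)‖ ≤ ‖c y‖ * ‖h (y, l)‖ := by
  rw [norm_mul, norm_mul]
  have := norm_vker_le hμ l (sub_pos.2 hy).le
  calc _ ≤ 1 * ‖c y‖ * ‖h (y, l)‖ := by gcongr
    _ = _ := by ring

lemma integrableOn_volt (hμ : 0 ≤ μ) (hc : Continuous c) (hci : Integrable c) (hh : Continuous h)
    {l : ℂ} {C : ℝ} (hC : ∀ y, ‖h (y, l)‖ ≤ C) (x : ℝ) :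
    IntegrableOn (fun y => vker μ l (y - x) * c y * h (y, l)) (Set.Ioi x) := by
  refine Integrable.mono' ((hci.norm.mul_const C).integrableOn) ?_ ?_
  · exact ((continuous_volt_integrand hc hh).comp
      (by fun_prop : Continuous fun y : ℝ => (y, x, l))).aestronglyMeasurable
  · refine (ae_restrict_iff' measurableSet_Ioi).2 (Eventually.of_forall fun y hy => ?_)
    refine (norm_volt_integrand_le hμ hy l).trans ?_
    gcongr
    exact hC y

lemma norm_volt_le (hμ : 0 ≤ μ) {p : ℝ × ℂ} {g : ℝ → ℝ} (hg : IntegrableOn g (Set.Ioi p.1))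
    (h1 : ∀ y, ‖c y‖ * ‖h (y, p.2)‖ ≤ g y) : ‖volt μ c h p‖ ≤ ∫ y in Set.Ioi p.1, g y := by
  refine norm_integral_le_of_norm_le hg ((ae_restrict_iff' measurableSet_Ioi).2
    (Eventually.of_forall fun y hy => ?_))
  exact (norm_volt_integrand_le hμ hy _).trans (h1 y)

lemma continuous_volt (hμ : 0 ≤ μ) (hc : Continuous c) (hci : Integrable c) (hh : Continuous h)
    {C : ℝ} (hC : ∀ p, ‖h p‖ ≤ C) : Continuous (volt μ c h) := by
  have hC0 : 0 ≤ C := (norm_nonneg _).trans (hC 0)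
  have e : volt μ c h = fun p => ∫ y, (Set.Ioi p.1).indicator
      (fun y => vker μ p.2 (y - p.1) * c y * h (y, p.2)) y := by
    ext p; rw [integral_indicator measurableSet_Ioi]; rfl
  rw [e, continuous_iff_continuousAt]
  intro p₀
  have hcont := continuous_volt_integrand (μ := μ) hc hh
  refine continuousAt_of_dominated (bound := fun y => ‖c y‖ * C) ?_ ?_ (hci.norm.mul_const C) ?_
  · refine Eventually.of_forall fun p => ?_
    exact ((hcont.comp (by fun_prop : Continuous fun y : ℝ =>
      (y, p.1, p.2))).aestronglyMeasurable).indicator measurableSet_Ioi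
  · refine Eventually.of_forall fun p => Eventually.of_forall fun y => ?_
    by_cases hy : y ∈ Set.Ioi p.1
    · rw [Set.indicator_of_mem hy]
      refine (norm_volt_integrand_le hμ hy p.2).trans ?_
      gcongr
      exact hC _
    · rw [Set.indicator_of_notMem hy, norm_zero]
      positivity
  -- As a function of p the integrand is continuous at p₀ for every y other than p₀.1, that is, for
  -- almost every y.
  · have : ∀ᵐ y : ℝ, y ≠ p₀.1 := by
      simp [ae_iff, measure_singleton]
    filter_upwards [this] with y hy
    rcases lt_or_gt_of_ne hy with hy | hy
    · have h1 : ∀ᶠ p : ℝ × ℂ in 𝓝 p₀, y < p.1 := continuous_fst.continuousAt.eventually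
        (lt_mem_nhds hy)
      refine (continuousAt_const (y := (0 : ℂ))).congr ?_
      filter_upwards [h1] with p hp
      rw [Set.indicator_of_notMem (by simpa using hp.le)]
    · have h1 : ∀ᶠ p : ℝ × ℂ in 𝓝 p₀, p.1 < y := continuous_fst.continuousAt.eventually
        (gt_mem_nhds hy)
      refine ((hcont.comp (by fun_prop : Continuous fun p : ℝ × ℂ =>
        (y, p.1, p.2))).continuousAt).congr ?_
      filter_upwards [h1] with p hp
      rw [Set.indicator_of_mem (by exact hp)]
      rfl

lemma differentiableAt_vker {l : ℂ} (hl : 0 < l.im) (s : ℝ) :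
    DifferentiableAt ℂ (fun l => vker μ l s) l := by
  have h1 : (fun l => vker μ l s) =ᶠ[𝓝 l] fun l => Complex.exp (2 * Complex.I * μ * l * s) := by
    filter_upwards [(isOpen_lt continuous_const Complex.continuous_im).mem_nhds hl] with w hw
    rw [vker, up_eq (le_of_lt hw)]
  exact DifferentiableAt.congr_of_eventuallyEq (by fun_prop) h1

lemma differentiableAt_volt (hμ : 0 ≤ μ) (hc : Continuous c) (hci : Integrable c)
    (hh : Continuous h) {C : ℝ} (hC : ∀ p, ‖h p‖ ≤ C)
    (hd : ∀ y (l : ℂ), 0 < l.im → DifferentiableAt ℂ (fun l => h (y, l)) l) (x : ℝ) {l : ℂ}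
    (hl : 0 < l.im) : DifferentiableAt ℂ (fun l => volt μ c h (x, l)) l := by
  set F : ℝ → ℂ → ℂ := fun y l => vker μ l (y - x) * c y * h (y, l) with hF
  have hFc : Continuous (Function.uncurry F) := by
    change Continuous fun a : ℝ × ℂ =>
      Complex.exp (2 * Complex.I * μ * up a.2 * (a.1 - x : ℝ)) * c a.1 * h (a.1, a.2)
    have := continuous_up
    fun_prop
  -- Closed discs of radius r about points within r of l stay in the open upper half plane. Cauchy's
  -- estimate on them gives an integrable bound for the derivative in l.
  set r := l.im / 3 with hr
  have hr0 : 0 < r := by positivity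
  have hFd : ∀ y (w : ℂ), 0 < w.im → DifferentiableAt ℂ (F y) w := fun y w hw =>
    ((differentiableAt_vker hw _).mul_const _).mul (hd y w hw)
  have him : ∀ w ∈ Metric.ball l r, ∀ w' ∈ Metric.closedBall w r, 0 < w'.im := by
    intro w hw w' hw'
    have h1 := Complex.abs_im_le_norm (w - l)
    have h2 := Complex.abs_im_le_norm (w' - w)
    rw [Metric.mem_ball, Complex.dist_eq] at hw
    rw [Metric.mem_closedBall, Complex.dist_eq] at hw'
    simp only [Complex.sub_im] at h1 h2
    have h3 := neg_abs_le (w.im - l.im)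
    have h4 := neg_abs_le (w'.im - w.im)
    have : l.im = 3 * r := by rw [hr]; ring
    linarith
  have key := hasDerivAt_integral_of_dominated_loc_of_deriv_le (μ := volume.restrict (Set.Ioi x))
    (F := fun l y => F y l) (F' := fun l y => deriv (F y) l) (x₀ := l) (s := Metric.ball l r)
    (bound := fun y => ‖c y‖ * C / r) (Metric.ball_mem_nhds l hr0) ?_ ?_ ?_ ?_ ?_ ?_
  · exact key.2.differentiableAt
  · exact Eventually.of_forall fun w => (hFc.comp
      (by fun_prop : Continuous fun y : ℝ => (y, w))).aestronglyMeasurable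
  · exact integrableOn_volt hμ hc hci hh (fun y => hC (y, l)) x
  · exact ((measurable_deriv_with_param hFc).comp
      (by fun_prop : Measurable fun y : ℝ => (y, l))).aestronglyMeasurable
  · refine (ae_restrict_iff' measurableSet_Ioi).2 (Eventually.of_forall fun y hy w hw => ?_)
    refine Complex.norm_deriv_le_of_forall_mem_sphere_norm_le hr0 ?_ ?_
    · refine (DifferentiableOn.diffContOnCl ?_)
      rw [closure_ball _ hr0.ne']
      exact fun w' hw' => (hFd y w' (him w hw w' hw')).differentiableWithinAt
    · intro w' _
      refine (norm_volt_integrand_le hμ hy w').trans ?_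
      gcongr
      exact hC _
  · exact ((hci.norm.mul_const C).div_const r).integrableOn
  · refine (ae_restrict_iff' measurableSet_Ioi).2 (Eventually.of_forall fun y hy w hw => ?_)
    exact (hFd y w (him w hw w (Metric.mem_closedBall_self hr0.le))).hasDerivAt

lemma hasDerivAt_volt (hμ : 0 ≤ μ) (hc : Continuous c) (hci : Integrable c)
    (hh : Continuous h) {C : ℝ} {l : ℂ} (hC : ∀ y, ‖h (y, l)‖ ≤ C) (hl : 0 ≤ l.im) (x : ℝ) :
    HasDerivAt (fun x => volt μ c h (x, l))
      (-(c x * h (x, l)) - 2 * Complex.I * μ * l * volt μ c h (x, l)) x := by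
  -- The x-dependence of the kernel factors out as an exponential, so that x otherwise enters only
  -- as the limit of integration.
  set F : ℝ → ℂ := fun y => Complex.exp (2 * Complex.I * μ * l * y) * (c y * h (y, l)) with hF
  have hFc : Continuous F := by
    have : Continuous fun y : ℝ => h (y, l) := hh.comp (by fun_prop)
    fun_prop
  have e1 : ∀ x y : ℝ, vker μ l (y - x) * c y * h (y, l) =
      Complex.exp (-(2 * Complex.I * μ * l * x)) * F y := by
    intro x y
    rw [hF, vker, up_eq hl, ← mul_assoc (Complex.exp (-_)), ← Complex.exp_add, mul_assoc]
    congr 2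
    push_cast; ring
  have e2 : ∀ x, volt μ c h (x, l) = Complex.exp (-(2 * Complex.I * μ * l * x)) *
      ∫ y in Set.Ioi x, F y := by
    intro x
    rw [volt, ← integral_const_mul]
    exact integral_congr_ae (Eventually.of_forall fun y => e1 x y)
  have hint : ∀ x, IntegrableOn F (Set.Ioi x) := by
    intro x
    have := (integrableOn_volt hμ hc hci hh hC x).const_mul
      (Complex.exp (2 * Complex.I * μ * l * x))
    refine this.congr (Eventually.of_forall fun y => ?_)
    simp only [e1]
    rw [← mul_assoc, ← Complex.exp_add, add_neg_cancel, Complex.exp_zero, one_mul]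
  have e3 : ∀ x, ∫ y in Set.Ioi x, F y = (∫ y in Set.Ioi 0, F y) - ∫ y in (0 : ℝ)..x, F y := by
    intro x
    have := intervalIntegral.integral_interval_add_Ioi (hint 0) (hint x)
    rw [← this]; ring
  have d1 : HasDerivAt (fun x : ℝ => ∫ y in Set.Ioi x, F y) (-F x) x := by
    rw [funext e3]
    exact (hFc.integral_hasStrictDerivAt 0 x).hasDerivAt.const_sub _
  have d2 : HasDerivAt (fun x : ℝ => Complex.exp (-(2 * Complex.I * μ * l * x)))
      (-(2 * Complex.I * μ * l) * Complex.exp (-(2 * Complex.I * μ * l * x))) x := by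
    have := (((Complex.ofRealCLM.hasDerivAt (x := x)).const_mul
      (2 * Complex.I * μ * l)).fun_neg).cexp
    exact this.congr_deriv (by simp; ring)
  rw [funext e2]
  refine (d2.fun_mul d1).congr_deriv ?_
  have : Complex.exp (-(2 * Complex.I * μ * l * x)) * F x = c x * h (x, l) := by
    rw [hF]; simp only
    rw [← mul_assoc, ← Complex.exp_add, neg_add_cancel, Complex.exp_zero, one_mul]
  rw [← this, e2 x]; ring

lemma tendsto_integral_Ioi_zero {g : ℝ → ℝ} (hg : Integrable g) :
    Tendsto (fun x => ∫ y in Set.Ioi x, g y) atTop (𝓝 0) := by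
  have h1 : ∀ x, ∫ y in Set.Ioi x, g y = (∫ y in Set.Ioi 0, g y) - ∫ y in (0 : ℝ)..x, g y := by
    intro x
    have := intervalIntegral.integral_interval_add_Ioi (hg.integrableOn (s := Set.Ioi 0))
      (hg.integrableOn (s := Set.Ioi x))
    rw [← this]; ring
  rw [funext h1]
  have := (intervalIntegral_tendsto_integral_Ioi 0 (hg.integrableOn) tendsto_id).const_sub
    (∫ y in Set.Ioi 0, g y)
  simpa using! this

lemma tendsto_volt (hμ : 0 ≤ μ) (hci : Integrable c) {C : ℝ} {l : ℂ}
    (hC : ∀ y, ‖h (y, l)‖ ≤ C) : Tendsto (fun x => volt μ c h (x, l)) atTop (𝓝 0) := by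
  refine squeeze_zero_norm (fun x => norm_volt_le hμ (p := (x, l))
    (hci.norm.mul_const C).integrableOn fun y => ?_)
    (tendsto_integral_Ioi_zero (hci.norm.mul_const C))
  gcongr
  exact hC y

/-- The weight `e^{-2∫₀ˣ p}`. -/
def vwt (p : ℝ → ℝ) (x : ℝ) : ℝ := Real.exp (-2 * ∫ y in (0 : ℝ)..x, p y)

variable {p : ℝ → ℝ}

lemma hasDerivAt_vwt (hp : Continuous p) (x : ℝ) : HasDerivAt (vwt p) (-2 * p x * vwt p x) x := by
  have := ((hp.integral_hasStrictDerivAt 0 x).hasDerivAt.const_mul (-2)).exp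
  exact this.congr_deriv (by rw [vwt]; ring)

lemma vwt_pos (x : ℝ) : 0 < vwt p x := Real.exp_pos _

lemma exists_vwt_le (hpi : Integrable p) :
    ∃ M, 0 < M ∧ ∀ x, vwt p x ≤ M ∧ (vwt p x)⁻¹ ≤ M := by
  refine ⟨Real.exp (2 * ∫ y, ‖p y‖), Real.exp_pos _, fun x => ?_⟩
  have h1 : |∫ y in (0 : ℝ)..x, p y| ≤ ∫ y, ‖p y‖ := by
    rw [← Real.norm_eq_abs]
    refine intervalIntegral.norm_integral_le_integral_norm_uIoc.trans ?_
    exact setIntegral_le_integral hpi.norm (Eventually.of_forall fun _ => norm_nonneg _)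
  rw [vwt, ← Real.exp_neg, Real.exp_le_exp, Real.exp_le_exp]
  have := abs_le.1 h1
  constructor <;> linarith

/-- The integrand is minus half the derivative of the weight. A Volterra operator whose coefficient
is dominated by p thus has norm at most 1/2 in the weighted norm. -/
lemma integral_Ioi_mul_vwt_le (hp : Continuous p) (hpi : Integrable p) (hp0 : ∀ y, 0 ≤ p y)
    (x : ℝ) : IntegrableOn (fun y => p y * vwt p y) (Set.Ioi x) ∧
      ∫ y in Set.Ioi x, p y * vwt p y ≤ vwt p x / 2 := by
  have h1 : ∀ y ∈ Set.Ici x, HasDerivAt (fun y => -vwt p y / 2) (p y * vwt p y) y := fun y _ =>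
    ((hasDerivAt_vwt hp y).neg.div_const 2).congr_deriv (by ring)
  have h2 : Tendsto (fun y => -vwt p y / 2) atTop
      (𝓝 (-Real.exp (-2 * ∫ y in Set.Ioi 0, p y) / 2)) := by
    have := (intervalIntegral_tendsto_integral_Ioi 0 (hpi.integrableOn) tendsto_id).const_mul (-2)
    exact ((Real.continuous_exp.tendsto _).comp this).neg.div_const 2
  have h3 : ∀ y ∈ Set.Ioi x, 0 ≤ p y * vwt p y := fun y _ => mul_nonneg (hp0 y) (vwt_pos y).le
  refine ⟨integrableOn_Ioi_deriv_of_nonneg' h1 h3 h2, ?_⟩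
  rw [integral_Ioi_of_hasDerivAt_of_nonneg' h1 h3 h2]
  have := Real.exp_pos (-2 * ∫ y in Set.Ioi 0, p y)
  linarith

lemma norm_volt_le_vwt (hμ : 0 ≤ μ) (hp : Continuous p) (hpi : Integrable p)
    (hcp : ∀ y, ‖c y‖ ≤ p y) {M : ℝ} (hM : 0 ≤ M) {l : ℂ} (hh : ∀ y, ‖h (y, l)‖ ≤ M * vwt p y)
    (x : ℝ) : ‖volt μ c h (x, l)‖ ≤ M / 2 * vwt p x := by
  obtain ⟨h1, h2⟩ := integral_Ioi_mul_vwt_le hp hpi (fun y => (norm_nonneg _).trans (hcp y)) x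
  refine (norm_volt_le hμ (p := (x, l)) (h1.const_mul M) fun y => ?_).trans ?_
  · calc _ ≤ p y * (M * vwt p y) := by
          gcongr
          · exact (norm_nonneg _).trans (hcp y)
          · exact hcp y
          · exact hh y
      _ = _ := by ring
  · rw [integral_const_mul]
    calc _ ≤ M * (vwt p x / 2) := by gcongr
      _ = _ := by ring

lemma volt_sub (hμ : 0 ≤ μ) (hc : Continuous c) (hci : Integrable c) {h h' : ℝ × ℂ → ℂ}
    (hh : Continuous h) (hh' : Continuous h') {C C' : ℝ} (hC : ∀ p, ‖h p‖ ≤ C)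
    (hC' : ∀ p, ‖h' p‖ ≤ C') (q : ℝ × ℂ) :
    volt μ c (fun p => h p - h' p) q = volt μ c h q - volt μ c h' q := by
  rw [volt, volt, volt, ← integral_sub
    (integrableOn_volt hμ hc hci hh (fun y => hC (y, q.2)) q.1)
    (integrableOn_volt hμ hc hci hh' (fun y => hC' (y, q.2)) q.1)]
  exact integral_congr_ae (Eventually.of_forall fun y => mul_sub _ _ _)

/-- No smallness is needed: in the norm weighted with p = |u| + |v| each of the two operators has
norm at most 1/2, so the map contracts with constant 1/4. Analyticity in l passes from the iterates
to their uniform limit. -/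
theorem exists_volt_fixedPoint {u v : ℝ → ℂ} (hu : Continuous u) (hv : Continuous v)
    (hui : Integrable u) (hvi : Integrable v) :
    ∃ m : ℝ × ℂ → ℂ, Continuous m ∧ (∃ C, ∀ p, ‖m p‖ ≤ C) ∧
      (∀ y (l : ℂ), 0 < l.im → DifferentiableAt ℂ (fun l => m (y, l)) l) ∧
      ∀ p, m p = 1 + volt 0 u (volt 1 v m) p := by
  set p : ℝ → ℝ := fun y => ‖u y‖ + ‖v y‖ with hp
  have hpc : Continuous p := by fun_prop
  have hpi : Integrable p := hui.norm.add hvi.norm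
  have hup : ∀ y, ‖u y‖ ≤ p y := fun y => le_add_of_nonneg_right (norm_nonneg _)
  have hvp : ∀ y, ‖v y‖ ≤ p y := fun y => le_add_of_nonneg_left (norm_nonneg _)
  obtain ⟨M, hM0, hM⟩ := exists_vwt_le hpi
  have hwc : Continuous (vwt p) := continuous_iff_continuousAt.2 fun x =>
    (hasDerivAt_vwt hpc x).continuousAt
  have hw0 : ∀ x, 0 < vwt p x := fun x => vwt_pos x
  -- The fixed point is sought as the weight times a bounded continuous function, so that the
  -- weighted norm becomes the supremum norm.
  let E : BoundedContinuousFunction (ℝ × ℂ) ℂ → ℝ × ℂ → ℂ := fun f q => (vwt p q.1 : ℂ) * f q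
  have hEc : ∀ f, Continuous (E f) := fun f => by
    have := f.continuous
    fun_prop
  have hEw : ∀ f q, ‖E f q‖ ≤ ‖f‖ * vwt p q.1 := fun f q => by
    rw [norm_mul, Complex.norm_real, Real.norm_of_nonneg (hw0 _).le, mul_comm]
    exact mul_le_mul_of_nonneg_right (f.norm_coe_le_norm q) (hw0 _).le
  have hEb : ∀ f q, ‖E f q‖ ≤ ‖f‖ * M := fun f q =>
    (hEw f q).trans (mul_le_mul_of_nonneg_left (hM _).1 (norm_nonneg _))
  have hVc : ∀ f, Continuous (volt 1 v (E f)) := fun f =>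
    continuous_volt zero_le_one hv hvi (hEc f) (hEb f)
  have hVw : ∀ f q, ‖volt 1 v (E f) q‖ ≤ ‖f‖ / 2 * vwt p q.1 := fun f q =>
    norm_volt_le_vwt zero_le_one hpc hpi hvp (norm_nonneg _) (l := q.2) (fun y => hEw f (y, q.2)) q.1
  have hVb : ∀ f q, ‖volt 1 v (E f) q‖ ≤ ‖f‖ / 2 * M := fun f q =>
    (hVw f q).trans (mul_le_mul_of_nonneg_left (hM _).1 (by positivity))
  have hUc : ∀ f, Continuous (volt 0 u (volt 1 v (E f))) := fun f =>
    continuous_volt le_rfl hu hui (hVc f) (hVb f)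
  have hUw : ∀ f q, ‖volt 0 u (volt 1 v (E f)) q‖ ≤ ‖f‖ / 4 * vwt p q.1 := fun f q => by
    have := norm_volt_le_vwt le_rfl hpc hpi hup (M := ‖f‖ / 2) (by positivity) (l := q.2)
      (fun y => hVw f (y, q.2)) q.1
    calc _ ≤ _ := this
      _ = _ := by ring
  have hKc : ∀ f, Continuous fun q : ℝ × ℂ =>
      ((vwt p q.1)⁻¹ : ℂ) * (1 + volt 0 u (volt 1 v (E f)) q) := fun f => by
    have h1 : Continuous fun q : ℝ × ℂ => ((vwt p q.1)⁻¹ : ℂ) := by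
      refine Continuous.inv₀ (by fun_prop) fun q => ?_
      exact_mod_cast (hw0 q.1).ne'
    have := hUc f
    fun_prop
  have hKb : ∀ f (q : ℝ × ℂ), ‖((vwt p q.1)⁻¹ : ℂ) * (1 + volt 0 u (volt 1 v (E f)) q)‖ ≤
      M * (1 + ‖f‖ / 4 * M) := fun f q => by
    rw [norm_mul, norm_inv, Complex.norm_real, Real.norm_of_nonneg (hw0 _).le]
    have h1 : ‖1 + volt 0 u (volt 1 v (E f)) q‖ ≤ 1 + ‖f‖ / 4 * M := by
      refine (norm_add_le _ _).trans ?_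
      rw [norm_one]
      gcongr
      exact (hUw f q).trans (mul_le_mul_of_nonneg_left (hM _).1 (by positivity))
    exact mul_le_mul (hM _).2 h1 (norm_nonneg _) hM0.le
  let K : BoundedContinuousFunction (ℝ × ℂ) ℂ → BoundedContinuousFunction (ℝ × ℂ) ℂ := fun f =>
    BoundedContinuousFunction.ofNormedAddCommGroup _ (hKc f) _ (hKb f)
  have hK : ∀ f q, K f q = ((vwt p q.1)⁻¹ : ℂ) * (1 + volt 0 u (volt 1 v (E f)) q) :=
    fun f q => rfl
  have hE_sub : ∀ f g, E (f - g) = fun q => E f q - E g q := fun f g => by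
    ext q
    change (vwt p q.1 : ℂ) * (f q - g q) = (vwt p q.1 : ℂ) * f q - (vwt p q.1 : ℂ) * g q
    ring
  have hcon : ContractingWith (1 / 4) K := by
    refine ⟨by rw [div_lt_one (by norm_num)]; norm_num, LipschitzWith.of_dist_le_mul fun f g => ?_⟩
    rw [BoundedContinuousFunction.dist_le (by positivity)]
    intro q
    have e1 : volt 0 u (volt 1 v (E f)) q - volt 0 u (volt 1 v (E g)) q =
        volt 0 u (volt 1 v (E (f - g))) q := by
      rw [← volt_sub le_rfl hu hui (hVc f) (hVc g) (hVb f) (hVb g), hE_sub]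
      congr 1
      ext q
      rw [volt_sub zero_le_one hv hvi (hEc f) (hEc g) (hEb f) (hEb g)]
    have e2 : K f q - K g q = ((vwt p q.1)⁻¹ : ℂ) * volt 0 u (volt 1 v (E (f - g))) q := by
      rw [hK, hK, ← e1]; ring
    rw [dist_eq_norm, e2, norm_mul, norm_inv, Complex.norm_real, Real.norm_of_nonneg (hw0 _).le,
      dist_eq_norm]
    calc _ ≤ (vwt p q.1)⁻¹ * (‖f - g‖ / 4 * vwt p q.1) := by
          have := inv_pos.2 (hw0 q.1)
          gcongr
          exact hUw _ q
      _ = (vwt p q.1)⁻¹ * vwt p q.1 * (‖f - g‖ / 4) := by ring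
      _ = _ := by
          rw [inv_mul_cancel₀ (hw0 q.1).ne']
          push_cast; ring
  set f := ContractingWith.fixedPoint K hcon with hf
  have hfix : K f = f := hcon.fixedPoint_isFixedPt
  have hdE : ∀ g : BoundedContinuousFunction (ℝ × ℂ) ℂ,
      (∀ y (l : ℂ), 0 < l.im → DifferentiableAt ℂ (fun l => g (y, l)) l) →
      ∀ y (l : ℂ), 0 < l.im → DifferentiableAt ℂ (fun l => E g (y, l)) l := fun g hg y l hl =>
    (hg y l hl).const_mul (vwt p y : ℂ)
  have hdK : ∀ g : BoundedContinuousFunction (ℝ × ℂ) ℂ,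
      (∀ y (l : ℂ), 0 < l.im → DifferentiableAt ℂ (fun l => g (y, l)) l) →
      ∀ y (l : ℂ), 0 < l.im → DifferentiableAt ℂ (fun l => K g (y, l)) l := fun g hg y l hl => by
    have h1 : ∀ y (l : ℂ), 0 < l.im → DifferentiableAt ℂ (fun l => volt 1 v (E g) (y, l)) l :=
      fun y l hl => differentiableAt_volt zero_le_one hv hvi (hEc g) (hEb g) (hdE g hg) y hl
    exact ((differentiableAt_volt le_rfl hu hui (hVc g) (hVb g) h1 y hl).const_add 1).const_mul
      ((vwt p y)⁻¹ : ℂ)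
  have hdit : ∀ n y (l : ℂ), 0 < l.im → DifferentiableAt ℂ (fun l => (K^[n] 0) (y, l)) l := by
    intro n
    induction n with
    | zero => intro y l _; exact differentiableAt_const (0 : ℂ)
    | succ n ih =>
      rw [Function.iterate_succ_apply']
      exact hdK _ ih
  have hlim : Tendsto (fun n => K^[n] 0) atTop (𝓝 f) := hcon.tendsto_iterate_fixedPoint 0
  rw [BoundedContinuousFunction.tendsto_iff_tendstoUniformly] at hlim
  have hdf : ∀ y (l : ℂ), 0 < l.im → DifferentiableAt ℂ (fun l => f (y, l)) l := by
    intro y l hl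
    have hU : IsOpen {l : ℂ | 0 < l.im} := isOpen_lt continuous_const Complex.continuous_im
    have h1 : TendstoLocallyUniformlyOn (fun n l => (K^[n] 0) (y, l)) (fun l => f (y, l)) atTop
        {l : ℂ | 0 < l.im} :=
      ((hlim.comp fun l : ℂ => (y, l)).tendstoUniformlyOn).tendstoLocallyUniformlyOn
    have h2 := h1.differentiableOn (Eventually.of_forall fun n l hl =>
      (hdit n y l hl).differentiableWithinAt) hU
    exact h2.differentiableAt (hU.mem_nhds hl)
  refine ⟨E f, hEc f, ⟨_, hEb f⟩, hdE f hdf, fun q => ?_⟩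
  have := hK f q
  rw [hfix] at this
  have h0 : (vwt p q.1 : ℂ) ≠ 0 := by exact_mod_cast (hw0 q.1).ne'
  change (vwt p q.1 : ℂ) * f q = _
  rw [this, mul_inv_cancel_left₀ h0]

end Volterra

/-! ## The spectral problem in the upper half plane -/

/-- Infinity of the closed upper half plane. -/
def infUpper : Filter ℂ := Bornology.cobounded ℂ ⊓ 𝓟 {l | 0 ≤ l.im}

/-- Dominated convergence along `infUpper` requires countable generation. -/
instance : infUpper.IsCountablyGenerated := by
  rw [infUpper, ← comap_norm_atTop]; infer_instance

lemma eventually_infUpper_im : ∀ᶠ l in infUpper, (0 : ℝ) ≤ l.im :=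
  eventually_inf_principal.2 (Eventually.of_forall fun _ h => h)

lemma tendsto_norm_infUpper : Tendsto (fun l : ℂ => ‖l‖) infUpper atTop :=
  tendsto_norm_cobounded_atTop.mono_left inf_le_left

/-- Solution of the spectral problem `m₁' = u m₂`, `m₂' = -2iλ m₂ + v m₁`, in the upper half plane
of `λ`, normalised at `x → +∞`. -/
structure UpperSol (u v : ℝ → ℂ) (m1 m2 : ℝ → ℂ → ℂ) : Prop where
  ode1 : ∀ x (l : ℂ), 0 ≤ l.im → HasDerivAt (fun x => m1 x l) (u x * m2 x l) x
  ode2 : ∀ x (l : ℂ), 0 ≤ l.im →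
    HasDerivAt (fun x => m2 x l) (-2 * Complex.I * l * m2 x l + v x * m1 x l) x
  top1 : ∀ l : ℂ, Tendsto (fun x => m1 x l) atTop (𝓝 1)
  top2 : ∀ l : ℂ, Tendsto (fun x => m2 x l) atTop (𝓝 0)
  cont1 : ∀ x, Continuous (m1 x)
  cont2 : ∀ x, Continuous (m2 x)
  diff1 : ∀ x (l : ℂ), 0 < l.im → DifferentiableAt ℂ (m1 x) l
  diff2 : ∀ x (l : ℂ), 0 < l.im → DifferentiableAt ℂ (m2 x) l
  bdd : ∃ C, ∀ x (l : ℂ), ‖m1 x l‖ ≤ C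
  inf1 : ∀ x, Tendsto (m1 x) infUpper (𝓝 1)
  inf2 : ∀ x, Tendsto (m2 x) infUpper (𝓝 0)

/-- Large-`λ` bound for the second component, by one integration by parts. -/
lemma norm_le_of_ode {v g n : ℝ → ℂ} {l : ℂ} (hl : 0 ≤ l.im) (hl0 : l ≠ 0) {K C x R : ℝ}
    (hxR : x ≤ R) (hK : ∀ y ∈ Set.Icc x R, ‖deriv (fun y => v y * g y) y‖ ≤ K)
    (hd : ∀ y, DifferentiableAt ℝ (fun y => v y * g y) y) (hC : ∀ y ∈ Set.Icc x R, ‖v y * g y‖ ≤ C)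
    (hn : ∀ y, HasDerivAt n (-2 * Complex.I * l * n y + v y * g y) y) :
    ‖n x‖ ≤ ‖n R‖ + (2 * C + K * (R - x)) / ‖l‖ := by
  have hc0 : 2 * Complex.I * l ≠ 0 := mul_ne_zero (mul_ne_zero two_ne_zero Complex.I_ne_zero) hl0
  have hnc : ‖2 * Complex.I * l‖ = 2 * ‖l‖ := by simp
  have hl1 : 0 < ‖l‖ := norm_pos_iff.2 hl0
  set w : ℝ → ℂ := fun y => n y - v y * g y / (2 * Complex.I * l) with hw
  set ψ : ℝ → ℂ := fun y => Complex.exp (2 * Complex.I * l * (y - x : ℝ)) * w y with hψ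
  have hψd : ∀ y, HasDerivAt ψ (Complex.exp (2 * Complex.I * l * (y - x : ℝ)) *
      (-(deriv (fun y => v y * g y) y) / (2 * Complex.I * l))) y := by
    intro y
    have h1 := (hn y).fun_sub ((hd y).hasDerivAt.div_const (2 * Complex.I * l))
    have h2 : HasDerivAt (fun y : ℝ => Complex.exp (2 * Complex.I * l * (y - x : ℝ)))
        (Complex.exp (2 * Complex.I * l * (y - x : ℝ)) * (2 * Complex.I * l)) y := by
      have := ((((hasDerivAt_id' y).sub_const x).ofReal_comp).const_mul (2 * Complex.I * l)).cexp
      exact this.congr_deriv (by simp)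
    refine (h2.fun_mul h1).congr_deriv ?_
    field_simp
    ring
  have hexp : ∀ y, x ≤ y → ‖Complex.exp (2 * Complex.I * l * (y - x : ℝ))‖ ≤ 1 := by
    intro y hy
    rw [Complex.norm_exp, Real.exp_le_one_iff]
    have : (2 * Complex.I * l * (y - x : ℝ)).re = -(2 * l.im * (y - x)) := by
      rw [Complex.re_mul_ofReal]; simp
    rw [this, neg_nonpos]
    exact mul_nonneg (by positivity) (sub_nonneg.2 hy)
  have h1 := Convex.norm_image_sub_le_of_norm_hasDerivWithin_le (f := ψ) (s := Set.Icc x R)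
    (C := K / (2 * ‖l‖)) (fun y _ => (hψd y).hasDerivWithinAt) (fun y hy => by
      rw [norm_mul, norm_div, norm_neg, hnc]
      calc _ ≤ 1 * (K / (2 * ‖l‖)) := by
            gcongr
            · exact hexp y hy.1
            · exact hK y hy
        _ = _ := one_mul _) (convex_Icc x R) (Set.right_mem_Icc.2 hxR) (Set.left_mem_Icc.2 hxR)
  have e1 : ψ x = w x := by simp [hψ]
  have h2 : ‖ψ R‖ ≤ ‖w R‖ := by
    rw [hψ]; simp only [norm_mul]
    exact mul_le_of_le_one_left (norm_nonneg _) (hexp R hxR)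
  have h3 : ‖w x‖ ≤ ‖ψ R‖ + K / (2 * ‖l‖) * (R - x) := by
    have h4 : ‖(x - R : ℝ)‖ = R - x := by
      rw [Real.norm_eq_abs, abs_sub_comm, abs_of_nonneg (sub_nonneg.2 hxR)]
    rw [h4, e1] at h1
    have := norm_le_norm_add_norm_sub' (w x) (ψ R)
    linarith
  have h5 : ∀ y ∈ Set.Icc x R, ‖v y * g y / (2 * Complex.I * l)‖ ≤ C / (2 * ‖l‖) := by
    intro y hy
    rw [norm_div, hnc]
    gcongr
    exact hC y hy
  have h6 : ‖n x‖ ≤ ‖w x‖ + C / (2 * ‖l‖) := by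
    have := norm_add_le (w x) (v x * g x / (2 * Complex.I * l))
    rw [show w x + v x * g x / (2 * Complex.I * l) = n x by simp [hw]] at this
    linarith [h5 x (Set.left_mem_Icc.2 hxR)]
  have h7 : ‖w R‖ ≤ ‖n R‖ + C / (2 * ‖l‖) := by
    have := norm_sub_le (n R) (v R * g R / (2 * Complex.I * l))
    linarith [h5 R (Set.right_mem_Icc.2 hxR)]
  have hK0 : 0 ≤ K := (norm_nonneg _).trans (hK x (Set.left_mem_Icc.2 hxR))
  have hC0 : 0 ≤ C := (norm_nonneg _).trans (hC x (Set.left_mem_Icc.2 hxR))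
  have h8 : K / (2 * ‖l‖) * (R - x) ≤ K * (R - x) / ‖l‖ := by
    rw [div_mul_eq_mul_div]
    have := mul_nonneg hK0 (sub_nonneg.2 hxR)
    gcongr
    linarith
  have h9 : (2 * C + K * (R - x)) / ‖l‖ = C / (2 * ‖l‖) + C / (2 * ‖l‖) + C / ‖l‖ +
      K * (R - x) / ‖l‖ := by field_simp; ring
  have : 0 ≤ C / ‖l‖ := by positivity
  rw [h9]
  linarith

/-- The first component is the fixed point m and the second is minus its inner Volterra integral.
For λ → ∞ the latter tends to zero: beyond a large R the tail of ∫|v| is small uniformly in λ, and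
on [x, R] an integration by parts, which needs v of class C¹, gains 1/|λ|. Dominated convergence
then gives the limit of m. -/
theorem exists_upperSol {u v : ℝ → ℂ} (hu : Continuous u) (hv : ContDiff ℝ 1 v)
    (hui : Integrable u) (hvi : Integrable v) : ∃ m1 m2, UpperSol u v m1 m2 := by
  have hvc := hv.continuous
  obtain ⟨m, hmc, ⟨C, hC⟩, hmd, hm⟩ := exists_volt_fixedPoint hu hvc hui hvi
  set V := volt 1 v m with hV
  have hVc : Continuous V := continuous_volt zero_le_one hvc hvi hmc hC
  obtain ⟨D, hD⟩ : ∃ D, ∀ p, ‖V p‖ ≤ D := by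
    refine ⟨∫ y, ‖v y‖ * C, fun p => (norm_volt_le zero_le_one
      (hvi.norm.mul_const C).integrableOn (fun y => ?_)).trans
      (setIntegral_le_integral (hvi.norm.mul_const C) (Eventually.of_forall fun y => ?_))⟩
    · gcongr
      exact hC _
    · exact mul_nonneg (norm_nonneg _) ((norm_nonneg _).trans (hC 0))
  have hC0 : 0 ≤ C := (norm_nonneg _).trans (hC 0)
  have hD0 : 0 ≤ D := (norm_nonneg _).trans (hD 0)
  have ode1 : ∀ x (l : ℂ), 0 ≤ l.im → HasDerivAt (fun x => m (x, l)) (u x * -V (x, l)) x := by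
    intro x l hl
    have h1 := (hasDerivAt_volt le_rfl hu hui hVc (fun y => hD (y, l)) hl x).const_add 1
    rw [show (fun x => m (x, l)) = fun x => 1 + volt 0 u V (x, l) from funext fun x => hm (x, l)]
    exact h1.congr_deriv (by simp)
  have ode2 : ∀ x (l : ℂ), 0 ≤ l.im → HasDerivAt (fun x => -V (x, l))
      (-2 * Complex.I * l * -V (x, l) + v x * m (x, l)) x := by
    intro x l hl
    have h1 := (hasDerivAt_volt zero_le_one hvc hvi hmc (fun y => hC (y, l)) hl x).fun_neg
    exact h1.congr_deriv (by rw [hV]; push_cast; ring)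
  have inf2 : ∀ x, Tendsto (fun l => -V (x, l)) infUpper (𝓝 0) := by
    intro x
    rw [Metric.tendsto_nhds]
    intro ε hε
    have h1 := (tendsto_integral_Ioi_zero (hvi.norm.mul_const C)).eventually (gt_mem_nhds (half_pos hε))
    obtain ⟨R, hR, hxR⟩ := (h1.and (eventually_ge_atTop x)).exists
    have hvd : Continuous (deriv v) := hv.continuous_deriv le_rfl
    obtain ⟨b0, hb0⟩ := (isCompact_Icc (a := x) (b := R)).exists_bound_of_continuousOn hvc.continuousOn
    obtain ⟨b1, hb1⟩ := (isCompact_Icc (a := x) (b := R)).exists_bound_of_continuousOn hvd.continuousOn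
    obtain ⟨b2, hb2⟩ := (isCompact_Icc (a := x) (b := R)).exists_bound_of_continuousOn hu.continuousOn
    have hb0' : 0 ≤ b0 := (norm_nonneg _).trans (hb0 x (Set.left_mem_Icc.2 hxR))
    have hb1' : 0 ≤ b1 := (norm_nonneg _).trans (hb1 x (Set.left_mem_Icc.2 hxR))
    have hb2' : 0 ≤ b2 := (norm_nonneg _).trans (hb2 x (Set.left_mem_Icc.2 hxR))
    have h2 : Tendsto (fun l : ℂ => (2 * (b0 * C) + (b1 * C + b0 * (b2 * D)) * (R - x)) / ‖l‖)
        infUpper (𝓝 0) := tendsto_norm_infUpper.const_div_atTop _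
    filter_upwards [h2.eventually (gt_mem_nhds (half_pos hε)), eventually_infUpper_im,
      tendsto_norm_infUpper.eventually (eventually_gt_atTop 0)] with l hl1 hl2 hl3
    have hprod : ∀ y, HasDerivAt (fun y => v y * m (y, l))
        (deriv v y * m (y, l) + v y * (u y * -V (y, l))) y := fun y =>
      ((hv.differentiable one_ne_zero y).hasDerivAt).fun_mul (ode1 y l hl2)
    have h3 := norm_le_of_ode (n := fun y => -V (y, l)) (g := fun y => m (y, l)) (v := v) hl2
      (norm_pos_iff.1 hl3) hxR (K := b1 * C + b0 * (b2 * D)) (C := b0 * C) (fun y hy => by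
        rw [(hprod y).deriv]
        refine (norm_add_le _ _).trans ?_
        rw [norm_mul, norm_mul, norm_mul, norm_neg]
        gcongr
        · exact hb1 y hy
        · exact hC _
        · exact hb0 y hy
        · exact hb2 y hy
        · exact hD _) (fun y => (hprod y).differentiableAt) (fun y hy => by
        rw [norm_mul]
        gcongr
        · exact hb0 y hy
        · exact hC _) (fun y => ode2 y l hl2)
    have h4 : ‖-V (R, l)‖ ≤ ∫ y in Set.Ioi R, ‖v y‖ * C := by
      rw [norm_neg]
      refine norm_volt_le zero_le_one (p := (R, l)) (hvi.norm.mul_const C).integrableOn fun y => ?_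
      gcongr
      exact hC _
    rw [dist_zero_right]
    linarith
  refine ⟨fun x l => m (x, l), fun x l => -V (x, l), ode1, ode2, fun l => ?_, fun l => ?_,
    fun x => by fun_prop, fun x => by fun_prop, hmd, fun x l hl => ?_,
    ⟨C, fun x l => hC _⟩, fun x => ?_, inf2⟩
  · simp only [hm]
    simpa using (tendsto_volt le_rfl hui (fun y => hD (y, l))).const_add 1
  · simpa using (tendsto_volt zero_le_one hvi (fun y => hC (y, l))).neg
  · exact (differentiableAt_volt zero_le_one hvc hvi hmc hC hmd x hl).neg
  · have h1 : Tendsto (fun l => volt 0 u V (x, l)) infUpper (𝓝 (∫ y in Set.Ioi x, 0)) := by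
      refine tendsto_integral_filter_of_dominated_convergence (fun y => ‖u y‖ * D) ?_ ?_
        (hui.norm.mul_const D).integrableOn ?_
      · exact Eventually.of_forall fun l =>
          (integrableOn_volt le_rfl hu hui hVc (fun y => hD (y, l)) x).aestronglyMeasurable
      · refine Eventually.of_forall fun l => (ae_restrict_iff' measurableSet_Ioi).2
          (Eventually.of_forall fun y hy => ?_)
        refine (norm_volt_integrand_le le_rfl hy l).trans ?_
        gcongr
        exact hD _
      · refine (ae_restrict_iff' measurableSet_Ioi).2 (Eventually.of_forall fun y hy => ?_)
        have h2 : Tendsto (fun l => ‖u y‖ * ‖V (y, l)‖) infUpper (𝓝 0) := by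
          simpa using ((inf2 y).norm.const_mul ‖u y‖)
        exact squeeze_zero_norm (fun l => norm_volt_integrand_le le_rfl hy l) h2
    rw [integral_zero] at h1
    have h2 : (fun l => m (x, l)) = fun l => 1 + volt 0 u V (x, l) := funext fun l => hm (x, l)
    rw [h2]
    simpa using h1.const_add 1

/-! ## Existence of the Jost columns -/

/-- A potential of the spectral problem at a fixed time. -/
structure IsPotential (p : ℝ → ℂ) : Prop where
  contDiff : ContDiff ℝ 2 p
  int : Integrable p
  int_deriv : Integrable (deriv p)
  top : Tendsto p atTop (𝓝 0)
  bot : Tendsto p atBot (𝓝 0)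

/-- The reflected potential. -/
def refl (p : ℝ → ℂ) (y : ℝ) : ℂ := conj (p (-y))

namespace IsPotential

variable {p : ℝ → ℂ} (hp : IsPotential p)
include hp

lemma hasDerivAt (x : ℝ) : HasDerivAt p (deriv p x) x :=
  (hp.contDiff.differentiable two_ne_zero x).hasDerivAt

lemma contDiff_deriv : ContDiff ℝ 1 (deriv p) :=
  (contDiff_succ_iff_deriv (n := 1).1 hp.contDiff).2.2

lemma refl : IsPotential (refl p) := by
  have hd : deriv (DNLS.refl p) = fun y => -conj (deriv p (-y)) := by
    ext y
    have h1 := (hp.hasDerivAt (-y)).scomp y (hasDerivAt_neg y)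
    have h2 : HasDerivAt (DNLS.refl p) _ y := h1.star
    rw [h2.deriv]
    simp
  refine ⟨?_, ?_, ?_, ?_, ?_⟩
  · exact Complex.conjCLE.contDiff.comp (hp.contDiff.comp contDiff_neg)
  · exact Complex.conjCLE.toContinuousLinearMap.integrable_comp hp.int.comp_neg
  · rw [hd]
    exact (Complex.conjCLE.toContinuousLinearMap.integrable_comp hp.int_deriv.comp_neg).neg
  · have := (Complex.continuous_conj.tendsto 0).comp (hp.bot.comp tendsto_neg_atTop_atBot)
    rwa [map_zero] at this
  · have := (Complex.continuous_conj.tendsto 0).comp (hp.top.comp tendsto_neg_atBot_atTop)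
    rwa [map_zero] at this

lemma bounded : ∃ C, 0 < C ∧ ∀ x, ‖p x‖ ≤ C := by
  have h : Tendsto p (cocompact ℝ) (𝓝 0) := by
    rw [cocompact_eq_atBot_atTop]
    exact hp.bot.sup hp.top
  let f : ZeroAtInftyContinuousMap ℝ ℂ := ⟨⟨p, hp.contDiff.continuous⟩, h⟩
  refine ⟨‖f.toBCF‖ + 1, by positivity, fun x => ?_⟩
  exact (f.toBCF.norm_coe_le_norm x).trans (by linarith)

end IsPotential

/-- The Jost solution at `x → +∞` in the variable `λ = k²`: the column `e^{iθ} (a, n / k)`. -/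
structure UpperJost (p : ℝ → ℂ) (a n : ℝ → ℂ → ℂ) : Prop where
  ode1 : ∀ x (l : ℂ), 0 ≤ l.im → HasDerivAt (fun x => a x l) (p x * n x l) x
  ode2 : ∀ x (l : ℂ), 0 ≤ l.im →
    HasDerivAt (fun x => n x l) (-2 * Complex.I * l * n x l - l * conj (p x) * a x l) x
  top1 : ∀ l : ℂ, Tendsto (fun x => a x l) atTop (𝓝 1)
  top2 : ∀ l : ℂ, Tendsto (fun x => n x l) atTop (𝓝 0)
  cont1 : ∀ x, Continuous (a x)
  cont2 : ∀ x, Continuous (n x)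
  diff1 : ∀ x (l : ℂ), 0 < l.im → DifferentiableAt ℂ (a x) l
  diff2 : ∀ x (l : ℂ), 0 < l.im → DifferentiableAt ℂ (n x) l
  bdd : ∃ C, ∀ x (l : ℂ), ‖a x l‖ ≤ C
  inf : ∀ x, ∃ e c : ℂ, ‖e‖ = 1 ∧ Tendsto (a x) infUpper (𝓝 e) ∧ Tendsto (n x) infUpper (𝓝 c)

/-- The coefficient λ conj(p) grows with λ. The substitution n = m + (i/2) conj(p) a removes it, at
the price of a derivative of p. The phases e^{∓iS/2} on a and m, with S(x) the integral of |p|² over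
(x, ∞), remove the remaining diagonal terms i|p|²/2. What is left is a system as in `UpperSol` with
integrable coefficients; the limit of a as λ → ∞ is the phase, of modulus one. -/
theorem IsPotential.exists_upperJost {p : ℝ → ℂ} (hp : IsPotential p) :
    ∃ a n, UpperJost p a n := by
  obtain ⟨M, hM0, hM⟩ := hp.bounded
  have hpc := hp.contDiff.continuous
  have hsq : Integrable fun y => ‖p y‖ ^ 2 := by
    refine (hp.int.norm.const_mul M).mono' (by fun_prop) (Eventually.of_forall fun y => ?_)
    rw [Real.norm_of_nonneg (by positivity), sq]
    exact mul_le_mul_of_nonneg_right (hM y) (norm_nonneg _)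
  set S : ℝ → ℝ := fun x => ∫ y in Set.Ioi x, ‖p y‖ ^ 2 with hS
  have hSd : ∀ x, HasDerivAt S (-‖p x‖ ^ 2) x := by
    intro x
    have h1 : S = fun x => S 0 - ∫ y in (0 : ℝ)..x, ‖p y‖ ^ 2 := by
      ext x
      have := intervalIntegral.integral_interval_add_Ioi (hsq.integrableOn (s := Set.Ioi 0))
        (hsq.integrableOn (s := Set.Ioi x))
      simp only [hS]
      rw [← this]; ring
    rw [h1]
    exact ((Continuous.integral_hasStrictDerivAt (by fun_prop) 0 x).hasDerivAt.const_sub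
      _).congr_deriv (by ring)
  set ph : ℝ → ℝ → ℂ := fun m x => Complex.exp (Complex.I * (m * S x : ℝ)) with hph
  have hphn : ∀ m x, ‖ph m x‖ = 1 := fun m x => by
    rw [hph]; simp only; rw [mul_comm]; exact Complex.norm_exp_ofReal_mul_I _
  have hphd : ∀ m x, HasDerivAt (ph m) (-(Complex.I * m * (p x * conj (p x))) * ph m x) x := by
    intro m x
    have h1 := ((((hSd x).const_mul m).ofReal_comp).const_mul Complex.I).cexp
    refine h1.congr_deriv ?_
    rw [Complex.mul_conj']
    simp only [hph]; push_cast; ring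
  have hphmul : ∀ m m' x, ph m x * ph m' x = ph (m + m') x := by
    intro m m' x
    rw [hph]; simp only
    rw [← Complex.exp_add]; congr 1; push_cast; ring
  have hph0 : ∀ x, ph 0 x = 1 := fun x => by simp [hph]
  have hphC : ∀ m, ContDiff ℝ 1 (ph m) := by
    intro m
    rw [contDiff_one_iff_deriv]
    have hc : Continuous (ph m) := continuous_iff_continuousAt.2 fun x => (hphd m x).continuousAt
    refine ⟨fun x => (hphd m x).differentiableAt, ?_⟩
    rw [funext fun x => (hphd m x).deriv]
    have := Complex.continuous_conj
    fun_prop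
  set w : ℝ → ℂ := fun x => -(Complex.I / 2) * conj (deriv p x) + 1 / 4 * (p x * conj (p x) * conj (p x))
    with hw
  have hcj : ∀ f : ℝ → ℂ, ContDiff ℝ 1 f → ContDiff ℝ 1 fun x => conj (f x) := fun f hf =>
    Complex.conjCLE.contDiff.comp hf
  have hp1 : ContDiff ℝ 1 p := hp.contDiff.of_le (by norm_num)
  have hwC : ContDiff ℝ 1 w :=
    (contDiff_const.mul (hcj _ hp.contDiff_deriv)).add
      (contDiff_const.mul ((hp1.mul (hcj _ hp1)).mul (hcj _ hp1)))
  have hui : Integrable fun x => p x * ph 1 x := by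
    refine hp.int.norm.mono' ?_ (Eventually.of_forall fun y => ?_)
    · exact (hpc.mul (hphC 1).continuous).aestronglyMeasurable
    · rw [norm_mul, hphn, mul_one]
  have hvi : Integrable fun x => ph (-1) x * w x := by
    refine ((hp.int_deriv.norm.const_mul (1 / 2)).add (hp.int.norm.const_mul (1 / 4 * M ^ 2))).mono'
      (((hphC (-1)).mul hwC).continuous).aestronglyMeasurable (Eventually.of_forall fun y => ?_)
    rw [norm_mul, hphn, one_mul]
    refine (norm_add_le _ _).trans ?_
    simp only [norm_mul, norm_neg, norm_div, Complex.norm_I, Complex.norm_conj, norm_one,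
      Pi.add_apply]
    have h3 : ‖p y‖ * ‖p y‖ ≤ M * M := mul_le_mul (hM y) (hM y) (norm_nonneg _) hM0.le
    have h4 := mul_le_mul_of_nonneg_right h3 (norm_nonneg (p y))
    norm_num
    linarith
  obtain ⟨m1, m2, h⟩ := exists_upperSol (u := fun x => p x * ph 1 x) (v := fun x => ph (-1) x * w x)
    (hpc.mul (hphC 1).continuous) ((hphC (-1)).mul hwC) hui hvi
  have hStop : Tendsto S atTop (𝓝 0) := tendsto_integral_Ioi_zero hsq
  have hphtop : ∀ m, Tendsto (ph m) atTop (𝓝 1) := by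
    intro m
    have h1 : Tendsto (fun x => Complex.I * ((m * S x : ℝ) : ℂ)) atTop (𝓝 (Complex.I * ((m * 0 : ℝ) : ℂ))) :=
      ((Complex.continuous_ofReal.tendsto _).comp (hStop.const_mul m)).const_mul _
    have h2 := (Complex.continuous_exp.tendsto _).comp h1
    rw [mul_zero, Complex.ofReal_zero, mul_zero, Complex.exp_zero] at h2
    exact h2
  set a : ℝ → ℂ → ℂ := fun x l => ph (-1 / 2) x * m1 x l with ha
  set m : ℝ → ℂ → ℂ := fun x l => ph (1 / 2) x * m2 x l with hm
  set n : ℝ → ℂ → ℂ := fun x l => m x l + Complex.I / 2 * conj (p x) * a x l with hn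
  have ode1 : ∀ x (l : ℂ), 0 ≤ l.im → HasDerivAt (fun x => a x l) (p x * n x l) x := by
    intro x l hl
    refine ((hphd (-1 / 2) x).fun_mul (h.ode1 x l hl)).congr_deriv ?_
    simp only [hn, hm, ha]
    have e1 := hphmul (-1 / 2) 1 x
    norm_num at e1 ⊢
    linear_combination (p x * m2 x l) * e1
  have odem : ∀ x (l : ℂ), 0 ≤ l.im → HasDerivAt (fun x => m x l)
      (-(Complex.I / 2 * (p x * conj (p x))) * m x l - 2 * Complex.I * l * m x l + w x * a x l) x := by
    intro x l hl
    refine ((hphd (1 / 2) x).fun_mul (h.ode2 x l hl)).congr_deriv ?_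
    simp only [hm, ha]
    have e1 := hphmul (1 / 2) (-1) x
    norm_num at e1 ⊢
    linear_combination (w x * m1 x l) * e1
  have ode2 : ∀ x (l : ℂ), 0 ≤ l.im →
      HasDerivAt (fun x => n x l) (-2 * Complex.I * l * n x l - l * conj (p x) * a x l) x := by
    intro x l hl
    have hpd : HasDerivAt (fun x => conj (p x)) (conj (deriv p x)) x := (hp.hasDerivAt x).star
    refine ((odem x l hl).fun_add ((hpd.const_mul (Complex.I / 2)).fun_mul (ode1 x l hl))).congr_deriv ?_
    simp only [hn, hw]
    linear_combination (p x * conj (p x) ^ 2 * a x l / 4 + l * conj (p x) * a x l) *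
      Complex.I_sq
  have hma : ∀ m x (e : ℂ), Tendsto (fun l : ℂ => ph m x * e) infUpper (𝓝 (ph m x * e)) :=
    fun m x e => tendsto_const_nhds
  refine ⟨a, n, ode1, ode2, fun l => ?_, fun l => ?_, fun x => ?_, fun x => ?_, fun x l hl => ?_,
    fun x l hl => ?_, ?_, fun x => ?_⟩
  · simpa using (hphtop (-1 / 2)).mul (h.top1 l)
  · have h1 : Tendsto (fun x => conj (p x)) atTop (𝓝 (conj 0)) :=
      (Complex.continuous_conj.tendsto _).comp hp.top
    have h2 := ((hphtop (1 / 2)).mul (h.top2 l)).add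
      ((h1.const_mul (Complex.I / 2)).mul ((hphtop (-1 / 2)).mul (h.top1 l)))
    rw [map_zero, mul_zero, mul_zero, zero_mul, add_zero] at h2
    exact h2
  · exact (h.cont1 x).const_mul _
  · exact ((h.cont2 x).const_mul _).add (((h.cont1 x).const_mul _).const_mul _)
  · exact (h.diff1 x l hl).const_mul _
  · exact ((h.diff2 x l hl).const_mul _).add (((h.diff1 x l hl).const_mul _).const_mul _)
  · obtain ⟨C, hC⟩ := h.bdd
    refine ⟨C, fun x l => ?_⟩
    rw [ha]; simp only [norm_mul, hphn, one_mul]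
    exact hC x l
  · have h1 := (h.inf1 x).const_mul (ph (-1 / 2) x)
    refine ⟨_, _, ?_, h1, ((h.inf2 x).const_mul _).add (h1.const_mul _)⟩
    rw [norm_mul, hphn, norm_one, mul_one]

namespace UpperJost

variable {p : ℝ → ℂ} {a n : ℝ → ℂ → ℂ} (h : UpperJost p a n)
include h

/-- The source in the equation for n carries a factor λ, and n vanishes at +∞, so integrating
e^{2iλ(y-x)} n over y > x gives a bound linear in |λ|. This is what makes n/k meaningful near k = 0.
-/
lemma exists_norm_le (hp : IsPotential p) (x : ℝ) :
    ∃ C, ∀ l : ℂ, 0 ≤ l.im → ‖n x l‖ ≤ C * ‖l‖ := by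
  obtain ⟨C, hC⟩ := h.bdd
  have hC0 : 0 ≤ C := (norm_nonneg _).trans (hC 0 0)
  refine ⟨C * ∫ y, ‖p y‖, fun l hl => ?_⟩
  set ψ : ℝ → ℂ := fun y => Complex.exp (2 * Complex.I * l * (y - x : ℝ)) * n y l with hψ
  have hψd : ∀ y, HasDerivAt ψ
      (Complex.exp (2 * Complex.I * l * (y - x : ℝ)) * -(l * conj (p y) * a y l)) y := by
    intro y
    have h2 : HasDerivAt (fun y : ℝ => Complex.exp (2 * Complex.I * l * (y - x : ℝ)))
        (Complex.exp (2 * Complex.I * l * (y - x : ℝ)) * (2 * Complex.I * l)) y := by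
      have := ((((hasDerivAt_id' y).sub_const x).ofReal_comp).const_mul (2 * Complex.I * l)).cexp
      exact this.congr_deriv (by simp)
    exact (h2.fun_mul (h.ode2 y l hl)).congr_deriv (by ring)
  have hexp : ∀ y, x ≤ y → ‖Complex.exp (2 * Complex.I * l * (y - x : ℝ))‖ ≤ 1 := by
    intro y hy
    rw [Complex.norm_exp, Real.exp_le_one_iff]
    have : (2 * Complex.I * l * (y - x : ℝ)).re = -(2 * l.im * (y - x)) := by
      rw [Complex.re_mul_ofReal]; simp
    rw [this, neg_nonpos]
    exact mul_nonneg (by positivity) (sub_nonneg.2 hy)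
  have hac : Continuous fun y => a y l := continuous_iff_continuousAt.2 fun y =>
    (h.ode1 y l hl).continuousAt
  have hpc := hp.contDiff.continuous
  have hcj := Complex.continuous_conj
  have key : ∀ R, x ≤ R → ‖n x l‖ ≤ ‖n R l‖ + C * (∫ y, ‖p y‖) * ‖l‖ := by
    intro R hR
    have h1 := intervalIntegral.integral_eq_sub_of_hasDerivAt (a := x) (b := R)
      (fun y _ => hψd y) (Continuous.intervalIntegrable (by fun_prop) _ _)
    have h2 : ‖ψ R - ψ x‖ ≤ ∫ y, ‖p y‖ * (C * ‖l‖) := by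
      rw [← h1, intervalIntegral.integral_of_le hR]
      refine (norm_integral_le_of_norm_le (g := fun y => ‖p y‖ * (C * ‖l‖))
        (hp.int.norm.mul_const _).integrableOn
        ((ae_restrict_iff' measurableSet_Ioc).2 (Eventually.of_forall fun y hy => ?_))).trans
        (setIntegral_le_integral (hp.int.norm.mul_const _) (Eventually.of_forall fun y => ?_))
      · rw [norm_mul, norm_neg, norm_mul, norm_mul, Complex.norm_conj]
        calc _ ≤ 1 * (‖l‖ * ‖p y‖ * C) := by
              gcongr
              · exact hexp y hy.1.le
              · exact hC _ _
          _ = _ := by ring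
      · positivity
    rw [integral_mul_const] at h2
    have h3 : ‖ψ R‖ ≤ ‖n R l‖ := by
      rw [hψ]; simp only [norm_mul]
      exact mul_le_of_le_one_left (norm_nonneg _) (hexp R hR)
    have h4 : ψ x = n x l := by simp [hψ]
    rw [h4, norm_sub_rev] at h2
    have := norm_le_norm_add_norm_sub' (n x l) (ψ R)
    linarith
  have h5 : Tendsto (fun R => ‖n R l‖ + C * (∫ y, ‖p y‖) * ‖l‖) atTop
      (𝓝 (0 + C * (∫ y, ‖p y‖) * ‖l‖)) := by
    simpa using (h.top2 l).norm.add_const (C * (∫ y, ‖p y‖) * ‖l‖)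
  rw [zero_add] at h5
  exact ge_of_tendsto h5 ((eventually_ge_atTop x).mono key)

lemma n_zero (hp : IsPotential p) (x : ℝ) : n x 0 = 0 := by
  obtain ⟨C, hC⟩ := h.exists_norm_le hp x
  simpa using hC 0 (by simp)

lemma a_zero (hp : IsPotential p) (x : ℝ) : a x 0 = 1 := by
  have hd : ∀ y, HasDerivAt (fun x => a x 0) 0 y := fun y =>
    (h.ode1 y 0 (by simp)).congr_deriv (by rw [h.n_zero hp, mul_zero])
  have h1 : (fun y => a y 0) = fun _ => a x 0 := funext fun y =>
    is_const_of_deriv_eq_zero (fun y => (hd y).differentiableAt) (fun y => (hd y).deriv) y x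
  have h2 := h.top1 0
  rw [h1] at h2
  exact tendsto_nhds_unique tendsto_const_nhds h2

end UpperJost

lemma sq_im (k : ℂ) : (k ^ 2).im = 2 * (k.re * k.im) := by
  rw [sq, Complex.mul_im]; ring

lemma isJostColumn_upperJost {q : ℝ → ℝ → ℂ} {t : ℝ} {a n : ℝ → ℂ → ℂ}
    (hp : IsPotential fun x => q x t) (h : UpperJost (fun x => q x t) a n) {k : ℂ}
    (hk : 0 ≤ k.re * k.im) :
    IsJostColumn q atTop 0 t k (fun x => bgExp 0 x t k • ![a x (k ^ 2), n x (k ^ 2) / k]) := by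
  have hl : 0 ≤ (k ^ 2).im := by rw [sq_im]; positivity
  -- At k = 0 the quotient is 0 by convention, and the identity survives because n vanishes at λ =
  -- 0.
  have hn : ∀ x, n x (k ^ 2) / k * k = n x (k ^ 2) := by
    intro x
    by_cases hk0 : k = 0
    · subst hk0; simp [h.n_zero hp]
    · field_simp
  constructor
  · refine isLaxSol_iff.2 fun x => ⟨?_, ?_⟩
    · refine (hasDerivAt_bgExp_zero.fun_mul (h.ode1 x _ hl)).congr_deriv ?_
      simp only [Pi.smul_apply, Matrix.cons_val_zero, Matrix.cons_val_one, smul_eq_mul]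
      linear_combination (-(q x t) * bgExp 0 x t k) * hn x
    · refine (hasDerivAt_bgExp_zero.fun_mul ((h.ode2 x _ hl).div_const k)).congr_deriv ?_
      simp only [Pi.smul_apply, Matrix.cons_val_zero, Matrix.cons_val_one, smul_eq_mul]
      by_cases hk0 : k = 0
      · subst hk0; simp
      · field_simp; ring
  · have h1 : ∀ x, (bgExp 0 x t k)⁻¹ • bgExp 0 x t k • ![a x (k ^ 2), n x (k ^ 2) / k] =
        ![a x (k ^ 2), n x (k ^ 2) / k] := fun x => inv_smul_smul₀ (Complex.exp_ne_zero _) _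
    simp only [h1]
    rw [tendsto_pi_nhds, Fin.forall_fin_two]
    refine ⟨by simpa using h.top1 _, by simpa using (h.top2 (k ^ 2)).div_const k⟩

/-- The reflection x ↦ -x with conjugation of the potential and exchange of the two entries turns
the normalisation at -∞ into the one at +∞. -/
lemma isJostColumn_upperJost_refl {q : ℝ → ℝ → ℂ} {t : ℝ} {a n : ℝ → ℂ → ℂ}
    (hp : IsPotential fun x => q x t) (h : UpperJost (refl fun x => q x t) a n) {k : ℂ}
    (hk : 0 ≤ k.re * k.im) :
    IsJostColumn q atBot 1 t k
      (fun x => bgExp 1 x t k • ![n (-x) (k ^ 2) / k, a (-x) (k ^ 2)]) := by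
  have hl : 0 ≤ (k ^ 2).im := by rw [sq_im]; positivity
  have hn : ∀ x, n x (k ^ 2) / k * k = n x (k ^ 2) := by
    intro x
    by_cases hk0 : k = 0
    · subst hk0; simp [h.n_zero hp.refl]
    · field_simp
  have hd1 : ∀ x, HasDerivAt (fun x => a (-x) (k ^ 2)) (-(conj (q x t) * n (-x) (k ^ 2))) x := by
    intro x
    refine ((h.ode1 (-x) _ hl).scomp x (hasDerivAt_neg x)).congr_deriv ?_
    simp [refl]
  have hd2 : ∀ x, HasDerivAt (fun x => n (-x) (k ^ 2))
      (2 * Complex.I * k ^ 2 * n (-x) (k ^ 2) + k ^ 2 * q x t * a (-x) (k ^ 2)) x := by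
    intro x
    refine ((h.ode2 (-x) _ hl).scomp x (hasDerivAt_neg x)).congr_deriv ?_
    simp [refl]; ring
  constructor
  · refine isLaxSol_iff.2 fun x => ⟨?_, ?_⟩
    · refine (hasDerivAt_bgExp_one.fun_mul ((hd2 x).div_const k)).congr_deriv ?_
      simp only [Pi.smul_apply, Matrix.cons_val_zero, Matrix.cons_val_one, smul_eq_mul]
      by_cases hk0 : k = 0
      · subst hk0; simp
      · field_simp; ring
    · refine (hasDerivAt_bgExp_one.fun_mul (hd1 x)).congr_deriv ?_
      simp only [Pi.smul_apply, Matrix.cons_val_zero, Matrix.cons_val_one, smul_eq_mul]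
      linear_combination (conj (q x t) * bgExp 1 x t k) * hn (-x)
  · have h1 : ∀ x, (bgExp 1 x t k)⁻¹ • bgExp 1 x t k • ![n (-x) (k ^ 2) / k, a (-x) (k ^ 2)] =
        ![n (-x) (k ^ 2) / k, a (-x) (k ^ 2)] := fun x => inv_smul_smul₀ (Complex.exp_ne_zero _) _
    simp only [h1]
    rw [tendsto_pi_nhds, Fin.forall_fin_two]
    refine ⟨by simpa using ((h.top2 (k ^ 2)).comp tendsto_neg_atBot_atTop).div_const k,
      (h.top1 (k ^ 2)).comp tendsto_neg_atBot_atTop⟩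

lemma IsZBCSolution.isPotential {q : ℝ → ℝ → ℂ} (h : IsZBCSolution q) (t : ℝ) :
    IsPotential fun x => q x t := by
  have hc : ContDiff ℝ 2 fun x => q x t :=
    h.contDiff.comp (contDiff_id.prodMk contDiff_const : ContDiff ℝ 2 fun x : ℝ => (x, t))
  obtain ⟨g, hg, hgb⟩ := h.decay |t|
  exact ⟨hc, hg.mono' hc.continuous.aestronglyMeasurable
      (Eventually.of_forall fun x => (hgb x t le_rfl).1),
    hg.mono' (hc.continuous_deriv (by norm_num)).aestronglyMeasurable
      (Eventually.of_forall fun x => (hgb x t le_rfl).2), h.tendsto_atTop t, h.tendsto_atBot t⟩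

lemma IsZBCSolution.hasJost {q : ℝ → ℝ → ℂ} (h : IsZBCSolution q) : HasJost q where
  continuous t := (h.isPotential t).contDiff.continuous
  top t z hz := by
    obtain ⟨a, n, hu⟩ := (h.isPotential t).exists_upperJost
    exact ⟨_, isJostColumn_upperJost (h.isPotential t) hu hz⟩
  bot t z hz := by
    obtain ⟨a, n, hu⟩ := (h.isPotential t).refl.exists_upperJost
    exact ⟨_, isJostColumn_upperJost_refl (h.isPotential t) hu hz⟩

/-! ## Evolution under the Lax pair -/

/-- Global solvability of a Lipschitz differential equation with time-dependent constant. -/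
theorem exists_hasDerivAt_of_lipschitz {E : Type*} [NormedAddCommGroup E] [NormedSpace ℝ E]
    [CompleteSpace E] {F : ℝ → E → E} {κ : ℝ → ℝ} (hF : Continuous fun p : ℝ × E => F p.1 p.2)
    (hκ : Continuous κ) (hκ0 : ∀ t, 0 ≤ κ t) (h0 : ∀ t, F t 0 = 0)
    (hL : ∀ t u v, ‖F t u - F t v‖ ≤ κ t * ‖u - v‖) (v₀ : E) :
    ∃ U : ℝ → E, U 0 = v₀ ∧ ∀ t, HasDerivAt U (F t (U t)) t := by
  set φ : ℝ → ℝ := fun t => 2 * ∫ s in (0 : ℝ)..t, κ s with hφ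
  have hφd : ∀ t, HasDerivAt φ (2 * κ t) t := fun t =>
    (hκ.integral_hasStrictDerivAt 0 t).hasDerivAt.const_mul 2
  have hφc : Continuous φ := continuous_iff_continuousAt.2 fun t => (hφd t).continuousAt
  -- This weight controls both directions of time: the integral of κ cosh φ is (sinh φ)/2, and
  -- |sinh| ≤ cosh, so the Picard map contracts with constant 1/2 on the whole line.
  set w : ℝ → ℝ := fun t => Real.cosh (φ t) with hw
  have hwc : Continuous w := Real.continuous_cosh.comp hφc
  have hw1 : ∀ t, 1 ≤ w t := fun t => Real.one_le_cosh _
  have hw0 : ∀ t, 0 < w t := fun t => Real.cosh_pos _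
  have hint : ∀ t, |∫ s in (0 : ℝ)..t, κ s * w s| ≤ w t / 2 := by
    intro t
    have hd : ∀ s, HasDerivAt (fun s => Real.sinh (φ s) / 2) (κ s * w s) s := fun s =>
      ((hφd s).sinh.div_const 2).congr_deriv (by simp only [hw]; ring)
    rw [intervalIntegral.integral_eq_sub_of_hasDerivAt (fun s _ => hd s)
      ((hκ.mul hwc).intervalIntegrable _ _)]
    have e1 : φ 0 = 0 := by simp [hφ]
    have e2 := Real.cosh_sub_sinh (φ t)
    have e3 := Real.cosh_add_sinh (φ t)
    have e4 := Real.exp_pos (φ t)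
    have e5 := Real.exp_pos (-φ t)
    rw [e1, Real.sinh_zero, abs_le]
    simp only [hw]
    constructor <;> linarith
  have hgc : ∀ f : BoundedContinuousFunction ℝ E, Continuous fun s => F s (w s • f s) := fun f =>
    hF.comp (continuous_id.prodMk (hwc.smul f.continuous))
  have hest : ∀ (f : BoundedContinuousFunction ℝ E) (G : ℝ → E) (_ : ∀ s, ‖G s‖ ≤ κ s * (w s * ‖f‖))
      (t : ℝ), ‖∫ s in (0 : ℝ)..t, G s‖ ≤ w t * (‖f‖ / 2) := by
    intro f G hG t
    have h1 := intervalIntegral.norm_integral_le_abs_of_norm_le (f := G) (a := 0) (b := t)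
      (μ := volume) (g := fun s => κ s * w s * ‖f‖)
      (Eventually.of_forall fun s => (hG s).trans_eq (by ring))
      (((hκ.mul hwc).mul_const ‖f‖).intervalIntegrable _ _)
    rw [intervalIntegral.integral_mul_const, abs_mul, abs_norm] at h1
    calc _ ≤ _ := h1
      _ ≤ w t / 2 * ‖f‖ := by gcongr; exact hint t
      _ = _ := by ring
  have hG0 : ∀ (f : BoundedContinuousFunction ℝ E) s, ‖F s (w s • f s)‖ ≤ κ s * (w s * ‖f‖) := by
    intro f s
    have := hL s (w s • f s) 0
    rw [h0, sub_zero, sub_zero, norm_smul, Real.norm_of_nonneg (hw0 s).le] at this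
    refine this.trans ?_
    have := hκ0 s
    have := (hw0 s).le
    gcongr
    exact f.norm_coe_le_norm s
  have hPc : ∀ f : BoundedContinuousFunction ℝ E, Continuous fun t =>
      (w t)⁻¹ • (v₀ + ∫ s in (0 : ℝ)..t, F s (w s • f s)) := fun f =>
    (hwc.inv₀ fun t => (hw0 t).ne').smul (continuous_const.add
      (continuous_iff_continuousAt.2 fun t =>
        ((hgc f).integral_hasStrictDerivAt 0 t).hasDerivAt.continuousAt))
  have hPb : ∀ (f : BoundedContinuousFunction ℝ E) t,
      ‖(w t)⁻¹ • (v₀ + ∫ s in (0 : ℝ)..t, F s (w s • f s))‖ ≤ ‖v₀‖ + ‖f‖ / 2 := by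
    intro f t
    rw [norm_smul, norm_inv, Real.norm_of_nonneg (hw0 t).le, inv_mul_le_iff₀ (hw0 t), mul_add]
    refine (norm_add_le _ _).trans (add_le_add ?_ (hest f _ (hG0 f) t))
    exact le_mul_of_one_le_left (norm_nonneg _) (hw1 t)
  let P : BoundedContinuousFunction ℝ E → BoundedContinuousFunction ℝ E := fun f =>
    BoundedContinuousFunction.ofNormedAddCommGroup _ (hPc f) _ (hPb f)
  have hP : ∀ f t, P f t = (w t)⁻¹ • (v₀ + ∫ s in (0 : ℝ)..t, F s (w s • f s)) := fun f t => rfl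
  have hcon : ContractingWith (1 / 2) P := by
    refine ⟨by rw [div_lt_one (by norm_num)]; norm_num, LipschitzWith.of_dist_le_mul fun f g => ?_⟩
    rw [BoundedContinuousFunction.dist_le (by positivity)]
    intro t
    have e : P f t - P g t = (w t)⁻¹ • ∫ s in (0 : ℝ)..t, (F s (w s • f s) - F s (w s • g s)) := by
      rw [hP, hP, ← smul_sub, intervalIntegral.integral_sub ((hgc f).intervalIntegrable _ _)
        ((hgc g).intervalIntegrable _ _)]
      congr 1; abel
    rw [dist_eq_norm, e, norm_smul, norm_inv, Real.norm_of_nonneg (hw0 t).le,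
      inv_mul_le_iff₀ (hw0 t), dist_eq_norm]
    refine (hest (f - g) _ (fun s => ?_) t).trans_eq (by push_cast; ring)
    refine (hL s _ _).trans ?_
    rw [← smul_sub, norm_smul, Real.norm_of_nonneg (hw0 s).le]
    have := hκ0 s
    have := (hw0 s).le
    gcongr
    exact (f - g).norm_coe_le_norm s
  set f := ContractingWith.fixedPoint P hcon
  have hfix : P f = f := hcon.fixedPoint_isFixedPt
  have hU : ∀ t, w t • f t = v₀ + ∫ s in (0 : ℝ)..t, F s (w s • f s) := by
    intro t
    have := hP f t
    rw [hfix] at this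
    conv_lhs => rw [this]
    rw [smul_inv_smul₀ (hw0 t).ne']
  refine ⟨fun t => w t • f t, by simp [hU 0], fun t => ?_⟩
  have h1 := ((hgc f).integral_hasStrictDerivAt 0 t).hasDerivAt.const_add v₀
  rwa [← show (fun t => w t • f t) = fun t => v₀ + ∫ s in (0 : ℝ)..t, F s (w s • f s) from
    funext hU] at h1

/-- The source is absorbed by adjoining ε as a constant second component, after which the
homogeneous Gronwall inequality applies. -/
lemma norm_le_exp_mul_of_norm_deriv_le_add {E : Type*} [NormedAddCommGroup E] [NormedSpace ℝ E]
    {φ φ' : ℝ → E} {K ε a b : ℝ} (hK0 : 0 ≤ K) (hε : 0 ≤ ε)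
    (hφ : ∀ x ∈ Set.uIcc a b, HasDerivAt φ (φ' x) x)
    (hK : ∀ x ∈ Set.uIcc a b, ‖φ' x‖ ≤ K * ‖φ x‖ + ε) :
    ‖φ b‖ ≤ (‖φ a‖ + ε) * Real.exp ((K + 1) * |b - a|) := by
  have h := norm_le_exp_mul_of_norm_deriv_le (φ := fun x => (φ x, ε)) (φ' := fun x => (φ' x, 0))
    (K := K + 1) (a := a) (b := b) (fun x hx => (hφ x hx).prodMk (hasDerivAt_const x ε))
    (fun x hx => by
      have h1 : ‖φ x‖ ≤ ‖(φ x, ε)‖ := norm_fst_le (φ x, ε)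
      have h2 : ‖ε‖ ≤ ‖(φ x, ε)‖ := norm_snd_le (φ x, ε)
      rw [Real.norm_of_nonneg hε] at h2
      rw [Prod.norm_def, norm_zero, max_eq_left (norm_nonneg _)]
      have := hK x hx
      have := mul_le_mul_of_nonneg_left h1 hK0
      linarith)
  have h1 : ‖φ b‖ ≤ ‖(φ b, ε)‖ := norm_fst_le (φ b, ε)
  have h2 : ‖(φ a, ε)‖ ≤ ‖φ a‖ + ε := by
    rw [Prod.norm_def, Real.norm_of_nonneg hε]
    exact max_le (by linarith) (by linarith [norm_nonneg (φ a)])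
  exact h1.trans (h.trans (by gcongr))

/-- The derivative varies little near x, uniformly on the compact set of times, and the mean value
inequality makes the first-order remainder uniform in t. -/
lemma eventually_norm_sub_sub_smul_le {E : Type*} [NormedAddCommGroup E] [NormedSpace ℝ E]
    {G G' : ℝ → ℝ → E} (hG : ∀ y t, HasDerivAt (fun y => G y t) (G' y t) y)
    (hc : Continuous fun p : ℝ × ℝ => G' p.1 p.2) {K : Set ℝ} (hK : IsCompact K) (x : ℝ) {ε : ℝ}
    (hε : 0 < ε) : ∀ᶠ y in 𝓝 x, ∀ t ∈ K, ‖G y t - G x t - (y - x) • G' x t‖ ≤ ε * |y - x| := by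
  have h1 : ∀ᶠ y in 𝓝 x, ∀ t ∈ K, ‖G' y t - G' x t‖ ≤ ε := by
    refine hK.eventually_forall_of_forall_eventually fun t _ => ?_
    have h2 : Continuous fun p : ℝ × ℝ => ‖G' p.1 p.2 - G' x p.2‖ :=
      (hc.sub (hc.comp (continuous_const.prodMk continuous_snd))).norm
    refine (h2.continuousAt (x := (x, t))).eventually (ge_mem_nhds ?_)
    simpa using hε
  obtain ⟨δ, hδ, hb⟩ := Metric.eventually_nhds_iff_ball.1 h1
  filter_upwards [Metric.ball_mem_nhds x hδ] with y hy t ht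
  have h3 := (convex_ball x δ).norm_image_sub_le_of_norm_hasDerivWithin_le
    (f := fun y => G y t - (y - x) • G' x t) (f' := fun y => G' y t - (1 : ℝ) • G' x t) (C := ε)
    (fun z _ => ((hG z t).sub (((hasDerivAt_id' z).sub_const x).smul_const _)).hasDerivWithinAt)
    (fun z hz => by rw [one_smul]; exact hb z hz t ht) (Metric.mem_ball_self hδ) hy
  simp only [sub_self, zero_smul, sub_zero] at h3
  rwa [sub_right_comm] at h3

/-- The action of a trace-free matrix. -/
def act (a b c : ℂ) (v : Fin 2 → ℂ) : Fin 2 → ℂ := ![a * v 0 + b * v 1, c * v 0 - a * v 1]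

lemma norm_act_le (a b c : ℂ) (v : Fin 2 → ℂ) : ‖act a b c v‖ ≤ (‖a‖ + ‖b‖ + ‖c‖) * ‖v‖ := by
  have h0 := norm_le_pi_norm v 0
  have h1 := norm_le_pi_norm v 1
  rw [pi_norm_le_iff_of_nonneg (by positivity), Fin.forall_fin_two]
  constructor
  · refine (norm_add_le _ _).trans ?_
    rw [norm_mul, norm_mul]
    calc _ ≤ ‖a‖ * ‖v‖ + ‖b‖ * ‖v‖ + ‖c‖ * ‖v‖ := by
          have := mul_nonneg (norm_nonneg c) (norm_nonneg v)
          refine le_add_of_le_of_nonneg ?_ this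
          gcongr
      _ = _ := by ring
  · refine (norm_sub_le _ _).trans ?_
    rw [norm_mul, norm_mul]
    calc _ ≤ ‖c‖ * ‖v‖ + ‖a‖ * ‖v‖ + ‖b‖ * ‖v‖ := by
          have := mul_nonneg (norm_nonneg b) (norm_nonneg v)
          refine le_add_of_le_of_nonneg ?_ this
          gcongr
      _ = _ := by ring

lemma act_sub (a b c : ℂ) (u v : Fin 2 → ℂ) : act a b c (u - v) = act a b c u - act a b c v := by
  ext i; fin_cases i <;> simp [act] <;> ring

lemma act_zero (a b c : ℂ) : act a b c 0 = 0 := by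
  ext i; fin_cases i <;> simp [act]

lemma laxX_mulVec_eq_act {q : ℝ → ℝ → ℂ} {x t : ℝ} {k : ℂ} (v : Fin 2 → ℂ) :
    (laxX q x t k).mulVec v = act (Complex.I * k ^ 2) (k * q x t) (-(k * conj (q x t))) v :=
  laxX_mulVec v

lemma HasDerivAt.act {a b c : ℝ → ℂ} {a' b' c' : ℂ} {v : ℝ → Fin 2 → ℂ} {v' : Fin 2 → ℂ} {t : ℝ}
    (ha : HasDerivAt a a' t) (hb : HasDerivAt b b' t) (hc : HasDerivAt c c' t)
    (hv : HasDerivAt v v' t) : HasDerivAt (fun t => act (a t) (b t) (c t) (v t))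
      (DNLS.act a' b' c' (v t) + DNLS.act (a t) (b t) (c t) v') t := by
  rw [hasDerivAt_pi] at hv ⊢
  rw [Fin.forall_fin_two]
  constructor
  · exact ((ha.fun_mul (hv 0)).fun_add (hb.fun_mul (hv 1))).congr_deriv (by simp [DNLS.act]; ring)
  · exact ((hc.fun_mul (hv 0)).fun_sub (ha.fun_mul (hv 1))).congr_deriv (by simp [DNLS.act]; ring)

lemma Continuous.act {X : Type*} [TopologicalSpace X] {a b c : X → ℂ} {v : X → Fin 2 → ℂ}
    (ha : Continuous a) (hb : Continuous b) (hc : Continuous c) (hv : Continuous v) :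
    Continuous fun x => act (a x) (b x) (c x) (v x) := by
  have h0 : Continuous fun x => v x 0 := (continuous_apply 0).comp hv
  have h1 : Continuous fun x => v x 1 := (continuous_apply 1).comp hv
  rw [continuous_pi_iff, Fin.forall_fin_two]
  exact ⟨(ha.mul h0).add (hb.mul h1), (hc.mul h0).sub (ha.mul h1)⟩

section Evolution

variable {q r D : ℝ → ℝ → ℂ} {x t : ℝ} {k : ℂ}

/-- The equation as a first order system: `r = i q_x + |q|² q` and `q_t = r_x`. -/
structure IsFlow (q r D : ℝ → ℝ → ℂ) : Prop where
  cq : Continuous fun p : ℝ × ℝ => q p.1 p.2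
  cr : Continuous fun p : ℝ × ℝ => r p.1 p.2
  cD : Continuous fun p : ℝ × ℝ => D p.1 p.2
  qx : ∀ x t, HasDerivAt (fun x => q x t) (-Complex.I * (r x t - q x t * conj (q x t) * q x t)) x
  rx : ∀ x t, HasDerivAt (fun x => r x t) (D x t) x
  qt : ∀ x t, HasDerivAt (fun t => q x t) (D x t) t

/-- The time part of the Lax pair. -/
def laxT (q r : ℝ → ℝ → ℂ) (x t : ℝ) (k : ℂ) : (Fin 2 → ℂ) → Fin 2 → ℂ :=
  act (-2 * Complex.I * k ^ 4 + Complex.I * k ^ 2 * (q x t * conj (q x t)))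
    (-2 * k ^ 3 * q x t + k * r x t) (2 * k ^ 3 * conj (q x t) - k * conj (r x t))

/-- A bound for the time part of the Lax pair. -/
def boundT (q r : ℝ → ℝ → ℂ) (x t : ℝ) (k : ℂ) : ℝ :=
  ‖-2 * Complex.I * k ^ 4 + Complex.I * k ^ 2 * (q x t * conj (q x t))‖ +
    ‖-2 * k ^ 3 * q x t + k * r x t‖ + ‖2 * k ^ 3 * conj (q x t) - k * conj (r x t)‖

lemma norm_laxT_le (v : Fin 2 → ℂ) : ‖laxT q r x t k v‖ ≤ boundT q r x t k * ‖v‖ :=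
  norm_act_le _ _ _ _

lemma IsFlow.continuous_boundT (h : IsFlow q r D) {X : Type*} [TopologicalSpace X] {ξ τ : X → ℝ}
    {κ : X → ℂ} (hξ : Continuous ξ) (hτ : Continuous τ) (hκ : Continuous κ) :
    Continuous fun p => boundT q r (ξ p) (τ p) (κ p) := by
  have key : ∀ a b : X → ℂ, Continuous a → Continuous b → Continuous fun p =>
      ‖-2 * Complex.I * κ p ^ 4 + Complex.I * κ p ^ 2 * (a p * conj (a p))‖ +
        ‖-2 * κ p ^ 3 * a p + κ p * b p‖ + ‖2 * κ p ^ 3 * conj (a p) - κ p * conj (b p)‖ := by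
    intro a b ha hb
    have ha' : Continuous fun p => conj (a p) := Complex.continuous_conj.comp ha
    have hb' : Continuous fun p => conj (b p) := Complex.continuous_conj.comp hb
    fun_prop
  exact key (fun p => q (ξ p) (τ p)) (fun p => r (ξ p) (τ p)) (h.cq.comp (hξ.prodMk hτ))
    (h.cr.comp (hξ.prodMk hτ))

lemma IsFlow.exists_solution (h : IsFlow q r D) (x : ℝ) (k : ℂ) (v₀ : Fin 2 → ℂ) :
    ∃ U : ℝ → Fin 2 → ℂ, U 0 = v₀ ∧ ∀ t, HasDerivAt U (laxT q r x t k (U t)) t := by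
  have h1 : Continuous fun t : ℝ => q x t := h.cq.comp (continuous_const.prodMk continuous_id)
  have h2 : Continuous fun t : ℝ => r x t := h.cr.comp (continuous_const.prodMk continuous_id)
  have key : ∀ a b : ℝ → ℂ, Continuous a → Continuous b → Continuous fun p : ℝ × (Fin 2 → ℂ) =>
      act (-2 * Complex.I * k ^ 4 + Complex.I * k ^ 2 * (a p.1 * conj (a p.1)))
        (-2 * k ^ 3 * a p.1 + k * b p.1) (2 * k ^ 3 * conj (a p.1) - k * conj (b p.1)) p.2 := by
    intro a b ha hb
    have h3 := Complex.continuous_conj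
    refine Continuous.act ?_ ?_ ?_ continuous_snd <;> fun_prop
  have hb : Continuous fun t => boundT q r x t k :=
    h.continuous_boundT continuous_const continuous_id continuous_const
  refine exists_hasDerivAt_of_lipschitz (F := fun t v => laxT q r x t k v)
    (κ := fun t => boundT q r x t k) ?_ hb (fun t => by unfold boundT; positivity)
    (fun t => act_zero _ _ _) (fun t u v => ?_) v₀
  · exact key _ _ h1 h2
  · unfold laxT
    rw [← act_sub]
    exact norm_act_le _ _ _ _

/-- The zero curvature condition transports solutions of the spectral problem in time. -/
theorem IsFlow.isLaxSol (h : IsFlow q r D) {U : ℝ → ℝ → Fin 2 → ℂ}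
    (hU : ∀ x t, HasDerivAt (U x) (laxT q r x t k (U x t)) t)
    (h0 : IsLaxSol q 0 k fun x => U x 0) (t₁ : ℝ) : IsLaxSol q t₁ k fun x => U x t₁ := by
  intro x
  have hcj := Complex.continuous_conj
  have cq := h.cq
  have cr := h.cr
  have cD := h.cD
  have cU : Continuous fun p : ℝ × ℝ => U x p.2 :=
    (continuous_iff_continuousAt.2 fun t => (hU x t).continuousAt).comp continuous_snd
  have cqx : Continuous fun p : ℝ × ℝ => q x p.2 :=
    h.cq.comp (continuous_const.prodMk continuous_snd)
  set qd : ℝ → ℝ → ℂ := fun x t => -Complex.I * (r x t - q x t * conj (q x t) * q x t) with hqd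
  have cqd : Continuous fun p : ℝ × ℝ => qd p.1 p.2 := by rw [hqd]; fun_prop
  set w : ℝ → Fin 2 → ℂ := fun t => act (Complex.I * k ^ 2) (k * q x t) (-(k * conj (q x t))) (U x t)
    with hw
  have cw : Continuous fun p : ℝ × ℝ => w p.2 :=
    Continuous.act (by fun_prop) (by fun_prop) (by fun_prop) cU
  set Td : ℝ → ℝ → (Fin 2 → ℂ) → Fin 2 → ℂ := fun y t =>
    act (Complex.I * k ^ 2 * (qd y t * conj (q y t) + q y t * conj (qd y t)))
      (-2 * k ^ 3 * qd y t + k * D y t) (2 * k ^ 3 * conj (qd y t) - k * conj (D y t)) with hTd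
  have hT : ∀ y t (v : ℝ → Fin 2 → ℂ) v', HasDerivAt v v' y →
      HasDerivAt (fun y => laxT q r y t k (v y)) (Td y t (v y) + laxT q r y t k v') y := by
    intro y t v v' hv
    have h1 := h.qx y t
    have h2 := h.rx y t
    have h3 : HasDerivAt (fun x => conj (q x t)) (conj (qd y t)) y := h1.star
    have h4 : HasDerivAt (fun x => conj (r x t)) (conj (D y t)) y := h2.star
    exact HasDerivAt.act (((h1.fun_mul h3).const_mul _).const_add _)
      ((h1.const_mul _).fun_add (h2.const_mul _)) ((h3.const_mul _).fun_sub (h4.const_mul _)) hv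
  -- U is given separately for each x, with no regularity in x for t ≠ 0. The aim is that E = U y -
  -- U x - (y - x) w be o(y - x). In t it satisfies the time equation at y, with the first-order
  -- remainder of G as source, and it is o(y - x) at t = 0, so Gronwall's inequality propagates the
  -- estimate.
  set G : ℝ → ℝ → Fin 2 → ℂ := fun y t => laxT q r y t k (U x t + (y - x) • w t) with hG
  set G' : ℝ → ℝ → Fin 2 → ℂ := fun y t =>
    Td y t (U x t + (y - x) • w t) + laxT q r y t k (w t) with hG'
  have hGd : ∀ y t, HasDerivAt (fun y => G y t) (G' y t) y := by
    intro y t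
    refine hT y t _ _ ?_
    have := (((hasDerivAt_id' y).sub_const x).smul_const (w t)).const_add (U x t)
    rwa [one_smul] at this
  have cG' : Continuous fun p : ℝ × ℝ => G' p.1 p.2 := by
    have c1 : Continuous fun p : ℝ × ℝ => U x p.2 + (p.1 - x) • w p.2 :=
      cU.add ((by fun_prop : Continuous fun p : ℝ × ℝ => p.1 - x).smul cw)
    refine Continuous.add ?_ ?_
    · exact Continuous.act (by fun_prop) (by fun_prop) (by fun_prop) c1
    · exact Continuous.act (by fun_prop) (by fun_prop) (by fun_prop) cw
  -- Zero curvature: with X and T the two Lax matrices, X_t + X T = T_x + T X, where q_t = r_x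
  -- enters.
  have hwd : ∀ t, HasDerivAt w (G' x t) t := by
    intro t
    have h1 := h.qt x t
    have h3 : HasDerivAt (fun t => conj (q x t)) (conj (D x t)) t := h1.star
    refine (HasDerivAt.act (hasDerivAt_const t (Complex.I * k ^ 2)) (h1.const_mul k)
      ((h3.const_mul k).fun_neg) (hU x t)).congr_deriv ?_
    simp only [hG', hTd, hw, hqd, laxT, sub_self, zero_smul, add_zero]
    ext i
    fin_cases i
    · simp [act]
      linear_combination (k ^ 2 * U x t 0 * (conj (q x t) * r x t - q x t * conj (r x t))) * Complex.I_sq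
    · simp [act]
      linear_combination (k ^ 2 * U x t 1 * (q x t * conj (r x t) - conj (q x t) * r x t)) * Complex.I_sq
  have hwt : ∀ t, w t = act (Complex.I * k ^ 2) (k * q x t) (-(k * conj (q x t))) (U x t) :=
    fun t => rfl
  clear_value G G' w Td qd
  have hE : ∀ y t, HasDerivAt (fun t => U y t - U x t - (y - x) • w t)
      (laxT q r y t k (U y t - U x t - (y - x) • w t) + (G y t - G x t - (y - x) • G' x t)) t := by
    intro y t
    refine (((hU y t).fun_sub (hU x t)).fun_sub ((hwd t).fun_const_smul (y - x))).congr_deriv ?_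
    have e1 : G x t = laxT q r x t k (U x t) := by simp [hG]
    rw [e1, hG]
    simp only [laxT]
    rw [sub_sub (U y t), act_sub]
    abel
  obtain ⟨κ, hκ⟩ : ∃ κ, ∀ y ∈ Set.Icc (x - 1) (x + 1), ∀ t ∈ Set.uIcc 0 t₁, boundT q r y t k ≤ κ := by
    have h1 : Continuous fun p : ℝ × ℝ => boundT q r p.1 p.2 k :=
      h.continuous_boundT continuous_fst continuous_snd continuous_const
    obtain ⟨κ, hκ⟩ := ((isCompact_Icc (a := x - 1) (b := x + 1)).prod
      (isCompact_uIcc (a := 0) (b := t₁))).exists_bound_of_continuousOn h1.continuousOn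
    exact ⟨κ, fun y hy t ht => (le_abs_self _).trans (hκ (y, t) ⟨hy, ht⟩)⟩
  have hκ0 : 0 ≤ κ := le_trans (by unfold boundT; positivity)
    (hκ x ⟨by linarith, by linarith⟩ 0 Set.left_mem_uIcc)
  rw [laxX_mulVec_eq_act, ← hwt, hasDerivAt_iff_isLittleO, Asymptotics.isLittleO_iff]
  intro c hc
  set M := Real.exp ((κ + 1) * |t₁ - 0|) with hM
  have hM0 : 0 < M := Real.exp_pos _
  have h0' := h0 x
  rw [laxX_mulVec_eq_act, ← hwt, hasDerivAt_iff_isLittleO, Asymptotics.isLittleO_iff] at h0'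
  filter_upwards [h0' (c := c / (2 * M)) (by positivity),
    eventually_norm_sub_sub_smul_le hGd cG' (isCompact_uIcc (a := 0) (b := t₁)) x
      (ε := c / (2 * M)) (by positivity), Icc_mem_nhds (a := x - 1) (b := x + 1) (by linarith)
      (by linarith)] with y hy1 hy2 hy3
  have key := norm_le_exp_mul_of_norm_deriv_le_add (K := κ) (ε := c / (2 * M) * |y - x|) hκ0
    (by positivity) (fun t _ => hE y t) (fun t ht => (norm_add_le _ _).trans
      (add_le_add ((norm_laxT_le _).trans
        (mul_le_mul_of_nonneg_right (hκ y hy3 t ht) (norm_nonneg _))) (hy2 t ht)))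
  rw [← hM] at key
  refine key.trans ?_
  calc _ ≤ (c / (2 * M) * ‖y - x‖ + c / (2 * M) * |y - x|) * M := by gcongr
    _ = _ := by rw [Real.norm_eq_abs]; field_simp; ring

end Evolution

/-! ## Time evolution of the Jost columns -/

/-- The function `r = i q_x + |q|² q`. -/
def flowR (q : ℝ → ℝ → ℂ) (x t : ℝ) : ℂ :=
  Complex.I * deriv (fun y => q y t) x + q x t * conj (q x t) * q x t

lemma IsZBCSolution.isFlow {q : ℝ → ℝ → ℂ} (h : IsZBCSolution q) :
    IsFlow q (flowR q) (fun x t => deriv (fun s => q x s) t) := by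
  have h1 : ContDiff ℝ 1 fun p : ℝ × ℝ => q p.1 p.2 := h.contDiff.of_le (by norm_num)
  have hdir : ∀ w, Continuous fun p : ℝ × ℝ => dirD w q p.1 p.2 := fun w =>
    (h1.continuous_fderiv one_ne_zero).clm_apply continuous_const
  have ex : ∀ x t, deriv (fun y => q y t) x = dirD (1, 0) q x t := fun x t =>
    (hasDerivAt_fst h1 x t).deriv
  have et : ∀ x t, deriv (fun s => q x s) t = dirD (0, 1) q x t := fun x t =>
    (hasDerivAt_snd h1 x t).deriv
  have hcj := Complex.continuous_conj
  have hqx : ∀ x t, HasDerivAt (fun x => q x t) (deriv (fun y => q y t) x) x := fun x t => by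
    rw [ex]; exact hasDerivAt_fst h1 x t
  refine ⟨h1.continuous, ?_, ?_, fun x t => ?_, fun x t => ?_, fun x t => ?_⟩
  · have := hdir (1, 0)
    have := h1.continuous
    simp only [flowR, ex]
    fun_prop
  · simp only [et]; exact hdir _
  · refine (hqx x t).congr_deriv ?_
    rw [flowR]
    linear_combination (deriv (fun y => q y t) x) * Complex.I_sq
  · have hp := h.isPotential t
    have hxx : HasDerivAt (deriv fun y => q y t) (iteratedDeriv 2 (fun y => q y t) x) x := by
      rw [iteratedDeriv_succ, iteratedDeriv_one]
      exact (hp.contDiff_deriv.differentiable one_ne_zero x).hasDerivAt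
    have hcub : HasDerivAt (fun y => q y t * conj (q y t) * q y t)
        (deriv (fun y => ((‖q y t‖ ^ 2 : ℝ) : ℂ) * q y t) x) x := by
      have e : (fun y => ((‖q y t‖ ^ 2 : ℝ) : ℂ) * q y t) = fun y => q y t * conj (q y t) * q y t := by
        ext y; rw [Complex.mul_conj']; push_cast; ring
      rw [e]
      have h2 := hqx x t
      have h3 : HasDerivAt (fun x => conj (q x t)) _ x := h2.star
      exact ((h2.fun_mul h3).fun_mul h2).differentiableAt.hasDerivAt
    refine ((hxx.const_mul Complex.I).fun_add hcub).congr_deriv ?_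
    linear_combination Complex.I * h.equation x t - (deriv (fun s => q x s) t -
      deriv (fun y => ((‖q y t‖ ^ 2 : ℝ) : ℂ) * q y t) x) * Complex.I_sq
  · rw [et]; exact hasDerivAt_snd h1 x t

/-- An integrable function need not tend to zero, but the set where it exceeds ε has finite measure.
Hence it tends to zero along a proper filter finer than l; for a bound on q and q_x this is all the
decay that is available. -/
lemma neBot_inf_comap_of_integrable {g : ℝ → ℝ} (hg : Integrable g) {l : Filter ℝ}
    (hl : ∀ s ∈ l, volume s = ⊤) : (l ⊓ comap g (𝓝 0)).NeBot := by
  rw [inf_neBot_iff]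
  intro s hs s' hs'
  obtain ⟨u, hu, hus⟩ := mem_comap.1 hs'
  obtain ⟨ε, hε, hb⟩ := Metric.mem_nhds_iff.1 hu
  by_contra hne
  rw [Set.not_nonempty_iff_eq_empty] at hne
  have h1 : s ⊆ {x | ε ≤ ‖g x‖} := by
    intro x hx
    by_contra hlt
    have : x ∈ s ∩ s' := ⟨hx, hus (hb (by
      rw [Metric.mem_ball, dist_zero_right]; exact not_le.1 hlt))⟩
    rw [hne] at this
    exact this
  have h2 := hg.measure_norm_ge_lt_top hε
  have h3 := measure_mono (μ := volume) h1
  rw [hl s hs, top_le_iff] at h3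
  exact h2.ne h3

lemma volume_eq_top_of_mem_atTop {s : Set ℝ} (hs : s ∈ (atTop : Filter ℝ)) : volume s = ⊤ := by
  obtain ⟨a, ha⟩ := mem_atTop_sets.1 hs
  rw [← top_le_iff, ← Real.volume_Ici (a := a)]
  exact measure_mono fun x hx => ha x hx

lemma volume_eq_top_of_mem_atBot {s : Set ℝ} (hs : s ∈ (atBot : Filter ℝ)) : volume s = ⊤ := by
  obtain ⟨a, ha⟩ := mem_atBot_sets.1 hs
  rw [← top_le_iff, ← Real.volume_Iic (a := a)]
  exact measure_mono fun x hx => ha x hx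

lemma act_smul (a b c s : ℂ) (v : Fin 2 → ℂ) : act a b c (s • v) = s • act a b c v := by
  ext i; fin_cases i <;> simp [act] <;> ring

lemma hasDerivAt_inv_bgExp (j : Fin 2) (x t : ℝ) (k : ℂ) :
    HasDerivAt (fun t => (bgExp j x t k)⁻¹)
      ((if j = 0 then 1 else -1) * (2 * Complex.I * k ^ 4) * (bgExp j x t k)⁻¹) t := by
  simp only [bgExp, ← Complex.exp_neg, ← neg_mul]
  exact (hasDerivAt_exp_theta_t _ _ _ _).congr_deriv (by ring)

/-- The Jost columns evolve in time by the second equation of the Lax pair. -/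
theorem IsZBCSolution.hasDerivAt_jost_time {q : ℝ → ℝ → ℂ} (h : IsZBCSolution q) {l : Filter ℝ}
    {j : Fin 2} {k : ℂ} (hl : ∀ s ∈ l, volume s = ⊤)
    (hex : ∀ t, ∃ φ, IsJostColumn q l j t k φ) (hb : ∀ t, BgBdd l j t k) (x t : ℝ) :
    HasDerivAt (fun t => jost q l j x t k) (laxT q (flowR q) x t k (jost q l j x t k)) t := by
  have hf := h.isFlow
  -- The time equation is solved from the Jost column at t = 0, for each x separately. The result
  -- solves the spectral problem at all times by zero curvature, so only its normalisation has to be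
  -- checked.
  choose U hU0 hU using fun x => hf.exists_solution x k (jost q l j x 0 k)
  have hLax := hf.isLaxSol hU (by
    simp only [hU0]; exact (jost_isJostColumn (hex 0)).isLaxSol)
  suffices hJ : ∀ x t, jost q l j x t k = U x t by
    simp only [hJ]; exact hU x t
  intro x t₁
  obtain ⟨g, hg, hgb⟩ := h.decay |t₁|
  have := neBot_inf_comap_of_integrable hg hl
  -- Along this finer filter the bound g of q and q_x tends to zero.
  set l' := l ⊓ comap g (𝓝 0) with hl'
  have hg0 : Tendsto g l' (𝓝 0) := tendsto_comap.mono_left inf_le_right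
  set c : ℂ := (if j = 0 then 1 else -1) * (2 * Complex.I * k ^ 4) with hc
  have hcn : ‖c‖ = 2 * ‖k‖ ^ 4 := by
    rw [hc]; split_ifs <;> simp
  set e : Fin 2 → ℂ := Pi.single j 1 with he
  -- The deviation of the normalised column from the unit vector. The time derivative of the
  -- exponential cancels the constant part of the Lax matrix on e, so the source in the equation of
  -- W is of size g.
  set W : ℝ → ℝ → Fin 2 → ℂ := fun x t => (bgExp j x t k)⁻¹ • U x t - e with hW
  have hWd : ∀ x t, HasDerivAt (W x)
      (c • W x t + laxT q (flowR q) x t k (W x t) + (c • e + laxT q (flowR q) x t k e)) t := by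
    intro x t
    refine (((hasDerivAt_inv_bgExp j x t k).smul (hU x t)).sub_const e).congr_deriv ?_
    simp only [hW, laxT, act_sub, act_smul, smul_sub, ← hc, smul_smul]
    abel
  set M : ℝ := ‖k‖ ^ 2 + 2 * ‖k‖ ^ 3 + 2 * ‖k‖ with hM
  set K : ℝ := 4 * ‖k‖ ^ 4 + ‖k‖ ^ 2 + 4 * ‖k‖ ^ 3 + 4 * ‖k‖ with hK
  have hr : ∀ x t, ‖q x t‖ ≤ g x → ‖deriv (fun y => q y t) x‖ ≤ g x → g x ≤ 1 →
      ‖q x t * conj (q x t)‖ ≤ g x ∧ ‖flowR q x t‖ ≤ 2 * g x := by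
    intro x t h1 h2 h3
    have h0 : 0 ≤ g x := (norm_nonneg _).trans h1
    have h4 : ‖q x t * conj (q x t)‖ ≤ g x := by
      rw [norm_mul, Complex.norm_conj]
      calc _ ≤ g x * 1 := by gcongr; exact h1.trans h3
        _ = _ := mul_one _
    refine ⟨h4, (norm_add_le _ _).trans ?_⟩
    rw [norm_mul, Complex.norm_I, norm_mul (q x t * _)]
    have : ‖q x t * conj (q x t)‖ * ‖q x t‖ ≤ g x * 1 := by gcongr; exact h1.trans h3
    linarith
  have hest : ∀ x t, ‖q x t‖ ≤ g x → ‖deriv (fun y => q y t) x‖ ≤ g x → g x ≤ 1 →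
      ‖c • W x t + laxT q (flowR q) x t k (W x t) + (c • e + laxT q (flowR q) x t k e)‖ ≤
        K * ‖W x t‖ + M * g x := by
    intro x t h1 h2 h3
    obtain ⟨h4, h5⟩ := hr x t h1 h2 h3
    have h0 : 0 ≤ g x := (norm_nonneg _).trans h1
    have b1 : ∀ ε, g x ≤ ε → ‖Complex.I * k ^ 2 * (q x t * conj (q x t))‖ ≤ ‖k‖ ^ 2 * ε := by
      intro ε hε
      rw [norm_mul, norm_mul, Complex.norm_I, one_mul, norm_pow]
      gcongr
      exact h4.trans hε
    have b2 : ∀ ε, g x ≤ ε →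
        ‖-2 * k ^ 3 * q x t + k * flowR q x t‖ ≤ (2 * ‖k‖ ^ 3 + 2 * ‖k‖) * ε := by
      intro ε hε
      refine (norm_add_le _ _).trans ?_
      simp only [norm_mul, norm_neg, norm_pow, Complex.norm_ofNat]
      calc _ ≤ 2 * ‖k‖ ^ 3 * ε + ‖k‖ * (2 * ε) := by
            gcongr
            · exact h1.trans hε
            · linarith
        _ = _ := by ring
    have b3 : ∀ ε, g x ≤ ε →
        ‖2 * k ^ 3 * conj (q x t) - k * conj (flowR q x t)‖ ≤ (2 * ‖k‖ ^ 3 + 2 * ‖k‖) * ε := by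
      intro ε hε
      refine (norm_sub_le _ _).trans ?_
      simp only [norm_mul, norm_pow, Complex.norm_ofNat, Complex.norm_conj]
      calc _ ≤ 2 * ‖k‖ ^ 3 * ε + ‖k‖ * (2 * ε) := by
            gcongr
            · exact h1.trans hε
            · linarith
        _ = _ := by ring
    refine (norm_add_le _ _).trans (add_le_add ?_ ?_)
    · refine (norm_add_le _ _).trans ?_
      have h6 : boundT q (flowR q) x t k ≤ 2 * ‖k‖ ^ 4 + ‖k‖ ^ 2 + 4 * ‖k‖ ^ 3 + 4 * ‖k‖ := by
        have h7 : ‖-2 * Complex.I * k ^ 4 + Complex.I * k ^ 2 * (q x t * conj (q x t))‖ ≤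
            2 * ‖k‖ ^ 4 + ‖k‖ ^ 2 * 1 := by
          refine (norm_add_le _ _).trans (add_le_add ?_ (b1 1 h3))
          simp
        have := b2 1 h3
        have := b3 1 h3
        rw [boundT]
        linarith
      rw [norm_smul, hcn]
      have := (norm_laxT_le (q := q) (r := flowR q) (x := x) (t := t) (k := k) (W x t)).trans
        (mul_le_mul_of_nonneg_right h6 (norm_nonneg _))
      rw [hK]
      linarith
    · have hMg : M * g x = ‖k‖ ^ 2 * g x + (2 * ‖k‖ ^ 3 + 2 * ‖k‖) * g x := by rw [hM]; ring
      have p1 : 0 ≤ ‖k‖ ^ 2 * g x := by positivity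
      have p2 : 0 ≤ (2 * ‖k‖ ^ 3 + 2 * ‖k‖) * g x := by positivity
      rw [pi_norm_le_iff_of_nonneg (by rw [hMg]; positivity), Fin.forall_fin_two, hMg]
      have b1 := b1 _ le_rfl
      have b2 := b2 _ le_rfl
      have b3 := b3 _ le_rfl
      fin_cases j
      · constructor
        · have : (c • e + laxT q (flowR q) x t k e) 0 =
              Complex.I * k ^ 2 * (q x t * conj (q x t)) := by
            simp [hc, he, laxT, act]
          rw [this]; linarith
        · have : (c • e + laxT q (flowR q) x t k e) 1 =
              2 * k ^ 3 * conj (q x t) - k * conj (flowR q x t) := by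
            simp [he, laxT, act]
          rw [this]; linarith
      · constructor
        · have : (c • e + laxT q (flowR q) x t k e) 0 = -2 * k ^ 3 * q x t + k * flowR q x t := by
            simp [he, laxT, act]
          rw [this]; linarith
        · have : (c • e + laxT q (flowR q) x t k e) 1 =
              -(Complex.I * k ^ 2 * (q x t * conj (q x t))) := by
            simp [hc, he, laxT, act]
          rw [this, norm_neg]; linarith
  have hM0 : 0 ≤ M := by positivity
  have hK0 : 0 ≤ K := by positivity
  have hW0 : Tendsto (fun x => W x 0) l' (𝓝 0) := by
    have h1 := ((jost_isJostColumn (hex 0)).2.mono_left inf_le_left : Tendsto _ l' _)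
    have h2 := h1.sub_const e
    rw [sub_self] at h2
    simpa only [hW, hU0] using h2
  have hW1 : Tendsto (fun x => W x t₁) l' (𝓝 0) := by
    have hlim : Tendsto (fun x => (‖W x 0‖ + M * g x) * Real.exp ((K + 1) * |t₁ - 0|)) l'
        (𝓝 ((0 + M * 0) * Real.exp ((K + 1) * |t₁ - 0|))) := by
      have h2 := hW0.norm
      rw [norm_zero] at h2
      exact (h2.add (hg0.const_mul M)).mul_const _
    rw [mul_zero, add_zero, zero_mul] at hlim
    refine squeeze_zero_norm' ?_ hlim
    filter_upwards [hg0.eventually (ge_mem_nhds one_pos)] with x hx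
    have hgx : 0 ≤ g x := (norm_nonneg _).trans (hgb x 0 (by simp)).1
    refine norm_le_exp_mul_of_norm_deriv_le_add hK0 (mul_nonneg hM0 hgx) (fun t _ => hWd x t)
      fun t ht => ?_
    have ht' : |t| ≤ |t₁| := by
      have := Set.abs_sub_left_of_mem_uIcc ht
      simpa using this
    exact hest x t (hgb x t ht').1 (hgb x t ht').2 hx
  have hcol : IsJostColumn q l' j t₁ k (fun x => U x t₁) := by
    refine ⟨hLax t₁, ?_⟩
    have := hW1.add_const e
    simpa only [hW, sub_add_cancel, zero_add] using this
  -- The true Jost column keeps its limit along the finer filter, and uniqueness of the columns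
  -- holds along that filter too.
  have hcol' : IsJostColumn q l' j t₁ k (fun x => jost q l j x t₁ k) :=
    ⟨(jost_isJostColumn (hex t₁)).1, (jost_isJostColumn (hex t₁)).2.mono_left inf_le_left⟩
  exact congrFun (hcol.unique (h.isPotential t₁).contDiff.continuous ((hb t₁).mono inf_le_left)
    hcol') x

/-! ## The discrete data of a soliton -/

section NormingConstants

variable {q : ℝ → ℝ → ℂ} {x t : ℝ} {z η b d : ℂ}

lemma wr_act (a b c : ℂ) (u v : Fin 2 → ℂ) : wr (act a b c u) v + wr u (act a b c v) = 0 := by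
  simp [wr, act]; ring

/-- A simultaneous solution of the Lax pair. -/
structure IsLaxPairSol (q : ℝ → ℝ → ℂ) (z : ℂ) (u : ℝ → ℝ → Fin 2 → ℂ) : Prop where
  lax : ∀ t, IsLaxSol q t z fun x => u x t
  time : ∀ x t, HasDerivAt (u x) (laxT q (flowR q) x t z (u x t)) t

lemma IsLaxPairSol.wr_eq {u v : ℝ → ℝ → Fin 2 → ℂ} (hu : IsLaxPairSol q z u)
    (hv : IsLaxPairSol q z v) (x t : ℝ) : wr (u x t) (v x t) = wr (u 0 0) (v 0 0) := by
  have hd : ∀ t, HasDerivAt (fun t => wr (u 0 t) (v 0 t)) 0 t := by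
    intro t
    have h1 := hasDerivAt_pi.1 (hu.time 0 t)
    have h2 := hasDerivAt_pi.1 (hv.time 0 t)
    refine (((h1 0).fun_mul (h2 1)).fun_sub ((h1 1).fun_mul (h2 0))).congr_deriv ?_
    rw [← wr_act (-2 * Complex.I * z ^ 4 + Complex.I * z ^ 2 * (q 0 t * conj (q 0 t)))
      (-2 * z ^ 3 * q 0 t + z * flowR q 0 t) (2 * z ^ 3 * conj (q 0 t) - z * conj (flowR q 0 t))
      (u 0 t) (v 0 t)]
    simp only [laxT, wr]
    ring
  rw [(hu.lax t).wr_eq (hv.lax t) x 0]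
  exact is_const_of_deriv_eq_zero (fun t => (hd t).differentiableAt) (fun t => (hd t).deriv) t 0

lemma IsLaxPairSol.sub_smul {u v : ℝ → ℝ → Fin 2 → ℂ} (hu : IsLaxPairSol q z u)
    (hv : IsLaxPairSol q z v) (c : ℂ) : IsLaxPairSol q z fun x t => u x t - c • v x t where
  lax t := (hu.lax t).sub ((hv.lax t).smul c)
  time x t := by
    refine ((hu.time x t).fun_sub ((hv.time x t).fun_const_smul c)).congr_deriv ?_
    rw [laxT, act_sub, act_smul]

variable (h : IsZBCSolution q)
include h

lemma IsZBCSolution.isLaxPairSol_P1 (hz : 0 ≤ z.re * z.im) :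
    IsLaxPairSol q z fun x t => jostP1 q x t z where
  lax _ := (h.hasJost.isP1 hz).isLaxSol
  time x t := h.hasDerivAt_jost_time (fun _ => volume_eq_top_of_mem_atTop)
    (fun _ => ⟨_, h.hasJost.isP1 hz⟩) (fun _ => bgBdd_of_nonneg_top hz) x t

lemma IsZBCSolution.isLaxPairSol_M2 (hz : 0 ≤ z.re * z.im) :
    IsLaxPairSol q z fun x t => jostM2 q x t z where
  lax _ := (h.hasJost.isM2 hz).isLaxSol
  time x t := h.hasDerivAt_jost_time (fun _ => volume_eq_top_of_mem_atBot)
    (fun _ => ⟨_, h.hasJost.isM2 hz⟩) (fun _ => bgBdd_of_nonneg_bot hz) x t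

lemma IsZBCSolution.isJostColumn_M1 (hz : z.re * z.im ≤ 0) :
    IsJostColumn q atBot 0 t z fun x => jostM1 q x t z :=
  jost_isJostColumn ⟨_, (h.hasJost.isM2 (z := conj z) (by simpa using hz)).jc_one⟩

lemma IsZBCSolution.isLaxPairSol_M1 (hz : z.re * z.im ≤ 0) :
    IsLaxPairSol q z fun x t => jostM1 q x t z where
  lax _ := (h.isJostColumn_M1 hz).isLaxSol
  time x t := h.hasDerivAt_jost_time (fun _ => volume_eq_top_of_mem_atBot)
    (fun _ => ⟨_, h.isJostColumn_M1 hz⟩) (fun _ => bgBdd_of_nonpos_bot hz) x t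

lemma IsZBCSolution.wr_P1_M2 (hz : 0 ≤ z.re * z.im) :
    wr (jostP1 q x t z) (jostM2 q x t z) = s11 q z :=
  (h.isLaxPairSol_P1 hz).wr_eq (h.isLaxPairSol_M2 hz) x t

/-- Gronwall's inequality in t along x = 0 and then in x, with constants uniform for z near η. It
carries the relation that defines `IsJet` from the origin to every (x, t). -/
lemma IsZBCSolution.exists_norm_le (η : ℂ) (x t : ℝ) :
    ∃ C, ∀ᶠ z in 𝓝 η, ∀ u, IsLaxPairSol q z u → ‖u x t‖ ≤ C * ‖u 0 0‖ := by
  have hb := (h.isFlow.continuous_boundT (ξ := fun _ : ℝ × ℂ => 0) continuous_const continuous_fst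
    continuous_snd).continuousOn (s := Set.uIcc 0 t ×ˢ Metric.closedBall η 1)
  obtain ⟨K, hK⟩ := (isCompact_uIcc.prod (isCompact_closedBall η 1)).exists_bound_of_continuousOn hb
  obtain ⟨M, hM⟩ := isCompact_uIcc.exists_bound_of_continuousOn
    ((h.isPotential t).contDiff.continuous.continuousOn (s := Set.uIcc 0 x))
  set L := (‖η‖ + 1) ^ 2 + (‖η‖ + 1) * M with hL
  refine ⟨Real.exp (K * |t - 0|) * Real.exp (L * |x - 0|), ?_⟩
  filter_upwards [Metric.closedBall_mem_nhds η one_pos] with z hz u hu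
  have hzn : ‖z‖ ≤ ‖η‖ + 1 := by
    rw [Metric.mem_closedBall, dist_eq_norm] at hz
    have := norm_le_norm_add_norm_sub' z η
    linarith
  have h1 := norm_le_exp_mul_of_norm_deriv_le (K := K) (a := 0) (b := t)
    (fun s _ => hu.time 0 s) (fun s hs => (norm_laxT_le _).trans
      (mul_le_mul_of_nonneg_right ((le_abs_self _).trans (hK (s, z) ⟨hs, hz⟩)) (norm_nonneg _)))
  have h2 := norm_le_exp_mul_of_norm_deriv_le (K := L) (a := 0) (b := x)
    (fun y _ => hu.lax t y) (fun y hy => (norm_laxX_mulVec_le _).trans (by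
      have := hM y hy
      rw [hL]
      gcongr))
  calc _ ≤ _ := h2
    _ ≤ ‖u 0 0‖ * Real.exp (K * |t - 0|) * Real.exp (L * |x - 0|) := by gcongr
    _ = _ := by ring

omit h in
lemma isOpen_upper : IsOpen {z : ℂ | 0 < z.re * z.im} :=
  isOpen_lt continuous_const (Complex.continuous_re.mul Complex.continuous_im)

lemma IsZBCSolution.differentiableAt_P1 (hz : 0 < z.re * z.im) :
    DifferentiableAt ℂ (jostP1 q x t) z := by
  obtain ⟨a, n, hu⟩ := (h.isPotential t).exists_upperJost
  have e : jostP1 q x t =ᶠ[𝓝 z] fun k => bgExp 0 x t k • ![a x (k ^ 2), n x (k ^ 2) / k] := by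
    filter_upwards [isOpen_upper.mem_nhds hz] with k hk
    exact (isJostColumn_upperJost (h.isPotential t) hu (le_of_lt hk)).jost_eq
      (h.hasJost.continuous t) (bgBdd_of_nonneg_top (le_of_lt hk)) x
  refine DifferentiableAt.congr_of_eventuallyEq ?_ e
  have hz2 : 0 < (z ^ 2).im := by rw [sq_im]; positivity
  have hz0 : z ≠ 0 := by rintro rfl; simp at hz
  have hb : DifferentiableAt ℂ (fun k => bgExp 0 x t k) z := by unfold bgExp theta; fun_prop
  have hsq : DifferentiableAt ℂ (fun k : ℂ => k ^ 2) z := by fun_prop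
  have h1 : DifferentiableAt ℂ (fun k => a x (k ^ 2)) z := DifferentiableAt.comp z (hu.diff1 x _ hz2) hsq
  have h2 : DifferentiableAt ℂ (fun k => n x (k ^ 2)) z := DifferentiableAt.comp z (hu.diff2 x _ hz2) hsq
  rw [differentiableAt_pi, Fin.forall_fin_two]
  exact ⟨hb.mul h1, hb.mul (h2.div differentiableAt_id hz0)⟩

lemma IsZBCSolution.differentiableAt_M2 (hz : 0 < z.re * z.im) :
    DifferentiableAt ℂ (jostM2 q x t) z := by
  obtain ⟨a, n, hu⟩ := (h.isPotential t).refl.exists_upperJost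
  have e : jostM2 q x t =ᶠ[𝓝 z]
      fun k => bgExp 1 x t k • ![n (-x) (k ^ 2) / k, a (-x) (k ^ 2)] := by
    filter_upwards [isOpen_upper.mem_nhds hz] with k hk
    exact (isJostColumn_upperJost_refl (h.isPotential t) hu (le_of_lt hk)).jost_eq
      (h.hasJost.continuous t) (bgBdd_of_nonneg_bot (le_of_lt hk)) x
  refine DifferentiableAt.congr_of_eventuallyEq ?_ e
  have hz2 : 0 < (z ^ 2).im := by rw [sq_im]; positivity
  have hz0 : z ≠ 0 := by rintro rfl; simp at hz
  have hb : DifferentiableAt ℂ (fun k => bgExp 1 x t k) z := by unfold bgExp theta; fun_prop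
  have hsq : DifferentiableAt ℂ (fun k : ℂ => k ^ 2) z := by fun_prop
  have h1 : DifferentiableAt ℂ (fun k => a (-x) (k ^ 2)) z := DifferentiableAt.comp z (hu.diff1 _ _ hz2) hsq
  have h2 : DifferentiableAt ℂ (fun k => n (-x) (k ^ 2)) z := DifferentiableAt.comp z (hu.diff2 _ _ hz2) hsq
  rw [differentiableAt_pi, Fin.forall_fin_two]
  exact ⟨hb.mul (h2.div differentiableAt_id hz0), hb.mul h1⟩

lemma IsZBCSolution.analyticAt_s11 (hz : 0 < z.re * z.im) : AnalyticAt ℂ (s11 q) z := by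
  rw [Complex.analyticAt_iff_eventually_differentiableAt]
  filter_upwards [isOpen_upper.mem_nhds hz] with w hw
  have h1 := differentiableAt_pi.1 (h.differentiableAt_P1 (x := 0) (t := 0) hw)
  have h2 := differentiableAt_pi.1 (h.differentiableAt_M2 (x := 0) (t := 0) hw)
  exact ((h1 0).mul (h2 1)).sub ((h1 1).mul (h2 0))

omit h in
/-- The columns are proportional at `η`, up to second order. -/
lemma eq_smul_of_isLittleO {u v : ℂ → Fin 2 → ℂ} (hu : DifferentiableAt ℂ u η)
    (hv : DifferentiableAt ℂ v η)
    (ho : (fun z => u z - (b + d * (z - η)) • v z) =o[𝓝 η] fun z => z - η) :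
    u η = b • v η ∧ deriv u η - b • deriv v η = d • v η := by
  have h0 : u η - (b + d * (η - η)) • v η = 0 := by
    have := (ho.def one_pos).self_of_nhds
    simpa using this
  have h1 : HasDerivAt (fun z => u z - (b + d * (z - η)) • v z) 0 η := by
    rw [hasDerivAt_iff_isLittleO]
    simpa only [h0, smul_zero, sub_zero] using ho
  have h2 := hu.hasDerivAt.fun_sub (((((hasDerivAt_id' η).sub_const η).const_mul d).const_add
    b).fun_smul hv.hasDerivAt)
  have h3 := h1.unique h2
  simp only [sub_self, mul_zero, add_zero, mul_one] at h0 h3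
  refine ⟨sub_eq_zero.1 h0, ?_⟩
  rw [eq_comm, ← sub_eq_zero, ← sub_sub] at h3
  simpa [sub_eq_zero] using h3

/-- The norming constants at a double zero `η` of `s₁₁`. -/
def IsJet (q : ℝ → ℝ → ℂ) (η b d : ℂ) : Prop := ∀ x t,
  (fun z => jostP1 q x t z - (b + d * (z - η)) • jostM2 q x t z) =o[𝓝 η] fun z => z - η

/-- At (0, 0) the vanishing of s₁₁ makes the columns proportional, with factor b, and that of its
derivative does the same for the differentiated columns, with factor d. For each z near η the
combination Φ₊₁ - (b + d(z-η)) Φ₋₂ is itself a solution of the Lax pair, so its smallness at the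
origin implies smallness at every (x, t) with the same b and d. -/
theorem IsZBCSolution.exists_isJet (hη : 0 < η.re * η.im) (hs : s11 q η = 0)
    (hs' : deriv (s11 q) η = 0) : ∃ b d, b ≠ 0 ∧ IsJet q η b d := by
  have hM0 : jostM2 q 0 0 η ≠ 0 := (h.hasJost.isM2 hη.le).ne_zero (h.hasJost.continuous 0) 0
  have hP0 : jostP1 q 0 0 η ≠ 0 := (h.hasJost.isP1 hη.le).ne_zero (h.hasJost.continuous 0) 0
  have hprop : ∀ v : Fin 2 → ℂ, wr v (jostM2 q 0 0 η) = 0 → ∃ c : ℂ, v = c • jostM2 q 0 0 η := by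
    intro v hv
    have hv' : v 0 * jostM2 q 0 0 η 1 = v 1 * jostM2 q 0 0 η 0 := sub_eq_zero.1 hv
    by_cases h0 : jostM2 q 0 0 η 0 = 0
    · have h1 : jostM2 q 0 0 η 1 ≠ 0 := fun h1 => hM0 (by ext i; fin_cases i <;> simp [h0, h1])
      refine ⟨v 1 / jostM2 q 0 0 η 1, ?_⟩
      ext i; fin_cases i
      · have : v 0 = 0 := by simpa [h0, h1] using hv'
        simp [this, h0]
      · simp [h1]
    · refine ⟨v 0 / jostM2 q 0 0 η 0, ?_⟩
      ext i; fin_cases i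
      · simp [h0]
      · simp; field_simp; linear_combination -hv'
  obtain ⟨b, hb⟩ := hprop _ hs
  have hPd := h.differentiableAt_P1 (x := 0) (t := 0) hη
  have hMd := h.differentiableAt_M2 (x := 0) (t := 0) hη
  obtain ⟨d, hd⟩ := hprop (deriv (jostP1 q 0 0) η - b • deriv (jostM2 q 0 0) η) (by
    have h1 := hasDerivAt_pi.1 hPd.hasDerivAt
    have h2 := hasDerivAt_pi.1 hMd.hasDerivAt
    have h3 : HasDerivAt (s11 q) _ η := ((h1 0).fun_mul (h2 1)).fun_sub ((h1 1).fun_mul (h2 0))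
    rw [h3.deriv] at hs'
    have hb0 := congrFun hb 0
    have hb1 := congrFun hb 1
    simp only [Pi.smul_apply, smul_eq_mul] at hb0 hb1
    simp only [wr, Pi.sub_apply, Pi.smul_apply, smul_eq_mul]
    linear_combination hs' - deriv (jostM2 q 0 0) η 1 * hb0 + deriv (jostM2 q 0 0) η 0 * hb1)
  refine ⟨b, d, ?_, ?_⟩
  · rintro rfl
    exact hP0 (by simpa using hb)
  have h00 : (fun z => jostP1 q 0 0 z - (b + d * (z - η)) • jostM2 q 0 0 z) =o[𝓝 η]
      fun z => z - η := by
    have h2 := hPd.hasDerivAt.fun_sub (((((hasDerivAt_id' η).sub_const η).const_mul d).const_add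
      b).fun_smul hMd.hasDerivAt)
    have h3 := h2.congr_deriv (g' := 0) (by
      simp only [sub_self, mul_zero, add_zero, mul_one]
      rw [← sub_sub, hd, sub_self])
    rw [hasDerivAt_iff_isLittleO] at h3
    have h4 : jostP1 q 0 0 η - (b + d * (η - η)) • jostM2 q 0 0 η = 0 := by
      rw [sub_self, mul_zero, add_zero, hb, sub_self]
    simpa only [h4, smul_zero, sub_zero] using h3
  intro x t
  obtain ⟨C, hC⟩ := h.exists_norm_le η x t
  refine Asymptotics.IsBigO.trans_isLittleO (Asymptotics.IsBigO.of_bound C ?_) h00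
  filter_upwards [hC, isOpen_upper.mem_nhds hη] with z hz hzp
  exact hz _ ((h.isLaxPairSol_P1 (le_of_lt hzp)).sub_smul (h.isLaxPairSol_M2 (le_of_lt hzp)) _)

variable (hη : 0 < η.re * η.im)
include hη

lemma IsJet.eq_smul (hj : IsJet q η b d) (x t : ℝ) : jostP1 q x t η = b • jostM2 q x t η ∧
    deriv (jostP1 q x t) η - b • deriv (jostM2 q x t) η = d • jostM2 q x t η :=
  eq_smul_of_isLittleO (h.differentiableAt_P1 hη) (h.differentiableAt_M2 hη) (hj x t)

lemma IsJet.normB_eq (hj : IsJet q η b d) : normB q η = b := by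
  rw [normB, if_pos hη]
  exact ratio_eq (fun x t => (hj.eq_smul h hη x t).1)
    ((h.hasJost.isM2 hη.le).ne_zero (h.hasJost.continuous 0) 0)

lemma IsJet.normD_eq (hj : IsJet q η b d) : normD q η = d := by
  rw [normD, if_pos hη, hj.normB_eq h hη]
  exact ratio_eq (fun x t => (hj.eq_smul h hη x t).2)
    ((h.hasJost.isM2 hη.le).ne_zero (h.hasJost.continuous 0) 0)

omit h in
lemma eventually_upper : ∀ᶠ z in 𝓝 η, 0 ≤ z.re * z.im := by
  filter_upwards [isOpen_upper.mem_nhds hη] with z hz using le_of_lt hz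

/-- The symmetry is applied to the little-o relation as a whole, which transforms b and d at once.
`IsJet.conj` does the same for the conjugation. -/
lemma IsJet.neg (hj : IsJet q η b d) : IsJet q (-η) (-b) d := by
  intro x t
  have ht : Tendsto (fun z : ℂ => -z) (𝓝 (-η)) (𝓝 η) := by
    simpa using (continuous_neg.tendsto (-η) : Tendsto (fun z : ℂ => -z) _ _)
  have h1 := (hj x t).comp_tendsto ht
  refine Asymptotics.IsBigO.trans_isLittleO (Asymptotics.IsBigO.of_bound 1 ?_)
    (h1.trans_isBigO (Asymptotics.IsBigO.of_bound 1 (Eventually.of_forall fun z => ?_)))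
  · filter_upwards [ht.eventually (eventually_upper hη)] with z hz
    have e1 : jostP1 q x t z = s3 (jostP1 q x t (-z)) := by rw [← h.hasJost.P1_neg hz, neg_neg]
    have e2 : jostM2 q x t z = -s3 (jostM2 q x t (-z)) := by rw [← h.hasJost.M2_neg hz, neg_neg]
    have e3 : jostP1 q x t z - (-b + d * (z - -η)) • jostM2 q x t z =
        s3 (jostP1 q x t (-z) - (b + d * (-z - η)) • jostM2 q x t (-z)) := by
      rw [e1, e2, s3_sub, s3_smul, smul_neg, ← neg_smul]
      congr 2; ring
    have e4 : ∀ v : Fin 2 → ℂ, ‖s3 v‖ ≤ 1 * ‖v‖ := fun v => by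
      rw [one_mul, pi_norm_le_iff_of_nonneg (norm_nonneg _), Fin.forall_fin_two]
      refine ⟨norm_le_pi_norm v 0, ?_⟩
      simpa [s3] using norm_le_pi_norm v 1
    rw [e3]
    exact e4 _
  · simp only [Function.comp_apply, one_mul]
    rw [← norm_neg]; simp [add_comm]

lemma IsJet.conj (hj : IsJet q η b d) (x t : ℝ) :
    (fun z => jostP2 q x t z - (-conj b + -conj d * (z - conj η)) • jostM1 q x t z) =o[𝓝 (conj η)]
      fun z => z - conj η := by
  have ht : Tendsto (fun z : ℂ => conj z) (𝓝 (conj η)) (𝓝 η) := by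
    simpa using Complex.continuous_conj.tendsto (conj η)
  have h1 := (hj x t).comp_tendsto ht
  refine Asymptotics.IsBigO.trans_isLittleO (Asymptotics.IsBigO.of_bound 1 ?_)
    (h1.trans_isBigO (Asymptotics.IsBigO.of_bound 1 (Eventually.of_forall fun z => ?_)))
  · filter_upwards [ht.eventually (eventually_upper hη)] with z hz
    have hz' : z.re * z.im ≤ 0 := by simpa using hz
    have e3 : jostP2 q x t z - (-conj b + -conj d * (z - conj η)) • jostM1 q x t z =
        -jc (jostP1 q x t (conj z) - (b + d * (conj z - η)) • jostM2 q x t (conj z)) := by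
      rw [h.hasJost.P2_eq hz', h.hasJost.M1_eq hz', jc_sub, jc_smul, neg_sub, sub_eq_add_neg,
        ← neg_smul, add_comm, ← sub_eq_add_neg]
      congr 2
      simp; ring
    have e4 : ∀ v : Fin 2 → ℂ, ‖jc v‖ ≤ 1 * ‖v‖ := fun v => by
      rw [one_mul, pi_norm_le_iff_of_nonneg (norm_nonneg _), Fin.forall_fin_two]
      constructor
      · simpa [jc] using norm_le_pi_norm v 1
      · simpa [jc] using norm_le_pi_norm v 0
    rw [e3, norm_neg]
    exact e4 _
  · simp only [Function.comp_apply, one_mul]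
    rw [← Complex.norm_conj]; simp

lemma IsZBCSolution.differentiableAt_P2 : DifferentiableAt ℂ (jostP2 q x t) (conj η) := by
  have e : jostP2 q x t =ᶠ[𝓝 (conj η)]
      fun z => ![-dag (fun z => jostP1 q x t z 1) z, dag (fun z => jostP1 q x t z 0) z] := by
    have ht : Tendsto (fun z : ℂ => conj z) (𝓝 (conj η)) (𝓝 η) := by
      simpa using Complex.continuous_conj.tendsto (conj η)
    filter_upwards [ht.eventually (eventually_upper hη)] with z hz
    have hz' : z.re * z.im ≤ 0 := by simpa using hz
    rw [h.hasJost.P2_eq hz']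
    ext i; fin_cases i <;> simp [jc, dag]
  refine DifferentiableAt.congr_of_eventuallyEq ?_ e
  have hd : ∀ i, DifferentiableAt ℂ (dag fun z => jostP1 q x t z i) (conj η) := fun i =>
    (differentiableAt_pi.1 (h.differentiableAt_P1 hη) i).hasDerivAt.conj_conj.differentiableAt
  rw [differentiableAt_pi, Fin.forall_fin_two]
  exact ⟨(hd 1).neg, hd 0⟩

lemma IsZBCSolution.differentiableAt_M1 : DifferentiableAt ℂ (jostM1 q x t) (conj η) := by
  have e : jostM1 q x t =ᶠ[𝓝 (conj η)]
      fun z => ![dag (fun z => jostM2 q x t z 1) z, -dag (fun z => jostM2 q x t z 0) z] := by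
    have ht : Tendsto (fun z : ℂ => conj z) (𝓝 (conj η)) (𝓝 η) := by
      simpa using Complex.continuous_conj.tendsto (conj η)
    filter_upwards [ht.eventually (eventually_upper hη)] with z hz
    have hz' : z.re * z.im ≤ 0 := by simpa using hz
    rw [h.hasJost.M1_eq hz']
    ext i; fin_cases i <;> simp [jc, dag]
  refine DifferentiableAt.congr_of_eventuallyEq ?_ e
  have hd : ∀ i, DifferentiableAt ℂ (dag fun z => jostM2 q x t z i) (conj η) := fun i =>
    (differentiableAt_pi.1 (h.differentiableAt_M2 hη) i).hasDerivAt.conj_conj.differentiableAt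
  rw [differentiableAt_pi, Fin.forall_fin_two]
  exact ⟨hd 1, (hd 0).neg⟩

lemma IsJet.norm_conj_eq (hj : IsJet q η b d) :
    normB q (conj η) = -conj b ∧ normD q (conj η) = -conj d := by
  have hn : ¬ 0 < (conj η).re * (conj η).im := by simpa using hη.le
  have hM : jostM1 q 0 0 (conj η) ≠ 0 :=
    (h.isJostColumn_M1 (t := 0) (z := conj η) (by simpa using hη.le)).ne_zero
      (h.hasJost.continuous 0) 0
  have key := fun x t => eq_smul_of_isLittleO (h.differentiableAt_P2 (x := x) (t := t) hη)
    (h.differentiableAt_M1 hη) (hj.conj h hη x t)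
  have hB : normB q (conj η) = -conj b := by
    rw [normB, if_neg hn]
    exact ratio_eq (fun x t => (key x t).1) hM
  refine ⟨hB, ?_⟩
  rw [normD, if_neg hn, hB]
  exact ratio_eq (fun x t => (key x t).2) hM

lemma IsZBCSolution.iteratedDeriv_s11_neg (n : ℕ) :
    iteratedDeriv n (s11 q) (-η) = (-1) ^ n * iteratedDeriv n (s11 q) η := by
  have e : s11 q =ᶠ[𝓝 (-η)] fun z => s11 q (-z) := by
    have : 0 < (-η).re * (-η).im := by simpa using hη
    filter_upwards [eventually_upper this] with z hz
    exact (h.hasJost.s11_neg hz).symm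
  rw [(e.iteratedDeriv n).self_of_nhds, iteratedDeriv_comp_neg, neg_neg, smul_eq_mul]

omit h hη in
lemma iteratedDeriv_dag (f : ℂ → ℂ) (n : ℕ) : iteratedDeriv n (dag f) = dag (iteratedDeriv n f) := by
  induction n with
  | zero => simp
  | succ n ih =>
    rw [iteratedDeriv_succ, ih, iteratedDeriv_succ]
    ext z
    rw [deriv_dag, dag]

lemma IsZBCSolution.iteratedDeriv_s22 (n : ℕ) :
    iteratedDeriv n (s22 q) (conj η) = conj (iteratedDeriv n (s11 q) η) := by
  have e : s22 q =ᶠ[𝓝 (conj η)] dag (s11 q) := by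
    have ht : Tendsto (fun z : ℂ => conj z) (𝓝 (conj η)) (𝓝 η) := by
      simpa using Complex.continuous_conj.tendsto (conj η)
    filter_upwards [ht.eventually (eventually_upper hη)] with z hz
    exact h.hasJost.s22_eq (by simpa using hz)
  rw [(e.iteratedDeriv n).self_of_nhds, iteratedDeriv_dag, dag, Complex.conj_conj]

lemma IsJet.disc_eq (hj : IsJet q η b d) : discA q η = 2 * b / iteratedDeriv 2 (s11 q) η ∧
    discB q η = d / b - iteratedDeriv 3 (s11 q) η / (3 * iteratedDeriv 2 (s11 q) η) := by
  rw [discA, discB, if_pos hη, if_pos hη, hj.normB_eq h hη, hj.normD_eq h hη]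
  exact ⟨rfl, rfl⟩

lemma IsJet.disc_neg (hj : IsJet q η b d) :
    discA q (-η) = -discA q η ∧ discB q (-η) = -discB q η := by
  have hη' : 0 < (-η).re * (-η).im := by simpa using hη
  obtain ⟨h1, h2⟩ := hj.disc_eq h hη
  obtain ⟨h3, h4⟩ := (hj.neg h hη).disc_eq h hη'
  rw [h1, h2, h3, h4, h.iteratedDeriv_s11_neg hη, h.iteratedDeriv_s11_neg hη]
  constructor
  · ring
  · rw [div_neg]; ring

lemma IsJet.disc_conj (hj : IsJet q η b d) :
    discA q (conj η) = -conj (discA q η) ∧ discB q (conj η) = conj (discB q η) := by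
  have hn : ¬ 0 < (conj η).re * (conj η).im := by simpa using hη.le
  obtain ⟨h1, h2⟩ := hj.disc_eq h hη
  obtain ⟨h3, h4⟩ := hj.norm_conj_eq h hη
  rw [h1, h2, discA, discB, if_neg hn, if_neg hn, h3, h4, h.iteratedDeriv_s22 hη,
    h.iteratedDeriv_s22 hη]
  have c2 : conj (2 : ℂ) = 2 := map_ofNat _ 2
  have c3 : conj (3 : ℂ) = 3 := map_ofNat _ 3
  constructor
  · simp [c2]; ring
  · simp [c3]

end NormingConstants

/-- The symmetries of the discrete data. -/
theorem IsDoublePoleSoliton.isNormingData {N : ℕ} {k : Fin N → ℂ} {q : ℝ → ℝ → ℂ}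
    (hq : IsDoublePoleSoliton k q) (hre : ∀ n, 0 < (k n).re) (him : ∀ n, 0 < (k n).im) :
    IsNormingData k (discA q) (discB q) := by
  have h := hq.solution
  have hη : ∀ n, 0 < (k n).re * (k n).im := fun n => mul_pos (hre n) (him n)
  have hη' : ∀ n, 0 < (-k n).re * (-k n).im := fun n => by simpa using hη n
  have hjet : ∀ n, ∃ b d, b ≠ 0 ∧ IsJet q (k n) b d := fun n =>
    h.exists_isJet (hη n) ((hq.zeros _ (hre n) (him n)).2 ⟨n, rfl⟩) (hq.deriv_zero n)
  choose b d hb hj using hjet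
  refine ⟨fun n => ?_, fun n => ((hj n).disc_conj h (hη n)).1, fun n => ?_,
    fun n => ((hj n).disc_neg h (hη n)).1, fun n => ((hj n).disc_conj h (hη n)).2, fun n => ?_,
    fun n => ((hj n).disc_neg h (hη n)).2⟩
  · rw [((hj n).disc_eq h (hη n)).1]
    exact div_ne_zero (mul_ne_zero two_ne_zero (hb n)) (hq.double n)
  · rw [← map_neg, (((hj n).neg h (hη n)).disc_conj h (hη' n)).1, ((hj n).disc_neg h (hη n)).1]
    simp
  · rw [← map_neg, (((hj n).neg h (hη n)).disc_conj h (hη' n)).2, ((hj n).disc_neg h (hη n)).2]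
    simp

/-! ## Gluing along the real line -/

section Gluing

/-- A function on the closed upper half plane, analytic in the interior and continuous up to the
boundary outside `S`, and bounded near infinity. -/
structure IsUpperFn (f : ℂ → ℂ) (S : Set ℂ) : Prop where
  cont : ∀ l : ℂ, 0 ≤ l.im → l ∉ S → ContinuousWithinAt f {l | 0 ≤ l.im} l
  diff : ∀ l : ℂ, 0 < l.im → l ∉ S → DifferentiableAt ℂ f l
  bdd : ∃ C, ∀ᶠ l in infUpper, ‖f l‖ ≤ C

/-- The function `f` in the upper half plane, continued by `g*` to the lower half plane. -/
def glue (f g : ℂ → ℂ) (l : ℂ) : ℂ := if 0 ≤ l.im then f l else dag g l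

variable {f g : ℂ → ℂ} {S T : Set ℂ}

lemma glue_of_nonneg {l : ℂ} (hl : 0 ≤ l.im) : glue f g l = f l := if_pos hl

lemma glue_of_nonpos (hfg : ∀ l : ℂ, l.im = 0 → f l = dag g l) {l : ℂ} (hl : l.im ≤ 0) :
    glue f g l = dag g l := by
  rcases hl.lt_or_eq with h | h
  · exact if_neg (not_le.2 h)
  · rw [glue_of_nonneg h.ge, hfg l h]

/-- The matching on the real axis makes the glued function continuous across it, and Morera's
theorem then makes it analytic there. -/
lemma glue_analyticAt (hf : IsUpperFn f S) (hg : IsUpperFn g T) (hS : S.Finite) (hT : T.Finite)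
    (hfg : ∀ l : ℂ, l.im = 0 → f l = dag g l) {l : ℂ} (hl : l ∉ S) (hl' : conj l ∉ T) :
    AnalyticAt ℂ (glue f g) l := by
  set U : Set ℂ := {l | l ∉ S ∧ conj l ∉ T} with hU
  have hUo : IsOpen U :=
    hS.isClosed.isOpen_compl.inter (hT.isClosed.isOpen_compl.preimage Complex.continuous_conj)
  have hdag : ∀ l : ℂ, l.im < 0 → conj l ∉ T → DifferentiableAt ℂ (dag g) l := by
    intro l hl hlT
    have := (hg.diff (conj l) (by simpa using hl) hlT).hasDerivAt.conj_conj
    rw [Complex.conj_conj] at this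
    exact this.differentiableAt
  have hd : ∀ z ∈ U, z.im ≠ 0 → DifferentiableAt ℂ (glue f g) z := by
    intro z hz hz0
    rcases lt_or_gt_of_ne hz0 with h | h
    · refine (hdag z h hz.2).congr_of_eventuallyEq ?_
      filter_upwards [(isOpen_lt Complex.continuous_im continuous_const).mem_nhds h] with w hw
      exact glue_of_nonpos hfg (le_of_lt hw)
    · refine (hf.diff z h hz.1).congr_of_eventuallyEq ?_
      filter_upwards [(isOpen_lt continuous_const Complex.continuous_im).mem_nhds h] with w hw
      exact glue_of_nonneg (le_of_lt hw)
  have hc : ContinuousOn (glue f g) U := by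
    intro z hz
    by_cases hz0 : z.im = 0
    · refine ContinuousAt.continuousWithinAt ?_
      rw [← continuousWithinAt_univ, ← show {l : ℂ | 0 ≤ l.im} ∪ {l : ℂ | l.im ≤ 0} = Set.univ from
        Set.eq_univ_of_forall fun l => le_total 0 l.im]
      refine ContinuousWithinAt.union ?_ ?_
      · exact (hf.cont z hz0.ge hz.1).congr (fun l hl => glue_of_nonneg hl) (glue_of_nonneg hz0.ge)
      · have h1 := hg.cont (conj z) (by simp [hz0]) hz.2
        have h2 : ContinuousWithinAt (fun l => g (conj l)) {l : ℂ | l.im ≤ 0} z :=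
          h1.comp Complex.continuous_conj.continuousWithinAt fun l hl => by
            have : l.im ≤ 0 := hl
            simpa using this
        have h3 : ContinuousWithinAt (dag g) {l : ℂ | l.im ≤ 0} z :=
          Complex.continuous_conj.continuousAt.comp_continuousWithinAt h2
        exact h3.congr (fun l hl => glue_of_nonpos hfg hl) (glue_of_nonpos hfg hz0.le)
    · exact (hd z hz hz0).continuousAt.continuousWithinAt
  exact (differentiableOn_of_continuousOn_of_off_real hUo hc hd).analyticAt
    (hUo.mem_nhds ⟨hl, hl'⟩)

lemma eventually_norm_glue_le (hf : IsUpperFn f S) (hg : IsUpperFn g T) :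
    ∃ C, ∀ᶠ l in Bornology.cobounded ℂ, ‖glue f g l‖ ≤ C := by
  obtain ⟨C, hC⟩ := hf.bdd
  obtain ⟨D, hD⟩ := hg.bdd
  refine ⟨max C D, ?_⟩
  have hconj : Tendsto (conj : ℂ → ℂ) (Bornology.cobounded ℂ) (Bornology.cobounded ℂ) := by
    simpa only [Metric.cobounded_eq_cocompact] using tendsto_conj_cocompact
  filter_upwards [eventually_inf_principal.1 hC, hconj.eventually (eventually_inf_principal.1 hD)]
    with l h1 h2
  by_cases hl : 0 ≤ l.im
  · rw [glue_of_nonneg hl]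
    exact (h1 hl).trans (le_max_left _ _)
  · rw [glue, if_neg hl, dag, Complex.norm_conj]
    exact (h2 (by simpa using (not_le.1 hl).le)).trans (le_max_right _ _)

lemma exists_eventually_norm_le_of_tendsto {l : Filter ℂ} {c : ℂ} (h : Tendsto f l (𝓝 c)) :
    ∃ C, ∀ᶠ z in l, ‖f z‖ ≤ C :=
  ⟨‖c‖ + 1, (h.norm.eventually (gt_mem_nhds (lt_add_one _))).mono fun _ => le_of_lt⟩

/-- A quotient by a function with a double zero, in terms of the double pole part. -/
lemma removable_sub_pp {η b d : ℂ} {p m U β : ℂ → ℂ} (hp : AnalyticAt ℂ p η)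
    (hm : AnalyticAt ℂ m η) (hU : AnalyticAt ℂ U η) (hU0 : U η ≠ 0) (hβ : AnalyticAt ℂ β η)
    (hβ0 : ∀ z, β z ≠ 0) (hb : b ≠ 0)
    (ho : (fun z => p z - (b + d * (z - η)) * m z) =o[𝓝 η] fun z => z - η)
    (hf : ∀ᶠ z in 𝓝[≠] η, f z = β z * p z / ((z - η) ^ 2 * U z))
    (hg : ∀ᶠ z in 𝓝[≠] η, g z = m z / β z) {c e : ℂ} (hc : c = b * β η ^ 2 / U η)
    (he : e = c * (d / b + 2 * (deriv β η / β η) - deriv U η / U η)) :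
    Removable (fun z => f z - pp η c e z * g z) η := by
  have hR : AnalyticAt ℂ (fun z => p z - (b + d * (z - η)) * m z) η := by fun_prop
  obtain ⟨R, hRa, hRe⟩ := exists_taylor_two hR
  have h0 : p η - (b + d * (η - η)) * m η = 0 := by
    have := (ho.def one_pos).self_of_nhds
    simpa using this
  have h1 : deriv (fun z => p z - (b + d * (z - η)) * m z) η = 0 := by
    refine HasDerivAt.deriv ?_
    rw [hasDerivAt_iff_isLittleO]
    simpa only [h0, smul_zero, sub_zero] using ho
  have hh : AnalyticAt ℂ (fun z => (b + d * (z - η)) * β z ^ 2 / U z) η := by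
    refine AnalyticAt.div (by fun_prop) hU hU0
  obtain ⟨u, hua, hue⟩ := exists_taylor_two hh
  have hhc : (b + d * (η - η)) * β η ^ 2 / U η = c := by rw [hc]; ring
  have hhe : deriv (fun z => (b + d * (z - η)) * β z ^ 2 / U z) η = e := by
    have h2 := (((((hasDerivAt_id' η).sub_const η).const_mul d).const_add b).fun_mul
      (hβ.differentiableAt.hasDerivAt.fun_pow 2)).fun_div hU.differentiableAt.hasDerivAt hU0
    rw [h2.deriv, he, hc]
    have := hβ0 η
    field_simp
    ring
  have hU0' : ∀ᶠ z in 𝓝[≠] η, U z ≠ 0 :=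
    (hU.continuousAt.eventually_ne hU0).filter_mono nhdsWithin_le_nhds
  refine ⟨fun z => u z * (m z / β z) + β z * R z / U z,
    (hua.mul (hm.div hβ (hβ0 η))).add ((hβ.mul hRa).div hU hU0), ?_⟩
  filter_upwards [hf, hg, hU0', self_mem_nhdsWithin] with z h2 h3 h4 h5
  have h6 : z - η ≠ 0 := sub_ne_zero.2 h5
  have h7 := hRe z
  have h8 := hue z
  simp only [h0, h1, hhc, hhe, zero_add, mul_zero] at h7 h8
  have h9 := hβ0 z
  have hpz : p z = (b + d * (z - η)) * m z + (z - η) ^ 2 * R z := by linear_combination h7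
  have hu : u z = ((b + d * (z - η)) * β z ^ 2 / U z - c - (z - η) * e) / (z - η) ^ 2 := by
    rw [h8]; field_simp; ring
  rw [h2, h3, hu, hpz, pp]
  field_simp
  ring

lemma exists_sq_eq_of_nonneg_im {l : ℂ} (hl : 0 ≤ l.im) :
    ∃ z : ℂ, z ^ 2 = l ∧ 0 ≤ z.re ∧ 0 ≤ z.im := by
  obtain ⟨z, hz⟩ := IsAlgClosed.exists_pow_nat_eq l (n := 2) two_pos
  have h1 : 0 ≤ z.re * z.im := by
    have := sq_im z
    rw [hz] at this
    linarith
  rcases le_total 0 z.re with h2 | h2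
  · rcases le_or_gt 0 z.im with h3 | h3
    · exact ⟨z, hz, h2, h3⟩
    · rcases h2.lt_or_eq with h4 | h4
      · exact absurd (mul_neg_of_pos_of_neg h4 h3) (not_lt.2 h1)
      · exact ⟨-z, by rw [neg_sq, hz], by simp [← h4], by simpa using h3.le⟩
  · rcases le_or_gt z.im 0 with h3 | h3
    · exact ⟨-z, by rw [neg_sq, hz], by simpa using h2, by simpa using h3⟩
    · rcases h2.lt_or_eq with h4 | h4
      · exact absurd (mul_neg_of_neg_of_pos h4 h3) (not_lt.2 h1)
      · exact ⟨z, hz, h4.ge, h3.le⟩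

end Gluing

/-! ### The reflectionless scattering relation in λ = k² -/

section Uniqueness

variable {N : ℕ} {k : Fin N → ℂ} {q : ℝ → ℝ → ℂ} {x t : ℝ} {a n a' n' : ℝ → ℂ → ℂ}

/-- The scattering coefficient `s₁₁` as a function of `λ = k²`. -/
def specS (a n a' n' : ℝ → ℂ → ℂ) (x : ℝ) (l : ℂ) : ℂ :=
  a x l * a' (-x) l - n x l * n' (-x) l / l

variable (h : IsZBCSolution q) (hP : UpperJost (fun x => q x t) a n)
  (hM : UpperJost (refl fun x => q x t) a' n')
include h

include hP in
lemma jostP1_eq_upper {z : ℂ} (hz : 0 ≤ z.re * z.im) :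
    jostP1 q x t z = bgExp 0 x t z • ![a x (z ^ 2), n x (z ^ 2) / z] :=
  (isJostColumn_upperJost (h.isPotential t) hP hz).jost_eq (h.hasJost.continuous t)
    (bgBdd_of_nonneg_top hz) x

include hM in
lemma jostM2_eq_upper {z : ℂ} (hz : 0 ≤ z.re * z.im) :
    jostM2 q x t z = bgExp 1 x t z • ![n' (-x) (z ^ 2) / z, a' (-x) (z ^ 2)] :=
  (isJostColumn_upperJost_refl (h.isPotential t) hM hz).jost_eq (h.hasJost.continuous t)
    (bgBdd_of_nonneg_bot hz) x

include hP hM in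
lemma specS_sq {z : ℂ} (hz : 0 ≤ z.re * z.im) : specS a n a' n' x (z ^ 2) = s11 q z := by
  rw [← h.wr_P1_M2 (x := x) (t := t) hz, jostP1_eq_upper h hP hz, jostM2_eq_upper h hM hz,
    wr_smul_left, wr_smul_right, ← mul_assoc, bgExp_mul, one_mul]
  simp only [wr, specS, Matrix.cons_val_zero, Matrix.cons_val_one]
  rw [div_mul_div_comm, ← sq]

include hP hM in
-- Only λ = 0 is delicate: there n = O(λ) compensates the division by λ and n' vanishes, which
-- agrees with the value 0 of the quotient at λ = 0.
lemma specS_cont {l : ℂ} (hl : 0 ≤ l.im) :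
    ContinuousWithinAt (specS a n a' n' x) {l | 0 ≤ l.im} l := by
  have c1 := (hP.cont1 x).continuousWithinAt (s := {l : ℂ | 0 ≤ l.im}) (x := l)
  have c2 := (hP.cont2 x).continuousWithinAt (s := {l : ℂ | 0 ≤ l.im}) (x := l)
  have c3 := (hM.cont1 (-x)).continuousWithinAt (s := {l : ℂ | 0 ≤ l.im}) (x := l)
  have c4 := (hM.cont2 (-x)).continuousWithinAt (s := {l : ℂ | 0 ≤ l.im}) (x := l)
  refine (c1.mul c3).sub ?_
  by_cases hl0 : l = 0
  · subst hl0
    obtain ⟨C, hC⟩ := hP.exists_norm_le (h.isPotential t) x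
    have h0 : n x 0 * n' (-x) 0 / 0 = 0 := by rw [div_zero]
    rw [ContinuousWithinAt, h0]
    have h1 : Tendsto (fun l => C * ‖n' (-x) l‖) (𝓝[{l : ℂ | 0 ≤ l.im}] 0) (𝓝 0) := by
      have := c4.norm.const_mul C
      rw [ContinuousWithinAt, hM.n_zero (h.isPotential t).refl, norm_zero, mul_zero] at this
      exact this
    refine squeeze_zero_norm' ?_ h1
    filter_upwards [self_mem_nhdsWithin] with l hl
    rw [norm_div, norm_mul]
    by_cases hl0 : l = 0
    · subst hl0
      simp [hM.n_zero (h.isPotential t).refl]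
    · have := norm_pos_iff.2 hl0
      rw [div_le_iff₀ this]
      calc _ ≤ C * ‖l‖ * ‖n' (-x) l‖ := by gcongr; exact hC l hl
        _ = _ := by ring
  · exact (c2.mul c4).div continuousWithinAt_id hl0

omit h in
include hP hM in
lemma specS_diff {l : ℂ} (hl : 0 < l.im) : DifferentiableAt ℂ (specS a n a' n' x) l := by
  have hl0 : l ≠ 0 := by rintro rfl; simp at hl
  exact ((hP.diff1 x l hl).mul (hM.diff1 (-x) l hl)).sub
    (((hP.diff2 x l hl).mul (hM.diff2 (-x) l hl)).div differentiableAt_id hl0)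

omit h in
include hP hM in
lemma specS_tendsto : ∃ e : ℂ, e ≠ 0 ∧ Tendsto (specS a n a' n' x) infUpper (𝓝 e) := by
  obtain ⟨e, c, he, h1, h2⟩ := hP.inf x
  obtain ⟨e', c', he', h3, h4⟩ := hM.inf (-x)
  have h5 : Tendsto (fun l : ℂ => l⁻¹) infUpper (𝓝 0) :=
    tendsto_inv₀_cobounded.mono_left inf_le_left
  refine ⟨e * e', mul_ne_zero (norm_ne_zero_iff.1 (by rw [he]; exact one_ne_zero))
    (norm_ne_zero_iff.1 (by rw [he']; exact one_ne_zero)), ?_⟩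
  have := (h1.mul h3).sub ((h2.mul h4).mul h5)
  rw [mul_zero, sub_zero] at this
  exact this

variable (hq : IsDoublePoleSoliton k q)
include hq hP hM

omit h in
-- The square root of λ is taken in the closed first quadrant. In its interior the zeros of s₁₁ are
-- the kₙ, and its boundary lies on the contour, where s₁₁ has no zeros.
lemma IsDoublePoleSoliton.specS_ne_zero {l : ℂ} (hl : 0 ≤ l.im)
    (hlS : l ∉ Set.range fun i => eta k i ^ 2) : specS a n a' n' x l ≠ 0 := by
  obtain ⟨z, rfl, hz1, hz2⟩ := exists_sq_eq_of_nonneg_im hl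
  rw [specS_sq hq.solution hP hM (mul_nonneg hz1 hz2)]
  rcases hz1.lt_or_eq with h1 | h1
  · rcases hz2.lt_or_eq with h2 | h2
    · rw [Ne, hq.zeros z h1 h2]
      rintro ⟨i, rfl⟩
      exact hlS ⟨.inl i, rfl⟩
    · exact (hq.no_spectral_singularity z (Or.inr h2.symm)).1
  · exact (hq.no_spectral_singularity z (Or.inl h1.symm)).1

omit h in
-- A real λ corresponds to k on the contour. There s₂₁ = 0 makes Φ₊₁ proportional to Φ₋₁, which is
-- the reflection of Φ₋₂, and det Φ₋ = 1 identifies the factor as s₁₁.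
lemma IsDoublePoleSoliton.real_eq {l : ℂ} (hl : l.im = 0) :
    a x l = specS a n a' n' x l * conj (a' (-x) l) ∧
      n x l = -(specS a n a' n' x l * conj (n' (-x) l)) := by
  have h := hq.solution
  obtain ⟨z, rfl, hz1, hz2⟩ := exists_sq_eq_of_nonneg_im hl.ge
  have hz0 : z.re * z.im = 0 := by
    have := sq_im z
    rw [hl] at this
    linarith
  have hzc : z ∈ contour := mul_eq_zero.1 hz0
  have hz0' : (conj z).re * (conj z).im = 0 := by simpa using hz0
  have hsq : conj z ^ 2 = z ^ 2 := by
    rw [← map_pow, Complex.conj_eq_iff_im.2 hl]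
  have h1 := (h.isLaxPairSol_M1 hz0.le).wr_eq (h.isLaxPairSol_P1 hz0.ge) x t
  have h21 : s21 q z = 0 := by
    have := (hq.reflectionless z hzc).1
    rw [rho, div_eq_zero_iff] at this
    exact this.resolve_right (hq.no_spectral_singularity z hzc).1
  rw [show wr (jostM1 q 0 0 z) (jostP1 q 0 0 z) = 0 from h21] at h1
  have hM1 : jostM1 q x t z = bgExp 0 x t z •
      ![conj (a' (-x) (z ^ 2)), -(conj (n' (-x) (z ^ 2)) / z)] := by
    rw [h.hasJost.M1_eq hz0.le, jostM2_eq_upper h hM hz0'.ge, jc_smul, hsq, conj_bgExp_one]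
    congr 1
    ext i; fin_cases i <;> simp [jc]
  have hb : bgExp 0 x t z ≠ 0 := Complex.exp_ne_zero _
  rw [hM1, jostP1_eq_upper h hP hz0.ge, wr_smul_left, wr_smul_right] at h1
  have h2 := (mul_eq_zero.1 ((mul_eq_zero.1 h1).resolve_left hb)).resolve_left hb
  simp only [wr, Matrix.cons_val_zero, Matrix.cons_val_one] at h2
  -- This is det Φ₋ = 1, a constant Wronskian evaluated in the limit x → -∞.
  have h3 : a' (-x) (z ^ 2) * conj (a' (-x) (z ^ 2)) +
      n' (-x) (z ^ 2) * conj (n' (-x) (z ^ 2)) / z ^ 2 = 1 := by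
    have hw : ∀ y, wr (jostM1 q y t z) (jostM2 q y t z) = 1 := by
      intro y
      have hlim : Tendsto (fun y => wr ((bgExp 0 y t z)⁻¹ • jostM1 q y t z)
          ((bgExp 1 y t z)⁻¹ • jostM2 q y t z)) atBot (𝓝 (wr (Pi.single 0 1) (Pi.single 1 1))) := by
        have e1 := tendsto_pi_nhds.1 (h.isJostColumn_M1 (t := t) hz0.le).2
        have e2 := tendsto_pi_nhds.1 (h.hasJost.isM2 (t := t) hz0.ge).2
        exact ((e1 0).mul (e2 1)).sub ((e1 1).mul (e2 0))
      have e3 : ∀ y', wr ((bgExp 0 y' t z)⁻¹ • jostM1 q y' t z)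
          ((bgExp 1 y' t z)⁻¹ • jostM2 q y' t z) = wr (jostM1 q y t z) (jostM2 q y t z) := by
        intro y'
        rw [wr_smul_left, wr_smul_right, ← mul_assoc, ← mul_inv, bgExp_mul, inv_one, one_mul]
        exact (h.isJostColumn_M1 hz0.le).isLaxSol.wr_eq (h.hasJost.isM2 hz0.ge).isLaxSol y' y
      simp only [e3] at hlim
      rw [tendsto_nhds_unique tendsto_const_nhds hlim]
      simp [wr]
    have := hw x
    rw [hM1, jostM2_eq_upper h hM hz0.ge, wr_smul_left, wr_smul_right, ← mul_assoc, bgExp_mul,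
      one_mul] at this
    simp only [wr, Matrix.cons_val_zero, Matrix.cons_val_one] at this
    rw [← this, sq, neg_mul, sub_neg_eq_add, div_mul_div_comm]
    ring
  rw [specS]
  by_cases hz : z = 0
  · subst hz
    have e1 := hP.n_zero (h.isPotential t) x
    have e2 := hM.n_zero (h.isPotential t).refl (-x)
    have e3 := hP.a_zero (h.isPotential t) x
    have e4 := hM.a_zero (h.isPotential t).refl (-x)
    simp [e1, e2, e3, e4]
  · have hn : n x (z ^ 2) * conj (a' (-x) (z ^ 2)) = -(conj (n' (-x) (z ^ 2)) * a x (z ^ 2)) := by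
      field_simp at h2
      linear_combination h2
    field_simp at h3 ⊢
    constructor
    · linear_combination (-a x (z ^ 2)) * h3 + n' (-x) (z ^ 2) * hn
    · linear_combination (-n x (z ^ 2)) * h3 + z ^ 2 * a' (-x) (z ^ 2) * hn

end Uniqueness

/-! ### Identification of the spectral row with the explicit row -/

section Identification

open Bornology

variable {N : ℕ} {k : Fin N → ℂ} {q : ℝ → ℝ → ℂ} {x t : ℝ} {a n a' n' : ℝ → ℂ → ℂ}

/-- The first component of the normalised spectral row, as a function of `z`. -/
def specF (a n a' n' : ℝ → ℂ → ℂ) (x : ℝ) (z : ℂ) : ℂ :=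
  glue (fun l => a x l / specS a n a' n' x l) (a' (-x)) (z ^ 2)

/-- The second component of the normalised spectral row, as a function of `z`. -/
def specG (a n a' n' : ℝ → ℂ → ℂ) (x : ℝ) (z : ℂ) : ℂ :=
  glue (n' (-x)) (fun l => -(n x l / specS a n a' n' x l)) (z ^ 2) / z

lemma eta_swap (i : Fin N ⊕ Fin N) : eta k (Sum.swap i) = -eta k i := by
  rcases i with i | i <;> simp [eta]

lemma sq_notMem_range_eta_sq {z : ℂ} (hz : ∀ i, z ≠ eta k i) :
    z ^ 2 ∉ Set.range fun i => eta k i ^ 2 := by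
  rintro ⟨i, hi⟩
  rcases sq_eq_sq_iff_eq_or_eq_neg.1 hi with h | h
  · exact hz i h.symm
  · exact hz (Sum.swap i) (by rw [eta_swap, h, neg_neg])

lemma isUpperFn_of_tendsto {p : ℂ → ℂ} {c : ℂ} (hc : Continuous p)
    (hd : ∀ l : ℂ, 0 < l.im → DifferentiableAt ℂ p l) (hinf : Tendsto p infUpper (𝓝 c)) :
    IsUpperFn p ∅ :=
  ⟨fun _ _ _ => hc.continuousWithinAt, fun l hl _ => hd l hl,
    exists_eventually_norm_le_of_tendsto hinf⟩

lemma UpperJost.isUpperFn_fst {p : ℝ → ℂ} (hP : UpperJost p a n) (x : ℝ) : IsUpperFn (a x) ∅ := by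
  obtain ⟨e, c, -, h1, -⟩ := hP.inf x
  exact isUpperFn_of_tendsto (hP.cont1 x) (hP.diff1 x) h1

lemma UpperJost.isUpperFn_snd {p : ℝ → ℂ} (hP : UpperJost p a n) (x : ℝ) : IsUpperFn (n x) ∅ := by
  obtain ⟨e, c, -, -, h1⟩ := hP.inf x
  exact isUpperFn_of_tendsto (hP.cont2 x) (hP.diff2 x) h1

lemma IsUpperFn.neg {f : ℂ → ℂ} {S : Set ℂ} (hf : IsUpperFn f S) : IsUpperFn (fun l => -f l) S :=
  ⟨fun l h1 h2 => (hf.cont l h1 h2).neg, fun l h1 h2 => (hf.diff l h1 h2).neg, by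
    simpa only [norm_neg] using hf.bdd⟩

variable (hP : UpperJost (fun x => q x t) a n) (hM : UpperJost (refl fun x => q x t) a' n')
include hP hM

section General

variable (h : IsZBCSolution q) {z : ℂ} (hz : 0 ≤ z.re * z.im)
include h hz

lemma specF_eq : specF a n a' n' x z = bgExp 1 x t z * jostP1 q x t z 0 / s11 q z := by
  rw [specF, glue_of_nonneg (by rw [sq_im]; linarith), specS_sq h hP hM hz, jostP1_eq_upper h hP hz,
    Pi.smul_apply, smul_eq_mul, ← mul_assoc, mul_comm (bgExp 1 x t z), bgExp_mul, one_mul]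
  rfl

omit hP in
lemma specG_eq : specG a n a' n' x z = jostM2 q x t z 0 / bgExp 1 x t z := by
  rw [specG, glue_of_nonneg (by rw [sq_im]; linarith), jostM2_eq_upper h hM hz, Pi.smul_apply,
    smul_eq_mul, mul_div_cancel_left₀ _ (bgExp_ne_zero)]
  rfl

end General

section Soliton

variable (hq : IsDoublePoleSoliton k q) (hre : ∀ i, 0 < (k i).re) (him : ∀ i, 0 < (k i).im)
include hq

lemma IsDoublePoleSoliton.isUpperFn_div {p : ℂ → ℂ} (hp : IsUpperFn p ∅) :
    IsUpperFn (fun l => p l / specS a n a' n' x l) (Set.range fun i => eta k i ^ 2) := by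
  obtain ⟨C, hC⟩ := hp.bdd
  obtain ⟨e, he, hlim⟩ := specS_tendsto (x := x) hP hM
  refine ⟨fun l h1 h2 => (hp.cont l h1 (Set.notMem_empty l)).div (specS_cont hq.solution hP hM h1)
    (hq.specS_ne_zero hP hM h1 h2), fun l h1 h2 => (hp.diff l h1 (Set.notMem_empty l)).div
    (specS_diff hP hM h1) (hq.specS_ne_zero hP hM h1.le h2), ?_⟩
  obtain ⟨D, hD⟩ := exists_eventually_norm_le_of_tendsto (hlim.inv₀ he)
  refine ⟨C * D, ?_⟩
  filter_upwards [hC, hD] with l h1 h2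
  rw [div_eq_mul_inv, norm_mul]
  exact mul_le_mul h1 h2 (norm_nonneg _) ((norm_nonneg _).trans h1)

include hre him

omit hP hM hq in
lemma notMem_range_eta_sq_of_im {l : ℂ} (hl : l.im = 0) :
    l ∉ Set.range fun i => eta k i ^ 2 := by
  rintro ⟨i, rfl⟩
  have := eta_mem hre him i
  have h2 := sq_im (eta k i)
  simp only [hl] at h2
  linarith

/-- `IsDoublePoleSoliton.real_eq` divided by s₁₁: this is the hypothesis under which the two halves
glue. -/
lemma IsDoublePoleSoliton.match_fst (l : ℂ) (hl : l.im = 0) :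
    a x l / specS a n a' n' x l = dag (a' (-x)) l := by
  rw [dag, Complex.conj_eq_iff_im.2 hl,
    div_eq_iff (hq.specS_ne_zero hP hM hl.ge (notMem_range_eta_sq_of_im hre him hl)),
    (hq.real_eq hP hM hl).1, mul_comm]

lemma IsDoublePoleSoliton.match_snd (l : ℂ) (hl : l.im = 0) :
    n' (-x) l = dag (fun l => -(n x l / specS a n a' n' x l)) l := by
  rw [dag, Complex.conj_eq_iff_im.2 hl, (hq.real_eq hP hM hl).2, neg_div, neg_neg,
    mul_div_cancel_left₀ _
      (hq.specS_ne_zero hP hM hl.ge (notMem_range_eta_sq_of_im hre him hl)), Complex.conj_conj]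

lemma IsDoublePoleSoliton.dag_specF_eq {z : ℂ} (hz : 0 ≤ z.re * z.im) :
    dag (specF a n a' n' x) z = jostM2 q x t z 1 / bgExp 1 x t z := by
  have h1 : ((conj z) ^ 2).im ≤ 0 := by
    rw [← map_pow, Complex.conj_im, sq_im]; linarith
  rw [dag, specF, glue_of_nonpos (hq.match_fst hP hM hre him) h1, dag, Complex.conj_conj, map_pow,
    Complex.conj_conj, jostM2_eq_upper hq.solution hM hz, Pi.smul_apply, smul_eq_mul,
    mul_div_cancel_left₀ _ (bgExp_ne_zero)]
  rfl

lemma IsDoublePoleSoliton.dag_specG_eq {z : ℂ} (hz : 0 ≤ z.re * z.im) :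
    dag (specG a n a' n' x) z = -(bgExp 1 x t z * jostP1 q x t z 1 / s11 q z) := by
  have h1 : ((conj z) ^ 2).im ≤ 0 := by
    rw [← map_pow, Complex.conj_im, sq_im]; linarith
  rw [dag, specG, glue_of_nonpos (hq.match_snd hP hM hre him) h1, dag, map_div₀,
    Complex.conj_conj, map_pow, Complex.conj_conj,
    specS_sq hq.solution hP hM hz, jostP1_eq_upper hq.solution hP hz,
    Pi.smul_apply, smul_eq_mul, ← mul_assoc, mul_comm (bgExp 1 x t z), bgExp_mul, one_mul, neg_div]
  simp only [Matrix.cons_val_one, Matrix.cons_val_zero]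
  rw [div_right_comm]

lemma IsDoublePoleSoliton.analyticAt_glue_fst {l : ℂ} (hl : l ∉ Set.range fun i => eta k i ^ 2) :
    AnalyticAt ℂ (glue (fun l => a x l / specS a n a' n' x l) (a' (-x))) l :=
  glue_analyticAt (hq.isUpperFn_div hP hM (hP.isUpperFn_fst x)) (hM.isUpperFn_fst (-x))
    (Set.finite_range _) Set.finite_empty (hq.match_fst hP hM hre him) hl (Set.notMem_empty _)

lemma IsDoublePoleSoliton.analyticAt_glue_snd {l : ℂ}
    (hl : conj l ∉ Set.range fun i => eta k i ^ 2) :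
    AnalyticAt ℂ (glue (n' (-x)) (fun l => -(n x l / specS a n a' n' x l))) l :=
  glue_analyticAt (hM.isUpperFn_snd (-x)) (hq.isUpperFn_div hP hM (hP.isUpperFn_snd x)).neg
    Set.finite_empty (Set.finite_range _) (hq.match_snd hP hM hre him) (Set.notMem_empty _) hl

lemma IsDoublePoleSoliton.analyticAt_specF {z : ℂ} (hz : ∀ i, z ≠ eta k i) :
    AnalyticAt ℂ (specF a n a' n' x) z :=
  AnalyticAt.fun_comp (f := fun z : ℂ => z ^ 2)
    (hq.analyticAt_glue_fst hP hM hre him (sq_notMem_range_eta_sq hz)) (analyticAt_id.fun_pow 2)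

omit hre him in
lemma IsDoublePoleSoliton.specF_zero : specF a n a' n' x 0 = 1 := by
  have h := hq.solution.isPotential t
  rw [specF, zero_pow two_ne_zero, glue_of_nonneg Complex.zero_im.ge, specS, hP.a_zero h,
    hM.a_zero h.refl]
  simp

/-- The division by z does no harm at the origin, because the glued function is evaluated at z² and
vanishes at 0. -/
lemma IsDoublePoleSoliton.analyticAt_specG {z : ℂ} (hz : ∀ i, z ≠ conj (eta k i)) :
    AnalyticAt ℂ (specG a n a' n' x) z := by
  have hz' : conj (z ^ 2) ∉ Set.range fun i => eta k i ^ 2 := by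
    rw [map_pow]
    refine sq_notMem_range_eta_sq fun i hi => hz i ?_
    rw [← hi, Complex.conj_conj]
  have hG := hq.analyticAt_glue_snd (x := x) hP hM hre him hz'
  by_cases h0 : z = 0
  · subst h0
    rw [zero_pow two_ne_zero] at hG
    have hG0 : glue (n' (-x)) (fun l => -(n x l / specS a n a' n' x l)) 0 = 0 := by
      rw [glue_of_nonneg Complex.zero_im.ge, hM.n_zero (hq.solution.isPotential t).refl]
    obtain ⟨u, hu, hue⟩ := exists_taylor_two hG
    have e : specG a n a' n' x = fun z =>
        z * deriv (glue (n' (-x)) (fun l => -(n x l / specS a n a' n' x l))) 0 +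
          z ^ 3 * u (z ^ 2) := by
      ext w
      rw [specG, hue (w ^ 2), hG0]
      by_cases hw : w = 0
      · simp [hw]
      · field_simp
        ring
    rw [e]
    have hu' : AnalyticAt ℂ (fun z => u (z ^ 2)) (0 : ℂ) :=
      AnalyticAt.fun_comp (by simpa using hu) (analyticAt_id.fun_pow 2)
    exact (analyticAt_id.fun_mul analyticAt_const).fun_add ((analyticAt_id.fun_pow 3).fun_mul hu')
  · exact (AnalyticAt.fun_comp (f := fun z : ℂ => z ^ 2) hG (analyticAt_id.fun_pow 2)).div
      analyticAt_id h0

omit hP hM hq hre him in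
lemma tendsto_sq_cobounded : Tendsto (fun z : ℂ => z ^ 2) (cobounded ℂ) (cobounded ℂ) := by
  rw [← tendsto_norm_atTop_iff_cobounded]
  simp only [norm_pow]
  exact (tendsto_pow_atTop two_ne_zero).comp tendsto_norm_cobounded_atTop

omit hre him in
lemma IsDoublePoleSoliton.isBigO_specF :
    specF a n a' n' x =O[cocompact ℂ] (fun _ => (1 : ℝ)) := by
  obtain ⟨C, hC⟩ := eventually_norm_glue_le (hq.isUpperFn_div hP hM (hP.isUpperFn_fst x))
    (hM.isUpperFn_fst (-x))
  rw [← Metric.cobounded_eq_cocompact]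
  refine Asymptotics.IsBigO.of_bound C ?_
  filter_upwards [tendsto_sq_cobounded.eventually hC] with z hz
  simpa [specF] using hz

omit hre him in
lemma IsDoublePoleSoliton.isBigO_specG :
    specG a n a' n' x =O[cocompact ℂ] (fun _ => (1 : ℝ)) := by
  obtain ⟨C, hC⟩ := eventually_norm_glue_le (hM.isUpperFn_snd (-x))
    (hq.isUpperFn_div hP hM (hP.isUpperFn_snd x)).neg
  rw [← Metric.cobounded_eq_cocompact]
  refine Asymptotics.IsBigO.of_bound C ?_
  filter_upwards [tendsto_sq_cobounded.eventually hC,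
    tendsto_norm_cobounded_atTop.eventually (eventually_ge_atTop 1)] with z hz h1
  rw [specG, norm_div, norm_one, mul_one]
  exact (div_le_self (norm_nonneg _) h1).trans hz

/-- Near ηₙ the row consists of the first entries of e^{-iθ} Φ₊₁/s₁₁ and e^{iθ} Φ₋₂, and the second
entries appear after reflection. Both conditions are thus the jet relation Φ₊₁ = (b + d(z-η)) Φ₋₂ +
o(z-η) divided by s₁₁ = (z-η)² U. The jet of U turns b and d into A and B, and the jet of e^{-2iθ}
supplies the rest of the data. -/
lemma IsDoublePoleSoliton.removable_spec (i : Fin N ⊕ Fin N) :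
    Removable (fun z => specF a n a' n' x z - pp (eta k i) (resC k (discA q) x t i)
      (resE k (discA q) (discB q) x t i) z * specG a n a' n' x z) (eta k i) ∧
    Removable (fun z => dag (specG a n a' n' x) z + pp (eta k i) (resC k (discA q) x t i)
      (resE k (discA q) (discB q) x t i) z * dag (specF a n a' n' x) z) (eta k i) := by
  have h := hq.solution
  have hη := eta_mem hre him i
  -- At -kₙ the double zero is inherited from kₙ because s₁₁ is even.
  have hs : s11 q (eta k i) = 0 ∧ deriv (s11 q) (eta k i) = 0 ∧
      iteratedDeriv 2 (s11 q) (eta k i) ≠ 0 := by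
    rcases i with i | i
    · exact ⟨(hq.zeros _ (hre i) (him i)).2 ⟨i, rfl⟩, hq.deriv_zero i, hq.double i⟩
    · have hk := mul_pos (hre i) (him i)
      have e1 := h.iteratedDeriv_s11_neg hk 1
      rw [iteratedDeriv_one, hq.deriv_zero i, mul_zero] at e1
      refine ⟨?_, e1, ?_⟩
      · change s11 q (-k i) = 0
        rw [h.hasJost.s11_neg hk.le]
        exact (hq.zeros _ (hre i) (him i)).2 ⟨i, rfl⟩
      · change iteratedDeriv 2 (s11 q) (-k i) ≠ 0
        rw [h.iteratedDeriv_s11_neg hk 2]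
        simpa using hq.double i
  rw [resE, resC, coefD]
  generalize eta k i = η at hη hs ⊢
  obtain ⟨hs0, hs1, hs2⟩ := hs
  obtain ⟨b, d, hb, hj⟩ := h.exists_isJet hη hs0 hs1
  obtain ⟨hA, hB⟩ := hj.disc_eq h hη
  obtain ⟨U, hU, hUe⟩ := exists_taylor_two (h.analyticAt_s11 hη)
  have hsU : ∀ z, s11 q z = (z - η) ^ 2 * U z := fun z => by rw [hUe z, hs0, hs1]; ring
  obtain ⟨-, hU2, hU3⟩ := deriv_sub_sq_mul hU (.of_forall hsU)
  rw [hU2] at hA hB hs2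
  rw [hU3] at hB
  have hU0 : U η ≠ 0 := fun h0 => hs2 (by rw [h0, mul_zero])
  have hβd : ∀ z, HasDerivAt (bgExp 1 x t)
      (bgExp 1 x t z * (-Complex.I * deriv (theta x t) z)) z := by
    intro z
    have h1 := (hasDerivAt_theta x t z).differentiableAt.hasDerivAt
    refine ((h1.const_mul (-1 * Complex.I)).cexp).congr_deriv ?_ |>.congr_of_eventuallyEq ?_
    · rw [bgExp, neg_one_mul]; simp
    · exact .of_forall fun w => by simp [bgExp]
  have hβ : AnalyticAt ℂ (bgExp 1 x t) η :=
    Complex.analyticAt_iff_eventually_differentiableAt.2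
      (.of_forall fun z => (hβd z).differentiableAt)
  have hβ2 : bgExp 1 x t η ^ 2 = Complex.exp (-2 * Complex.I * theta x t η) := by
    rw [bgExp, ← Complex.exp_nat_mul]
    congr 1
    simp; ring
  have hPa : ∀ j, AnalyticAt ℂ (fun z => jostP1 q x t z j) η := fun j => by
    rw [Complex.analyticAt_iff_eventually_differentiableAt]
    filter_upwards [isOpen_upper.mem_nhds hη] with w hw
      using differentiableAt_pi.1 (h.differentiableAt_P1 hw) j
  have hMa : ∀ j, AnalyticAt ℂ (fun z => jostM2 q x t z j) η := fun j => by
    rw [Complex.analyticAt_iff_eventually_differentiableAt]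
    filter_upwards [isOpen_upper.mem_nhds hη] with w hw
      using differentiableAt_pi.1 (h.differentiableAt_M2 hw) j
  have ho : ∀ j, (fun z => jostP1 q x t z j - (b + d * (z - η)) * jostM2 q x t z j)
      =o[𝓝 η] fun z => z - η := fun j => (Asymptotics.isLittleO_pi.1 (hj x t)) j
  have hc : discA q η * Complex.exp (-2 * Complex.I * theta x t η) =
      b * bgExp 1 x t η ^ 2 / U η := by
    rw [hβ2, hA]
    field_simp
  have he : discA q η * Complex.exp (-2 * Complex.I * theta x t η) *
      (discB q η - 2 * Complex.I * deriv (theta x t) η) =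
      discA q η * Complex.exp (-2 * Complex.I * theta x t η) *
        (d / b + 2 * (deriv (bgExp 1 x t) η / bgExp 1 x t η) - deriv U η / U η) := by
    rw [(hβd η).deriv, mul_div_cancel_left₀ _ bgExp_ne_zero, hB]
    congr 1
    field_simp
    ring
  have hup : ∀ᶠ z in 𝓝[≠] η, 0 ≤ z.re * z.im := (eventually_upper hη).filter_mono nhdsWithin_le_nhds
  constructor
  · refine removable_sub_pp (hPa 0) (hMa 0) hU hU0 hβ (fun _ => bgExp_ne_zero) hb (ho 0) ?_ ?_ hc he
    · filter_upwards [hup] with z hz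
      rw [specF_eq hP hM h hz, hsU]
    · filter_upwards [hup] with z hz using specG_eq hM h hz
  · have := removable_sub_pp (f := fun z => -dag (specG a n a' n' x) z)
      (g := dag (specF a n a' n' x)) (hPa 1) (hMa 1) hU hU0 hβ (fun _ => bgExp_ne_zero) hb (ho 1)
      (by
        filter_upwards [hup] with z hz
        rw [hq.dag_specG_eq hP hM hre him hz, neg_neg, hsU])
      (by filter_upwards [hup] with z hz using hq.dag_specF_eq hP hM hre him hz) hc he
    refine this.neg.congr (.of_forall fun z => ?_)
    simp only
    ring

theorem IsDoublePoleSoliton.rowSol_spec : RowSol (eta k) (resC k (discA q) x t)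
    (resE k (discA q) (discB q) x t) (specF a n a' n' x) (specG a n a' n' x) where
  anf _ hz := hq.analyticAt_specF hP hM hre him hz
  ang _ hz := hq.analyticAt_specG hP hM hre him hz
  reg i := (hq.removable_spec hP hM hre him i).1
  reg' i := (hq.removable_spec hP hM hre him i).2
  bdf := hq.isBigO_specF hP hM
  bdg := hq.isBigO_specG hP hM

omit hP hM in
-- Uniqueness of the row with value (1, 0) at the origin. The point k = 1 on the contour is not a
-- pole of either row, and one such point suffices to recover q.
lemma IsDoublePoleSoliton.jostM2_one (hk : Function.Injective k) (x t : ℝ) :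
    jostM2 q x t 1 = solM2 k (discA q) (discB q) x t 1 := by
  obtain ⟨a, n, hP⟩ := (hq.solution.isPotential t).exists_upperJost
  obtain ⟨a', n', hM⟩ := (hq.solution.isPotential t).refl.exists_upperJost
  have hz : (0 : ℝ) ≤ (1 : ℂ).re * (1 : ℂ).im := by simp
  obtain ⟨h1, h2⟩ := (hq.rowSol_spec (x := x) hP hM hre him).eq_sol hre him hk
    (hq.isNormingData hre him) (hq.specF_zero hP hM) (by simp [specG])
  have hne : ∀ i, (1 : ℂ) ≠ eta k i := by
    rintro i hi
    have := eta_mem hre him i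
    rw [← hi] at this
    simp at this
  have hne' : ∀ i, (1 : ℂ) ≠ conj (eta k i) := fun i hi => hne i (by
    rw [← Complex.conj_conj (eta k i), ← hi, map_one])
  have e1 := (specG_eq (a := a) (n := n) (x := x) hM hq.solution hz).symm.trans (h2 1 hne')
  have e2 := (hq.dag_specF_eq (x := x) hP hM hre him hz).symm
  rw [dag, map_one, h1 1 hne] at e2
  rw [div_eq_iff bgExp_ne_zero] at e1 e2
  ext i
  fin_cases i
  · simpa [solM2, mul_comm] using e1
  · simpa [solM2, mul_comm, dag] using e2

omit hP hM in
-- The two potentials share a solution φ of their spectral problems at k = 1. Subtracting the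
-- equations shows that their difference annihilates φ₂ and its conjugate annihilates φ₁, while φ
-- vanishes nowhere.
theorem IsDoublePoleSoliton.eq_solQ (hk : Function.Injective k) (x t : ℝ) :
    q x t = solQ k (discA q) (discB q) x t := by
  have h := hq.solution
  have hA := hq.isNormingData hre him
  have hz : (0 : ℝ) ≤ (1 : ℂ).re * (1 : ℂ).im := by simp
  have hM := h.hasJost.isM2 (t := t) hz
  have hne := hM.ne_zero (h.hasJost.continuous t) x
  have h1 := (isLaxSol_iff.1 hM.isLaxSol) x
  have hM' := (hasJost_solQ hre him hk hA).isM2 (t := t) hz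
  have e : (fun x => jostM2 (solQ k (discA q) (discB q)) x t 1) = fun x => jostM2 q x t 1 := by
    ext1 y
    rw [jostM2_solQ hre him hk hA hz, hq.jostM2_one hre him hk]
  rw [e] at hM'
  have h2 := (isLaxSol_iff.1 hM'.isLaxSol) x
  have e1 := h1.1.unique h2.1
  have e2 := h1.2.unique h2.2
  by_contra hcon
  have hcon' : q x t - solQ k (discA q) (discB q) x t ≠ 0 := sub_ne_zero.2 hcon
  refine hne (funext (Fin.forall_fin_two.2 ⟨?_, ?_⟩))
  · refine (mul_eq_zero.1 (?_ : conj (q x t - solQ k (discA q) (discB q) x t) * _ = 0)).resolve_left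
      ((map_ne_zero _).2 hcon')
    rw [map_sub]
    linear_combination -e2
  · refine (mul_eq_zero.1 (?_ : (q x t - solQ k (discA q) (discB q) x t) * _ = 0)).resolve_left
      hcon'
    linear_combination e1

end Soliton

end Identification

end DNLS

end

theorem mainTheorem1 (N : ℕ) (k : Fin N → ℂ) (hk : Function.Injective k)
    (hre : ∀ n, 0 < (k n).re) (him : ∀ n, 0 < (k n).im) :
    (∀ q : ℝ → ℝ → ℂ, DNLS.IsDoublePoleSoliton k q →
      DNLS.IsNormingData k (DNLS.discA q) (DNLS.discB q) ∧
      ∀ x t : ℝ,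
        (1 - DNLS.matH k (DNLS.discA q) (DNLS.discB q) x t).det ≠ 0 ∧
        (1 - DNLS.matHHat k (DNLS.discA q) (DNLS.discB q) x t).det ≠ 0 ∧
        ((DNLS.matG k (DNLS.discA q) (DNLS.discB q) x t).det = 0 ↔ q x t = 0) ∧
        q x t = DNLS.solitonFormula k (DNLS.discA q) (DNLS.discB q) x t) ∧
    (∀ A B : ℂ → ℂ, DNLS.IsNormingData k A B →
      DNLS.IsDoublePoleSoliton k (fun x t => DNLS.solitonFormula k A B x t) ∧
      ∀ n, DNLS.discA (fun x t => DNLS.solitonFormula k A B x t) (k n) = A (k n) ∧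
        DNLS.discB (fun x t => DNLS.solitonFormula k A B x t) (k n) = B (k n)) := by
  have hform : ∀ A B : ℂ → ℂ, DNLS.IsNormingData k A B →
      (fun x t => DNLS.solitonFormula k A B x t) = DNLS.solQ k A B := fun A B hA =>
    funext fun _ => funext fun _ => DNLS.solitonFormula_eq hre him hk hA
  refine ⟨fun q hq => ?_, fun A B hA => ?_⟩
  · have hA := hq.isNormingData hre him
    refine ⟨hA, fun x t => ⟨DNLS.det_one_sub_matH_ne_zero hre him hk hA,
      DNLS.det_one_sub_matHHat_ne_zero hre him hk hA, ?_, ?_⟩⟩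
    · rw [DNLS.det_matG_eq_zero_iff hre him hk hA, ← hq.eq_solQ hre him hk]
    · rw [DNLS.solitonFormula_eq hre him hk hA, ← hq.eq_solQ hre him hk]
  · rw [hform A B hA]
    exact ⟨DNLS.isDoublePoleSoliton_solQ hre him hk hA, fun n =>
      ⟨DNLS.discA_solQ hre him hk hA (.inl n), DNLS.discB_solQ hre him hk hA (.inl n)⟩⟩
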